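/- Let $M$ be a closed smooth Riemannian manifold and $f:M\to M$ a diffeomorphism. For $x\in M$ let $\mathrm{d}f_x^{T}:T_{f(x)}M\to T_xM$ be the adjoint of $\mathrm{d}f_x$ for the Riemannian metric and $\mathrm{d}f_x^{-T}$ its inverse. Let $G_t:TM\to TM$ be the geodesic flow and $\hat f:TM\to TM$, $\hat f(x,v)=(f(x),\mathrm{d}f_x^{-T}v)$. Endow the unit tangent bundle $\pi: SM\to M$ with the contact form $\alpha_{(x,v)}(\xi)=\langle v,\mathrm{d}\pi\,\xi\rangle$, with Reeb flow $(\phi^\alpha_t)$, and let $\tilde f:SM\to SM$ be the contactomorphism $\tilde f(x,v)=\left(f(x),\mathrm{d}f_x^{-T}v/\|\mathrm{d}f_x^{-T}v\|\right)$. A point $p\in SM$ is a translated point of $\tilde f$ with time-shift $t$ if $\varphi=\phi^\alpha_{-t}\circ\tilde f$ fixes $p$ and the function $h$ defined by $\varphi^*\alpha=e^{h}\alpha$ satisfies $h(p)=0$; it is non-degenerate for the time-shift $t$ if the differential $\mathrm{d}(G_{-t}\circ\hat f)_p$, an endomorphism of $T_p(TM)$, does not have $1$ as an eigenvalue. Let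 $\Lambda(f)$ be the Hilbert manifold of paths $\gamma\in H^1([0,1],M)$ with $\gamma(1)=f(\gamma(0))$, whose tangent space $T_\gamma\Lambda(f)$ consists of the $H^1$ vector fields $U$ along $\gamma$ with $U(1)=\mathrm{d}f\cdot U(0)$, and let $E_f:\Lambda(f)\to\mathbb{R}$, $E_f(\gamma)=\int_0^1\|\dot\gamma\|^2\,\mathrm{d}t$. A critical point $\gamma$ of $E_f$ is non-degenerate if the kernel of its Hessian $\mathrm{d}^2E_f(\gamma)$ on $T_\gamma\Lambda(f)$ is $\{0\}$. Proposition. Let $p=(x,v)\in SM$ be a translated point of $\tilde f$ with time-shift $t>0$, and let $\gamma:[0,1]\to M$, $\gamma(s)=\pi(G_{ts}(x,v))$, be the associated geodesic, of length $t$, with $\dot\gamma(0)=tv$. Then $\gamma$ is a critical point of $E_f$, and $p$ is non-degenerate for the time-shift $t$ if and only if $\gamma$ is a non-degenerate critical point of $E_f$. -/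

import Mathlib

open scoped Manifold ContDiff Topology

namespace TranslatedPoint

noncomputable section

section Riemannian

variable {n : ℕ} {M : Type*} [TopologicalSpace M] [ChartedSpace (EuclideanSpace ℝ (Fin n)) M]

/-- The tangent bundle `TM`. -/
abbrev TM (n : ℕ) (M : Type*) [TopologicalSpace M] [ChartedSpace (EuclideanSpace ℝ (Fin n)) M] :
    Type _ :=
  TangentBundle (𝓡 n) M

/-- The velocity `(c t, c' t) ∈ TM` of a curve `c` in `M`. -/
def velocity (c : ℝ → M) (t : ℝ) : TM n M :=
  ⟨c t, mfderiv 𝓘(ℝ, ℝ) (𝓡 n) c t (1 : ℝ)⟩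

variable [IsManifold (𝓡 n) ∞ M]

/-- Smooth Riemannian metrics on `M`. -/
abbrev Metric (n : ℕ) (M : Type*) [TopologicalSpace M]
    [ChartedSpace (EuclideanSpace ℝ (Fin n)) M] [IsManifold (𝓡 n) ∞ M] : Type _ :=
  Bundle.ContMDiffRiemannianMetric (𝓡 n) ∞ (EuclideanSpace ℝ (Fin n))
    (fun x : M => TangentSpace (𝓡 n) x)

/-- `‖v‖²` for a tangent vector `q = (x, v)`. -/
def normSq (g : Metric n M) (q : TM n M) : ℝ := g.inner q.1 q.2 q.2

/-- The metric read in the chart of `M` at `x₀`: the coefficient `g_y(a, b)` at the point of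
coordinates `y`, for coordinate vectors `a` and `b`. -/
def metricInChart (g : Metric n M) (x₀ : M) (y a b : EuclideanSpace ℝ (Fin n)) : ℝ :=
  g.inner ((extChartAt (𝓡 n) x₀).symm y)
    (mfderiv 𝓘(ℝ, EuclideanSpace ℝ (Fin n)) (𝓡 n) (extChartAt (𝓡 n) x₀).symm y a)
    (mfderiv 𝓘(ℝ, EuclideanSpace ℝ (Fin n)) (𝓡 n) (extChartAt (𝓡 n) x₀).symm y b)

/-- `c : ℝ → M` is a geodesic (parametrized proportionally to arc length): `c` is smooth and
`∇_{c'} c' = 0`. Writing `u` for `c` in the chart at `c t`, the scalar product of the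
Levi-Civita covariant derivative `∇_{c'} c'` with a coordinate vector `w` is, by Koszul's formula,
`g(u'', w) + (∂_{u'} g)(u', w) - (1/2) (∂_w g)(u', u')`. -/
def IsGeodesic (g : Metric n M) (c : ℝ → M) : Prop :=
  ContMDiff 𝓘(ℝ, ℝ) (𝓡 n) ∞ c ∧
  ∀ t : ℝ,
    let u : ℝ → EuclideanSpace ℝ (Fin n) := fun s => extChartAt (𝓡 n) (c t) (c s)
    ∀ w : EuclideanSpace ℝ (Fin n),
      metricInChart g (c t) (u t) (deriv (deriv u) t) w
        + fderiv ℝ (fun y => metricInChart g (c t) y (deriv u t) w) (u t) (deriv u t)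
        - (1 / 2) * fderiv ℝ (fun y => metricInChart g (c t) y (deriv u t) (deriv u t)) (u t) w
        = 0

open Classical in
/-- The geodesic flow `G_t : TM → TM`: `G_t (x, v) = (c t, c' t)`, where `c` is the geodesic with
`(c 0, c' 0) = (x, v)`. (On a closed manifold there is exactly one.) -/
def geodesicFlow (g : Metric n M) (t : ℝ) (p : TM n M) : TM n M :=
  if h : ∃ c : ℝ → M, IsGeodesic g c ∧ velocity c 0 = p then velocity h.choose t else p

/-- The adjoint `Aᵀ : T_y M → T_x M` of a linear map `A : T_x M → T_y M` with respect to the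
metric: `g_x(Aᵀ w, u) = g_y(w, A u)`, see `inner_adjoint`. -/
def adjoint (g : Metric n M) {x y : M} (A : TangentSpace (𝓡 n) x →L[ℝ] TangentSpace (𝓡 n) y) :
    TangentSpace (𝓡 n) y →L[ℝ] TangentSpace (𝓡 n) x :=
  (g.inner x).inverse.comp
    (((ContinuousLinearMap.compL ℝ (EuclideanSpace ℝ (Fin n)) (EuclideanSpace ℝ (Fin n)) ℝ).flip
      A).comp (g.inner y))

theorem inner_adjoint (g : Metric n M) {x y : M}
    (A : TangentSpace (𝓡 n) x →L[ℝ] TangentSpace (𝓡 n) y)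
    (w : TangentSpace (𝓡 n) y) (u : TangentSpace (𝓡 n) x) :
    g.inner x (adjoint g A w) u = g.inner y w (A u) := by
  let E := EuclideanSpace ℝ (Fin n)
  let B : E →L[ℝ] E →L[ℝ] ℝ := g.inner x
  have hinj : Function.Injective B := by
    rw [injective_iff_map_eq_zero]
    intro v hv
    by_contra hne
    have h1 := g.pos x v hne
    have h2 : B v v = 0 := by rw [hv]; rfl
    exact absurd h2 (ne_of_gt h1)
  have hdim : Module.finrank ℝ E = Module.finrank ℝ (E →L[ℝ] ℝ) := by
    rw [← (LinearMap.toContinuousLinearMap (𝕜 := ℝ) (E := E) (F' := ℝ)).finrank_eq]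
    exact (Subspace.dual_finrank_eq (K := ℝ) (V := E)).symm
  let e : E ≃L[ℝ] (E →L[ℝ] ℝ) :=
    (LinearEquiv.ofInjectiveOfFinrankEq (B : E →ₗ[ℝ] (E →L[ℝ] ℝ)) hinj hdim).toContinuousLinearEquiv
  have he : B = (e : E →L[ℝ] (E →L[ℝ] ℝ)) := by
    ext v z
    rfl
  have key : ∀ L : E →L[ℝ] ℝ, B (B.inverse L) = L := by
    intro L
    rw [he, ContinuousLinearMap.inverse_equiv]
    exact e.apply_symm_apply L
  exact congrArg (fun L : E →L[ℝ] ℝ => L u) (key ((g.inner y w).comp A))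

/-- The symplectic lift `f̂ (x, v) = (f x, (df_x)⁻ᵀ v)`. -/
def symplecticLift (g : Metric n M) (f : M → M) (q : TM n M) : TM n M :=
  ⟨f q.1, (adjoint g (mfderiv (𝓡 n) (𝓡 n) f q.1)).inverse q.2⟩

/-! ### The contact manifold `SM` -/

/-- The unit tangent bundle `SM`, as a subset of `TM`. -/
def unitTangent (g : Metric n M) : Set (TM n M) := {q | normSq g q = 1}

/-- The tangent space of the level hypersurface `SM = {‖v‖² = 1}` at `p`, as a subset of
`T_p (TM)`. -/
def tangentSM (g : Metric n M) (p : TM n M) : Set (TangentSpace (𝓡 n).tangent p) :=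
  {ξ | mfderiv (𝓡 n).tangent 𝓘(ℝ, ℝ) (normSq g) p ξ = (0 : ℝ)}

/-- The 1-form `α_{(x, v)} ξ = ⟨v, dπ ξ⟩` on `TM`; its restriction to `SM` is the contact form. -/
def contactForm (g : Metric n M) (p : TM n M) : TangentSpace (𝓡 n).tangent p →L[ℝ] ℝ :=
  (g.inner p.1 p.2).comp (mfderiv (𝓡 n).tangent (𝓡 n) (fun q : TM n M => q.1) p)

/-- The form `α` read in the chart of `TM` at `p`. -/
def contactFormInChart (g : Metric n M) (p : TM n M)
    (y : EuclideanSpace ℝ (Fin n) × EuclideanSpace ℝ (Fin n)) :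
    EuclideanSpace ℝ (Fin n) × EuclideanSpace ℝ (Fin n) →L[ℝ] ℝ :=
  (contactForm g ((extChartAt (𝓡 n).tangent p).symm y)).comp
    (mfderiv 𝓘(ℝ, EuclideanSpace ℝ (Fin n) × EuclideanSpace ℝ (Fin n)) (𝓡 n).tangent
      (extChartAt (𝓡 n).tangent p).symm y)

/-- The exterior derivative `dα_p(ξ, η)`, computed in the chart of `TM` at `p` as
`(Dα · ξ) η - (Dα · η) ξ`. -/
def dContactForm (g : Metric n M) (p : TM n M) (ξ η : TangentSpace (𝓡 n).tangent p) : ℝ :=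
  let φ := extChartAt (𝓡 n).tangent p
  let d := mfderiv (𝓡 n).tangent
    𝓘(ℝ, EuclideanSpace ℝ (Fin n) × EuclideanSpace ℝ (Fin n)) φ p
  fderiv ℝ (contactFormInChart g p) (φ p) (d ξ) (d η)
    - fderiv ℝ (contactFormInChart g p) (φ p) (d η) (d ξ)

/-- `ξ` is the value at `p ∈ SM` of the Reeb vector field of `(SM, α)`:
`ξ ∈ T_p SM`, `α(ξ) = 1`, and `dα(ξ, ·) = 0` on `T_p SM`. -/
def IsReebVector (g : Metric n M) (p : TM n M) (ξ : TangentSpace (𝓡 n).tangent p) : Prop :=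
  ξ ∈ tangentSM g p ∧ contactForm g p ξ = 1 ∧ ∀ η ∈ tangentSM g p, dContactForm g p ξ η = 0

/-- `σ : ℝ → SM` is an orbit of the Reeb flow of `(SM, α)`. -/
def IsReebOrbit (g : Metric n M) (σ : ℝ → TM n M) : Prop :=
  ∀ s : ℝ, σ s ∈ unitTangent g ∧ MDifferentiableAt 𝓘(ℝ, ℝ) (𝓡 n).tangent σ s ∧
    IsReebVector g (σ s) (mfderiv 𝓘(ℝ, ℝ) (𝓡 n).tangent σ s (1 : ℝ))

open Classical in
/-- The Reeb flow `φ^α_t : SM → SM` (extended by the identity outside `SM`). -/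
def reebFlow (g : Metric n M) (t : ℝ) (p : TM n M) : TM n M :=
  if h : ∃ σ : ℝ → TM n M, IsReebOrbit g σ ∧ σ 0 = p then h.choose t else p

/-- The contact lift `f̃ (x, v) = (f x, (df_x)⁻ᵀ v / ‖(df_x)⁻ᵀ v‖)` of a diffeomorphism `f`.
It is a map `SM → SM`; the same formula is used on `TM` minus the zero section, which it maps
smoothly to `SM`. -/
def contactLift (g : Metric n M) (f : M → M) (q : TM n M) : TM n M :=
  ⟨f q.1, (Real.sqrt (normSq g (symplecticLift g f q)))⁻¹ • (symplecticLift g f q).2⟩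

/-- `p ∈ SM` is a discriminant point of the contactomorphism of `(SM, α)` that is given by the
restriction to `SM` of `φ`, a map from a neighbourhood of `SM` in `TM` to `SM`: it is a fixed
point, at which the conformal factor `e^h` in `φ^* α = e^h α` is equal to `1`. -/
def IsDiscriminantPoint (g : Metric n M) (φ : TM n M → TM n M) (p : TM n M) : Prop :=
  p ∈ unitTangent g ∧ φ p = p ∧
    ∀ ξ ∈ tangentSM g p,
      contactForm g (φ p) (mfderiv (𝓡 n).tangent (𝓡 n).tangent φ p ξ) = contactForm g p ξ

/-- `p` is a translated point of the contact lift `f̃` with time-shift `t`: a discriminant point of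
`φ^α_{-t} ∘ f̃`. -/
def IsTranslatedPoint (g : Metric n M) (f : M → M) (t : ℝ) (p : TM n M) : Prop :=
  IsDiscriminantPoint g (reebFlow g (-t) ∘ contactLift g f) p

/-- The translated point `p` (a fixed point of `G_{-t} ∘ f̂`) is non-degenerate for the
time-shift `t`: the endomorphism `d(G_{-t} ∘ f̂)_p` of `T_p (TM)` does not have the
eigenvalue `1`. -/
def IsNondegenerateTranslatedPoint (g : Metric n M) (f : M → M) (t : ℝ) (p : TM n M) : Prop :=
  IsTranslatedPoint g f t p ∧
    ∀ ξ : TangentSpace (𝓡 n).tangent p,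
      mfderiv (𝓡 n).tangent (𝓡 n).tangent (geodesicFlow g (-t) ∘ symplecticLift g f) p ξ = ξ →
        ξ = 0

/-- The geodesic `γ : [0, 1] → M`, `γ(s) = π (G_{ts} (x, v))`, with `γ'(0) = t v`; it has
length `|t|` when `(x, v) ∈ SM`. -/
def associatedGeodesic (g : Metric n M) (t : ℝ) (p : TM n M) (s : unitInterval) : M :=
  (geodesicFlow g (t * s) p).1

end Riemannian

/-! ### The path space `PM = H¹([0, 1], M)` and the energy functional -/

/-- The Hilbert space `H¹([0, 1], ℝ)`: a function `h` is encoded by its initial value `h(0)` and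
its weak derivative `h' ∈ L²([0, 1])`. -/
abbrev H1 : Type :=
  ℝ × MeasureTheory.Lp ℝ 2 (MeasureTheory.volume.restrict (Set.Icc (0 : ℝ) 1))

/-- The function encoded by an element of `H¹([0, 1], ℝ)`. -/
def H1.eval (u : H1) (t : unitInterval) : ℝ := u.1 + ∫ s in (0 : ℝ)..t, u.2 s

section Paths

variable {n : ℕ} {M : Type*} [TopologicalSpace M] [ChartedSpace (EuclideanSpace ℝ (Fin n)) M]

/-- `γ : [0, 1] → M` is a path of class `H¹`: it is continuous and `h ∘ γ` is in
`H¹([0, 1], ℝ)` for every smooth function `h` on `M`. -/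
def IsH1Path (n : ℕ) {M : Type*} [TopologicalSpace M] [ChartedSpace (EuclideanSpace ℝ (Fin n)) M]
    (γ : unitInterval → M) : Prop :=
  Continuous γ ∧ ∀ h : M → ℝ, ContMDiff (𝓡 n) 𝓘(ℝ, ℝ) ∞ h → ∃ u : H1, ∀ t, h (γ t) = u.eval t

/-- The space `Λ(f)` of the `H¹`-paths with `γ(1) = f(γ(0))`. -/
def Lam (n : ℕ) {M : Type*} [TopologicalSpace M] [ChartedSpace (EuclideanSpace ℝ (Fin n)) M]
    (f : M → M) : Set (unitInterval → M) :=
  {γ | IsH1Path n γ ∧ γ 1 = f (γ 0)}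

/-- `c` is a smooth map from the normed space `P` to the Hilbert manifold `H¹([0, 1], M)`, for
compact `M`: for every smooth function `h` on `M`, the map `p ↦ h ∘ c p` is smooth from `P` to the
Hilbert space `H¹([0, 1], ℝ)`. (Taking for `h` the coordinates of an embedding of `M` into `ℝᴺ`,
this is smoothness in the submanifold `H¹([0, 1], M)` of `H¹([0, 1], ℝᴺ)`.) -/
def IsSmoothFamily (n : ℕ) {M : Type*} [TopologicalSpace M]
    [ChartedSpace (EuclideanSpace ℝ (Fin n)) M]
    {P : Type*} [NormedAddCommGroup P] [NormedSpace ℝ P] (c : P → unitInterval → M) : Prop :=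
  (∀ p, IsH1Path n (c p)) ∧
  ∀ h : M → ℝ, ContMDiff (𝓡 n) 𝓘(ℝ, ℝ) ∞ h →
    ∃ Φ : P → H1, ContDiff ℝ ∞ Φ ∧ ∀ p t, h (c p t) = (Φ p).eval t

/-- `U` belongs to the tangent space `T_γ Λ(f)`: it is a vector field along `γ` of class `H¹`
(`t ↦ dh (U t)` is in `H¹([0, 1], ℝ)` for every smooth `h`) with `df (U 0) = U 1`. The last
equality is written in `TM`. -/
def IsTangent (f : M → M) (γ : unitInterval → M) (U : ∀ t, TangentSpace (𝓡 n) (γ t)) : Prop :=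
  (∀ h : M → ℝ, ContMDiff (𝓡 n) 𝓘(ℝ, ℝ) ∞ h →
    ∃ u : H1, ∀ t, (mfderiv (𝓡 n) 𝓘(ℝ, ℝ) h (γ t) (U t) : ℝ) = u.eval t) ∧
  (⟨f (γ 0), mfderiv (𝓡 n) (𝓡 n) f (γ 0) (U 0)⟩ : TM n M) = ⟨γ 1, U 1⟩

variable [IsManifold (𝓡 n) ∞ M]

/-- The energy `E(γ) = ∫₀¹ ‖γ'(t)‖² dt`; an `H¹`-path is differentiable almost everywhere. -/
def energy (g : Metric n M) (γ : unitInterval → M) : ℝ :=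
  ∫ t in (0 : ℝ)..1, normSq g (velocity (Set.IccExtend zero_le_one γ) t)

/-- `γ ∈ Λ(f)` is a critical point of the restriction `E_f` of the energy to `Λ(f)`: the
derivative of the energy vanishes along each smooth curve of `Λ(f)` through `γ`. -/
def IsCriticalPoint (g : Metric n M) (f : M → M) (γ : unitInterval → M) : Prop :=
  γ ∈ Lam n f ∧
    ∀ c : ℝ → unitInterval → M, IsSmoothFamily n c → (∀ s, c s ∈ Lam n f) → c 0 = γ →
      deriv (fun s => energy g (c s)) 0 = 0

/-- `d²E_f(γ)[U, V] = a`, where `d²E_f(γ)` is the Hessian of `E_f` at the critical point `γ`: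
`a = ∂²/∂u∂v E(γ_{u,v})` at `(0, 0)` for a smooth two-parameter family `γ_{u,v}` in `Λ(f)`
with `γ_{0,0} = γ`, `∂_u γ_{u,0} = U` and `∂_v γ_{0,v} = V` at `0`. -/
def HasHessian (g : Metric n M) (f : M → M) (γ : unitInterval → M)
    (U V : ∀ t, TangentSpace (𝓡 n) (γ t)) (a : ℝ) : Prop :=
  ∃ c : ℝ × ℝ → unitInterval → M,
    IsSmoothFamily n c ∧ (∀ p, c p ∈ Lam n f) ∧ c (0, 0) = γ ∧
    (∀ t, velocity (fun u => c (u, 0) t) 0 = (⟨γ t, U t⟩ : TM n M)) ∧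
    (∀ t, velocity (fun v => c (0, v) t) 0 = (⟨γ t, V t⟩ : TM n M)) ∧
    deriv (fun u => deriv (fun v => energy g (c (u, v))) 0) 0 = a

/-- `γ` is a non-degenerate critical point of `E_f`: a critical point at which the Hessian has
trivial kernel. -/
def IsNondegenerateCriticalPoint (g : Metric n M) (f : M → M) (γ : unitInterval → M) : Prop :=
  IsCriticalPoint g f γ ∧
    ∀ U : (∀ t, TangentSpace (𝓡 n) (γ t)), IsTangent f γ U →
      (∀ V : (∀ t, TangentSpace (𝓡 n) (γ t)), IsTangent f γ V → HasHessian g f γ U V 0) →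
      U = 0

end Paths

end

end TranslatedPoint

open scoped Manifold ContDiff Topology
open MeasureTheory

set_option linter.unusedSectionVars false

/-! Write `G_t` for the geodesic flow, `f̂` for the symplectic lift and `D` for the differential of
`G_{-t} ∘ f̂` at `p`.

A translated point with time-shift `t` satisfies `f̂ p = G_t p`. Indeed the Reeb flow of `SM` is the
geodesic flow (`Frame.isReebVector_iff`, `reebFlow_eq`), which preserves `α`, while `f̂` preserves
`α` and `f̃` is `f̂` divided by its norm. The conformal factor of `φ^α_{-t} ∘ f̃` at `p` is
therefore `1 / ‖f̂ p‖`; it equals `1` only if `f̃ p = f̂ p` (`symplecticLift_eq_geodesicFlow`). The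
relation `⟨f̂ p, df w⟩ = ⟨p, w⟩` then says that the two boundary terms of the first variation of the
energy cancel, so `γ` is critical (`isCriticalPoint_associatedGeodesic`).

For the Hessian, consider the field along `γ` that is the Jacobi field of `ξ` on `[0, s₀]` and that
of `η` on `[s₀, 1]`. It is tangent to `Λ(f)` if it is continuous at `s₀` and `dG_t η = df̂ ξ`, that
is, `η = D ξ`. Integrating by parts on the two intervals, the boundary terms at `0` and `1` cancel
by the linearized boundary condition, and only the break survives: if `dG_{t s₀}(η - ξ)` is the
vertical vector `w`, the Hessian on this field and `V` is `-2 t ⟨w, V(s₀)⟩`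
(`deriv_deriv_energy_eq`).

Both implications follow. If `D ξ = ξ` there is no break, and the Jacobi field of `ξ` lies in the
kernel of the Hessian; it is nonzero when `ξ ≠ 0`. Conversely, if `1` is not an eigenvalue, `D - 1`
is onto, so every `w` occurs as the jump of a broken Jacobi field at every `s₀`. Testing a kernel
element `U` against the field with jump `U(s₀)` gives `-2 t ‖U(s₀)‖² = 0`. No regularity theory for
`U`, which is only of class `H¹`, is involved.

The computations are carried out in a `Frame`, functions `h j` and fields `X j` with `v = ∑ dh_j(v)
X_j`. The metric becomes `∑ G_jk dh_j dh_k`, the energy a sum of integrals of `G_jk u_j' u_k'` with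
`H¹` functions (`Frame.energy_eq`), and the geodesic equation an identity for the momenta `Q_k = 2 ∑
G_jk dh_j`; no connection appears. Smoothness of the geodesic flow is derived from the implicit
function theorem in a space of paths, and the two-parameter families needed for the Hessian are
built with the exponential map (`exists_family`). -/

namespace TranslatedPoint

noncomputable section

/-! ### Superposition operators on spaces of continuous functions. -/

section Superposition

universe u
variable {K : Type*} [TopologicalSpace K] [CompactSpace K]
  {E F : Type u} [NormedAddCommGroup E] [NormedSpace ℝ E] [NormedAddCommGroup F] [NormedSpace ℝ F]

/-- Pointwise application of a continuous family of linear maps to a continuous function. -/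
def pointwiseApply (K : Type*) [TopologicalSpace K] [CompactSpace K] (E F : Type u)
    [NormedAddCommGroup E] [NormedSpace ℝ E] [NormedAddCommGroup F] [NormedSpace ℝ F] :
    C(K, E →L[ℝ] F) →L[ℝ] C(K, E) →L[ℝ] C(K, F) :=
  LinearMap.mkContinuous₂
    (LinearMap.mk₂ ℝ (fun (A : C(K, E →L[ℝ] F)) (b : C(K, E)) =>
        (⟨fun k => A k (b k), by fun_prop⟩ : C(K, F)))
      (fun A A' b => by ext k; simp) (fun c A b => by ext k; simp)
      (fun A b b' => by ext k; simp) (fun c A b => by ext k; simp)) 1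
    (fun A b => by
      rw [one_mul, ContinuousMap.norm_le _ (by positivity)]
      intro k
      exact ((A k).le_opNorm (b k)).trans
        (mul_le_mul (A.norm_coe_le_norm k) (b.norm_coe_le_norm k) (norm_nonneg _) (norm_nonneg A)))

/-- The mean value inequality on the segment from `a k` to `a k + b k` bounds the error at each `k`;
uniformity in `k` comes from the continuity of postcomposition with `fderiv ℝ f` in the supremum
norm. -/
theorem hasFDerivAt_postcomp {f : E → F} (hf : ContDiff ℝ 1 f) (a : C(K, E)) :
    HasFDerivAt (fun b : C(K, E) => (ContinuousMap.mk f hf.continuous).comp b)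
      (pointwiseApply K E F
        ((ContinuousMap.mk (fderiv ℝ f) (hf.continuous_fderiv one_ne_zero)).comp a)) a := by
  rw [hasFDerivAt_iff_isLittleO_nhds_zero, Asymptotics.isLittleO_iff]
  intro c hc
  have hcont := (ContinuousMap.continuous_postcomp (X := K)
    (ContinuousMap.mk (fderiv ℝ f) (hf.continuous_fderiv one_ne_zero))).continuousAt (x := a)
  obtain ⟨δ, hδ, h⟩ := (Metric.continuousAt_iff (α := C(K, E)) (β := C(K, E →L[ℝ] F))).1 hcont c hc
  filter_upwards [Metric.ball_mem_nhds (0 : C(K, E)) hδ] with b hb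
  rw [ContinuousMap.norm_le _ (by positivity)]
  intro k
  have hb' : ‖b‖ < δ := by simpa using hb
  have key : ∀ z ∈ segment ℝ (a k) (a k + b k), ‖fderiv ℝ f z - fderiv ℝ f (a k)‖ ≤ c := by
    intro z hz
    rw [segment_eq_image'] at hz
    obtain ⟨θ, hθ, rfl⟩ := hz
    -- The point of the segment is the value at `k` of the function `a + θ • b`, which is uniformly
    -- close to `a`.
    have h1 : dist (a + θ • b) a < δ := by
      rw [dist_eq_norm, add_sub_cancel_left, norm_smul, Real.norm_of_nonneg hθ.1]
      exact (mul_le_of_le_one_left (norm_nonneg _) hθ.2).trans_lt hb'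
    have h2 := (ContinuousMap.dist_apply_le_dist k).trans (h h1).le
    rw [dist_eq_norm] at h2
    simpa using h2
  have := (convex_segment (𝕜 := ℝ) (a k) (a k + b k)).norm_image_sub_le_of_norm_fderiv_le'
    (f := f) (φ := fderiv ℝ f (a k))
    (fun z _ => hf.differentiable one_ne_zero z) key (left_mem_segment ℝ _ _)
    (right_mem_segment ℝ _ _)
  rw [add_sub_cancel_left] at this
  exact this.trans (by gcongr; exact b.norm_coe_le_norm k)

/-- Composition with a smooth map is smooth on spaces of continuous functions on a compact space. -/
theorem contDiff_postcomp {f : E → F} (hf : ContDiff ℝ ∞ f) :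
    ContDiff ℝ ∞ (fun b : C(K, E) => (ContinuousMap.mk f hf.continuous).comp b) := by
  rw [contDiff_infty]
  intro n
  -- The derivative is again a postcomposition, by `fderiv ℝ f`, followed by a bounded linear map.
  -- `E` and `F` share a universe so that `E →L[ℝ] F` can take the place of `F`.
  induction n generalizing F with
  | zero =>
    exact contDiff_zero.2 (ContinuousMap.continuous_postcomp _)
  | succ n ih =>
    refine contDiff_succ_iff_hasFDerivAt.2 ⟨_, ?_, hasFDerivAt_postcomp (hf.of_le (by simp))⟩
    exact (pointwiseApply K E F).contDiff.comp (ih (hf.fderiv_right (by simp)))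

end Superposition

/-! ### Smooth dependence of solutions of differential equations on time and initial value. -/

section LocalFlow

variable {E : Type} [NormedAddCommGroup E] [NormedSpace ℝ E] [CompleteSpace E]

/-- The primitive that vanishes at `0`, on the unit interval. -/
def primitiveL (E : Type) [NormedAddCommGroup E] [NormedSpace ℝ E] [CompleteSpace E] :
    C(unitInterval, E) →L[ℝ] C(unitInterval, E) :=
  LinearMap.mkContinuous
    { toFun := fun a => ⟨fun t => ∫ s in (0 : ℝ)..t, Set.IccExtend zero_le_one a s, by
        have h : Continuous (Set.IccExtend zero_le_one a) := a.continuous.Icc_extend'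
        exact (intervalIntegral.continuous_primitive
          (fun x y => h.intervalIntegrable x y) 0).comp continuous_subtype_val⟩
      map_add' := fun a b => by
        have ha : Continuous (Set.IccExtend zero_le_one a) := a.continuous.Icc_extend'
        have hb : Continuous (Set.IccExtend zero_le_one b) := b.continuous.Icc_extend'
        ext t
        exact intervalIntegral.integral_add (ha.intervalIntegrable _ _) (hb.intervalIntegrable _ _)
      map_smul' := fun c a => by
        ext t
        exact intervalIntegral.integral_smul c _ } 1
    (fun a => by
      rw [one_mul, ContinuousMap.norm_le _ (norm_nonneg _)]
      intro t
      refine (intervalIntegral.norm_integral_le_of_norm_le_const (C := ‖a‖)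
        (fun s _ => a.norm_coe_le_norm _)).trans ?_
      rw [sub_zero, abs_of_nonneg t.2.1]
      exact mul_le_of_le_one_right (norm_nonneg _) t.2.2)

theorem primitiveL_apply (a : C(unitInterval, E)) (t : unitInterval) :
    primitiveL E a t = ∫ s in (0 : ℝ)..t, Set.IccExtend zero_le_one a s := rfl

/-- The solutions of `y' = f y` with initial value `x` depend smoothly on time and on `x`. -/
theorem contDiffAt_of_hasDerivAt {f : E → E} (hf : ContDiff ℝ ∞ f) {B : ℝ} (hB : ∀ x, ‖f x‖ ≤ B)
    {S : ℝ → E → E} {x₀ : E} {ε : ℝ} (hε : 0 < ε)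
    (hS0 : ∀ x ∈ Metric.ball x₀ ε, S 0 x = x)
    (hS : ∀ x ∈ Metric.ball x₀ ε, ∀ τ ∈ Set.Ioo (-ε) ε,
      HasDerivAt (fun τ => S τ x) (f (S τ x)) τ) :
    ContDiffAt ℝ ∞ (fun q : ℝ × E => S q.1 q.2) (0, x₀) := by
  -- The Picard equation on a fixed interval: after the time change `s ↦ τ * s` the solution with
  -- initial value `x` is a zero of `Φ ((τ, x), ·)`, and time has become a parameter.
  let Φ : (ℝ × E) × C(unitInterval, E) → C(unitInterval, E) := fun q =>
    q.2 - ContinuousLinearMap.const ℝ unitInterval q.1.2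
      - q.1.1 • primitiveL E ((ContinuousMap.mk f hf.continuous).comp q.2)
  have hΦ : ContDiff ℝ ∞ Φ := by
    have h1 : ContDiff ℝ ∞ (fun q : (ℝ × E) × C(unitInterval, E) =>
      primitiveL E ((ContinuousMap.mk f hf.continuous).comp q.2)) :=
      (primitiveL E).contDiff.comp ((contDiff_postcomp hf).comp contDiff_snd)
    have h2 : ContDiff ℝ ∞ (fun q : (ℝ × E) × C(unitInterval, E) =>
      ContinuousLinearMap.const ℝ unitInterval q.1.2) :=
      ContDiff.comp (g := (ContinuousLinearMap.const ℝ unitInterval : E →L[ℝ] C(unitInterval, E)))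
        (ContinuousLinearMap.contDiff _) (contDiff_snd.comp contDiff_fst)
    exact (contDiff_snd.sub h2).sub ((contDiff_fst.comp contDiff_fst).smul h1)
  let u : (ℝ × E) × C(unitInterval, E) := ((0, x₀), ContinuousMap.const _ x₀)
  have hu : Φ u = 0 := by
    ext t
    simp [Φ, u]
  -- At `τ = 0` the integral term disappears, so the partial derivative in the path is the identity
  -- and the implicit function theorem applies.
  have hinv : (fderiv ℝ Φ u ∘L .inr ℝ (ℝ × E) C(unitInterval, E)) =
      ContinuousLinearMap.id ℝ _ := by
    have h1 : HasFDerivAt (fun a : C(unitInterval, E) => Φ ((0, x₀), a))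
        (fderiv ℝ Φ u ∘L .inr ℝ (ℝ × E) C(unitInterval, E)) (ContinuousMap.const _ x₀) :=
      HasFDerivAt.comp (g := Φ) (ContinuousMap.const _ x₀)
        ((hΦ.differentiable (by simp)) u).hasFDerivAt (hasFDerivAt_prodMk_right (0, x₀) _)
    have h2 : HasFDerivAt (fun a : C(unitInterval, E) => Φ ((0, x₀), a))
        (ContinuousLinearMap.id ℝ _) (ContinuousMap.const _ x₀) := by
      simp only [Φ, zero_smul, sub_zero]
      exact (hasFDerivAt_id _).sub_const _
    exact h1.unique h2
  have hif : (fderiv ℝ Φ u ∘L .inr ℝ (ℝ × E) C(unitInterval, E)).IsInvertible := by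
    rw [hinv]
    exact ⟨ContinuousLinearEquiv.refl ℝ _, rfl⟩
  have hne : (∞ : WithTop ℕ∞) ≠ 0 := by simp
  let ψ := (hΦ.contDiffAt (x := u)).implicitFunction hne hif
  have hψ : ContDiffAt ℝ ∞ ψ (0, x₀) :=
    (hΦ.contDiffAt (x := u)).contDiffAt_implicitFunction hne hif
  have huniq := (hΦ.contDiffAt (x := u)).eventually_apply_eq_iff_implicitFunction hne hif
  obtain ⟨δ, hδ, hball⟩ := Metric.eventually_nhds_iff_ball.1 huniq
  have hev1 : ContDiffAt ℝ ∞ (fun q => ContinuousMap.evalCLM ℝ (1 : unitInterval) (ψ q)) (0, x₀) :=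
    ContDiffAt.comp (g := (ContinuousMap.evalCLM ℝ (1 : unitInterval) : C(unitInterval, E) →L[ℝ] E))
      _ (ContinuousLinearMap.contDiff _).contDiffAt hψ
  refine hev1.congr_of_eventuallyEq ?_
  have hB0 : 0 ≤ B := (norm_nonneg _).trans (hB 0)
  -- Uniqueness in the implicit function theorem is only local. Since `‖f‖ ≤ B`, these radii keep
  -- the rescaled solution within `δ` of the constant path `x₀`; `B + 1` avoids a zero denominator.
  have hopen : Metric.ball (0 : ℝ) (min ε (δ / (2 * (B + 1)))) ×ˢ Metric.ball x₀ (min ε (δ / 2))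
      ∈ 𝓝 ((0 : ℝ), x₀) :=
    prod_mem_nhds (Metric.ball_mem_nhds _ (by positivity)) (Metric.ball_mem_nhds _ (by positivity))
  filter_upwards [hopen] with ⟨τ, x⟩ ⟨hτ, hx⟩
  simp only [Metric.mem_ball, dist_zero_right, Real.norm_eq_abs, lt_min_iff] at hτ hx
  have hxε : x ∈ Metric.ball x₀ ε := hx.1
  have hmem : ∀ s ∈ Set.Icc (0 : ℝ) 1, τ * s ∈ Set.Ioo (-ε) ε := by
    intro s hs
    rw [Set.mem_Ioo, ← abs_lt, abs_mul, abs_of_nonneg hs.1]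
    exact (mul_le_of_le_one_right (abs_nonneg _) hs.2).trans_lt hτ.1
  have hder : ∀ s ∈ Set.Icc (0 : ℝ) 1,
      HasDerivAt (fun s => S (τ * s) x) (τ • f (S (τ * s) x)) s := by
    intro s hs
    have h1 : HasDerivAt (fun s : ℝ => τ * s) τ s := by
      simpa using (hasDerivAt_id s).const_mul τ
    exact HasDerivAt.scomp s (hS x hxε _ (hmem s hs)) h1
  have hcont : ContinuousOn (fun s => S (τ * s) x) (Set.Icc 0 1) :=
    fun s hs => (hder s hs).continuousAt.continuousWithinAt
  let a : C(unitInterval, E) := ⟨fun s => S (τ * s) x, hcont.domRestrict⟩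
  have ha : Φ ((τ, x), a) = 0 := by
    ext s
    have hint : (∫ r in (0 : ℝ)..s, τ • f (S (τ * r) x)) = S (τ * s) x - S (τ * 0) x := by
      have hsub : Set.uIcc (0 : ℝ) s ⊆ Set.Icc 0 1 := by
        rw [Set.uIcc_of_le s.2.1]; exact Set.Icc_subset_Icc_right s.2.2
      refine intervalIntegral.integral_eq_sub_of_hasDerivAt (fun r hr => hder r (hsub hr)) ?_
      exact ((hf.continuous.comp_continuousOn (hcont.mono hsub)).const_smul τ).intervalIntegrable
    have hint2 : primitiveL E ((ContinuousMap.mk f hf.continuous).comp a) s =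
        ∫ r in (0 : ℝ)..s, f (S (τ * r) x) := by
      rw [primitiveL_apply]
      refine intervalIntegral.integral_congr (fun r hr => ?_)
      rw [Set.uIcc_of_le s.2.1] at hr
      have hr' : r ∈ Set.Icc (0 : ℝ) 1 := ⟨hr.1, hr.2.trans s.2.2⟩
      simp only [Set.IccExtend_of_mem _ _ hr']
      rfl
    have : (Φ ((τ, x), a)) s = S (τ * s) x - x
        - τ • primitiveL E ((ContinuousMap.mk f hf.continuous).comp a) s := rfl
    rw [this, hint2, ← intervalIntegral.integral_smul, hint, mul_zero, hS0 x hxε]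
    simp
  have hclose : ((τ, x), a) ∈ Metric.ball u δ := by
    rw [Metric.mem_ball, Prod.dist_eq, Prod.dist_eq]
    have hB1 : (B + 1) * (δ / (2 * (B + 1))) = δ / 2 := by
      field_simp
    have hτδ : |τ| < δ := by
      refine hτ.2.trans_le ?_
      rw [div_le_iff₀ (by positivity)]
      nlinarith
    refine max_lt (max_lt (by simpa [u] using hτδ) (by simpa [u] using hx.2.trans (half_lt_self hδ))) ?_
    refine (ContinuousMap.dist_lt_iff hδ).2 (fun s => ?_)
    have h1 : ‖S (τ * s) x - S (τ * 0) x‖ ≤ (|τ| * B) * ‖(s : ℝ) - 0‖ := by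
      refine (convex_Icc (0 : ℝ) 1).norm_image_sub_le_of_norm_hasDerivWithin_le
        (f := fun s => S (τ * s) x)
        (fun r hr => (hder r hr).hasDerivWithinAt) (fun r _ => ?_) ⟨le_rfl, zero_le_one⟩ s.2
      rw [norm_smul, Real.norm_eq_abs]
      gcongr
      exact hB _
    rw [mul_zero, hS0 x hxε, sub_zero, Real.norm_of_nonneg s.2.1] at h1
    have h2 : |τ| * B * s ≤ δ / 2 := by
      have h3 : |τ| * B * s ≤ |τ| * B := mul_le_of_le_one_right (by positivity) s.2.2
      have h4 : |τ| * B ≤ |τ| * (B + 1) := by gcongr; linarith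
      have h5 : |τ| * (B + 1) ≤ δ / (2 * (B + 1)) * (B + 1) := by gcongr; exact hτ.2.le
      linarith [h5, hB1]
    calc dist (a s) (u.2 s) ≤ dist (S (τ * s) x) x + dist x x₀ := dist_triangle _ _ _
      _ < δ / 2 + δ / 2 := by
          rw [dist_eq_norm (S (τ * s) x)]
          exact add_lt_add_of_le_of_lt (h1.trans h2) hx.2
      _ = δ := add_halves δ
  have := (hball _ hclose).1 (ha.trans hu.symm)
  change S τ x = ψ (τ, x) 1
  rw [show ψ (τ, x) = a from this]
  change S τ x = S (τ * ((1 : unitInterval) : ℝ)) x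
  simp

end LocalFlow

end

end TranslatedPoint

namespace TranslatedPoint

noncomputable section

/-! ### Calculus in `H¹([0, 1])`. -/

section SobolevCalculus

/-- Lebesgue measure on the unit interval, as a measure on `ℝ`. -/
abbrev unitMeasure : Measure ℝ := volume.restrict (Set.Icc (0 : ℝ) 1)

instance : IsProbabilityMeasure unitMeasure := ⟨by simp⟩

theorem lp_integrable (x : Lp ℝ 2 unitMeasure) : Integrable x unitMeasure :=
  (Lp.memLp x).integrable one_le_two

theorem lp_intervalIntegrable (x : Lp ℝ 2 unitMeasure) {a b : ℝ} (ha : a ∈ Set.Icc (0 : ℝ) 1)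
    (hb : b ∈ Set.Icc (0 : ℝ) 1) : IntervalIntegrable x volume a b :=
  (IntegrableOn.mono_set (t := Set.Icc 0 1) (lp_integrable x)
    (Set.uIcc_subset_Icc ha hb)).intervalIntegrable

theorem ae_uIoc_of_ae_unitMeasure {p : ℝ → Prop} (h : ∀ᵐ s ∂unitMeasure, p s) {a b : ℝ}
    (ha : a ∈ Set.Icc (0 : ℝ) 1) (hb : b ∈ Set.Icc (0 : ℝ) 1) :
    ∀ᵐ s, s ∈ Set.uIoc a b → p s := by
  rw [ae_restrict_iff' measurableSet_Icc] at h
  filter_upwards [h] with s hs hs'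
  exact hs (Set.uIcc_subset_Icc ha hb (Set.uIoc_subset_uIcc hs'))

/-- On a probability space the `L¹` norm is at most the `L²` norm. -/
theorem norm_integral_lp_le (x : Lp ℝ 2 unitMeasure) (t : unitInterval) :
    |∫ s in (0 : ℝ)..t, x s| ≤ ‖x‖ := by
  have h1 : |∫ s in (0 : ℝ)..t, x s| ≤ ∫ s in Set.Ioc 0 (t : ℝ), ‖x s‖ := by
    rw [intervalIntegral.integral_of_le t.2.1]
    exact norm_integral_le_integral_norm (fun s => x s)
  have h2 : ∫ s in Set.Ioc 0 (t : ℝ), ‖x s‖ ≤ ∫ s, ‖x s‖ ∂unitMeasure := by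
    refine setIntegral_mono_set (lp_integrable x).norm (ae_of_all _ fun s => norm_nonneg _) ?_
    exact (Set.Ioc_subset_Icc_self.trans (Set.Icc_subset_Icc_right t.2.2)).eventuallyLE
  refine (h1.trans h2).trans ?_
  rw [Lp.norm_def]
  have h3 : eLpNorm x 1 unitMeasure ≤ eLpNorm x 2 unitMeasure :=
    eLpNorm_le_eLpNorm_of_exponent_le one_le_two (Lp.aestronglyMeasurable x)
  have h4 : ∫ s, ‖x s‖ ∂unitMeasure = (eLpNorm x 1 unitMeasure).toReal := by
    rw [eLpNorm_one_eq_lintegral_enorm, integral_norm_eq_lintegral_enorm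
      (Lp.aestronglyMeasurable x)]
  rw [h4]
  exact ENNReal.toReal_mono (Lp.eLpNorm_ne_top x) h3

/-- The inclusion of `H¹([0, 1], ℝ)` into the continuous functions. -/
def evalL : H1 →L[ℝ] C(unitInterval, ℝ) :=
  LinearMap.mkContinuous
    { toFun := fun u => ⟨fun t => u.eval t, by
        have h : ContinuousOn (fun t => ∫ s in (0 : ℝ)..t, u.2 s) (Set.uIcc 0 1) :=
          intervalIntegral.continuousOn_primitive_interval (by
            rw [Set.uIcc_of_le zero_le_one]; exact lp_integrable u.2)
        rw [Set.uIcc_of_le zero_le_one] at h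
        exact continuous_const.add (h.domRestrict)⟩
      map_add' := fun u v => by
        ext t
        have h0 : (0 : ℝ) ∈ Set.Icc (0 : ℝ) 1 := ⟨le_rfl, zero_le_one⟩
        have h : ∫ s in (0 : ℝ)..t, (u.2 + v.2 : Lp ℝ 2 unitMeasure) s =
            ∫ s in (0 : ℝ)..t, (u.2 s + v.2 s) :=
          intervalIntegral.integral_congr_ae (ae_uIoc_of_ae_unitMeasure (Lp.coeFn_add u.2 v.2) h0 t.2)
        simp only [H1.eval, ContinuousMap.coe_mk, ContinuousMap.add_apply, Prod.fst_add,
          Prod.snd_add]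
        rw [h, intervalIntegral.integral_add (lp_intervalIntegrable _ h0 t.2)
          (lp_intervalIntegrable _ h0 t.2)]
        ring
      map_smul' := fun c u => by
        ext t
        have h0 : (0 : ℝ) ∈ Set.Icc (0 : ℝ) 1 := ⟨le_rfl, zero_le_one⟩
        have h : ∫ s in (0 : ℝ)..t, (c • u.2 : Lp ℝ 2 unitMeasure) s =
            ∫ s in (0 : ℝ)..t, c • u.2 s :=
          intervalIntegral.integral_congr_ae (ae_uIoc_of_ae_unitMeasure (Lp.coeFn_smul c u.2) h0 t.2)
        simp only [H1.eval, ContinuousMap.coe_mk, ContinuousMap.smul_apply, Prod.smul_fst,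
          Prod.smul_snd, RingHom.id_apply]
        rw [h, intervalIntegral.integral_smul, smul_add] } 2
    (fun u => by
      rw [ContinuousMap.norm_le _ (by positivity)]
      intro t
      have h1 := norm_integral_lp_le u.2 t
      have h2 : ‖u.1‖ ≤ ‖u‖ := norm_fst_le u
      have h3 : ‖u.2‖ ≤ ‖u‖ := norm_snd_le u
      have h4 : ‖u.eval t‖ ≤ ‖u.1‖ + |∫ s in (0 : ℝ)..t, u.2 s| := norm_add_le _ _
      exact h4.trans (by linarith))

theorem memLp_mul (f : C(unitInterval, ℝ)) (x : Lp ℝ 2 unitMeasure) :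
    MemLp (fun s => Set.IccExtend zero_le_one f s * x s) 2 unitMeasure :=
  MemLp.of_le_mul (c := ‖f‖) (Lp.memLp x)
    ((f.continuous.Icc_extend').aestronglyMeasurable.mul (Lp.aestronglyMeasurable x))
    (ae_of_all _ fun s => by
      rw [norm_mul]
      exact mul_le_mul_of_nonneg_right (f.norm_coe_le_norm _) (norm_nonneg _))

/-- Multiplication of a square integrable function by a continuous function. -/
def mulL : C(unitInterval, ℝ) →L[ℝ] Lp ℝ 2 unitMeasure →L[ℝ] Lp ℝ 2 unitMeasure :=
  LinearMap.mkContinuous₂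
    (LinearMap.mk₂ ℝ (fun (f : C(unitInterval, ℝ)) (x : Lp ℝ 2 unitMeasure) =>
        (memLp_mul f x).toLp _)
      (fun f f' x => by
        rw [← MemLp.toLp_add]
        exact MemLp.toLp_congr _ _ (ae_of_all _ fun s => add_mul _ _ _))
      (fun c f x => by
        rw [← MemLp.toLp_const_smul]
        exact MemLp.toLp_congr _ _ (ae_of_all _ fun s => mul_assoc _ _ _))
      (fun f x y => by
        rw [← MemLp.toLp_add]
        refine MemLp.toLp_congr _ _ ?_
        filter_upwards [Lp.coeFn_add x y] with s hs
        simp only [hs, Pi.add_apply, mul_add])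
      (fun c f x => by
        rw [← MemLp.toLp_const_smul]
        refine MemLp.toLp_congr _ _ ?_
        filter_upwards [Lp.coeFn_smul c x] with s hs
        simp only [hs, Pi.smul_apply, smul_eq_mul]
        ring)) 1
    (fun f x => by
      rw [one_mul]
      refine Lp.norm_le_mul_norm_of_ae_le_mul ?_
      simp only [LinearMap.mk₂_apply]
      filter_upwards [(memLp_mul f x).coeFn_toLp] with s hs
      rw [hs, norm_mul]
      exact mul_le_mul_of_nonneg_right (f.norm_coe_le_norm _) (norm_nonneg _))

theorem coeFn_mulL (f : C(unitInterval, ℝ)) (x : Lp ℝ 2 unitMeasure) :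
    mulL f x =ᵐ[unitMeasure] fun s => Set.IccExtend zero_le_one f s * x s :=
  (memLp_mul f x).coeFn_toLp

theorem integral_unitInterval_eq (φ : ℝ → ℝ) :
    ∫ s in (0 : ℝ)..1, φ s = ∫ s, φ s ∂unitMeasure := by
  rw [intervalIntegral.integral_of_le zero_le_one, integral_Icc_eq_integral_Ioc]

/-- The trilinear form `∫₀¹ a b' c'`. -/
def energyForm (a b c : H1) : ℝ := inner ℝ (mulL (evalL a) b.2) c.2

theorem energyForm_eq (a b c : H1) :
    energyForm a b c = ∫ s in (0 : ℝ)..1, Set.IccExtend zero_le_one a.eval s * b.2 s * c.2 s := by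
  rw [energyForm, L2.inner_def, integral_unitInterval_eq]
  refine integral_congr_ae ?_
  filter_upwards [coeFn_mulL (evalL a) b.2] with s hs
  rw [hs]
  simp only [RCLike.inner_apply, conj_trivial]
  rw [mul_comm]
  rfl

/-- The form is a composition of the continuous linear and bilinear maps `evalL`, `mulL` and the
inner product of `L²`, so the product rule applies. -/
theorem HasDerivAt.energyForm {a b c : ℝ → H1} {a' b' c' : H1} {r : ℝ} (ha : HasDerivAt a a' r)
    (hb : HasDerivAt b b' r) (hc : HasDerivAt c c' r) :
    HasDerivAt (fun r => energyForm (a r) (b r) (c r))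
      (energyForm a' (b r) (c r) + energyForm (a r) b' (c r) + energyForm (a r) (b r) c') r := by
  have ha1 : HasDerivAt (fun r => mulL (evalL (a r))) (mulL (evalL a')) r :=
    mulL.hasFDerivAt.comp_hasDerivAt r (evalL.hasFDerivAt.comp_hasDerivAt r ha)
  have hb1 : HasDerivAt (fun r => (b r).2) b'.2 r :=
    (ContinuousLinearMap.snd ℝ ℝ (Lp ℝ 2 unitMeasure)).hasFDerivAt.comp_hasDerivAt r hb
  have hc1 : HasDerivAt (fun r => (c r).2) c'.2 r :=
    (ContinuousLinearMap.snd ℝ ℝ (Lp ℝ 2 unitMeasure)).hasFDerivAt.comp_hasDerivAt r hc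
  have h := (ha1.clm_apply hb1).inner ℝ hc1
  refine h.congr_deriv ?_
  simp only [TranslatedPoint.energyForm, inner_add_left]
  ring

section Composition

variable {ι : Type} [Fintype ι]

/-- The map `H¹([0, 1], ℝ^ι) → C([0, 1], ℝ^ι)`. -/
def evalPiL (ι : Type) [Fintype ι] : (ι → H1) →L[ℝ] C(unitInterval, ι → ℝ) :=
  ∑ i : ι, (ContinuousLinearMap.compLeftContinuous ℝ unitInterval
    (ContinuousLinearMap.pi fun j => by
      classical exact if i = j then ContinuousLinearMap.id ℝ ℝ else 0)).comp
      (evalL.comp (ContinuousLinearMap.proj i))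

@[simp]
theorem evalPiL_apply (u : ι → H1) (t : unitInterval) (i : ι) :
    evalPiL ι u t i = (u i).eval t := by
  classical
  simp only [evalPiL, sum_apply, ContinuousMap.coe_sum, Finset.sum_apply]
  rw [Finset.sum_eq_single i]
  · simp [ContinuousLinearMap.compLeftContinuous]
    rfl
  · intro j _ hj
    simp [ContinuousLinearMap.compLeftContinuous, hj]
  · simp

/-- Composition of a vector valued `H¹` function with a smooth function. -/
def compH1 (f : (ι → ℝ) → ℝ) (hf : ContDiff ℝ ∞ f) (u : ι → H1) : H1 := by
  classical
  exact (f fun i => (u i).1, ∑ i, mulL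
    ((ContinuousMap.mk (fun y => fderiv ℝ f y (Pi.single i 1))
      ((hf.continuous_fderiv (by simp)).clm_apply continuous_const)).comp (evalPiL ι u)) (u i).2)

theorem contDiff_compH1 (f : (ι → ℝ) → ℝ) (hf : ContDiff ℝ ∞ f) :
    ContDiff ℝ ∞ (compH1 f hf) := by
  classical
  refine ContDiff.prodMk (hf.comp (contDiff_pi.2 fun i => ?_)) (ContDiff.sum fun i _ => ?_)
  · exact contDiff_fst.comp (contDiff_apply ℝ H1 i)
  · have hfi : ContDiff ℝ ∞ (fun y => fderiv ℝ f y (Pi.single i 1)) :=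
      (hf.fderiv_right (m := ∞) (by simp)).clm_apply contDiff_const
    refine ContDiff.clm_apply (mulL.contDiff.comp ?_) (contDiff_snd.comp (contDiff_apply ℝ H1 i))
    exact (contDiff_postcomp (K := unitInterval) hfi).comp (evalPiL ι).contDiff

/-- The square integrable function given by a bounded continuous one. -/
abbrev bcfToLp : (BoundedContinuousFunction ℝ ℝ) →L[ℝ] Lp ℝ 2 unitMeasure :=
  BoundedContinuousFunction.toLp 2 unitMeasure ℝ

theorem denseRange_bcfToLp : DenseRange bcfToLp :=
  BoundedContinuousFunction.toLp_denseRange _ _ ℝ (by simp)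

theorem integral_bcfToLp (v : BoundedContinuousFunction ℝ ℝ) {a b : ℝ}
    (ha : a ∈ Set.Icc (0 : ℝ) 1) (hb : b ∈ Set.Icc (0 : ℝ) 1) :
    ∫ s in a..b, bcfToLp v s = ∫ s in a..b, v s :=
  intervalIntegral.integral_congr_ae
    (ae_uIoc_of_ae_unitMeasure (BoundedContinuousFunction.coeFn_toLp 2 unitMeasure ℝ v) ha hb)

/-- Both sides are continuous in `u`, so it suffices to treat the dense set of those `u` whose weak
derivatives are bounded continuous functions. For these the classical chain rule and the fundamental
theorem of calculus apply. -/
theorem eval_compH1 (f : (ι → ℝ) → ℝ) (hf : ContDiff ℝ ∞ f) (u : ι → H1) (t : unitInterval) :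
    (compH1 f hf u).eval t = f fun i => (u i).eval t := by
  classical
  have hd : DenseRange (Pi.map fun _ : ι => Prod.map (id : ℝ → ℝ) bcfToLp) :=
    DenseRange.piMap fun _ => denseRange_id.prodMap denseRange_bcfToLp
  have hc1 : Continuous fun u : ι → H1 => (compH1 f hf u).eval t :=
    (continuous_eval_const t).comp
      (evalL.continuous.comp (contDiff_compH1 f hf).continuous)
  have hc2 : Continuous fun u : ι → H1 => f fun i => (u i).eval t :=
    hf.continuous.comp (continuous_pi fun i =>
      (continuous_eval_const t).comp (evalL.continuous.comp (continuous_apply i)))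
  refine congrFun (hd.equalizer hc1 hc2 (funext fun w => ?_)) u
  set U : ι → H1 := Pi.map (fun _ : ι => Prod.map (id : ℝ → ℝ) bcfToLp) w with hU
  have h0 : (0 : ℝ) ∈ Set.Icc (0 : ℝ) 1 := ⟨le_rfl, zero_le_one⟩
  let y : ℝ → ι → ℝ := fun s i => (w i).1 + ∫ r in (0 : ℝ)..s, (w i).2 r
  have hy : ∀ s, HasDerivAt y (fun i => (w i).2 s) s := by
    intro s
    rw [hasDerivAt_pi]
    intro i
    exact ((w i).2.continuous.integral_hasStrictDerivAt 0 s).hasDerivAt.const_add _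
  have hyU : ∀ (s : unitInterval) i, (U i).eval s = y s i := by
    intro s i
    exact congrArg (fun z => (w i).1 + z) (integral_bcfToLp (w i).2 h0 s.2)
  have hycont : Continuous y := continuous_iff_continuousAt.2 fun s => (hy s).continuousAt
  have hfy : ∀ s, HasDerivAt (f ∘ y) (∑ i, fderiv ℝ f (y s) (Pi.single i 1) * (w i).2 s) s := by
    intro s
    refine (((hf.differentiable (by simp)) (y s)).hasFDerivAt.comp_hasDerivAt s (hy s)).congr_deriv ?_
    conv_lhs => rw [pi_eq_sum_univ' (fun i => (w i).2 s), map_sum]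
    refine Finset.sum_congr rfl fun i _ => ?_
    rw [map_smul, smul_eq_mul, mul_comm]
  have hcont : Continuous fun s => ∑ i, fderiv ℝ f (y s) (Pi.single i 1) * (w i).2 s := by
    refine continuous_finsetSum _ fun i _ => ?_
    exact (((hf.continuous_fderiv (by simp)).comp hycont).clm_apply continuous_const).mul
      (w i).2.continuous
  have hFTC := intervalIntegral.integral_eq_sub_of_hasDerivAt (a := 0) (b := t)
    (fun s _ => hfy s) (hcont.intervalIntegrable _ _)
  have hae : ∀ᵐ s ∂unitMeasure, (compH1 f hf U).2 s =
      ∑ i, fderiv ℝ f (y s) (Pi.single i 1) * (w i).2 s := by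
    have hsum : ∀ (T : Finset ι) (F : ι → Lp ℝ 2 unitMeasure),
        (∑ i ∈ T, F i : Lp ℝ 2 unitMeasure) =ᵐ[unitMeasure] fun s => ∑ i ∈ T, F i s :=
      Lp.coeFn_fun_finsetSum
    have h1 : ∀ᵐ s ∂unitMeasure, ∀ i, mulL ((ContinuousMap.mk
        (fun y => fderiv ℝ f y (Pi.single i 1))
        ((hf.continuous_fderiv (by simp)).clm_apply continuous_const)).comp (evalPiL ι U)) (U i).2 s
        = fderiv ℝ f (y s) (Pi.single i 1) * (w i).2 s := by
      rw [ae_all_iff]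
      intro i
      filter_upwards [coeFn_mulL ((ContinuousMap.mk
        (fun y => fderiv ℝ f y (Pi.single i 1))
        ((hf.continuous_fderiv (by simp)).clm_apply continuous_const)).comp (evalPiL ι U)) (U i).2,
        BoundedContinuousFunction.coeFn_toLp 2 unitMeasure ℝ (w i).2,
        ae_restrict_mem measurableSet_Icc] with s hs1 hs2 hs3
      rw [hs1, Set.IccExtend_of_mem _ _ hs3]
      have : evalPiL ι U ⟨s, hs3⟩ = y s := by
        ext j
        rw [evalPiL_apply, hyU]
      simp only [ContinuousMap.comp_apply, ContinuousMap.coe_mk, this]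
      congr 1
    filter_upwards [h1, hsum Finset.univ fun i => mulL ((ContinuousMap.mk
        (fun y => fderiv ℝ f y (Pi.single i 1))
        ((hf.continuous_fderiv (by simp)).clm_apply continuous_const)).comp (evalPiL ι U)) (U i).2]
      with s hs1 hs2
    refine Eq.trans ?_ (hs2.trans (Finset.sum_congr rfl fun i _ => hs1 i))
    rfl
  have hint : ∫ s in (0 : ℝ)..t, (compH1 f hf U).2 s =
      ∫ s in (0 : ℝ)..t, ∑ i, fderiv ℝ f (y s) (Pi.single i 1) * (w i).2 s :=
    intervalIntegral.integral_congr_ae (ae_uIoc_of_ae_unitMeasure hae h0 t.2)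
  have hfirst : (compH1 f hf U).1 = f (y 0) := by
    change f _ = f _
    congr 1
    ext i
    simp [y, U]
  change (compH1 f hf U).1 + ∫ s in (0 : ℝ)..t, (compH1 f hf U).2 s = f fun i => (U i).eval t
  rw [hint, hFTC, hfirst, Function.comp_apply, Function.comp_apply, add_sub_cancel]
  congr 1
  ext i
  exact (hyU t i).symm

/-- The source of smooth families of paths: such a family is obtained by inserting smoothly varying
`H¹` functions into a smooth map of finitely many variables. -/
theorem exists_contDiff_comp_eval {P : Type*} [NormedAddCommGroup P] [NormedSpace ℝ P]
    {f : (ι → ℝ) → ℝ} (hf : ContDiff ℝ ∞ f) {Ψ : ι → P → H1} (hΨ : ∀ i, ContDiff ℝ ∞ (Ψ i)) :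
    ∃ Φ : P → H1, ContDiff ℝ ∞ Φ ∧ ∀ p t, (f fun i => (Ψ i p).eval t) = (Φ p).eval t :=
  ⟨fun p => compH1 f hf fun i => Ψ i p, (contDiff_compH1 f hf).comp (contDiff_pi.2 hΨ),
    fun _ t => (eval_compH1 f hf _ t).symm⟩

end Composition

end SobolevCalculus

end

end TranslatedPoint

namespace TranslatedPoint

noncomputable section

/-! ### Absolutely continuous representatives and weak derivatives. -/

section SobolevFunctions

/-- The absolutely continuous function on `ℝ` that extends an `H¹` function. -/
def evalReal (u : H1) (s : ℝ) : ℝ := u.1 + ∫ r in (0 : ℝ)..s, u.2 r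

theorem ae_hasDerivAt_evalReal (u : H1) :
    ∀ᵐ s, s ∈ Set.Icc (0 : ℝ) 1 → HasDerivAt (evalReal u) (u.2 s) s := by
  have h := (lp_intervalIntegrable u.2 (a := 0) (b := 1) (by simp) (by simp)).ae_hasDerivAt_integral
  filter_upwards [h] with s hs hs'
  rw [← Set.uIcc_of_le zero_le_one] at hs'
  exact (hs hs' 0 Set.left_mem_uIcc).const_add _

theorem absolutelyContinuousOnInterval_evalReal (u : H1) {a b : ℝ} (ha : a ∈ Set.Icc (0 : ℝ) 1)
    (hb : b ∈ Set.Icc (0 : ℝ) 1) : AbsolutelyContinuousOnInterval (evalReal u) a b := by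
  have h := (lp_intervalIntegrable u.2 (a := 0) (b := 1) (by simp)
    (by simp)).absolutelyContinuousOnInterval_intervalIntegral (c := 0) Set.left_mem_uIcc
  have h2 : AbsolutelyContinuousOnInterval (fun _ : ℝ => u.1) 0 1 :=
    ContDiffOn.absolutelyContinuousOnInterval (contDiff_const.contDiffOn)
  exact (h2.add h).mono (by rw [Set.uIcc_of_le zero_le_one]; exact Set.uIcc_subset_Icc ha hb)

theorem exists_eval_eq_integral (a : ℝ) {d : ℝ → ℝ} (hd : Measurable d) {B : ℝ}
    (hB : ∀ s ∈ Set.Icc (0 : ℝ) 1, |d s| ≤ B) :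
    ∃ u : H1, u.1 = a ∧ (∀ᵐ s ∂unitMeasure, u.2 s = d s) ∧
      ∀ t : unitInterval, u.eval t = a + ∫ s in (0 : ℝ)..t, d s := by
  have hm : MemLp d 2 unitMeasure :=
    MemLp.of_bound hd.aestronglyMeasurable B
      ((ae_restrict_iff' measurableSet_Icc).2 (ae_of_all _ hB))
  refine ⟨(a, hm.toLp d), rfl, hm.coeFn_toLp, fun t => ?_⟩
  exact congrArg (fun z => a + z) (intervalIntegral.integral_congr_ae
    (ae_uIoc_of_ae_unitMeasure hm.coeFn_toLp ⟨le_rfl, zero_le_one⟩ t.2))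

/-- The weak derivative is the piecewise classical one; there is no contribution at `r` because the
two pieces agree there. This is what makes broken Jacobi fields elements of `H¹`. -/
theorem exists_eval_eq_of_piecewise {c₁ c₂ : ℝ → ℝ} (h₁ : ContDiff ℝ 1 c₁) (h₂ : ContDiff ℝ 1 c₂)
    {r : ℝ} (hr : r ∈ Set.Icc (0 : ℝ) 1) (hc : c₁ r = c₂ r) :
    ∃ u : H1, ∀ t : unitInterval, (if (t : ℝ) ≤ r then c₁ t else c₂ t) = u.eval t := by
  have hd₁ := h₁.continuous_deriv le_rfl
  have hd₂ := h₂.continuous_deriv le_rfl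
  obtain ⟨B₁, hB₁⟩ := isCompact_Icc.exists_bound_of_continuousOn (s := Set.Icc (0 : ℝ) 1)
    hd₁.continuousOn
  obtain ⟨B₂, hB₂⟩ := isCompact_Icc.exists_bound_of_continuousOn (s := Set.Icc (0 : ℝ) 1)
    hd₂.continuousOn
  obtain ⟨u, -, -, hu⟩ := exists_eval_eq_integral (c₁ 0)
    (d := fun s => if s ≤ r then deriv c₁ s else deriv c₂ s) (B := max B₁ B₂)
    (Measurable.ite measurableSet_Iic hd₁.measurable hd₂.measurable) (fun s hs => by
      split_ifs
      · exact (hB₁ s hs).trans (le_max_left _ _)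
      · exact (hB₂ s hs).trans (le_max_right _ _))
  refine ⟨u, fun t => ?_⟩
  rw [hu]
  have ftc₁ : ∀ x y : ℝ, ∫ s in x..y, deriv c₁ s = c₁ y - c₁ x := fun x y =>
    intervalIntegral.integral_deriv_eq_sub
      (fun s _ => (h₁.differentiable one_ne_zero) s) (hd₁.intervalIntegrable _ _)
  have ftc₂ : ∀ x y : ℝ, ∫ s in x..y, deriv c₂ s = c₂ y - c₂ x := fun x y =>
    intervalIntegral.integral_deriv_eq_sub
      (fun s _ => (h₂.differentiable one_ne_zero) s) (hd₂.intervalIntegrable _ _)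
  have hleft : ∀ y ∈ Set.Icc 0 r, ∫ s in (0 : ℝ)..y, (if s ≤ r then deriv c₁ s else deriv c₂ s) =
      c₁ y - c₁ 0 := by
    intro y hy
    rw [← ftc₁]
    refine intervalIntegral.integral_congr fun s hs => ?_
    rw [Set.uIcc_of_le hy.1] at hs
    exact if_pos (hs.2.trans hy.2)
  split_ifs with ht
  · rw [hleft t ⟨t.2.1, ht⟩]
    ring
  · have hright : ∫ s in r..t, (if s ≤ r then deriv c₁ s else deriv c₂ s) = c₂ t - c₂ r := by
      rw [← ftc₂]
      refine intervalIntegral.integral_congr_ae (ae_of_all _ fun s hs => ?_)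
      rw [Set.uIoc_of_le (not_le.1 ht).le] at hs
      exact if_neg (not_le.2 hs.1)
    rw [← intervalIntegral.integral_add_adjacent_intervals (b := r), hleft r ⟨hr.1, le_rfl⟩, hright,
      hc]
    · ring
    · refine (IntervalIntegrable.congr_ae (f := deriv c₁) (hd₁.intervalIntegrable _ _) ?_)
      refine (ae_restrict_iff' measurableSet_uIoc).2 (ae_of_all _ fun s hs => ?_)
      rw [Set.uIoc_of_le hr.1] at hs
      exact (if_pos hs.2).symm
    · refine (IntervalIntegrable.congr_ae (f := deriv c₂) (hd₂.intervalIntegrable _ _) ?_)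
      refine (ae_restrict_iff' measurableSet_uIoc).2 (ae_of_all _ fun s hs => ?_)
      rw [Set.uIoc_of_le (not_le.1 ht).le] at hs
      exact (if_neg (not_le.2 hs.1)).symm

theorem exists_eval_eq_of_contDiff {c : ℝ → ℝ} (hc : ContDiff ℝ 1 c) :
    ∃ u : H1, ∀ t : unitInterval, c t = u.eval t := by
  obtain ⟨u, hu⟩ := exists_eval_eq_of_piecewise hc hc (r := 0) (by simp) rfl
  exact ⟨u, fun t => by simpa using hu t⟩

theorem evalReal_eq {u : H1} {c : ℝ → ℝ} (h : ∀ t : unitInterval, c t = u.eval t) {s : ℝ}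
    (hs : s ∈ Set.Icc (0 : ℝ) 1) : evalReal u s = c s :=
  (h ⟨s, hs⟩).symm

/-- The weak derivative of an `H¹` function that agrees with a smooth one on an interval. -/
theorem ae_snd_eq_deriv {u : H1} {c : ℝ → ℝ} {a b : ℝ}
    (ha : a ∈ Set.Icc (0 : ℝ) 1) (hb : b ∈ Set.Icc (0 : ℝ) 1)
    (h : ∀ s ∈ Set.Icc a b, evalReal u s = c s) :
    ∀ᵐ s, s ∈ Set.Ioo a b → u.2 s = deriv c s := by
  filter_upwards [ae_hasDerivAt_evalReal u] with s hs hs'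
  have h1 := hs ⟨ha.1.trans hs'.1.le, hs'.2.le.trans hb.2⟩
  have h2 : evalReal u =ᶠ[𝓝 s] c := by
    filter_upwards [Ioo_mem_nhds hs'.1 hs'.2] with r hr using h r ⟨hr.1.le, hr.2.le⟩
  rw [← h2.deriv_eq, h1.deriv]

theorem energyForm_eq_evalReal (a b c : H1) :
    energyForm a b c = ∫ s in (0 : ℝ)..1, evalReal a s * b.2 s * c.2 s := by
  rw [energyForm_eq]
  refine intervalIntegral.integral_congr fun s hs => ?_
  rw [Set.uIcc_of_le zero_le_one] at hs
  simp only [Set.IccExtend_of_mem _ _ hs]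
  rfl

end SobolevFunctions

end

end TranslatedPoint

namespace TranslatedPoint

noncomputable section

/-! ### Charts of boundaryless manifolds and coordinate expressions of vector fields. -/

section Charts

variable {E : Type} [NormedAddCommGroup E] [NormedSpace ℝ E]
  {H : Type*} [TopologicalSpace H] {I : ModelWithCorners ℝ E H} [I.Boundaryless]
  {N : Type*} [TopologicalSpace N] [ChartedSpace H N] [IsManifold I ∞ N]

theorem isManifold_one_of_infty (I : ModelWithCorners ℝ E H) (N : Type*) [TopologicalSpace N]
    [ChartedSpace H N] [IsManifold I ∞ N] : IsManifold I 1 N :=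
  IsManifold.of_le (n := ∞) (by simp)

theorem contMDiffAt_extChartAt_symm_of_mem {x₀ : N} {y : E} (hy : y ∈ (extChartAt I x₀).target) :
    ContMDiffAt 𝓘(ℝ, E) I ∞ (extChartAt I x₀).symm y :=
  (contMDiffOn_extChartAt_symm x₀).contMDiffAt ((isOpen_extChartAt_target x₀).mem_nhds hy)

theorem contMDiffAt_extChartAt_of_mem {x₀ x : N} (hx : x ∈ (extChartAt I x₀).source) :
    ContMDiffAt I 𝓘(ℝ, E) ∞ (extChartAt I x₀) x :=
  contMDiffAt_extChartAt' (by rwa [extChartAt_source] at hx)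

theorem mfderiv_extChartAt_mfderiv_symm {x₀ : N} {y : E} (hy : y ∈ (extChartAt I x₀).target)
    (a : E) : mfderiv I 𝓘(ℝ, E) (extChartAt I x₀) ((extChartAt I x₀).symm y)
      (mfderiv 𝓘(ℝ, E) I (extChartAt I x₀).symm y a) = a := by
  have := isManifold_one_of_infty I N
  have h := mfderiv_extChartAt_comp_mfderivWithin_extChartAt_symm (I := I) hy
  rw [I.range_eq_univ, mfderivWithin_univ] at h
  exact congrArg (fun A => A a) h

theorem mfderiv_symm_mfderiv_extChartAt {x₀ x : N} (hx : x ∈ (extChartAt I x₀).source)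
    (v : TangentSpace I x) : mfderiv 𝓘(ℝ, E) I (extChartAt I x₀).symm (extChartAt I x₀ x)
      (mfderiv I 𝓘(ℝ, E) (extChartAt I x₀) x v) = v := by
  have := isManifold_one_of_infty I N
  have h := mfderivWithin_extChartAt_symm_comp_mfderiv_extChartAt' (I := I) hx
  rw [I.range_eq_univ, mfderivWithin_univ] at h
  exact congrArg (fun A => A v) h

theorem mfderiv_extChartAt_self_apply (x : N) (v : TangentSpace I x) :
    mfderiv I 𝓘(ℝ, E) (extChartAt I x) x v = v := by
  have := isManifold_one_of_infty I N
  have h := mfderiv_extChartAt_self (I := I) (x := x)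
  exact congrArg (fun A => A v) h

/-- A vector field is smooth at a point iff its coordinate expression is. -/
theorem contMDiffAt_vectorField_iff {Z : ∀ x : N, TangentSpace I x} {x₀ x : N}
    (hx : x ∈ (extChartAt I x₀).source) :
    ContMDiffAt I I.tangent ∞ (fun x => (⟨x, Z x⟩ : TangentBundle I N)) x ↔
      ContMDiffAt I 𝓘(ℝ, E) ∞ (fun x => (mfderiv I 𝓘(ℝ, E) (extChartAt I x₀) x (Z x) : E)) x := by
  have := isManifold_one_of_infty I N
  have hx' : x ∈ (trivializationAt E (TangentSpace I) x₀).baseSet := by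
    rwa [TangentBundle.trivializationAt_baseSet, ← extChartAt_source (I := I)]
  rw [show ContMDiffAt I I.tangent ∞ (fun x => (⟨x, Z x⟩ : TangentBundle I N)) x ↔ _ from
    (trivializationAt E (TangentSpace I) x₀).contMDiffAt_section_iff hx']
  refine Filter.EventuallyEq.contMDiffAt_iff ?_
  filter_upwards [(isOpen_extChartAt_source (I := I) x₀).mem_nhds hx] with z hz
  have hz' : z ∈ (trivializationAt E (TangentSpace I) x₀).baseSet := by
    rwa [TangentBundle.trivializationAt_baseSet, ← extChartAt_source (I := I)]
  have h1 := TangentBundle.continuousLinearMapAt_trivializationAt (𝕜 := ℝ) (I := I)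
    (x₀ := x₀) (x := z) (by rwa [extChartAt_source] at hz)
  have h2 : (trivializationAt E (TangentSpace I) x₀).continuousLinearMapAt ℝ z (Z z) =
      ((trivializationAt E (TangentSpace I) x₀) ⟨z, Z z⟩).2 := by
    rw [Bundle.Trivialization.continuousLinearMapAt_apply,
      Bundle.Trivialization.linearMapAt_apply, if_pos hz']
  rw [← h2, h1]
  rfl

end Charts

/-! ### Local flows of smooth vector fields. -/

section Flow

variable {E : Type} [NormedAddCommGroup E] [NormedSpace ℝ E] [FiniteDimensional ℝ E]
  {H : Type*} [TopologicalSpace H] {I : ModelWithCorners ℝ E H} [I.Boundaryless]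
  {N : Type*} [TopologicalSpace N] [ChartedSpace H N] [IsManifold I ∞ N]

/-- Local flows of smooth vector fields. -/
theorem exists_local_flow {Z : ∀ x : N, TangentSpace I x}
    (hZ : ContMDiff I I.tangent ∞ (fun x => (⟨x, Z x⟩ : TangentBundle I N))) (x₀ : N) :
    ∃ ε > 0, ∃ U ∈ 𝓝 x₀, ∃ Ψ : ℝ → N → N,
      (∀ x ∈ U, Ψ 0 x = x ∧ IsMIntegralCurveOn (fun τ => Ψ τ x) Z (Set.Ioo (-ε) ε)) ∧
      ContMDiffAt (𝓘(ℝ, ℝ).prod I) I ∞ (fun q : ℝ × N => Ψ q.1 q.2) (0, x₀) := by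
  let φ := extChartAt I x₀
  have hopen : IsOpen φ.target := isOpen_extChartAt_target x₀
  let F₀ : E → E := fun y => (mfderiv I 𝓘(ℝ, E) φ (φ.symm y) (Z (φ.symm y)) : E)
  have hF₀ : ContDiffOn ℝ ∞ F₀ φ.target := by
    intro y hy
    have h1 : ContMDiffAt I 𝓘(ℝ, E) ∞
        (fun x => (mfderiv I 𝓘(ℝ, E) φ x (Z x) : E)) (φ.symm y) :=
      (contMDiffAt_vectorField_iff (φ.map_target hy)).1 hZ.contMDiffAt
    exact (contMDiffAt_iff_contDiffAt.1
      (h1.comp y (contMDiffAt_extChartAt_symm_of_mem hy))).contDiffWithinAt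
  have hy₀ : φ x₀ ∈ φ.target := mem_extChartAt_target x₀
  obtain ⟨r, hr, hball⟩ := Metric.nhds_basis_closedBall.mem_iff.1 (hopen.mem_nhds hy₀)
  -- The cutoff makes the coordinate field smooth and bounded on all of `E`; on the ball of radius
  -- `r / 2` it equals `1` and the field is unchanged.
  let χ : ContDiffBump (φ x₀) := ⟨r / 2, r, by positivity, by linarith⟩
  let F : E → E := fun y => χ y • F₀ y
  have hF : ContDiff ℝ ∞ F := by
    rw [contDiff_iff_contDiffAt]
    intro y
    by_cases hy : y ∈ φ.target
    · exact χ.contDiff.contDiffAt.smul ((hF₀ y hy).contDiffAt (hopen.mem_nhds hy))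
    · have : y ∉ tsupport χ := by
        rw [χ.tsupport_eq]
        exact fun h => hy (hball h)
      have h0 : F =ᶠ[𝓝 y] fun _ => 0 := by
        filter_upwards [(isClosed_tsupport χ).isOpen_compl.mem_nhds this] with z hz
        simp [F, image_eq_zero_of_notMem_tsupport hz]
      exact contDiffAt_const.congr_of_eventuallyEq h0
  have hFc : HasCompactSupport F := χ.hasCompactSupport.smul_right
  obtain ⟨B, hB⟩ := hF.continuous.bounded_above_of_compact_support hFc
  have hB0 : 0 ≤ B := (norm_nonneg _).trans (hB 0)
  obtain ⟨ρ, hρ, ε₁, hε₁, hS⟩ :=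
    (hF.of_le (m := 1) (by simp)).contDiffAt.exists_forall_mem_closedBall_exists_eq_forall_mem_Ioo_hasDerivAt
      (x₀ := φ x₀) 0
  simp only [zero_sub, zero_add] at hS
  choose! S hS0 hSd using hS
  -- A solution starting within `ε` of the centre moves by at most `B * ε` during time `ε`; the two
  -- bounds by `r / 4` keep it in the ball where the cutoff is `1`.
  let ε := min (min ρ ε₁) (min (r / 4) (r / (4 * (B + 1))))
  have hε : 0 < ε := by positivity
  have hερ : ε ≤ ρ := (min_le_left _ _).trans (min_le_left _ _)
  have hεε₁ : ε ≤ ε₁ := (min_le_left _ _).trans (min_le_right _ _)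
  have hεr : ε ≤ r / 4 := (min_le_right _ _).trans (min_le_left _ _)
  have hεB : ε * (B + 1) ≤ r / 4 := by
    have h1 : ε ≤ r / (4 * (B + 1)) := (min_le_right _ _).trans (min_le_right _ _)
    calc ε * (B + 1) ≤ r / (4 * (B + 1)) * (B + 1) := by gcongr
      _ = r / 4 := by field_simp
  have hmem : ∀ y ∈ Metric.ball (φ x₀) ε, y ∈ Metric.closedBall (φ x₀) ρ := fun y hy =>
    Metric.closedBall_subset_closedBall hερ (Metric.ball_subset_closedBall hy)
  have hstay : ∀ y ∈ Metric.ball (φ x₀) ε, ∀ τ ∈ Set.Ioo (-ε) ε,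
      S y τ ∈ Metric.closedBall (φ x₀) (r / 2) := by
    intro y hy τ hτ
    have h1 : ‖S y τ - S y 0‖ ≤ B * ‖τ - 0‖ :=
      (convex_Ioo (-ε) ε).norm_image_sub_le_of_norm_hasDerivWithin_le
        (fun s hs => (hSd y (hmem y hy) s ⟨by linarith [hs.1], by linarith [hs.2]⟩).hasDerivWithinAt)
        (fun s _ => hB _) ⟨by linarith, hε⟩ hτ
    rw [hS0 y (hmem y hy), sub_zero, Real.norm_eq_abs] at h1
    have h2 : |τ| ≤ ε := (abs_lt.2 hτ).le
    have h3 : B * |τ| ≤ ε * (B + 1) := by nlinarith [abs_nonneg τ]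
    have h4 : dist y (φ x₀) < ε := hy
    rw [Metric.mem_closedBall]
    calc dist (S y τ) (φ x₀) ≤ dist (S y τ) y + dist y (φ x₀) := dist_triangle _ _ _
      _ ≤ r / 4 + r / 4 := by
        rw [dist_eq_norm]
        exact add_le_add (h1.trans (h3.trans hεB)) (h4.le.trans hεr)
      _ = r / 2 := by ring
  have hsmooth : ContDiffAt ℝ ∞ (fun q : ℝ × E => S q.2 q.1) (0, φ x₀) :=
    contDiffAt_of_hasDerivAt hF hB (S := fun τ y => S y τ) hε
      (fun y hy => hS0 y (hmem y hy))
      (fun y hy τ hτ => hSd y (hmem y hy) τ ⟨by linarith [hτ.1], by linarith [hτ.2]⟩)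
  refine ⟨ε, hε, φ.source ∩ φ ⁻¹' Metric.ball (φ x₀) ε, ?_, fun τ x => φ.symm (S (φ x) τ), ?_, ?_⟩
  · exact Filter.inter_mem (extChartAt_source_mem_nhds x₀)
      ((continuousAt_extChartAt x₀).preimage_mem_nhds (Metric.ball_mem_nhds _ hε))
  · rintro x ⟨hx, hxb⟩
    refine ⟨?_, fun τ hτ => ?_⟩
    · simp only [hS0 _ (hmem _ hxb)]
      exact φ.left_inv hx
    · have hmemS := hstay _ hxb τ hτ
      have htarget : S (φ x) τ ∈ φ.target :=
        hball (Metric.closedBall_subset_closedBall (by linarith) hmemS)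
      have h1 : HasDerivAt (S (φ x)) (F (S (φ x) τ)) τ :=
        hSd _ (hmem _ hxb) τ ⟨by linarith [hτ.1], by linarith [hτ.2]⟩
      have h2 : F (S (φ x) τ) = F₀ (S (φ x) τ) := by
        simp only [F, χ.one_of_mem_closedBall hmemS, one_smul]
      rw [h2] at h1
      have h3 : HasMFDerivAt 𝓘(ℝ, ℝ) 𝓘(ℝ, E) (S (φ x)) τ
          (ContinuousLinearMap.toSpanSingleton ℝ (F₀ (S (φ x) τ))) := h1.hasFDerivAt.hasMFDerivAt
      have h4 := ((contMDiffAt_extChartAt_symm_of_mem (I := I) htarget).mdifferentiableAt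
        (by simp)).hasMFDerivAt
      have h5 := h4.comp τ h3
      refine HasMFDerivAt.hasMFDerivWithinAt (h5.congr_mfderiv ?_)
      ext
      change mfderiv 𝓘(ℝ, E) I φ.symm (S (φ x) τ) ((1 : ℝ) • F₀ (S (φ x) τ)) =
        (1 : ℝ) • Z (φ.symm (S (φ x) τ))
      rw [one_smul, one_smul]
      have h6 := mfderiv_symm_mfderiv_extChartAt (φ.map_target htarget) (Z (φ.symm (S (φ x) τ)))
      rw [φ.right_inv htarget] at h6
      exact h6
  · have h1 : ContMDiffAt (𝓘(ℝ, ℝ).prod I) (𝓘(ℝ, ℝ).prod 𝓘(ℝ, E)) ∞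
        (fun q : ℝ × N => (q.1, φ q.2)) (0, x₀) :=
      contMDiffAt_fst.prodMk ((contMDiffAt_extChartAt_of_mem (mem_extChartAt_source x₀)).comp
        (0, x₀) contMDiffAt_snd)
    have h2 : ContMDiffAt (𝓘(ℝ, ℝ).prod 𝓘(ℝ, E)) 𝓘(ℝ, E) ∞ (fun q : ℝ × E => S q.2 q.1)
        (0, φ x₀) := by
      rw [← modelWithCornersSelf_prod, chartedSpaceSelf_prod]
      exact hsmooth.contMDiffAt
    have h3 : S (φ x₀) 0 = φ x₀ := hS0 _ (hmem _ (Metric.mem_ball_self hε))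
    have h4 : ContMDiffAt 𝓘(ℝ, E) I ∞ φ.symm ((fun q : ℝ × E => S q.2 q.1) (0, φ x₀)) := by
      change ContMDiffAt 𝓘(ℝ, E) I ∞ φ.symm (S (φ x₀) 0)
      rw [h3]
      exact contMDiffAt_extChartAt_symm_of_mem hy₀
    exact h4.comp (0, x₀) (h2.comp (0, x₀) h1)

end Flow

end

end TranslatedPoint

namespace TranslatedPoint

noncomputable section

/-! ### Complete vector fields and smoothness of their flows. -/

section GlobalFlow

variable {E : Type} [NormedAddCommGroup E] [NormedSpace ℝ E] [FiniteDimensional ℝ E]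
  {H : Type*} [TopologicalSpace H] {I : ModelWithCorners ℝ E H} [I.Boundaryless]
  {N : Type*} [TopologicalSpace N] [ChartedSpace H N] [IsManifold I ∞ N] [T2Space N]

/-- Vector fields with compact support are complete. -/
theorem exists_isMIntegralCurve_of_isCompact {Z : ∀ x : N, TangentSpace I x}
    (hZ : ContMDiff I I.tangent ∞ (fun x => (⟨x, Z x⟩ : TangentBundle I N))) {K : Set N}
    (hK : IsCompact K) (hZK : ∀ x, x ∉ K → Z x = 0) (x : N) :
    ∃ γ : ℝ → N, γ 0 = x ∧ IsMIntegralCurve γ Z := by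
  have := isManifold_one_of_infty I N
  have h1 : ∃ ε > 0, ∀ x ∈ K, ∃ γ : ℝ → N, γ 0 = x ∧ IsMIntegralCurveOn γ Z (Set.Ioo (-ε) ε) := by
    -- Compactness yields one existence time for all points of `K`; outside `K` the field vanishes
    -- and the constant curves are solutions. A uniform existence time implies completeness.
    refine hK.induction_on (p := fun s => ∃ ε > 0, ∀ x ∈ s, ∃ γ : ℝ → N,
      γ 0 = x ∧ IsMIntegralCurveOn γ Z (Set.Ioo (-ε) ε)) ⟨1, one_pos, by simp⟩ ?_ ?_ ?_
    · rintro s t hst ⟨ε, hε, h⟩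
      exact ⟨ε, hε, fun x hx => h x (hst hx)⟩
    · rintro s t ⟨ε, hε, h⟩ ⟨ε', hε', h'⟩
      refine ⟨min ε ε', lt_min hε hε', fun x hx => ?_⟩
      rcases hx with hx | hx
      · obtain ⟨γ, hγ, hγ'⟩ := h x hx
        exact ⟨γ, hγ, hγ'.mono (Set.Ioo_subset_Ioo (neg_le_neg (min_le_left _ _)) (min_le_left _ _))⟩
      · obtain ⟨γ, hγ, hγ'⟩ := h' x hx
        exact ⟨γ, hγ, hγ'.mono (Set.Ioo_subset_Ioo (neg_le_neg (min_le_right _ _))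
          (min_le_right _ _))⟩
    · intro x _
      obtain ⟨ε, hε, U, hU, Ψ, hΨ, -⟩ := exists_local_flow hZ x
      exact ⟨U, mem_nhdsWithin_of_mem_nhds hU, ε, hε, fun y hy => ⟨fun τ => Ψ τ y, hΨ y hy⟩⟩
  obtain ⟨ε, hε, h⟩ := h1
  refine exists_isMIntegralCurve_of_isMIntegralCurveOn (hZ.of_le (by simp)) hε (fun y => ?_) x
  by_cases hy : y ∈ K
  · exact h y hy
  · exact ⟨fun _ => y, rfl, (isMIntegralCurve_const (hZK y hy)).isMIntegralCurveOn _⟩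

variable {Z : ∀ x : N, TangentSpace I x} {F : ℝ → N → N}

/-- Both sides are integral curves in `s` with the same value at `s = 0`. -/
theorem flow_add (hZ : ContMDiff I I.tangent ∞ (fun x => (⟨x, Z x⟩ : TangentBundle I N)))
    (hF0 : ∀ x, F 0 x = x) (hF : ∀ x, IsMIntegralCurve (fun τ => F τ x) Z) (s τ : ℝ) (x : N) :
    F (s + τ) x = F s (F τ x) := by
  have := isManifold_one_of_infty I N
  have h := isMIntegralCurve_Ioo_eq_of_contMDiff_boundaryless (t₀ := 0) (hZ.of_le (by simp))
    ((hF x).comp_add τ) (hF (F τ x)) (by simp [hF0])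
  exact congrFun h s

/-- The flow of a complete smooth vector field is smooth. -/
theorem contMDiff_flow (hZ : ContMDiff I I.tangent ∞ (fun x => (⟨x, Z x⟩ : TangentBundle I N)))
    (hF0 : ∀ x, F 0 x = x) (hF : ∀ x, IsMIntegralCurve (fun τ => F τ x) Z) :
    ContMDiff (𝓘(ℝ, ℝ).prod I) I ∞ (fun q : ℝ × N => F q.1 q.2) := by
  have := isManifold_one_of_infty I N
  -- At time zero, uniqueness identifies the flow with the smooth local flow.
  have hzero : ∀ x, ContMDiffAt (𝓘(ℝ, ℝ).prod I) I ∞ (fun q : ℝ × N => F q.1 q.2) (0, x) := by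
    intro x
    obtain ⟨ε, hε, U, hU, Ψ, hΨ, hΨs⟩ := exists_local_flow hZ x
    refine hΨs.congr_of_eventuallyEq ?_
    filter_upwards [prod_mem_nhds (Ioo_mem_nhds (neg_lt_zero.2 hε) hε) hU] with ⟨τ, y⟩ ⟨hτ, hy⟩
    exact isMIntegralCurveOn_Ioo_eqOn_of_contMDiff_boundaryless (t₀ := 0)
      ⟨neg_lt_zero.2 hε, hε⟩ (hZ.of_le (by simp)) ((hF y).isMIntegralCurveOn _) (hΨ y hy).2
      (by simp [hF0, (hΨ y hy).1]) hτ
  -- For finite `k`, being `C^k` at a point implies the same at nearby points, which is used below;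
  -- this openness is lost at order `∞`.
  rw [contMDiff_infty]
  rintro k ⟨τ, x⟩
  have hk : ((k : ℕ∞) : WithTop ℕ∞) ≤ ∞ := by exact_mod_cast le_top
  have : IsManifold I k N := IsManifold.of_le hk
  have : IsManifold (𝓘(ℝ, ℝ).prod I) k (ℝ × N) := inferInstance
  let A : Set ℝ := {τ | ContMDiffAt (𝓘(ℝ, ℝ).prod I) I k (fun q : ℝ × N => F q.1 q.2) (τ, x)}
  -- As `F τ' = F (τ' - τ₀) ∘ F τ₀`, smoothness passes from `τ₀` to `τ'` through the flow for small
  -- times near `F σ x`. The radius `δ` depends on `σ` only, which makes `A` both open and closed.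
  have key : ∀ σ : ℝ, ∃ δ > 0, ∀ τ₀ ∈ Metric.ball σ δ, τ₀ ∈ A → Metric.ball σ δ ⊆ A := by
    intro σ
    have h1 := (contMDiffAt_iff_contMDiffAt_nhds (n := k) (by simp)).1 ((hzero (F σ x)).of_le hk)
    obtain ⟨T, hT, V, hV, hTV⟩ := mem_nhds_prod_iff.1 h1
    obtain ⟨ε, hε, hεT⟩ := Metric.mem_nhds_iff.1 hT
    have hcont : Continuous fun τ => F τ x := (hF x).continuous
    obtain ⟨δ, hδ, hδV⟩ := Metric.mem_nhds_iff.1 (hcont.continuousAt.preimage_mem_nhds hV)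
    refine ⟨min δ (ε / 2), by positivity, fun τ₀ hτ₀ hA τ' hτ' => ?_⟩
    rw [Metric.mem_ball, lt_min_iff] at hτ₀ hτ'
    have h2 : ContMDiffAt (𝓘(ℝ, ℝ).prod I) I k (fun q : ℝ × N => F q.1 q.2)
        (τ' - τ₀, F τ₀ x) := by
      refine hTV ⟨hεT ?_, hδV hτ₀.1⟩
      rw [Metric.mem_ball, dist_zero_right, ← dist_eq_norm]
      have := dist_triangle_right τ' τ₀ σ
      linarith [hτ₀.2, hτ'.2]
    have h3 : ContMDiffAt (𝓘(ℝ, ℝ).prod I) (𝓘(ℝ, ℝ).prod I) k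
        (fun q : ℝ × N => (q.1 - τ₀, F τ₀ q.2)) (τ', x) := by
      refine ContMDiffAt.prodMk ?_ ?_
      · exact (contMDiff_id.sub contMDiff_const).contMDiffAt.comp (τ', x) contMDiffAt_fst
      · have h4 : ContMDiffAt (𝓘(ℝ, ℝ).prod I) (𝓘(ℝ, ℝ).prod I) k
            (fun q : ℝ × N => (τ₀, q.2)) (τ', x) := contMDiffAt_const.prodMk contMDiffAt_snd
        have hA' : ContMDiffAt (𝓘(ℝ, ℝ).prod I) I k (fun q : ℝ × N => F q.1 q.2) (τ₀, x) := hA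
        exact ContMDiffAt.comp (f := fun q : ℝ × N => (τ₀, q.2)) (τ', x) hA' h4
    have h5 : (fun q : ℝ × N => F q.1 q.2) =
        (fun q : ℝ × N => F q.1 q.2) ∘ (fun q : ℝ × N => (q.1 - τ₀, F τ₀ q.2)) := by
      ext q
      simp only [Function.comp_apply]
      rw [← flow_add hZ hF0 hF, sub_add_cancel]
    change ContMDiffAt (𝓘(ℝ, ℝ).prod I) I k (fun q : ℝ × N => F q.1 q.2) (τ', x)
    rw [h5]
    exact h2.comp (τ', x) h3
  have hclopen : IsClopen A := by
    constructor
    · rw [← isOpen_compl_iff, Metric.isOpen_iff]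
      intro σ hσ
      obtain ⟨δ, hδ, h⟩ := key σ
      exact ⟨δ, hδ, fun τ₀ hτ₀ hA => hσ (h τ₀ hτ₀ hA (Metric.mem_ball_self hδ))⟩
    · rw [Metric.isOpen_iff]
      intro σ hσ
      obtain ⟨δ, hδ, h⟩ := key σ
      exact ⟨δ, hδ, h σ (Metric.mem_ball_self hδ) hσ⟩
  have huniv : A = Set.univ := hclopen.eq_univ ⟨0, (hzero x).of_le hk⟩
  exact (huniv ▸ Set.mem_univ τ : τ ∈ A)

end GlobalFlow

end

end TranslatedPoint

namespace TranslatedPoint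

noncomputable section

/-! ### Global frames of functions and vector fields. -/

section Frames

variable {n : ℕ} {M : Type*} [TopologicalSpace M] [ChartedSpace (EuclideanSpace ℝ (Fin n)) M]

/-- The differential of a function, as a linear form on the model space. -/
def diffAt (n : ℕ) {M : Type*} [TopologicalSpace M] [ChartedSpace (EuclideanSpace ℝ (Fin n)) M]
    (h : M → ℝ) (x : M) : EuclideanSpace ℝ (Fin n) →L[ℝ] ℝ :=
  mfderiv (𝓡 n) 𝓘(ℝ, ℝ) h x

/-- The derivative at `x` of the chart centred at `x₀`. -/
def toCoord (x₀ x : M) : EuclideanSpace ℝ (Fin n) →L[ℝ] EuclideanSpace ℝ (Fin n) :=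
  mfderiv (𝓡 n) 𝓘(ℝ, EuclideanSpace ℝ (Fin n)) (extChartAt (𝓡 n) x₀) x

/-- The derivative at `y` of the inverse of the chart centred at `x₀`. -/
def ofCoord (x₀ : M) (y : EuclideanSpace ℝ (Fin n)) :
    EuclideanSpace ℝ (Fin n) →L[ℝ] EuclideanSpace ℝ (Fin n) :=
  mfderiv 𝓘(ℝ, EuclideanSpace ℝ (Fin n)) (𝓡 n) (extChartAt (𝓡 n) x₀).symm y

/-- The vector component of a point of the tangent bundle, as an element of the model space. -/
def vec (q : TM n M) : EuclideanSpace ℝ (Fin n) := q.2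

/-- The function `(x, v) ↦ dh_x v` on the tangent bundle. -/
def fiberDeriv (h : M → ℝ) (q : TM n M) : ℝ := diffAt n h q.1 (vec q)

variable [IsManifold (𝓡 n) ∞ M]

theorem contMDiff_fiberDeriv {h : M → ℝ} (hh : ContMDiff (𝓡 n) 𝓘(ℝ, ℝ) ∞ h) :
    ContMDiff (𝓡 n).tangent 𝓘(ℝ, ℝ) ∞ (fiberDeriv (n := n) h) := by
  have := isManifold_one_of_infty (𝓡 n) M
  exact (contMDiff_snd_tangentBundle_modelSpace ℝ 𝓘(ℝ, ℝ)).comp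
    (hh.contMDiff_tangentMap (m := ∞) (by simp))

theorem toCoord_ofCoord {x₀ : M} {y : EuclideanSpace ℝ (Fin n)}
    (hy : y ∈ (extChartAt (𝓡 n) x₀).target) (a : EuclideanSpace ℝ (Fin n)) :
    toCoord x₀ ((extChartAt (𝓡 n) x₀).symm y) (ofCoord x₀ y a) = a :=
  mfderiv_extChartAt_mfderiv_symm (I := 𝓡 n) hy a

theorem ofCoord_toCoord {x₀ x : M} (hx : x ∈ (extChartAt (𝓡 n) x₀).source)
    (v : EuclideanSpace ℝ (Fin n)) : ofCoord x₀ (extChartAt (𝓡 n) x₀ x) (toCoord x₀ x v) = v :=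
  mfderiv_symm_mfderiv_extChartAt (I := 𝓡 n) hx v

/-- Points over different base points are separated by the projection, points of one fibre by a
trivialization. -/
instance t2Space_tangentBundle [T2Space M] : T2Space (TM n M) := by
  refine ⟨fun p q hpq => ?_⟩
  by_cases h : p.1 = q.1
  · have := isManifold_one_of_infty (𝓡 n) M
    let e := trivializationAt (EuclideanSpace ℝ (Fin n)) (TangentSpace (𝓡 n) : M → Type) p.1
    have hp : p ∈ e.source := e.mem_source.2 (FiberBundle.mem_baseSet_trivializationAt' p.1)
    have hq : q ∈ e.source := e.mem_source.2 (h ▸ FiberBundle.mem_baseSet_trivializationAt' p.1)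
    have hne : e p ≠ e q := fun h' => hpq (e.injOn hp hq h')
    obtain ⟨u, v, hu, hv, hpu, hqv, huv⟩ := t2_separation hne
    refine ⟨e.source ∩ e ⁻¹' u, e.source ∩ e ⁻¹' v, e.isOpen_inter_preimage hu,
      e.isOpen_inter_preimage hv, ⟨hp, hpu⟩, ⟨hq, hqv⟩, ?_⟩
    exact (huv.preimage e).mono Set.inter_subset_right Set.inter_subset_right
  · exact separated_by_continuous (Bundle.contMDiff_proj (n := ∞) (IB := 𝓡 n)
      (TangentSpace (𝓡 n) : M → Type)).continuous h

/-- A finite system of smooth functions `h j` and vector fields `X j` on `M` with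
`v = ∑ j, dh_j(v) X_j`, such that the functions contain coordinates near each point. -/
structure Frame (n : ℕ) (M : Type*) [TopologicalSpace M]
    [ChartedSpace (EuclideanSpace ℝ (Fin n)) M] [IsManifold (𝓡 n) ∞ M] where
  J : Type
  fintypeJ : Fintype J
  h : J → M → ℝ
  X : J → M → EuclideanSpace ℝ (Fin n)
  contMDiff_h : ∀ j, ContMDiff (𝓡 n) 𝓘(ℝ, ℝ) ∞ (h j)
  contMDiff_X : ∀ j, ContMDiff (𝓡 n) (𝓡 n).tangent ∞ (fun x => (⟨x, X j x⟩ : TM n M))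
  sum_smul : ∀ (x : M) (v : EuclideanSpace ℝ (Fin n)), ∑ j, diffAt n (h j) x v • X j x = v
  exists_chart : ∀ x : M, ∃ x₀ : M, x ∈ (extChartAt (𝓡 n) x₀).source ∧ ∃ a : Fin n → J,
    ∀ᶠ y in 𝓝 x, ∀ i, extChartAt (𝓡 n) x₀ y i = h (a i) y

attribute [instance] Frame.fintypeJ

variable [T2Space M] [CompactSpace M]

/-- The functions are coordinates times bump functions, the fields are coordinate fields times a
partition of unity. The partition is subordinate to the sets where the bumps are locally `1`, so one
chart `c` contributes `ρ_c v` to the sum, and these add up to `v`. -/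
theorem nonempty_frame (n : ℕ) (M : Type*) [TopologicalSpace M] [T2Space M] [CompactSpace M]
    [ChartedSpace (EuclideanSpace ℝ (Fin n)) M] [IsManifold (𝓡 n) ∞ M] :
    Nonempty (Frame n M) := by
  have := isManifold_one_of_infty (𝓡 n) M
  let f : ∀ c : M, SmoothBumpFunction (𝓡 n) c := fun c => Classical.arbitrary _
  -- The bump has to be `1` near the point and not just at it, so that the differentials of the `h
  -- j` are those of the coordinates.
  let U : M → Set M := fun c => {y | ∀ᶠ z in 𝓝 y, f c z = 1}
  have hUo : ∀ c, IsOpen (U c) := fun c => isOpen_setOfPred_eventually_nhds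
  have hcU : ∀ c, c ∈ U c := fun c => (f c).eventuallyEq_one
  have hUs : ∀ c, U c ⊆ (extChartAt (𝓡 n) c).source := fun c y hy => by
    rw [extChartAt_source]
    refine (f c).support_subset_source ?_
    rw [Function.mem_support, Filter.Eventually.self_of_nhds hy]
    exact one_ne_zero
  obtain ⟨t, ht⟩ := isCompact_univ.elim_finite_subcover U hUo
    (fun x _ => Set.mem_iUnion.2 ⟨x, hcU x⟩)
  obtain ⟨ρ, hρ⟩ := SmoothPartitionOfUnity.exists_isSubordinate (𝓡 n) (isClosed_univ (X := M))
    (fun c : t => U c) (fun c => hUo c) (fun x hx => by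
      obtain ⟨c, hc, hx⟩ := Set.mem_iUnion₂.1 (ht hx)
      exact Set.mem_iUnion.2 ⟨⟨c, hc⟩, hx⟩)
  let h : t × Fin n → M → ℝ := fun j y => f j.1 y • extChartAt (𝓡 n) (j.1 : M) y j.2
  let X : t × Fin n → M → EuclideanSpace ℝ (Fin n) := fun j x =>
    ρ j.1 x • ofCoord (j.1 : M) (extChartAt (𝓡 n) (j.1 : M) x) (EuclideanSpace.single j.2 (1 : ℝ))
  have hh : ∀ j, ContMDiff (𝓡 n) 𝓘(ℝ, ℝ) ∞ (h j) := by
    intro j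
    refine (f j.1).contMDiff_smul ?_
    have h1 := contMDiffOn_extChartAt (I := 𝓡 n) (n := ∞) (x := (j.1 : M))
    exact (EuclideanSpace.proj (𝕜 := ℝ) j.2).contDiff.contMDiff.comp_contMDiffOn h1
  have hX : ∀ j, ContMDiff (𝓡 n) (𝓡 n).tangent ∞ (fun x => (⟨x, X j x⟩ : TM n M)) := by
    intro j x
    by_cases hx : x ∈ tsupport (ρ j.1)
    · have hx' := hUs _ (hρ j.1 hx)
      refine (contMDiffAt_vectorField_iff (Z := X j) hx').2 ?_
      have h1 : ContMDiffAt (𝓡 n) 𝓘(ℝ, EuclideanSpace ℝ (Fin n)) ∞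
          (fun x => ρ j.1 x • (EuclideanSpace.single j.2 (1 : ℝ) : EuclideanSpace ℝ (Fin n))) x :=
        (ρ j.1).contMDiff.contMDiffAt.smul contMDiffAt_const
      refine h1.congr_of_eventuallyEq ?_
      filter_upwards [(isOpen_extChartAt_source (I := 𝓡 n) (j.1 : M)).mem_nhds hx'] with y hy
      have h2 := toCoord_ofCoord (x₀ := (j.1 : M))
        ((extChartAt (𝓡 n) (j.1 : M)).map_source hy) (EuclideanSpace.single j.2 (1 : ℝ))
      rw [(extChartAt (𝓡 n) (j.1 : M)).left_inv hy] at h2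
      change toCoord (j.1 : M) y (ρ j.1 y • _) = _
      rw [map_smul, h2]
    · have h1 : ContMDiffAt (𝓡 n) (𝓡 n).tangent ∞ (fun x => (⟨x, 0⟩ : TM n M)) x :=
        (Bundle.contMDiff_zeroSection ℝ (fun x : M => TangentSpace (𝓡 n) x)).contMDiffAt
      refine h1.congr_of_eventuallyEq ?_
      filter_upwards [(isClosed_tsupport _).isOpen_compl.mem_nhds hx] with y hy
      have h2 : ρ j.1 y = 0 := image_eq_zero_of_notMem_tsupport hy
      have h3 : X j y = 0 := by simp only [X, h2, zero_smul]
      rw [h3]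
      rfl
  have hd : ∀ (c : t) (x : M) (v : EuclideanSpace ℝ (Fin n)) (i : Fin n), x ∈ U c →
      diffAt n (h (c, i)) x v = toCoord (c : M) x v i := by
    intro c x v i hx
    have h1 : h (c, i) =ᶠ[𝓝 x]
        (EuclideanSpace.proj (𝕜 := ℝ) (ι := Fin n) i) ∘ extChartAt (𝓡 n) (c : M) := by
      filter_upwards [(hx : ∀ᶠ z in 𝓝 x, f c z = 1)] with y hy
      simp only [h, hy, one_smul]
      rfl
    have h2 : MDifferentiableAt (𝓡 n) 𝓘(ℝ, EuclideanSpace ℝ (Fin n)) (extChartAt (𝓡 n) (c : M)) x :=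
      (contMDiffAt_extChartAt_of_mem (hUs _ hx)).mdifferentiableAt (by simp)
    unfold diffAt
    rw [h1.mfderiv_eq, mfderiv_comp x
      (ContinuousLinearMap.differentiableAt _).mdifferentiableAt h2]
    rw [mfderiv_eq_fderiv, ContinuousLinearMap.fderiv]
    rfl
  have hsum : ∀ (x : M) (v : EuclideanSpace ℝ (Fin n)), ∑ j, diffAt n (h j) x v • X j x = v := by
    intro x v
    rw [Fintype.sum_prod_type]
    have h1 : ∀ c : t, ∑ i, diffAt n (h (c, i)) x v • X (c, i) x = ρ c x • v := by
      intro c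
      by_cases hc : ρ c x = 0
      · simp only [X, hc, zero_smul, smul_zero, Finset.sum_const_zero]
      · have hx := hρ c (subset_tsupport _ hc)
        have h2 : ∀ i, diffAt n (h (c, i)) x v • X (c, i) x = ρ c x •
            ofCoord (c : M) (extChartAt (𝓡 n) (c : M) x)
              (toCoord (c : M) x v i • EuclideanSpace.single i (1 : ℝ)) := by
          intro i
          rw [hd c x v i hx, map_smul, smul_comm]
        rw [Finset.sum_congr rfl fun i _ => h2 i, ← Finset.smul_sum, ← map_sum]
        have h3 := (EuclideanSpace.basisFun (Fin n) ℝ).sum_repr (toCoord (c : M) x v)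
        simp only [EuclideanSpace.basisFun_repr, EuclideanSpace.basisFun_apply] at h3
        rw [h3, ofCoord_toCoord (hUs _ hx)]
    rw [Finset.sum_congr rfl fun c _ => h1 c, ← Finset.sum_smul, ← finsum_eq_sum_of_fintype,
      ρ.sum_eq_one (Set.mem_univ x), one_smul]
  -- Reindexing by `Fin` puts the index set in `Type`, whatever the universe of `M`.
  let e := (Fintype.equivFin (t × Fin n)).symm
  refine ⟨⟨Fin (Fintype.card (t × Fin n)), inferInstance, fun j => h (e j), fun j => X (e j),
    fun j => hh _, fun j => hX _, fun x v => ?_, fun x => ?_⟩⟩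
  · rw [e.sum_comp (fun j => diffAt n (h j) x v • X j x)]
    exact hsum x v
  · obtain ⟨c, hc, hx⟩ := Set.mem_iUnion₂.1 (ht (Set.mem_univ x))
    refine ⟨c, hUs _ hx, fun i => e.symm (⟨c, hc⟩, i), ?_⟩
    filter_upwards [(hx : ∀ᶠ z in 𝓝 x, f c z = 1)] with y hy i
    simp [h, hy]

end Frames

end

end TranslatedPoint

namespace TranslatedPoint

noncomputable section

/-! ### Charts of the tangent bundle. -/

section TangentChart

variable {n : ℕ} {M : Type*} [TopologicalSpace M] [ChartedSpace (EuclideanSpace ℝ (Fin n)) M]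
  [IsManifold (𝓡 n) ∞ M]

theorem mem_extChartAt_tangent_source {q₀ q : TM n M} :
    q ∈ (extChartAt (𝓡 n).tangent q₀).source ↔ q.1 ∈ (extChartAt (𝓡 n) q₀.1).source := by
  have := isManifold_one_of_infty (𝓡 n) M
  rw [extChartAt_source, extChartAt_source]
  exact TangentBundle.mem_chart_source_iff q q₀

/-- The chart of `TM` is the tangent map of the chart of `M`. -/
theorem extChartAt_tangent_apply {q₀ q : TM n M} (hq : q.1 ∈ (extChartAt (𝓡 n) q₀.1).source) :
    extChartAt (𝓡 n).tangent q₀ q = (extChartAt (𝓡 n) q₀.1 q.1, toCoord q₀.1 q.1 (vec q)) := by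
  have := isManifold_one_of_infty (𝓡 n) M
  have h := tangentMap_chart (I := 𝓡 n) (p := q₀) (q := q) (by rwa [extChartAt_source] at hq)
  have h2 := congrArg (Bundle.TotalSpace.toProd _ _) h
  exact h2.symm

theorem mem_extChartAt_tangent_target {q₀ : TM n M}
    {z : EuclideanSpace ℝ (Fin n) × EuclideanSpace ℝ (Fin n)} :
    z ∈ (extChartAt (𝓡 n).tangent q₀).target ↔ z.1 ∈ (extChartAt (𝓡 n) q₀.1).target := by
  have := isManifold_one_of_infty (𝓡 n) M
  rw [extChartAt_target, extChartAt_target, (𝓡 n).tangent.range_eq_univ, (𝓡 n).range_eq_univ,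
    Set.inter_univ, Set.inter_univ]
  exact TangentBundle.mem_chart_target_iff (I := 𝓡 n) (H := EuclideanSpace ℝ (Fin n)) z q₀

theorem diffAt_ofCoord {h : M → ℝ} (hh : ContMDiff (𝓡 n) 𝓘(ℝ, ℝ) ∞ h) {x₀ : M}
    {y : EuclideanSpace ℝ (Fin n)} (hy : y ∈ (extChartAt (𝓡 n) x₀).target)
    (w : EuclideanSpace ℝ (Fin n)) :
    diffAt n h ((extChartAt (𝓡 n) x₀).symm y) (ofCoord x₀ y w) =
      fderiv ℝ (h ∘ (extChartAt (𝓡 n) x₀).symm) y w := by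
  rw [← mfderiv_eq_fderiv, mfderiv_comp y ((hh _).mdifferentiableAt (by simp))
    ((contMDiffAt_extChartAt_symm_of_mem hy).mdifferentiableAt (by simp))]
  rfl

theorem contDiffOn_comp_extChartAt_symm {h : M → ℝ} (hh : ContMDiff (𝓡 n) 𝓘(ℝ, ℝ) ∞ h) (x₀ : M) :
    ContDiffOn ℝ ∞ (h ∘ (extChartAt (𝓡 n) x₀).symm) (extChartAt (𝓡 n) x₀).target :=
  contMDiffOn_iff_contDiffOn.1 (hh.comp_contMDiffOn (contMDiffOn_extChartAt_symm x₀))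

theorem contDiffOn_fderiv_comp_symm {h : M → ℝ} (hh : ContMDiff (𝓡 n) 𝓘(ℝ, ℝ) ∞ h) (x₀ : M) :
    ContDiffOn ℝ ∞ (fderiv ℝ (h ∘ (extChartAt (𝓡 n) x₀).symm)) (extChartAt (𝓡 n) x₀).target :=
  (contDiffOn_comp_extChartAt_symm hh x₀).fderiv_of_isOpen (isOpen_extChartAt_target x₀) (by simp)

end TangentChart

theorem contDiffOn_smul_smulRight {E : Type*} [NormedAddCommGroup E] [NormedSpace ℝ E]
    {c : E → ℝ} {A B : E → E →L[ℝ] ℝ} {s : Set E} (hc : ContDiffOn ℝ ∞ c s)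
    (hA : ContDiffOn ℝ ∞ A s) (hB : ContDiffOn ℝ ∞ B s) :
    ContDiffOn ℝ ∞ (fun y => (c y • A y).smulRight (B y)) s :=
  (hc.smul hA).smulRight hB

/-! ### The metric in a frame and in a chart. -/

section FrameMetric

variable {n : ℕ} {M : Type*} [TopologicalSpace M] [ChartedSpace (EuclideanSpace ℝ (Fin n)) M]
  [IsManifold (𝓡 n) ∞ M]

/-- The scalar product of `T_x M`, as a bilinear form on the model space. -/
def metricAt (g : Metric n M) (x : M) :
    EuclideanSpace ℝ (Fin n) →L[ℝ] EuclideanSpace ℝ (Fin n) →L[ℝ] ℝ := g.inner x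

theorem metricAt_symm (g : Metric n M) (x : M) (v w : EuclideanSpace ℝ (Fin n)) :
    metricAt g x v w = metricAt g x w v := g.symm x v w

theorem metricAt_pos (g : Metric n M) (x : M) {v : EuclideanSpace ℝ (Fin n)} (hv : v ≠ 0) :
    0 < metricAt g x v v := g.pos x v hv

theorem eq_zero_of_metricAt (g : Metric n M) (x : M) {v : EuclideanSpace ℝ (Fin n)}
    (h : ∀ w, metricAt g x v w = 0) : v = 0 := by
  by_contra hv
  exact (metricAt_pos g x hv).ne' (h v)

/-- The coefficients of the metric in a frame. -/
def Frame.coeff (Φ : Frame n M) (g : Metric n M) (j k : Φ.J) (x : M) : ℝ :=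
  metricAt g x (Φ.X j x) (Φ.X k x)

variable (Φ : Frame n M) (g : Metric n M)

theorem Frame.coeff_symm (j k : Φ.J) (x : M) : Φ.coeff g j k x = Φ.coeff g k j x :=
  metricAt_symm _ _ _ _

theorem Frame.contMDiff_coeff (j k : Φ.J) : ContMDiff (𝓡 n) 𝓘(ℝ, ℝ) ∞ (Φ.coeff g j k) := by
  have h : ContMDiff (𝓡 n) ((𝓡 n).prod 𝓘(ℝ)) ∞ (fun m => Bundle.TotalSpace.mk' ℝ
      (E := Bundle.Trivial M ℝ) m (g.inner m (Φ.X j m) (Φ.X k m))) :=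
    ContMDiff.clm_bundle_apply₂ (F₁ := EuclideanSpace ℝ (Fin n))
      (F₂ := EuclideanSpace ℝ (Fin n)) g.contMDiff (Φ.contMDiff_X j) (Φ.contMDiff_X k)
  intro x
  have h2 := h x
  rw [Bundle.contMDiffAt_totalSpace] at h2
  exact h2.2

theorem Frame.metricAt_eq_sum (x : M) (v w : EuclideanSpace ℝ (Fin n)) :
    metricAt g x v w = ∑ j, ∑ k, Φ.coeff g j k x *
      (diffAt n (Φ.h j) x v * diffAt n (Φ.h k) x w) := by
  conv_lhs => rw [← Φ.sum_smul x v, ← Φ.sum_smul x w]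
  simp only [map_sum, map_smul, sum_apply, smul_apply,
    smul_eq_mul]
  rw [Finset.sum_comm]
  refine Finset.sum_congr rfl fun k _ => ?_
  rw [Finset.mul_sum]
  refine Finset.sum_congr rfl fun j _ => ?_
  rw [Frame.coeff]
  ring

theorem Frame.ext_of_diffAt {x : M} {v w : EuclideanSpace ℝ (Fin n)}
    (h : ∀ j, diffAt n (Φ.h j) x v = diffAt n (Φ.h j) x w) : v = w := by
  rw [← Φ.sum_smul x v, ← Φ.sum_smul x w]
  simp [h]

/-- The metric in the chart at `x₀`, as a function with values in the bilinear forms. -/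
def localMetric (g : Metric n M) (x₀ : M) (y : EuclideanSpace ℝ (Fin n)) :
    EuclideanSpace ℝ (Fin n) →L[ℝ] EuclideanSpace ℝ (Fin n) →L[ℝ] ℝ :=
  (metricAt g ((extChartAt (𝓡 n) x₀).symm y)).bilinearComp (ofCoord x₀ y) (ofCoord x₀ y)

theorem metricInChart_eq_localMetric (x₀ : M) (y a b : EuclideanSpace ℝ (Fin n)) :
    metricInChart g x₀ y a b = localMetric g x₀ y a b := rfl

theorem Frame.localMetric_eq_sum {x₀ : M} {y : EuclideanSpace ℝ (Fin n)}
    (hy : y ∈ (extChartAt (𝓡 n) x₀).target) :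
    localMetric g x₀ y = ∑ j, ∑ k, (Φ.coeff g j k ((extChartAt (𝓡 n) x₀).symm y) •
      fderiv ℝ (Φ.h j ∘ (extChartAt (𝓡 n) x₀).symm) y).smulRight
        (fderiv ℝ (Φ.h k ∘ (extChartAt (𝓡 n) x₀).symm) y) := by
  ext a b
  simp only [localMetric, ContinuousLinearMap.bilinearComp_apply, Φ.metricAt_eq_sum,
    diffAt_ofCoord (Φ.contMDiff_h _) hy, sum_apply,
    smul_apply, ContinuousLinearMap.smulRight_apply, smul_eq_mul, mul_assoc]

/-- In the chart the metric is a finite sum of products of the smooth functions `G_jk` and the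
smooth differentials of the `h j`. -/
theorem Frame.contDiffOn_localMetric (Φ : Frame n M) (g : Metric n M) (x₀ : M) :
    ContDiffOn ℝ ∞ (localMetric g x₀) (extChartAt (𝓡 n) x₀).target := by
  refine ContDiffOn.congr ?_ fun y hy => Φ.localMetric_eq_sum g hy
  refine ContDiffOn.sum fun j _ => ContDiffOn.sum fun k _ => ?_
  exact contDiffOn_smul_smulRight (contDiffOn_comp_extChartAt_symm (Φ.contMDiff_coeff g j k) x₀)
    (contDiffOn_fderiv_comp_symm (Φ.contMDiff_h j) x₀)
    (contDiffOn_fderiv_comp_symm (Φ.contMDiff_h k) x₀)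

theorem localMetric_pos {x₀ : M} {y : EuclideanSpace ℝ (Fin n)}
    (hy : y ∈ (extChartAt (𝓡 n) x₀).target) {a : EuclideanSpace ℝ (Fin n)} (ha : a ≠ 0) :
    0 < localMetric g x₀ y a a := by
  refine metricAt_pos g _ fun h => ha ?_
  have := toCoord_ofCoord hy a
  rw [show ofCoord x₀ y a = 0 from h, map_zero] at this
  exact this.symm

/-- The metric as an isomorphism to the dual space. -/
theorem exists_equiv_localMetric {x₀ : M} {y : EuclideanSpace ℝ (Fin n)}
    (hy : y ∈ (extChartAt (𝓡 n) x₀).target) :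
    ∃ e : EuclideanSpace ℝ (Fin n) ≃L[ℝ] (EuclideanSpace ℝ (Fin n) →L[ℝ] ℝ),
      (e : EuclideanSpace ℝ (Fin n) →L[ℝ] (EuclideanSpace ℝ (Fin n) →L[ℝ] ℝ)) =
        localMetric g x₀ y := by
  have hinj : Function.Injective (localMetric g x₀ y) := by
    rw [injective_iff_map_eq_zero]
    intro v hv
    by_contra hne
    have h1 := localMetric_pos g hy hne
    rw [hv] at h1
    exact lt_irrefl _ h1
  have hdim : Module.finrank ℝ (EuclideanSpace ℝ (Fin n)) =
      Module.finrank ℝ (EuclideanSpace ℝ (Fin n) →L[ℝ] ℝ) := by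
    rw [← (LinearMap.toContinuousLinearMap (𝕜 := ℝ) (E := EuclideanSpace ℝ (Fin n))
      (F' := ℝ)).finrank_eq]
    exact (Subspace.dual_finrank_eq (K := ℝ) (V := EuclideanSpace ℝ (Fin n))).symm
  exact ⟨(LinearEquiv.ofInjectiveOfFinrankEq (localMetric g x₀ y).toLinearMap hinj
    hdim).toContinuousLinearEquiv, by ext; rfl⟩

theorem localMetric_inverse {x₀ : M} {y : EuclideanSpace ℝ (Fin n)}
    (hy : y ∈ (extChartAt (𝓡 n) x₀).target) (a : EuclideanSpace ℝ (Fin n)) :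
    (localMetric g x₀ y).inverse (localMetric g x₀ y a) = a := by
  obtain ⟨e, he⟩ := exists_equiv_localMetric g hy
  rw [← he, ContinuousLinearMap.inverse_equiv]
  exact e.symm_apply_apply a

theorem localMetric_inverse' {x₀ : M} {y : EuclideanSpace ℝ (Fin n)}
    (hy : y ∈ (extChartAt (𝓡 n) x₀).target) (l : EuclideanSpace ℝ (Fin n) →L[ℝ] ℝ) :
    localMetric g x₀ y ((localMetric g x₀ y).inverse l) = l := by
  obtain ⟨e, he⟩ := exists_equiv_localMetric g hy
  rw [← he, ContinuousLinearMap.inverse_equiv]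
  exact e.apply_symm_apply l

theorem Frame.contDiffOn_inverse_localMetric (Φ : Frame n M) (g : Metric n M) (x₀ : M) :
    ContDiffOn ℝ ∞ (fun y => (localMetric g x₀ y).inverse) (extChartAt (𝓡 n) x₀).target := by
  intro y hy
  obtain ⟨e, he⟩ := exists_equiv_localMetric g hy
  have h1 := contDiffAt_map_inverse (n := ∞) e
  rw [he] at h1
  exact h1.comp_contDiffWithinAt y (Φ.contDiffOn_localMetric g x₀ y hy)

end FrameMetric

end

end TranslatedPoint

namespace TranslatedPoint

noncomputable section

/-! ### Curves in manifolds and smoothness criteria in terms of a frame. -/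

section Curves

variable {E : Type*} [NormedAddCommGroup E] [NormedSpace ℝ E]
  {H : Type*} [TopologicalSpace H] {I : ModelWithCorners ℝ E H}
  {N : Type*} [TopologicalSpace N] [ChartedSpace H N]

theorem hasDerivAt_comp_curve {F : Type*} [NormedAddCommGroup F] [NormedSpace ℝ F] {K : N → F}
    {α : ℝ → N} {s : ℝ}
    (hK : MDifferentiableAt I 𝓘(ℝ, F) K (α s)) (hα : MDifferentiableAt 𝓘(ℝ, ℝ) I α s) :
    HasDerivAt (fun r => K (α r)) (mfderiv I 𝓘(ℝ, F) K (α s) (mfderiv 𝓘(ℝ, ℝ) I α s (1 : ℝ))) s := by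
  obtain ⟨L, hL⟩ : ∃ L : ℝ →L[ℝ] F, L = (mfderiv I 𝓘(ℝ, F) K (α s)).comp
      (mfderiv 𝓘(ℝ, ℝ) I α s) := ⟨_, rfl⟩
  have h : HasFDerivAt (fun r => K (α r)) L s := by
    rw [hL]
    exact (hK.hasMFDerivAt.comp s hα.hasMFDerivAt).hasFDerivAt
  have h1 := congrArg (fun A : ℝ →L[ℝ] F => A 1) hL
  have h2 := HasFDerivAt.hasDerivAt h
  rw [h1] at h2
  exact h2

end Curves

section Criteria

variable {n : ℕ} {M : Type*} [TopologicalSpace M] [ChartedSpace (EuclideanSpace ℝ (Fin n)) M]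
  [IsManifold (𝓡 n) ∞ M]

/-- The functions of a frame have a smooth local left inverse. -/
theorem Frame.exists_local_leftInverse (Φ : Frame n M) (x : M) :
    ∃ S : (Φ.J → ℝ) → M, ContMDiffAt 𝓘(ℝ, Φ.J → ℝ) (𝓡 n) ∞ S (fun j => Φ.h j x) ∧
      ∀ᶠ y in 𝓝 x, S (fun j => Φ.h j y) = y := by
  obtain ⟨x₀, hx, a, ha⟩ := Φ.exists_chart x
  let T : (Φ.J → ℝ) → EuclideanSpace ℝ (Fin n) := fun b => WithLp.toLp 2 (fun i => b (a i))
  have hT : ContDiff ℝ ∞ T := by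
    rw [contDiff_euclidean]
    intro i
    exact contDiff_apply ℝ ℝ (a i)
  have hTy : ∀ᶠ y in 𝓝 x, T (fun j => Φ.h j y) = extChartAt (𝓡 n) x₀ y := by
    filter_upwards [ha] with y hy
    ext i
    exact (hy i).symm
  refine ⟨fun b => (extChartAt (𝓡 n) x₀).symm (T b), ?_, ?_⟩
  · refine ContMDiffAt.comp (g := (extChartAt (𝓡 n) x₀).symm) (f := T) _ ?_ hT.contMDiff.contMDiffAt
    rw [hTy.self_of_nhds]
    exact contMDiffAt_extChartAt_symm_of_mem ((extChartAt (𝓡 n) x₀).map_source hx)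
  · filter_upwards [hTy, (isOpen_extChartAt_source x₀).mem_nhds hx] with y hy hys
    rw [hy, (extChartAt (𝓡 n) x₀).left_inv hys]

variable {E' : Type*} [NormedAddCommGroup E'] [NormedSpace ℝ E']
  {H' : Type*} [TopologicalSpace H'] {I' : ModelWithCorners ℝ E' H'}
  {P : Type*} [TopologicalSpace P] [ChartedSpace H' P]

/-- The `h j` contain local coordinates, so near `p` the map `c` is recovered from its components by
a smooth left inverse; continuity keeps `c` in the domain where this inverse works. -/
theorem Frame.contMDiffAt (Φ : Frame n M) {c : P → M} {p : P} (hc : ContinuousAt c p)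
    (h : ∀ j, ContMDiffAt I' 𝓘(ℝ, ℝ) ∞ (fun q => Φ.h j (c q)) p) :
    ContMDiffAt I' (𝓡 n) ∞ c p := by
  obtain ⟨S, hS, hSy⟩ := Φ.exists_local_leftInverse (c p)
  have h1 : ContMDiffAt I' 𝓘(ℝ, Φ.J → ℝ) ∞ (fun q j => Φ.h j (c q)) p :=
    contMDiffAt_pi_space.2 h
  refine (ContMDiffAt.comp (f := fun q j => Φ.h j (c q)) p hS h1).congr_of_eventuallyEq ?_
  filter_upwards [hc.eventually hSy] with q hq
  exact hq.symm

theorem Frame.mdifferentiableAt (Φ : Frame n M) {c : ℝ → M} {s : ℝ} (hc : ContinuousAt c s)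
    (h : ∀ j, DifferentiableAt ℝ (fun r => Φ.h j (c r)) s) :
    MDifferentiableAt 𝓘(ℝ, ℝ) (𝓡 n) c s := by
  obtain ⟨S, hS, hSy⟩ := Φ.exists_local_leftInverse (c s)
  have h1 : MDifferentiableAt 𝓘(ℝ, ℝ) 𝓘(ℝ, Φ.J → ℝ) (fun q j => Φ.h j (c q)) s :=
    (differentiableAt_pi.2 h).mdifferentiableAt
  refine (MDifferentiableAt.comp (f := fun q j => Φ.h j (c q)) s (hS.mdifferentiableAt (by simp))
    h1).congr_of_eventuallyEq ?_
  filter_upwards [hc.eventually hSy] with q hq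
  exact hq.symm

/-- Supports of bump functions form a basis of neighbourhoods of a point. -/
theorem continuousAt_of_forall_contMDiff [T2Space M] {X : Type*} [TopologicalSpace X] {c : X → M}
    {p : X} (h : ∀ f : M → ℝ, ContMDiff (𝓡 n) 𝓘(ℝ, ℝ) ∞ f → ContinuousAt (fun q => f (c q)) p) :
    ContinuousAt c p := by
  intro s hs
  obtain ⟨f, -, hf⟩ := (SmoothBumpFunction.nhds_basis_support (I := 𝓡 n) hs).mem_iff.1 hs
  have h1 := h f f.contMDiff
  have h2 : (fun q => f (c q)) p ≠ 0 := by simp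
  rw [Filter.mem_map]
  filter_upwards [h1.eventually_ne h2] with q hq
  exact hf hq

theorem fiberDeriv_velocity {h : M → ℝ} (hh : ContMDiff (𝓡 n) 𝓘(ℝ, ℝ) ∞ h) {c : ℝ → M} {s : ℝ}
    (hc : MDifferentiableAt 𝓘(ℝ, ℝ) (𝓡 n) c s) :
    HasDerivAt (fun r => h (c r)) (fiberDeriv h (velocity (n := n) c s)) s :=
  hasDerivAt_comp_curve ((hh _).mdifferentiableAt (by simp)) hc

/-- Smoothness of a map to `TM` can be tested by scalar products. -/
theorem Frame.contMDiffAt_tangent (Φ : Frame n M) (g : Metric n M) {c : P → TM n M} {p : P}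
    (hπ : ContMDiffAt I' (𝓡 n) ∞ (fun q => (c q).1) p)
    (h : ∀ j, ContMDiffAt I' 𝓘(ℝ, ℝ) ∞
      (fun q => metricAt g (c q).1 (vec (c q)) (Φ.X j (c q).1)) p) :
    ContMDiffAt I' (𝓡 n).tangent ∞ c p := by
  let x₀ := (c p).1
  let y : P → EuclideanSpace ℝ (Fin n) := fun q => extChartAt (𝓡 n) x₀ (c q).1
  have hy : ContMDiffAt I' 𝓘(ℝ, EuclideanSpace ℝ (Fin n)) ∞ y p :=
    ContMDiffAt.comp (g := extChartAt (𝓡 n) x₀) p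
      (contMDiffAt_extChartAt_of_mem (mem_extChartAt_source x₀)) hπ
  have hyp : y p ∈ (extChartAt (𝓡 n) x₀).target :=
    (extChartAt (𝓡 n) x₀).map_source (mem_extChartAt_source x₀)
  have hT := (isOpen_extChartAt_target (I := 𝓡 n) x₀).mem_nhds hyp
  -- `l q` is the covector `⟨c q, ·⟩` in the chart. It is determined by the pairings with the `X j`,
  -- and the inverse of the metric turns it back into the fibre coordinate of `c q`.
  let l : P → EuclideanSpace ℝ (Fin n) →L[ℝ] ℝ := fun q => ∑ j,
    metricAt g (c q).1 (vec (c q)) (Φ.X j (c q).1) •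
      fderiv ℝ (Φ.h j ∘ (extChartAt (𝓡 n) x₀).symm) (y q)
  have hl : ContMDiffAt I' 𝓘(ℝ, EuclideanSpace ℝ (Fin n) →L[ℝ] ℝ) ∞ l p := by
    refine ContMDiffAt.sum fun j _ => (h j).smul ?_
    exact ContMDiffAt.comp (g := fderiv ℝ (Φ.h j ∘ (extChartAt (𝓡 n) x₀).symm)) p
      ((contDiffOn_fderiv_comp_symm (Φ.contMDiff_h j) x₀).contDiffAt hT).contMDiffAt hy
  have hinv : ContMDiffAt I' 𝓘(ℝ, (EuclideanSpace ℝ (Fin n) →L[ℝ] ℝ) →L[ℝ]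
      EuclideanSpace ℝ (Fin n)) ∞ (fun q => (localMetric g x₀ (y q)).inverse) p :=
    ContMDiffAt.comp (g := fun y => (localMetric g x₀ y).inverse) p
      ((Φ.contDiffOn_inverse_localMetric g x₀).contDiffAt hT).contMDiffAt hy
  have hW := hinv.clm_apply hl
  have hz := hy.prodMk_space hW
  have hs : ContMDiffAt 𝓘(ℝ, EuclideanSpace ℝ (Fin n) × EuclideanSpace ℝ (Fin n)) (𝓡 n).tangent ∞
      (extChartAt (𝓡 n).tangent (c p)).symm (y p, (localMetric g x₀ (y p)).inverse (l p)) :=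
    contMDiffAt_extChartAt_symm_of_mem (I := (𝓡 n).tangent) (mem_extChartAt_tangent_target.2 hyp)
  refine (ContMDiffAt.comp (f := fun q => (y q, (localMetric g x₀ (y q)).inverse (l q)))
    p hs hz).congr_of_eventuallyEq ?_
  filter_upwards [hπ.continuousAt.preimage_mem_nhds
    ((isOpen_extChartAt_source (I := 𝓡 n) x₀).mem_nhds (mem_extChartAt_source x₀))] with q hq
  have hq' : (c q).1 ∈ (extChartAt (𝓡 n) x₀).source := hq
  have hyq : y q ∈ (extChartAt (𝓡 n) x₀).target := (extChartAt (𝓡 n) x₀).map_source hq'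
  have hl : l q = localMetric g x₀ (y q) (toCoord x₀ (c q).1 (vec (c q))) := by
    ext b
    simp only [localMetric, ContinuousLinearMap.bilinearComp_apply, y]
    rw [ofCoord_toCoord hq', (extChartAt (𝓡 n) x₀).left_inv hq']
    have h2 := Φ.sum_smul (c q).1 (ofCoord x₀ (extChartAt (𝓡 n) x₀ (c q).1) b)
    conv_rhs => rw [← h2]
    simp only [l, sum_apply, smul_apply, map_sum, map_smul, smul_eq_mul]
    refine Finset.sum_congr rfl fun j _ => ?_
    have h3 := diffAt_ofCoord (Φ.contMDiff_h j) hyq b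
    simp only [y] at h3
    rw [(extChartAt (𝓡 n) x₀).left_inv hq'] at h3
    rw [h3, mul_comm]
  simp only [Function.comp_apply]
  rw [hl, localMetric_inverse g hyq, ← extChartAt_tangent_apply (q₀ := c p) hq',
    (extChartAt (𝓡 n).tangent (c p)).left_inv (mem_extChartAt_tangent_source.2 hq')]

/-- The map `(x, a) ↦ ∑ j, a_j X_j(x)`. -/
def Frame.combine (Φ : Frame n M) (z : M × (Φ.J → ℝ)) : TM n M := ⟨z.1, ∑ j, z.2 j • Φ.X j z.1⟩

theorem Frame.contMDiff_combine (Φ : Frame n M) (g : Metric n M) :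
    ContMDiff ((𝓡 n).prod 𝓘(ℝ, Φ.J → ℝ)) (𝓡 n).tangent ∞ Φ.combine := by
  intro z
  refine Φ.contMDiffAt_tangent g contMDiffAt_fst fun k => ?_
  have h : (fun q : M × (Φ.J → ℝ) => metricAt g (Φ.combine q).1 (vec (Φ.combine q))
      (Φ.X k (Φ.combine q).1)) = fun q => ∑ j, q.2 j * Φ.coeff g j k q.1 := by
    ext q
    have h1 : (vec (Φ.combine q)) = ∑ j, q.2 j • Φ.X j q.1 := rfl
    rw [h1]
    simp [Frame.coeff, Frame.combine, map_sum, sum_apply]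
  rw [h]
  refine ContMDiffAt.sum fun j _ => ContMDiffAt.mul ?_ ?_
  · exact contMDiffAt_pi_space.1 contMDiffAt_snd j
  · exact ((Φ.contMDiff_coeff g j k) z.1).comp z contMDiffAt_fst

theorem Frame.combine_fiberDeriv (Φ : Frame n M) (q : TM n M) :
    Φ.combine (q.1, fun j => fiberDeriv (Φ.h j) q) = q :=
  congrArg (Bundle.TotalSpace.mk q.1) (Φ.sum_smul q.1 q.2)

end Criteria

end

end TranslatedPoint

namespace TranslatedPoint

noncomputable section

/-! ### Tangent vectors of `TM` in a frame. -/

section TangentVectors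

variable {n : ℕ} {M : Type*} [TopologicalSpace M] [ChartedSpace (EuclideanSpace ℝ (Fin n)) M]
  [IsManifold (𝓡 n) ∞ M]

/-- The differential of a function on `TM`, as a linear form on the model space. -/
def diffTM (K : TM n M → ℝ) (q : TM n M) :
    EuclideanSpace ℝ (Fin n) × EuclideanSpace ℝ (Fin n) →L[ℝ] ℝ :=
  mfderiv (𝓡 n).tangent 𝓘(ℝ, ℝ) K q

/-- The velocity of a curve in `TM`, as an element of the model space. -/
def velTM (α : ℝ → TM n M) (s : ℝ) : EuclideanSpace ℝ (Fin n) × EuclideanSpace ℝ (Fin n) :=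
  mfderiv 𝓘(ℝ, ℝ) (𝓡 n).tangent α s (1 : ℝ)

theorem contMDiff_fst_tangent : ContMDiff (𝓡 n).tangent (𝓡 n) ∞ (fun q : TM n M => q.1) := by
  have := isManifold_one_of_infty (𝓡 n) M
  exact Bundle.contMDiff_proj (IB := 𝓡 n) (TangentSpace (𝓡 n) : M → Type)

theorem contMDiff_comp_fst {h : M → ℝ} (hh : ContMDiff (𝓡 n) 𝓘(ℝ, ℝ) ∞ h) :
    ContMDiff (𝓡 n).tangent 𝓘(ℝ, ℝ) ∞ (fun q : TM n M => h q.1) :=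
  hh.comp contMDiff_fst_tangent

theorem hasDerivAt_velTM {K : TM n M → ℝ} (hK : ContMDiff (𝓡 n).tangent 𝓘(ℝ, ℝ) ∞ K)
    {α : ℝ → TM n M} {s : ℝ} (hα : MDifferentiableAt 𝓘(ℝ, ℝ) (𝓡 n).tangent α s) :
    HasDerivAt (fun r => K (α r)) (diffTM K (α s) (velTM α s)) s :=
  hasDerivAt_comp_curve ((hK _).mdifferentiableAt (by simp)) hα

theorem exists_curve_velTM (q : TM n M)
    (ξ : EuclideanSpace ℝ (Fin n) × EuclideanSpace ℝ (Fin n)) :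
    ∃ α : ℝ → TM n M, ContMDiffAt 𝓘(ℝ, ℝ) (𝓡 n).tangent ∞ α 0 ∧ α 0 = q ∧ velTM α 0 = ξ := by
  let ψ := extChartAt (𝓡 n).tangent q
  let l : ℝ → EuclideanSpace ℝ (Fin n) × EuclideanSpace ℝ (Fin n) := fun r => ψ q + r • ξ
  have hl : ContDiff ℝ ∞ l := contDiff_const.add (contDiff_id.smul contDiff_const)
  have hl0 : l 0 = ψ q := by simp [l]
  have hs : ContMDiffAt 𝓘(ℝ, EuclideanSpace ℝ (Fin n) × EuclideanSpace ℝ (Fin n)) (𝓡 n).tangent ∞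
      ψ.symm (l 0) := by
    rw [hl0]
    exact contMDiffAt_extChartAt_symm_of_mem (I := (𝓡 n).tangent)
      (ψ.map_source (mem_extChartAt_source q))
  have hq : ψ.symm (l 0) = q := by
    rw [hl0]
    exact ψ.left_inv (mem_extChartAt_source q)
  refine ⟨fun r => ψ.symm (l r), ContMDiffAt.comp 0 hs hl.contMDiff.contMDiffAt, hq, ?_⟩
  have h1 : HasDerivAt l ξ 0 := by
    have := ((hasDerivAt_id (0 : ℝ)).smul_const ξ).const_add (ψ q)
    simpa [l] using this
  have h2 : mfderiv 𝓘(ℝ, ℝ) 𝓘(ℝ, EuclideanSpace ℝ (Fin n) × EuclideanSpace ℝ (Fin n)) l 0 (1 : ℝ)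
      = ξ := by
    rw [mfderiv_eq_fderiv]
    have h3 : fderiv ℝ l 0 1 = ξ := fderiv_apply_one_eq_deriv.trans h1.deriv
    exact h3
  unfold velTM
  have h3 := mfderiv_comp_apply (I' := 𝓘(ℝ, EuclideanSpace ℝ (Fin n) × EuclideanSpace ℝ (Fin n)))
    (0 : ℝ) (g := ψ.symm) (f := l) (hs.mdifferentiableAt (by simp))
    (hl.contMDiff.contMDiffAt.mdifferentiableAt (by simp)) (1 : ℝ)
  refine h3.trans ?_
  rw [h2]
  have h4 := mfderiv_symm_mfderiv_extChartAt (I := (𝓡 n).tangent) (mem_extChartAt_source q) ξ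
  rw [mfderiv_extChartAt_self_apply (I := (𝓡 n).tangent) q ξ] at h4
  rw [hl0]
  exact h4

variable (Φ : Frame n M)

/-- Tangent vectors of `TM` are determined by their action on the functions `h_j` and `dh_j`. -/
theorem Frame.tangent_ext (g : Metric n M) {q : TM n M}
    {ξ η : EuclideanSpace ℝ (Fin n) × EuclideanSpace ℝ (Fin n)}
    (h1 : ∀ j, diffTM (fun q => Φ.h j q.1) q ξ = diffTM (fun q => Φ.h j q.1) q η)
    (h2 : ∀ j, diffTM (fiberDeriv (Φ.h j)) q ξ = diffTM (fiberDeriv (Φ.h j)) q η) : ξ = η := by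
  let C : TM n M → M × (Φ.J → ℝ) := fun q => (q.1, fun j => fiberDeriv (Φ.h j) q)
  let b : TM n M → Φ.J → ℝ := fun q j => fiberDeriv (Φ.h j) q
  have hb : MDifferentiableAt (𝓡 n).tangent 𝓘(ℝ, Φ.J → ℝ) b q :=
    ((contMDiff_pi_space.2 fun j => contMDiff_fiberDeriv (Φ.contMDiff_h j)) q).mdifferentiableAt
      (by simp)
  have hf : MDifferentiableAt (𝓡 n).tangent (𝓡 n) (fun q : TM n M => q.1) q :=
    (contMDiff_fst_tangent q).mdifferentiableAt (by simp)
  have hC : MDifferentiableAt (𝓡 n).tangent ((𝓡 n).prod 𝓘(ℝ, Φ.J → ℝ)) C q := hf.prodMk hb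
  have hΘ : MDifferentiableAt ((𝓡 n).prod 𝓘(ℝ, Φ.J → ℝ)) (𝓡 n).tangent Φ.combine (C q) :=
    (Φ.contMDiff_combine g (C q)).mdifferentiableAt (by simp)
  -- Since `combine` is a left inverse of `C`, its differential recovers a tangent vector from the
  -- images under the differentials of the projection and of `b`.
  have hid : Φ.combine ∘ C = id := funext Φ.combine_fiberDeriv
  have key : ∀ v : EuclideanSpace ℝ (Fin n) × EuclideanSpace ℝ (Fin n),
      mfderiv ((𝓡 n).prod 𝓘(ℝ, Φ.J → ℝ)) (𝓡 n).tangent Φ.combine (C q)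
        (mfderiv (𝓡 n).tangent (𝓡 n) (fun q : TM n M => q.1) q v,
          mfderiv (𝓡 n).tangent 𝓘(ℝ, Φ.J → ℝ) b q v) = v := by
    intro v
    have h3 := mfderiv_comp_apply q hΘ hC v
    rw [hid, mfderiv_id] at h3
    have h4 : mfderiv (𝓡 n).tangent ((𝓡 n).prod 𝓘(ℝ, Φ.J → ℝ)) C q =
      (mfderiv (𝓡 n).tangent (𝓡 n) (fun q : TM n M => q.1) q).prod
        (mfderiv (𝓡 n).tangent 𝓘(ℝ, Φ.J → ℝ) b q) := mfderiv_prodMk hf hb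
    rw [h4] at h3
    exact h3.symm
  have hbv : ∀ v : EuclideanSpace ℝ (Fin n) × EuclideanSpace ℝ (Fin n), ∀ j,
      (mfderiv (𝓡 n).tangent 𝓘(ℝ, Φ.J → ℝ) b q v : Φ.J → ℝ) j =
        diffTM (fiberDeriv (Φ.h j)) q v := by
    intro v j
    have h3 := mfderiv_comp_apply (I'' := 𝓘(ℝ, ℝ)) q (g := fun c : Φ.J → ℝ => c j)
      (ContinuousLinearMap.proj (R := ℝ) (φ := fun _ : Φ.J => ℝ) j).mdifferentiableAt hb v
    have h4 := (ContinuousLinearMap.proj (R := ℝ) (φ := fun _ : Φ.J => ℝ) j).mfderiv_eq (x := b q)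
    refine Eq.trans ?_ h3.symm
    exact (congrArg (fun A : (Φ.J → ℝ) →L[ℝ] ℝ => A (mfderiv (𝓡 n).tangent 𝓘(ℝ, Φ.J → ℝ) b q v))
      h4).symm
  have hfv : ∀ v : EuclideanSpace ℝ (Fin n) × EuclideanSpace ℝ (Fin n), ∀ j,
      diffAt n (Φ.h j) q.1 (mfderiv (𝓡 n).tangent (𝓡 n) (fun q : TM n M => q.1) q v) =
        diffTM (fun q => Φ.h j q.1) q v := by
    intro v j
    exact (mfderiv_comp_apply q ((Φ.contMDiff_h j _).mdifferentiableAt (by simp)) hf v).symm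
  have e1 : (mfderiv (𝓡 n).tangent (𝓡 n) (fun q : TM n M => q.1) q ξ : EuclideanSpace ℝ (Fin n)) =
      mfderiv (𝓡 n).tangent (𝓡 n) (fun q : TM n M => q.1) q η :=
    Φ.ext_of_diffAt fun j => by rw [hfv, hfv, h1]
  have e2 : (mfderiv (𝓡 n).tangent 𝓘(ℝ, Φ.J → ℝ) b q ξ : Φ.J → ℝ) =
      mfderiv (𝓡 n).tangent 𝓘(ℝ, Φ.J → ℝ) b q η := by
    refine funext fun j => ?_
    rw [hbv, hbv, h2]
  have k1 := key ξ
  have k2 := key η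
  rw [← k1, ← k2]
  exact congrArg (fun z : EuclideanSpace ℝ (Fin n) × (Φ.J → ℝ) =>
    (mfderiv ((𝓡 n).prod 𝓘(ℝ, Φ.J → ℝ)) (𝓡 n).tangent Φ.combine (C q) z :
      EuclideanSpace ℝ (Fin n) × EuclideanSpace ℝ (Fin n))) (Prod.ext e1 e2)

/-- By `Frame.tangent_ext` the two curves have the same velocity. -/
theorem Frame.deriv_eq_of_curves (g : Metric n M) {K : TM n M → ℝ}
    (hK : ContMDiff (𝓡 n).tangent 𝓘(ℝ, ℝ) ∞ K) {α β : ℝ → TM n M} {s r : ℝ}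
    (hα : MDifferentiableAt 𝓘(ℝ, ℝ) (𝓡 n).tangent α s)
    (hβ : MDifferentiableAt 𝓘(ℝ, ℝ) (𝓡 n).tangent β r) (h0 : α s = β r)
    (h1 : ∀ j, deriv (fun s => Φ.h j (α s).1) s = deriv (fun s => Φ.h j (β s).1) r)
    (h2 : ∀ j, deriv (fun s => fiberDeriv (Φ.h j) (α s)) s =
      deriv (fun s => fiberDeriv (Φ.h j) (β s)) r) :
    deriv (fun s => K (α s)) s = deriv (fun s => K (β s)) r := by
  rw [(hasDerivAt_velTM hK hα).deriv, (hasDerivAt_velTM hK hβ).deriv]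
  have h3 : velTM α s = velTM β r := by
    refine Φ.tangent_ext g (q := β r) (fun j => ?_) (fun j => ?_)
    · rw [← (hasDerivAt_velTM (contMDiff_comp_fst (Φ.contMDiff_h j)) hβ).deriv, ← h1, ← h0,
        (hasDerivAt_velTM (contMDiff_comp_fst (Φ.contMDiff_h j)) hα).deriv]
    · rw [← (hasDerivAt_velTM (contMDiff_fiberDeriv (Φ.contMDiff_h j)) hβ).deriv, ← h2, ← h0,
        (hasDerivAt_velTM (contMDiff_fiberDeriv (Φ.contMDiff_h j)) hα).deriv]
  rw [h3, h0]

theorem Frame.contMDiff_diffAt_X {h : M → ℝ} (hh : ContMDiff (𝓡 n) 𝓘(ℝ, ℝ) ∞ h) (k : Φ.J) :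
    ContMDiff (𝓡 n) 𝓘(ℝ, ℝ) ∞ (fun x => diffAt n h x (Φ.X k x)) :=
  (contMDiff_fiberDeriv hh).comp (Φ.contMDiff_X k)

/-- A function `∑ A_i(p) B_i(q)` vanishing on the fibre product `TM ×_M TM` has zero derivative
along its tangent vectors. -/
theorem Frame.sum_deriv_eq_zero (Φ : Frame n M) (g : Metric n M) {ι : Type*} [Fintype ι] {A B : ι → TM n M → ℝ}
    (hA : ∀ i, ContMDiff (𝓡 n).tangent 𝓘(ℝ, ℝ) ∞ (A i))
    (hB : ∀ i, ContMDiff (𝓡 n).tangent 𝓘(ℝ, ℝ) ∞ (B i))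
    (hAB : ∀ p q : TM n M, p.1 = q.1 → ∑ i, A i p * B i q = 0) {a b : ℝ → TM n M} {s : ℝ}
    (ha : MDifferentiableAt 𝓘(ℝ, ℝ) (𝓡 n).tangent a s)
    (hb : MDifferentiableAt 𝓘(ℝ, ℝ) (𝓡 n).tangent b s) (hab : (a s).1 = (b s).1)
    (hv : ∀ h : M → ℝ, ContMDiff (𝓡 n) 𝓘(ℝ, ℝ) ∞ h →
      deriv (fun r => h (a r).1) s = deriv (fun r => h (b r).1) s) :
    ∑ i, (deriv (fun r => A i (a r)) s * B i (b s) + A i (a s) * deriv (fun r => B i (b r)) s)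
      = 0 := by
  -- The pair `(a, b)` lies in the fibre product only at time `s`. Carrying the components of `b`
  -- over to the base point of `a` gives a curve `b'` above the base curve of `a`, where the
  -- relation holds identically; `b'` and `b` have the same velocity at `s` because the base curves
  -- do.
  let c : ℝ → M × (Φ.J → ℝ) := fun r => ((a r).1, fun j => fiberDeriv (Φ.h j) (b r))
  let b' : ℝ → TM n M := fun r => Φ.combine (c r)
  have hc : MDifferentiableAt 𝓘(ℝ, ℝ) ((𝓡 n).prod 𝓘(ℝ, Φ.J → ℝ)) c s := by
    refine MDifferentiableAt.prodMk ?_ ?_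
    · exact ((contMDiff_fst_tangent (a s)).mdifferentiableAt (by simp)).comp s ha
    · refine (differentiableAt_pi.2 fun j => ?_).mdifferentiableAt
      exact (hasDerivAt_velTM (contMDiff_fiberDeriv (Φ.contMDiff_h j)) hb).differentiableAt
  have hb' : MDifferentiableAt 𝓘(ℝ, ℝ) (𝓡 n).tangent b' s :=
    ((Φ.contMDiff_combine g (c s)).mdifferentiableAt (by simp)).comp s hc
  have hbs : b' s = b s := by
    simp only [b', c]
    rw [hab]
    exact Φ.combine_fiberDeriv (b s)
  have hfd : ∀ (j : Φ.J) (z : M × (Φ.J → ℝ)), fiberDeriv (Φ.h j) (Φ.combine z) =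
      ∑ k, z.2 k * diffAt n (Φ.h j) z.1 (Φ.X k z.1) := by
    intro j z
    change diffAt n (Φ.h j) z.1 (∑ k, z.2 k • Φ.X k z.1) = _
    simp [map_sum]
  have hdX : ∀ (x : ℝ → TM n M) (hx : MDifferentiableAt 𝓘(ℝ, ℝ) (𝓡 n).tangent x s) (j k : Φ.J),
      HasDerivAt (fun r => fiberDeriv (Φ.h k) (b r) * diffAt n (Φ.h j) (x r).1 (Φ.X k (x r).1))
        (deriv (fun r => fiberDeriv (Φ.h k) (b r)) s * diffAt n (Φ.h j) (x s).1 (Φ.X k (x s).1) +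
          fiberDeriv (Φ.h k) (b s) *
            deriv (fun r => diffAt n (Φ.h j) (x r).1 (Φ.X k (x r).1)) s) s := by
    intro x hx j k
    exact (hasDerivAt_velTM (contMDiff_fiberDeriv (Φ.contMDiff_h k)) hb).differentiableAt.hasDerivAt.mul
      (hasDerivAt_velTM (contMDiff_comp_fst (Φ.contMDiff_diffAt_X (Φ.contMDiff_h j) k))
        hx).differentiableAt.hasDerivAt
  have hder : ∀ K : TM n M → ℝ, ContMDiff (𝓡 n).tangent 𝓘(ℝ, ℝ) ∞ K →
      deriv (fun r => K (b' r)) s = deriv (fun r => K (b r)) s := by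
    intro K hK
    refine Φ.deriv_eq_of_curves g hK hb' hb hbs (fun j => hv _ (Φ.contMDiff_h j)) fun j => ?_
    have e1 : (fun r => fiberDeriv (Φ.h j) (b' r)) = fun r => ∑ k, fiberDeriv (Φ.h k) (b r) *
        diffAt n (Φ.h j) (a r).1 (Φ.X k (a r).1) := funext fun r => hfd j (c r)
    have e2 : (fun r => fiberDeriv (Φ.h j) (b r)) = fun r => ∑ k, fiberDeriv (Φ.h k) (b r) *
        diffAt n (Φ.h j) (b r).1 (Φ.X k (b r).1) := by
      funext r
      have := hfd j ((b r).1, fun j => fiberDeriv (Φ.h j) (b r))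
      rw [Φ.combine_fiberDeriv] at this
      exact this
    rw [e1, e2, (HasDerivAt.fun_sum fun k _ => hdX a ha j k).deriv,
      (HasDerivAt.fun_sum fun k _ => hdX b hb j k).deriv]
    refine Finset.sum_congr rfl fun k _ => ?_
    rw [hab, hv _ (Φ.contMDiff_diffAt_X (Φ.contMDiff_h j) k)]
  have hzero : (fun r => ∑ i, A i (a r) * B i (b' r)) = fun _ => 0 :=
    funext fun r => hAB _ _ rfl
  have hsum : HasDerivAt (fun r => ∑ i, A i (a r) * B i (b' r))
      (∑ i, (deriv (fun r => A i (a r)) s * B i (b' s) +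
        A i (a s) * deriv (fun r => B i (b' r)) s)) s :=
    HasDerivAt.fun_sum fun i _ => (hasDerivAt_velTM (hA i) ha).differentiableAt.hasDerivAt.mul
      (hasDerivAt_velTM (hB i) hb').differentiableAt.hasDerivAt
  rw [hzero] at hsum
  have h1 := hsum.unique (hasDerivAt_const s 0)
  simpa only [hbs, hder _ (hB _)] using h1

end TangentVectors

/-! ### The symplectic lift of a diffeomorphism. -/

section SymplecticLift

variable {n : ℕ} {M : Type*} [TopologicalSpace M] [ChartedSpace (EuclideanSpace ℝ (Fin n)) M]

/-- The derivative of a map, as an endomorphism of the model space. -/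
def mapDeriv (f : M → M) (x : M) : EuclideanSpace ℝ (Fin n) →L[ℝ] EuclideanSpace ℝ (Fin n) :=
  mfderiv (𝓡 n) (𝓡 n) f x

variable [IsManifold (𝓡 n) ∞ M] (g : Metric n M) (f : M ≃ₘ⟮𝓡 n, 𝓡 n⟯ M)

theorem mdifferentiableAt_diffeomorph (x : M) : MDifferentiableAt (𝓡 n) (𝓡 n) f x :=
  (f.contMDiff x).mdifferentiableAt (by simp)

theorem diffAt_comp {h : M → ℝ} (hh : ContMDiff (𝓡 n) 𝓘(ℝ, ℝ) ∞ h) (x : M)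
    (v : EuclideanSpace ℝ (Fin n)) :
    diffAt n (fun y => h (f y)) x v = diffAt n h (f x) (mapDeriv f x v) :=
  mfderiv_comp_apply x ((hh _).mdifferentiableAt (by simp)) (mdifferentiableAt_diffeomorph f x) v

theorem mapDeriv_symm_mapDeriv (x : M) (v : EuclideanSpace ℝ (Fin n)) :
    mapDeriv f.symm (f x) (mapDeriv f x v) = v := by
  have h := mfderiv_comp_apply (I'' := 𝓡 n) x (mdifferentiableAt_diffeomorph f.symm (f x))
    (mdifferentiableAt_diffeomorph f x) v
  have h1 : f.symm ∘ f = id := funext f.symm_apply_apply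
  rw [h1, mfderiv_id] at h
  exact h.symm

theorem mapDeriv_mapDeriv_symm (x : M) (v : EuclideanSpace ℝ (Fin n)) :
    mapDeriv f x (mapDeriv f.symm (f x) v) = v := by
  have h := mapDeriv_symm_mapDeriv f.symm (f x) v
  rwa [f.symm_apply_apply] at h

/-- This is the defining relation of the inverse adjoint. Since `inverse` is zero on maps that are
not invertible, the adjoint has to be shown injective, which comes from the surjectivity of `df`. -/
theorem metricAt_symplecticLift (q : TM n M) (w : EuclideanSpace ℝ (Fin n)) :
    metricAt g (f q.1) (vec (symplecticLift g f q)) (mapDeriv f q.1 w) =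
      metricAt g q.1 (vec q) w := by
  let B : EuclideanSpace ℝ (Fin n) →L[ℝ] EuclideanSpace ℝ (Fin n) :=
    adjoint g (mfderiv (𝓡 n) (𝓡 n) f q.1)
  have hB : ∀ a u, metricAt g q.1 (B a) u = metricAt g (f q.1) a (mapDeriv f q.1 u) :=
    fun a u => inner_adjoint g (mfderiv (𝓡 n) (𝓡 n) f q.1) a u
  have hinj : Function.Injective B := by
    rw [injective_iff_map_eq_zero]
    intro a ha
    refine eq_zero_of_metricAt g (f q.1) fun w => ?_
    rw [← mapDeriv_mapDeriv_symm f q.1 w, ← hB, ha]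
    simp
  let e := (LinearEquiv.ofInjectiveEndo B.toLinearMap hinj).toContinuousLinearEquiv
  have he : (e : EuclideanSpace ℝ (Fin n) →L[ℝ] EuclideanSpace ℝ (Fin n)) = B := by
    ext; rfl
  have h1 : B (B.inverse (vec q)) = vec q := by
    rw [← he, ContinuousLinearMap.inverse_equiv]
    exact e.apply_symm_apply _
  rw [← hB]
  exact congrArg (fun z => metricAt g q.1 z w) h1

/-- It suffices to pair with the fields `X j` at `f q.1`; by `metricAt_symplecticLift` the pairing
can be computed at `q.1`, where it is a finite sum of products of smooth functions. -/
theorem contMDiff_symplecticLift (Φ : Frame n M) :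
    ContMDiff (𝓡 n).tangent (𝓡 n).tangent ∞ (symplecticLift g f) := by
  intro q
  have hf : ContMDiff (𝓡 n).tangent (𝓡 n) ∞ (fun q : TM n M => f q.1) :=
    f.contMDiff.comp contMDiff_fst_tangent
  refine Φ.contMDiffAt_tangent g (hf q) fun j => ?_
  have h1 : (fun q : TM n M => metricAt g (symplecticLift g f q).1 (vec (symplecticLift g f q))
      (Φ.X j (symplecticLift g f q).1)) = fun q => ∑ k, ∑ l, Φ.coeff g k l q.1 *
        (fiberDeriv (Φ.h k) q * diffAt n (fun y => Φ.h l (f.symm y)) (f q.1) (Φ.X j (f q.1))) := by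
    funext q
    change metricAt g (f q.1) (vec (symplecticLift g f q)) (Φ.X j (f q.1)) = _
    rw [← mapDeriv_mapDeriv_symm f q.1 (Φ.X j (f q.1)), metricAt_symplecticLift,
      Φ.metricAt_eq_sum]
    refine Finset.sum_congr rfl fun k _ => Finset.sum_congr rfl fun l _ => ?_
    rw [diffAt_comp f.symm (Φ.contMDiff_h l), mapDeriv_mapDeriv_symm, f.symm_apply_apply]
    rfl
  rw [h1]
  refine ContMDiffAt.sum fun k _ => ContMDiffAt.sum fun l _ => ContMDiffAt.mul
    (contMDiff_comp_fst (Φ.contMDiff_coeff g k l) q) (ContMDiffAt.mul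
      (contMDiff_fiberDeriv (Φ.contMDiff_h k) q) ?_)
  exact ((Φ.contMDiff_diffAt_X ((Φ.contMDiff_h l).comp f.symm.contMDiff) j).comp hf) q

end SymplecticLift

end

end TranslatedPoint

namespace TranslatedPoint

noncomputable section

theorem hasDerivAt_comp_fderiv {E F : Type*} [NormedAddCommGroup E] [NormedSpace ℝ E]
    [NormedAddCommGroup F] [NormedSpace ℝ F] {L : E → F} {y : ℝ → E} {y' : E} {s : ℝ}
    (hL : DifferentiableAt ℝ L (y s)) (hy : HasDerivAt y y' s) :
    HasDerivAt (fun r => L (y r)) (fderiv ℝ L (y s) y') s :=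
  hL.hasFDerivAt.comp_hasDerivAt s hy

theorem hasDerivAt_clm_apply_comp {E : Type*} [NormedAddCommGroup E] [NormedSpace ℝ E]
    {L : E → E →L[ℝ] ℝ} {y W : ℝ → E} {y' W' : E} {s : ℝ}
    (hL : DifferentiableAt ℝ L (y s)) (hy : HasDerivAt y y' s) (hW : HasDerivAt W W' s) :
    HasDerivAt (fun r => L (y r) (W r)) (fderiv ℝ L (y s) y' (W s) + L (y s) W') s :=
  (hL.hasFDerivAt.comp_hasDerivAt s hy).clm_apply hW

/-! ### The geodesic equation in charts and in frames. -/

section Spray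

variable {n : ℕ} {M : Type*} [TopologicalSpace M] [ChartedSpace (EuclideanSpace ℝ (Fin n)) M]
  [IsManifold (𝓡 n) ∞ M]

/-- The left hand side of the geodesic equation in a chart, at the point `y`, for a curve of
velocity `w` and acceleration `a`, paired with the vector `b`. -/
def geodesicEq (g : Metric n M) (x₀ : M) (y w a b : EuclideanSpace ℝ (Fin n)) : ℝ :=
  localMetric g x₀ y a b + fderiv ℝ (fun z => localMetric g x₀ z w b) y w -
    1 / 2 * fderiv ℝ (fun z => localMetric g x₀ z w w) y b

variable (Φ : Frame n M) (g : Metric n M)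

/-- A function of a frame in the chart at `x₀`. -/
abbrev Frame.hCoord (Φ : Frame n M) (x₀ : M) (j : Φ.J) : EuclideanSpace ℝ (Fin n) → ℝ :=
  Φ.h j ∘ (extChartAt (𝓡 n) x₀).symm

/-- A coefficient of the metric in the chart at `x₀`. -/
abbrev Frame.coeffCoord (Φ : Frame n M) (g : Metric n M) (x₀ : M) (j k : Φ.J) :
    EuclideanSpace ℝ (Fin n) → ℝ :=
  Φ.coeff g j k ∘ (extChartAt (𝓡 n) x₀).symm

/-- The covector dual to the acceleration of the geodesics in a chart. -/
def Frame.sprayCovector (Φ : Frame n M) (g : Metric n M) (x₀ : M)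
    (z : EuclideanSpace ℝ (Fin n) × EuclideanSpace ℝ (Fin n)) : EuclideanSpace ℝ (Fin n) →L[ℝ] ℝ :=
  ∑ j, ∑ k, ((1 / 2 * (fderiv ℝ (Φ.hCoord x₀ j) z.1 z.2 * fderiv ℝ (Φ.hCoord x₀ k) z.1 z.2)) •
    fderiv ℝ (Φ.coeffCoord g x₀ j k) z.1 -
    (fderiv ℝ (Φ.coeffCoord g x₀ j k) z.1 z.2 * fderiv ℝ (Φ.hCoord x₀ j) z.1 z.2 +
      Φ.coeffCoord g x₀ j k z.1 * fderiv ℝ (fderiv ℝ (Φ.hCoord x₀ j)) z.1 z.2 z.2) •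
    fderiv ℝ (Φ.hCoord x₀ k) z.1)

/-- The acceleration of the geodesics in a chart. -/
def Frame.sprayCoord (Φ : Frame n M) (g : Metric n M) (x₀ : M)
    (z : EuclideanSpace ℝ (Fin n) × EuclideanSpace ℝ (Fin n)) : EuclideanSpace ℝ (Fin n) :=
  (localMetric g x₀ z.1).inverse (Φ.sprayCovector g x₀ z)

theorem Frame.contDiffOn_sprayCoord (Φ : Frame n M) (g : Metric n M) (x₀ : M) :
    ContDiffOn ℝ ∞ (Φ.sprayCoord g x₀) ((extChartAt (𝓡 n) x₀).target ×ˢ Set.univ) := by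
  have hm : Set.MapsTo (Prod.fst : EuclideanSpace ℝ (Fin n) × EuclideanSpace ℝ (Fin n) → _)
    ((extChartAt (𝓡 n) x₀).target ×ˢ Set.univ) (extChartAt (𝓡 n) x₀).target := fun z hz => hz.1
  have h1 := (Φ.contDiffOn_inverse_localMetric g x₀).comp contDiffOn_fst hm
  have h2 : ContDiffOn ℝ ∞ (fun z : EuclideanSpace ℝ (Fin n) × EuclideanSpace ℝ (Fin n) => z.2)
    ((extChartAt (𝓡 n) x₀).target ×ˢ Set.univ) := contDiffOn_snd
  have hA := fun j => (contDiffOn_fderiv_comp_symm (Φ.contMDiff_h j) x₀).comp contDiffOn_fst hm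
  have hG := fun j k =>
    (contDiffOn_comp_extChartAt_symm (Φ.contMDiff_coeff g j k) x₀).comp contDiffOn_fst hm
  have hDG := fun j k =>
    (contDiffOn_fderiv_comp_symm (Φ.contMDiff_coeff g j k) x₀).comp contDiffOn_fst hm
  have hDA : ∀ j, ContDiffOn ℝ ∞ (fun z : EuclideanSpace ℝ (Fin n) × EuclideanSpace ℝ (Fin n) =>
      fderiv ℝ (fderiv ℝ (Φ.hCoord x₀ j)) z.1) ((extChartAt (𝓡 n) x₀).target ×ˢ Set.univ) :=
    fun j => ((contDiffOn_fderiv_comp_symm (Φ.contMDiff_h j) x₀).fderiv_of_isOpen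
      (isOpen_extChartAt_target x₀) (by simp)).comp contDiffOn_fst hm
  refine h1.clm_apply (ContDiffOn.sum fun j _ => ContDiffOn.sum fun k _ => ContDiffOn.sub ?_ ?_)
  · exact (contDiffOn_const.mul (((hA j).clm_apply h2).mul ((hA k).clm_apply h2))).smul (hDG j k)
  · exact ((((hDG j k).clm_apply h2).mul ((hA j).clm_apply h2)).add
      ((hG j k).mul (((hDA j).clm_apply h2).clm_apply h2))).smul (hA k)

/-- The algebra of `Frame.eulerLagrange_eq`. `G` stands for the coefficients of the metric, `P` and
`Q` for their derivatives along the velocity and the test vector; `A`, `B`, `C` for the `dh_j` of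
velocity, test vector and acceleration, and `D` for the second derivatives of the `h j` on the
velocity. -/
theorem sum_eulerLagrange_aux {J : Type*} [Fintype J] {G P Q : J → J → ℝ} {A B C D : J → ℝ} :
    ∑ k, (∑ j, 2 * (P j k * A j + G j k * (D j + C j))) * B k - ∑ j, ∑ k, Q j k * (A j * A k) =
      2 * (∑ j, ∑ k, G j k * (C j * B k) -
        ∑ j, ∑ k, (1 / 2 * (A j * A k) * Q j k - (P j k * A j + G j k * D j) * B k)) := by
  have h1 : ∑ k, (∑ j, 2 * (P j k * A j + G j k * (D j + C j))) * B k =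
      ∑ j, ∑ k, 2 * (P j k * A j + G j k * (D j + C j)) * B k := by
    rw [Finset.sum_comm]
    exact Finset.sum_congr rfl fun k _ => Finset.sum_mul _ _ _
  rw [h1, mul_sub]
  simp only [Finset.mul_sum, ← Finset.sum_sub_distrib]
  refine Finset.sum_congr rfl fun j _ => Finset.sum_congr rfl fun k _ => ?_
  ring

theorem sum_geodesicEq_aux {J : Type*} [Fintype J] {G P Q : J → J → ℝ} {A B D F : J → ℝ}
    (hG : ∀ j k, G j k = G k j) :
    ∑ j, ∑ k, (P j k * (A j * B k) + G j k * (D j * B k + A j * F k)) -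
        1 / 2 * ∑ j, ∑ k, (Q j k * (A j * A k) + G j k * (F j * A k + A j * F k)) =
      -∑ j, ∑ k, (1 / 2 * (A j * A k) * Q j k - (P j k * A j + G j k * D j) * B k) := by
  have h2 : ∑ j, ∑ k, (G j k * (F j * A k) - G j k * (A j * F k)) = 0 := by
    simp only [Finset.sum_sub_distrib]
    rw [sub_eq_zero, Finset.sum_comm]
    refine Finset.sum_congr rfl fun k _ => Finset.sum_congr rfl fun j _ => ?_
    rw [hG]
    ring
  rw [← sub_eq_zero, ← mul_zero (-(1 / 2 : ℝ)), ← h2]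
  simp only [Finset.mul_sum, ← Finset.sum_sub_distrib, sub_neg_eq_add, ← Finset.sum_add_distrib]
  refine Finset.sum_congr rfl fun j _ => Finset.sum_congr rfl fun k _ => ?_
  ring

theorem Frame.fderiv_localMetric_apply {x₀ : M} {y : EuclideanSpace ℝ (Fin n)}
    (hy : y ∈ (extChartAt (𝓡 n) x₀).target) (w a b : EuclideanSpace ℝ (Fin n)) :
    fderiv ℝ (fun z => localMetric g x₀ z a b) y w = ∑ j, ∑ k,
      (fderiv ℝ (Φ.coeffCoord g x₀ j k) y w *
        (fderiv ℝ (Φ.hCoord x₀ j) y a * fderiv ℝ (Φ.hCoord x₀ k) y b) +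
      Φ.coeffCoord g x₀ j k y *
        (fderiv ℝ (fderiv ℝ (Φ.hCoord x₀ j)) y w a * fderiv ℝ (Φ.hCoord x₀ k) y b +
        fderiv ℝ (Φ.hCoord x₀ j) y a * fderiv ℝ (fderiv ℝ (Φ.hCoord x₀ k)) y w b)) := by
  have hT := (isOpen_extChartAt_target (I := 𝓡 n) x₀).mem_nhds hy
  have hG : ∀ j k, HasFDerivAt (Φ.coeffCoord g x₀ j k) (fderiv ℝ (Φ.coeffCoord g x₀ j k) y) y :=
    fun j k => (((contDiffOn_comp_extChartAt_symm (Φ.contMDiff_coeff g j k) x₀).contDiffAt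
        hT).differentiableAt (by simp)).hasFDerivAt
  have hA : ∀ j v, HasFDerivAt (fun z => fderiv ℝ (Φ.hCoord x₀ j) z v)
      ((fderiv ℝ (fderiv ℝ (Φ.hCoord x₀ j)) y).flip v) y := by
    intro j v
    have h3 := (((contDiffOn_fderiv_comp_symm (Φ.contMDiff_h j) x₀).contDiffAt
        hT).differentiableAt (by simp)).hasFDerivAt.clm_apply (hasFDerivAt_const v y)
    refine h3.congr_fderiv ?_
    rw [ContinuousLinearMap.comp_zero, zero_add]
  have h3 : (fun z => localMetric g x₀ z a b) =ᶠ[𝓝 y] fun z => ∑ j, ∑ k,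
      Φ.coeffCoord g x₀ j k z *
        (fderiv ℝ (Φ.hCoord x₀ j) z a * fderiv ℝ (Φ.hCoord x₀ k) z b) := by
    filter_upwards [hT] with z hz
    rw [Φ.localMetric_eq_sum g hz]
    simp only [sum_apply, smul_apply, ContinuousLinearMap.smulRight_apply, smul_eq_mul, mul_assoc]
    rfl
  rw [h3.fderiv_eq, (HasFDerivAt.fun_sum fun j _ => HasFDerivAt.fun_sum fun k _ =>
      (hG j k).fun_mul ((hA j a).fun_mul (hA k b))).fderiv]
  simp only [sum_apply, add_apply, smul_apply, smul_eq_mul, ContinuousLinearMap.flip_apply]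
  refine Finset.sum_congr rfl fun j _ => Finset.sum_congr rfl fun k _ => ?_
  ring

theorem Frame.localMetric_apply_eq_sum {x₀ : M} {y : EuclideanSpace ℝ (Fin n)}
    (hy : y ∈ (extChartAt (𝓡 n) x₀).target) (a b : EuclideanSpace ℝ (Fin n)) :
    localMetric g x₀ y a b = ∑ j, ∑ k, Φ.coeffCoord g x₀ j k y *
        (fderiv ℝ (Φ.hCoord x₀ j) y a * fderiv ℝ (Φ.hCoord x₀ k) y b) := by
  rw [Φ.localMetric_eq_sum g hy]
  simp only [sum_apply, smul_apply, ContinuousLinearMap.smulRight_apply, smul_eq_mul, mul_assoc]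
  rfl

theorem Frame.sprayCovector_apply (x₀ : M) (y w b : EuclideanSpace ℝ (Fin n)) :
    Φ.sprayCovector g x₀ (y, w) b = ∑ j, ∑ k,
      (1 / 2 * (fderiv ℝ (Φ.hCoord x₀ j) y w * fderiv ℝ (Φ.hCoord x₀ k) y w) *
        fderiv ℝ (Φ.coeffCoord g x₀ j k) y b -
      (fderiv ℝ (Φ.coeffCoord g x₀ j k) y w * fderiv ℝ (Φ.hCoord x₀ j) y w +
        Φ.coeffCoord g x₀ j k y * fderiv ℝ (fderiv ℝ (Φ.hCoord x₀ j)) y w w) *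
      fderiv ℝ (Φ.hCoord x₀ k) y b) := by
  simp only [sprayCovector, sum_apply, sub_apply, smul_apply, smul_eq_mul]

/-- Inserting `∑ G_jk dh_j dh_k` for the metric produces terms with `D²h(w, b)`. They cancel between
the two derivatives of the metric, by symmetry of second derivatives and of the coefficients. -/
theorem Frame.geodesicEq_eq {x₀ : M} {y : EuclideanSpace ℝ (Fin n)}
    (hy : y ∈ (extChartAt (𝓡 n) x₀).target) (w a b : EuclideanSpace ℝ (Fin n)) :
    geodesicEq g x₀ y w a b = localMetric g x₀ y a b - Φ.sprayCovector g x₀ (y, w) b := by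
  have hsym : ∀ k, fderiv ℝ (fderiv ℝ (Φ.hCoord x₀ k)) y b w =
      fderiv ℝ (fderiv ℝ (Φ.hCoord x₀ k)) y w b := fun k =>
    (((contDiffOn_comp_extChartAt_symm (Φ.contMDiff_h k) x₀).contDiffAt
      ((isOpen_extChartAt_target (I := 𝓡 n) x₀).mem_nhds hy)).isSymmSndFDerivAt
        (by rw [minSmoothness_of_isRCLikeNormedField]; exact WithTop.coe_le_coe.2 le_top)) _ _
  rw [geodesicEq, Φ.fderiv_localMetric_apply g hy, Φ.fderiv_localMetric_apply g hy,
    Φ.sprayCovector_apply, sub_eq_add_neg _ (∑ j, _), add_sub_assoc]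
  congr 1
  simp only [hsym]
  exact sum_geodesicEq_aux (G := fun j k => Φ.coeffCoord g x₀ j k y)
    (fun j k => Φ.coeff_symm g j k _)

theorem Frame.eq_sprayCoord_iff {x₀ : M} {y : EuclideanSpace ℝ (Fin n)}
    (hy : y ∈ (extChartAt (𝓡 n) x₀).target) {w a : EuclideanSpace ℝ (Fin n)} :
    a = Φ.sprayCoord g x₀ (y, w) ↔
      ∀ b, localMetric g x₀ y a b - Φ.sprayCovector g x₀ (y, w) b = 0 := by
  constructor
  · rintro rfl b
    rw [sprayCoord, localMetric_inverse' g hy, sub_self]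
  · intro h
    have h1 : localMetric g x₀ y a = Φ.sprayCovector g x₀ (y, w) := by
      ext b
      exact sub_eq_zero.1 (h b)
    rw [sprayCoord, ← h1, localMetric_inverse g hy]

/-- The momenta `q ↦ 2 ∑ j, G_jk ĥ_j`. -/
def Frame.momentum (Φ : Frame n M) (g : Metric n M) (k : Φ.J) (q : TM n M) : ℝ :=
  ∑ j, 2 * (Φ.coeff g j k q.1 * fiberDeriv (Φ.h j) q)

theorem Frame.contMDiff_momentum (k : Φ.J) :
    ContMDiff (𝓡 n).tangent 𝓘(ℝ, ℝ) ∞ (Φ.momentum g k) :=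
  ContMDiff.sum fun j _ => contMDiff_const.mul
    ((contMDiff_comp_fst (Φ.contMDiff_coeff g j k)).mul (contMDiff_fiberDeriv (Φ.contMDiff_h j)))

/-- So `∑ Q_k dh_k` is twice the contact form; the boundary terms in the variations of the energy
have this shape as well. -/
theorem Frame.sum_momentum (q : TM n M) (w : EuclideanSpace ℝ (Fin n)) :
    ∑ k, Φ.momentum g k q * diffAt n (Φ.h k) q.1 w = 2 * metricAt g q.1 (vec q) w := by
  rw [Φ.metricAt_eq_sum, Finset.sum_comm, Finset.mul_sum]
  refine Finset.sum_congr rfl fun k _ => ?_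
  rw [momentum, Finset.sum_mul, Finset.mul_sum]
  refine Finset.sum_congr rfl fun j _ => ?_
  rw [fiberDeriv]
  ring

/-- The geodesic equation for a tangent vector `ζ` of `TM`, in terms of a frame. -/
def Frame.eulerLagrange (Φ : Frame n M) (g : Metric n M) (q : TM n M)
    (ζ : EuclideanSpace ℝ (Fin n) × EuclideanSpace ℝ (Fin n)) (v : EuclideanSpace ℝ (Fin n)) : ℝ :=
  ∑ k, diffTM (Φ.momentum g k) q ζ * diffAt n (Φ.h k) q.1 v -
    ∑ j, ∑ k, diffAt n (Φ.coeff g j k) q.1 v * (fiberDeriv (Φ.h j) q * fiberDeriv (Φ.h k) q)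

theorem diffAt_eq_fderiv_toCoord {h : M → ℝ} (hh : ContMDiff (𝓡 n) 𝓘(ℝ, ℝ) ∞ h) {x₀ x : M}
    (hx : x ∈ (extChartAt (𝓡 n) x₀).source) (v : EuclideanSpace ℝ (Fin n)) :
    diffAt n h x v = fderiv ℝ (h ∘ (extChartAt (𝓡 n) x₀).symm) (extChartAt (𝓡 n) x₀ x)
      (toCoord x₀ x v) := by
  have h1 := diffAt_ofCoord hh ((extChartAt (𝓡 n) x₀).map_source hx) (toCoord x₀ x v)
  rwa [(extChartAt (𝓡 n) x₀).left_inv hx, ofCoord_toCoord hx] at h1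

/-- The coordinates of a tangent vector of `TM` in the chart at `x₀`. -/
def coordTM (q₀ q : TM n M) : EuclideanSpace ℝ (Fin n) × EuclideanSpace ℝ (Fin n) →L[ℝ]
    EuclideanSpace ℝ (Fin n) × EuclideanSpace ℝ (Fin n) :=
  mfderiv (𝓡 n).tangent 𝓘(ℝ, EuclideanSpace ℝ (Fin n) × EuclideanSpace ℝ (Fin n))
    (extChartAt (𝓡 n).tangent q₀) q

theorem coordTM_self (q : TM n M) (ζ : EuclideanSpace ℝ (Fin n) × EuclideanSpace ℝ (Fin n)) :
    coordTM q q ζ = ζ :=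
  mfderiv_extChartAt_self_apply (I := (𝓡 n).tangent) q ζ

theorem hasDerivAt_chart {q₀ : TM n M} {α : ℝ → TM n M} {s : ℝ}
    (hs : (α s).1 ∈ (extChartAt (𝓡 n) q₀.1).source)
    (hα : MDifferentiableAt 𝓘(ℝ, ℝ) (𝓡 n).tangent α s) :
    HasDerivAt (fun r => extChartAt (𝓡 n) q₀.1 (α r).1) (coordTM q₀ (α s) (velTM α s)).1 s ∧
    HasDerivAt (fun r => toCoord q₀.1 (α r).1 (vec (α r))) (coordTM q₀ (α s) (velTM α s)).2 s := by
  have h1 : HasDerivAt (fun r => extChartAt (𝓡 n).tangent q₀ (α r))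
      (coordTM q₀ (α s) (velTM α s)) s :=
    hasDerivAt_comp_curve (I := (𝓡 n).tangent) ((contMDiffAt_extChartAt_of_mem (I := (𝓡 n).tangent)
      (mem_extChartAt_tangent_source.2 hs)).mdifferentiableAt (by simp)) hα
  have h2 : (fun r => extChartAt (𝓡 n).tangent q₀ (α r)) =ᶠ[𝓝 s]
      fun r => (extChartAt (𝓡 n) q₀.1 (α r).1, toCoord q₀.1 (α r).1 (vec (α r))) := by
    have hc : ContinuousAt (fun r => (α r).1) s :=
      contMDiff_fst_tangent.continuous.continuousAt.comp hα.continuousAt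
    filter_upwards [hc.preimage_mem_nhds ((isOpen_extChartAt_source (I := 𝓡 n) q₀.1).mem_nhds hs)]
      with r hr
    exact extChartAt_tangent_apply hr
  have h3 := h1.congr_of_eventuallyEq h2.symm
  exact ⟨h3.fst, h3.snd⟩

/-- The geodesic equation in a chart is the one in a frame. -/
theorem Frame.eulerLagrange_eq {q₀ q : TM n M}
    (hq : q.1 ∈ (extChartAt (𝓡 n) q₀.1).source)
    {ζ : EuclideanSpace ℝ (Fin n) × EuclideanSpace ℝ (Fin n)}
    (hζ : (coordTM q₀ q ζ).1 = toCoord q₀.1 q.1 (vec q)) (v : EuclideanSpace ℝ (Fin n)) :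
    Φ.eulerLagrange g q ζ v = 2 * (localMetric g q₀.1 (extChartAt (𝓡 n) q₀.1 q.1)
      (coordTM q₀ q ζ).2 (toCoord q₀.1 q.1 v) - Φ.sprayCovector g q₀.1
        (extChartAt (𝓡 n) q₀.1 q.1, toCoord q₀.1 q.1 (vec q)) (toCoord q₀.1 q.1 v)) := by
  obtain ⟨α, hα, hα0, hαζ⟩ := exists_curve_velTM q ζ
  have hα' := hα.mdifferentiableAt (by simp)
  have hs : (α 0).1 ∈ (extChartAt (𝓡 n) q₀.1).source := by rwa [hα0]
  obtain ⟨hy, hW⟩ := hasDerivAt_chart hs hα'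
  have hyT : extChartAt (𝓡 n) q₀.1 (α 0).1 ∈ (extChartAt (𝓡 n) q₀.1).target :=
    (extChartAt (𝓡 n) q₀.1).map_source hs
  have hT := (isOpen_extChartAt_target (I := 𝓡 n) q₀.1).mem_nhds hyT
  have hev : ∀ᶠ r in 𝓝 (0 : ℝ), (α r).1 ∈ (extChartAt (𝓡 n) q₀.1).source := by
    have hc : ContinuousAt (fun r => (α r).1) 0 :=
      contMDiff_fst_tangent.continuous.continuousAt.comp hα'.continuousAt
    exact hc.preimage_mem_nhds ((isOpen_extChartAt_source (I := 𝓡 n) q₀.1).mem_nhds hs)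
  have hG : ∀ j k, HasDerivAt (fun r => Φ.coeff g j k (α r).1)
      (fderiv ℝ (Φ.coeffCoord g q₀.1 j k) (extChartAt (𝓡 n) q₀.1 (α 0).1)
        (coordTM q₀ (α 0) (velTM α 0)).1) 0 := by
    intro j k
    refine (hasDerivAt_comp_fderiv (L := Φ.coeffCoord g q₀.1 j k)
      (((contDiffOn_comp_extChartAt_symm (Φ.contMDiff_coeff g j k) q₀.1).contDiffAt
        hT).differentiableAt (by simp)) hy).congr_of_eventuallyEq ?_
    filter_upwards [hev] with r hr
    simp only [Function.comp_apply]
    rw [(extChartAt (𝓡 n) q₀.1).left_inv hr]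
  have hA : ∀ j, HasDerivAt (fun r => fiberDeriv (Φ.h j) (α r))
      (fderiv ℝ (fderiv ℝ (Φ.hCoord q₀.1 j)) (extChartAt (𝓡 n) q₀.1 (α 0).1)
        (coordTM q₀ (α 0) (velTM α 0)).1 (toCoord q₀.1 (α 0).1 (vec (α 0))) +
      fderiv ℝ (Φ.hCoord q₀.1 j) (extChartAt (𝓡 n) q₀.1 (α 0).1)
        (coordTM q₀ (α 0) (velTM α 0)).2) 0 := by
    intro j
    refine (hasDerivAt_clm_apply_comp (L := fderiv ℝ (Φ.hCoord q₀.1 j))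
      (((contDiffOn_fderiv_comp_symm (Φ.contMDiff_h j) q₀.1).contDiffAt
        hT).differentiableAt (by simp)) hy hW).congr_of_eventuallyEq ?_
    filter_upwards [hev] with r hr
    exact diffAt_eq_fderiv_toCoord (Φ.contMDiff_h j) hr _
  have hQ : ∀ k, diffTM (Φ.momentum g k) (α 0) (velTM α 0) = ∑ j, 2 *
      (fderiv ℝ (Φ.coeffCoord g q₀.1 j k) (extChartAt (𝓡 n) q₀.1 (α 0).1)
        (coordTM q₀ (α 0) (velTM α 0)).1 * fiberDeriv (Φ.h j) (α 0) +
      Φ.coeff g j k (α 0).1 *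
      (fderiv ℝ (fderiv ℝ (Φ.hCoord q₀.1 j)) (extChartAt (𝓡 n) q₀.1 (α 0).1)
        (coordTM q₀ (α 0) (velTM α 0)).1 (toCoord q₀.1 (α 0).1 (vec (α 0))) +
      fderiv ℝ (Φ.hCoord q₀.1 j) (extChartAt (𝓡 n) q₀.1 (α 0).1)
        (coordTM q₀ (α 0) (velTM α 0)).2)) := by
    intro k
    refine (hasDerivAt_velTM (Φ.contMDiff_momentum g k) hα').unique ?_
    exact HasDerivAt.fun_sum fun j _ => ((hG j k).fun_mul (hA j)).const_mul 2
  rw [hα0, hαζ, hζ] at hQ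
  unfold Frame.eulerLagrange
  simp only [hQ]
  rw [Φ.localMetric_apply_eq_sum g ((extChartAt (𝓡 n) q₀.1).map_source hq),
    Φ.sprayCovector_apply]
  simp only [fiberDeriv, diffAt_eq_fderiv_toCoord (Φ.contMDiff_h _) hq,
    diffAt_eq_fderiv_toCoord (Φ.contMDiff_coeff g _ _) hq, Function.comp_apply,
    (extChartAt (𝓡 n) q₀.1).left_inv hq]
  exact sum_eulerLagrange_aux

end Spray

end

end TranslatedPoint

namespace TranslatedPoint

noncomputable section

/-! ### The geodesic spray as a smooth vector field on `TM`. -/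

section GeodesicSpray

variable {n : ℕ} {M : Type*} [TopologicalSpace M] [ChartedSpace (EuclideanSpace ℝ (Fin n)) M]
  [IsManifold (𝓡 n) ∞ M] (Φ : Frame n M) (g : Metric n M)

/-- The geodesic spray: the vector field on `TM` generating the geodesic flow. -/
def Frame.spray (Φ : Frame n M) (g : Metric n M) (q : TM n M) :
    EuclideanSpace ℝ (Fin n) × EuclideanSpace ℝ (Fin n) :=
  (vec q, Φ.sprayCoord g q.1 (extChartAt (𝓡 n) q.1 q.1, vec q))

theorem toCoord_self (x : M) (v : EuclideanSpace ℝ (Fin n)) : toCoord x x v = v :=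
  mfderiv_extChartAt_self_apply (I := 𝓡 n) x v

theorem diffTM_comp_fst {h : M → ℝ} (hh : ContMDiff (𝓡 n) 𝓘(ℝ, ℝ) ∞ h) {q₀ q : TM n M}
    (hq : q.1 ∈ (extChartAt (𝓡 n) q₀.1).source)
    (ζ : EuclideanSpace ℝ (Fin n) × EuclideanSpace ℝ (Fin n)) :
    diffTM (fun q => h q.1) q ζ = fderiv ℝ (h ∘ (extChartAt (𝓡 n) q₀.1).symm)
      (extChartAt (𝓡 n) q₀.1 q.1) (coordTM q₀ q ζ).1 := by
  obtain ⟨α, hα, hα0, hαζ⟩ := exists_curve_velTM q ζ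
  have hα' := hα.mdifferentiableAt (by simp)
  have hs : (α 0).1 ∈ (extChartAt (𝓡 n) q₀.1).source := by rwa [hα0]
  obtain ⟨hy, -⟩ := hasDerivAt_chart hs hα'
  have hT := (isOpen_extChartAt_target (I := 𝓡 n) q₀.1).mem_nhds
    ((extChartAt (𝓡 n) q₀.1).map_source hs)
  have h1 := hasDerivAt_velTM (contMDiff_comp_fst hh) hα'
  have h2 := hasDerivAt_comp_fderiv (L := h ∘ (extChartAt (𝓡 n) q₀.1).symm)
      (((contDiffOn_comp_extChartAt_symm hh q₀.1).contDiffAt hT).differentiableAt (by simp)) hy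
  have h3 : (fun r => h (α r).1) =ᶠ[𝓝 0]
      fun r => (h ∘ (extChartAt (𝓡 n) q₀.1).symm) (extChartAt (𝓡 n) q₀.1 (α r).1) := by
    have hc : ContinuousAt (fun r => (α r).1) 0 :=
      contMDiff_fst_tangent.continuous.continuousAt.comp hα'.continuousAt
    filter_upwards [hc.preimage_mem_nhds ((isOpen_extChartAt_source (I := 𝓡 n) q₀.1).mem_nhds hs)]
      with r hr
    simp only [Function.comp_apply]
    rw [(extChartAt (𝓡 n) q₀.1).left_inv hr]
  have h4 := h1.unique (h2.congr_of_eventuallyEq h3)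
  rwa [hα0, hαζ] at h4

/-- Each side says that the tangent vector `ζ` of `TM` at `(x, v)` projects to `v`. -/
theorem Frame.coordTM_fst_iff {q₀ q : TM n M} (hq : q.1 ∈ (extChartAt (𝓡 n) q₀.1).source)
    {ζ : EuclideanSpace ℝ (Fin n) × EuclideanSpace ℝ (Fin n)} :
    (∀ j, diffTM (fun q => Φ.h j q.1) q ζ = fiberDeriv (Φ.h j) q) ↔
      (coordTM q₀ q ζ).1 = toCoord q₀.1 q.1 (vec q) := by
  have hy := (extChartAt (𝓡 n) q₀.1).map_source hq
  constructor
  · intro h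
    have h1 : ofCoord q₀.1 (extChartAt (𝓡 n) q₀.1 q.1) (coordTM q₀ q ζ).1 = vec q := by
      refine Φ.ext_of_diffAt (x := q.1) fun j => ?_
      have h2 := diffAt_ofCoord (Φ.contMDiff_h j) hy (coordTM q₀ q ζ).1
      rw [(extChartAt (𝓡 n) q₀.1).left_inv hq] at h2
      rw [h2, ← diffTM_comp_fst (Φ.contMDiff_h j) hq, h j]
      rfl
    rw [← h1]
    have h3 := toCoord_ofCoord hy (coordTM q₀ q ζ).1
    rw [(extChartAt (𝓡 n) q₀.1).left_inv hq] at h3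
    exact h3.symm
  · intro h j
    rw [diffTM_comp_fst (Φ.contMDiff_h j) hq, h, fiberDeriv,
      diffAt_eq_fderiv_toCoord (Φ.contMDiff_h j) hq]

theorem Frame.eulerLagrange_iff {q₀ q : TM n M} (hq : q.1 ∈ (extChartAt (𝓡 n) q₀.1).source)
    {ζ : EuclideanSpace ℝ (Fin n) × EuclideanSpace ℝ (Fin n)} :
    ((∀ j, diffTM (fun q => Φ.h j q.1) q ζ = fiberDeriv (Φ.h j) q) ∧
      ∀ v, Φ.eulerLagrange g q ζ v = 0) ↔
    coordTM q₀ q ζ = (toCoord q₀.1 q.1 (vec q), Φ.sprayCoord g q₀.1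
      (extChartAt (𝓡 n) q₀.1 q.1, toCoord q₀.1 q.1 (vec q))) := by
  have hy := (extChartAt (𝓡 n) q₀.1).map_source hq
  rw [Prod.ext_iff, Φ.coordTM_fst_iff hq]
  refine and_congr_right fun h1 => ?_
  rw [Φ.eq_sprayCoord_iff g hy]
  constructor
  · intro h b
    have h2 := h (ofCoord q₀.1 (extChartAt (𝓡 n) q₀.1 q.1) b)
    rw [Φ.eulerLagrange_eq g hq h1] at h2
    have h3 := toCoord_ofCoord hy b
    rw [(extChartAt (𝓡 n) q₀.1).left_inv hq] at h3
    rw [h3] at h2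
    linarith
  · intro h v
    rw [Φ.eulerLagrange_eq g hq h1, h, mul_zero]

/-- The right-hand side mentions no chart. Hence the spray, defined at each point by the chart
centred there, has the expected expression in every chart, and this gives its smoothness. -/
theorem Frame.eq_spray_iff {q : TM n M}
    {ζ : EuclideanSpace ℝ (Fin n) × EuclideanSpace ℝ (Fin n)} :
    ζ = Φ.spray g q ↔ (∀ j, diffTM (fun q => Φ.h j q.1) q ζ = fiberDeriv (Φ.h j) q) ∧
      ∀ v, Φ.eulerLagrange g q ζ v = 0 := by
  rw [Φ.eulerLagrange_iff g (q₀ := q) (mem_extChartAt_source _), coordTM_self, toCoord_self]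
  rfl

theorem Frame.eulerLagrange_spray (q : TM n M) (v : EuclideanSpace ℝ (Fin n)) :
    Φ.eulerLagrange g q (Φ.spray g q) v = 0 :=
  ((Φ.eq_spray_iff g).1 rfl).2 v

theorem Frame.coordTM_spray {q₀ q : TM n M} (hq : q.1 ∈ (extChartAt (𝓡 n) q₀.1).source) :
    coordTM q₀ q (Φ.spray g q) = (toCoord q₀.1 q.1 (vec q), Φ.sprayCoord g q₀.1
      (extChartAt (𝓡 n) q₀.1 q.1, toCoord q₀.1 q.1 (vec q))) :=
  (Φ.eulerLagrange_iff g hq).1 ((Φ.eq_spray_iff g).1 rfl)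

theorem Frame.diffTM_comp_fst_spray {h : M → ℝ} (hh : ContMDiff (𝓡 n) 𝓘(ℝ, ℝ) ∞ h) (q : TM n M) :
    diffTM (fun q => h q.1) q (Φ.spray g q) = fiberDeriv h q := by
  rw [diffTM_comp_fst hh (q₀ := q) (mem_extChartAt_source _), coordTM_self, fiberDeriv,
    diffAt_eq_fderiv_toCoord hh (x₀ := q.1) (mem_extChartAt_source _), toCoord_self]
  rfl

theorem Frame.contMDiff_spray : ContMDiff (𝓡 n).tangent (𝓡 n).tangent.tangent ∞
    (fun q => (⟨q, Φ.spray g q⟩ : TangentBundle (𝓡 n).tangent (TM n M))) := by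
  intro q₀
  refine (contMDiffAt_vectorField_iff (I := (𝓡 n).tangent) (Z := Φ.spray g)
    (mem_extChartAt_source q₀)).2 ?_
  have h1 : ContMDiffAt (𝓡 n).tangent 𝓘(ℝ, EuclideanSpace ℝ (Fin n) × EuclideanSpace ℝ (Fin n)) ∞
      (extChartAt (𝓡 n).tangent q₀) q₀ :=
    contMDiffAt_extChartAt_of_mem (I := (𝓡 n).tangent) (mem_extChartAt_source q₀)
  have h2 : ContDiffAt ℝ ∞ (Φ.sprayCoord g q₀.1) (extChartAt (𝓡 n).tangent q₀ q₀) := by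
    refine (Φ.contDiffOn_sprayCoord g q₀.1).contDiffAt (prod_mem_nhds ?_ Filter.univ_mem)
    exact (isOpen_extChartAt_target (I := 𝓡 n) q₀.1).mem_nhds (mem_extChartAt_tangent_target.1
      ((extChartAt (𝓡 n).tangent q₀).map_source (mem_extChartAt_source q₀)))
  have h3 : ContMDiffAt (𝓡 n).tangent 𝓘(ℝ, EuclideanSpace ℝ (Fin n) × EuclideanSpace ℝ (Fin n)) ∞
      (fun q => ((extChartAt (𝓡 n).tangent q₀ q).2,
        Φ.sprayCoord g q₀.1 (extChartAt (𝓡 n).tangent q₀ q))) q₀ :=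
    ContMDiffAt.prodMk_space (contDiff_snd.contMDiff.contMDiffAt.comp q₀ h1)
      (ContMDiffAt.comp q₀ h2.contMDiffAt h1)
  refine h3.congr_of_eventuallyEq ?_
  filter_upwards [(isOpen_extChartAt_source (I := (𝓡 n).tangent) q₀).mem_nhds
    (mem_extChartAt_source q₀)] with q hq
  have hq' := mem_extChartAt_tangent_source.1 hq
  rw [extChartAt_tangent_apply hq']
  exact Φ.coordTM_spray g hq'

theorem Frame.contMDiff_velocity (Φ : Frame n M) (g : Metric n M) {c : ℝ → M}
    (hc : ContMDiff 𝓘(ℝ, ℝ) (𝓡 n) ∞ c) :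
    ContMDiff 𝓘(ℝ, ℝ) (𝓡 n).tangent ∞ (velocity (n := n) c) := by
  intro s
  refine Φ.contMDiffAt_tangent g (hc s) fun k => ?_
  have hd : ∀ j, ContMDiff 𝓘(ℝ, ℝ) 𝓘(ℝ, ℝ) ∞
      (fun s => fiberDeriv (Φ.h j) (velocity (n := n) c s)) := by
    intro j
    have h1 : (fun s => fiberDeriv (Φ.h j) (velocity (n := n) c s)) =
        deriv (fun s => Φ.h j (c s)) := funext fun s => (fiberDeriv_velocity (Φ.contMDiff_h j)
          ((hc s).mdifferentiableAt (by simp))).deriv.symm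
    have h2 : ContDiff ℝ ∞ (fun s => Φ.h j (c s)) :=
      contMDiff_iff_contDiff.1 ((Φ.contMDiff_h j).comp hc)
    rw [h1]
    exact (contDiff_infty_iff_deriv.1 h2).2.contMDiff
  have h1 : (fun s => metricAt g (velocity (n := n) c s).1 (vec (velocity (n := n) c s))
      (Φ.X k (velocity (n := n) c s).1)) = fun s => ∑ j, ∑ l, Φ.coeff g j l (c s) *
        (fiberDeriv (Φ.h j) (velocity (n := n) c s) * diffAt n (Φ.h l) (c s) (Φ.X k (c s))) :=
    funext fun s => Φ.metricAt_eq_sum g _ _ _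
  rw [h1]
  exact ContMDiffAt.sum fun j _ => ContMDiffAt.sum fun l _ =>
    (((Φ.contMDiff_coeff g j l).comp hc) s).mul ((hd j s).mul
      (((Φ.contMDiff_diffAt_X (Φ.contMDiff_h l) k).comp hc) s))

/-- Geodesics are the curves whose velocity is an integral curve of the spray. -/
theorem Frame.isGeodesic_iff {c : ℝ → M} : IsGeodesic g c ↔
    ContMDiff 𝓘(ℝ, ℝ) (𝓡 n) ∞ c ∧
      ∀ s, velTM (velocity (n := n) c) s = Φ.spray g (velocity (n := n) c s) := by
  refine and_congr_right fun hc => forall_congr' fun t => ?_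
  have hv := Φ.contMDiff_velocity g hc
  obtain ⟨h1, h2⟩ := hasDerivAt_chart (q₀ := velocity (n := n) c t) (α := velocity (n := n) c)
    (s := t) (mem_extChartAt_source _) ((hv t).mdifferentiableAt (by simp))
  rw [coordTM_self] at h1 h2
  -- The derivative of `u` is the fibre coordinate of the velocity, so `u''` is the second component
  -- of the velocity of the curve `velocity c` in `TM`.
  have hu : ∀ᶠ r in 𝓝 t, deriv (fun s => extChartAt (𝓡 n) (c t) (c s)) r =
      toCoord (c t) (c r) (vec (velocity (n := n) c r)) := by
    filter_upwards [hc.continuous.continuousAt.preimage_mem_nhds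
      ((isOpen_extChartAt_source (I := 𝓡 n) (c t)).mem_nhds (mem_extChartAt_source _))] with r hr
    exact (hasDerivAt_comp_curve (I := 𝓡 n) ((contMDiffAt_extChartAt_of_mem hr).mdifferentiableAt
      (by simp)) ((hc r).mdifferentiableAt (by simp))).deriv
  have hut := hu.self_of_nhds
  rw [toCoord_self] at hut
  have h3 : deriv (deriv (fun s => extChartAt (𝓡 n) (c t) (c s))) t =
      (velTM (velocity (n := n) c) t).2 := (h2.congr_of_eventuallyEq hu).deriv
  have h4 : deriv (fun s => extChartAt (𝓡 n) (c t) (c s)) t =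
      (velTM (velocity (n := n) c) t).1 := h1.deriv
  have hy : extChartAt (𝓡 n) (c t) (c t) ∈ (extChartAt (𝓡 n) (c t)).target :=
    (extChartAt (𝓡 n) (c t)).map_source (mem_extChartAt_source _)
  have h5 : velTM (velocity (n := n) c) t = Φ.spray g (velocity (n := n) c t) ↔
      (velTM (velocity (n := n) c) t).2 = Φ.sprayCoord g (c t) (extChartAt (𝓡 n) (c t) (c t),
        vec (velocity (n := n) c t)) := by
    rw [Prod.ext_iff]
    exact and_iff_right (h4.symm.trans hut)
  rw [h5, Φ.eq_sprayCoord_iff g hy]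
  refine forall_congr' fun w => ?_
  rw [← Φ.geodesicEq_eq g hy, ← h3, ← hut]
  rfl

end GeodesicSpray

end

end TranslatedPoint

namespace TranslatedPoint

noncomputable section

/-! ### Completeness of the spray and the geodesic flow. -/

section GeodesicFlow

variable {n : ℕ} {M : Type*} [TopologicalSpace M] [ChartedSpace (EuclideanSpace ℝ (Fin n)) M]
  [IsManifold (𝓡 n) ∞ M] (Φ : Frame n M) (g : Metric n M)

theorem normSq_eq_metricAt (q : TM n M) : normSq g q = metricAt g q.1 (vec q) (vec q) := rfl

theorem Frame.normSq_eq_sum (q : TM n M) : normSq g q = ∑ j, ∑ k, Φ.coeff g j k q.1 *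
    (fiberDeriv (Φ.h j) q * fiberDeriv (Φ.h k) q) :=
  Φ.metricAt_eq_sum g _ _ _

theorem Frame.contMDiff_normSq (Φ : Frame n M) (g : Metric n M) :
    ContMDiff (𝓡 n).tangent 𝓘(ℝ, ℝ) ∞ (normSq g) := by
  rw [funext (Φ.normSq_eq_sum g)]
  exact ContMDiff.sum fun j _ => ContMDiff.sum fun k _ =>
    (contMDiff_comp_fst (Φ.contMDiff_coeff g j k)).mul
      ((contMDiff_fiberDeriv (Φ.contMDiff_h j)).mul (contMDiff_fiberDeriv (Φ.contMDiff_h k)))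

theorem Frame.diffTM_momentum (q : TM n M)
    (ζ : EuclideanSpace ℝ (Fin n) × EuclideanSpace ℝ (Fin n)) (k : Φ.J) :
    diffTM (Φ.momentum g k) q ζ = ∑ j, 2 * (diffTM (fun q => Φ.coeff g j k q.1) q ζ *
      fiberDeriv (Φ.h j) q + Φ.coeff g j k q.1 * diffTM (fiberDeriv (Φ.h j)) q ζ) := by
  obtain ⟨α, hα, hα0, hαζ⟩ := exists_curve_velTM q ζ
  have hα' := hα.mdifferentiableAt (by simp)
  have h1 := hasDerivAt_velTM (Φ.contMDiff_momentum g k) hα'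
  have h2 : HasDerivAt (fun r => Φ.momentum g k (α r)) _ 0 := HasDerivAt.fun_sum fun j _ =>
    ((hasDerivAt_velTM (contMDiff_comp_fst (Φ.contMDiff_coeff g j k)) hα').fun_mul
      (hasDerivAt_velTM (contMDiff_fiberDeriv (Φ.contMDiff_h j)) hα')).const_mul 2
  have h3 := h1.unique h2
  rwa [hα0, hαζ] at h3

theorem Frame.diffTM_normSq (q : TM n M)
    (ζ : EuclideanSpace ℝ (Fin n) × EuclideanSpace ℝ (Fin n)) :
    diffTM (normSq g) q ζ = ∑ j, ∑ k, (diffTM (fun q => Φ.coeff g j k q.1) q ζ *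
      (fiberDeriv (Φ.h j) q * fiberDeriv (Φ.h k) q) + Φ.coeff g j k q.1 *
      (diffTM (fiberDeriv (Φ.h j)) q ζ * fiberDeriv (Φ.h k) q +
        fiberDeriv (Φ.h j) q * diffTM (fiberDeriv (Φ.h k)) q ζ)) := by
  obtain ⟨α, hα, hα0, hαζ⟩ := exists_curve_velTM q ζ
  have hα' := hα.mdifferentiableAt (by simp)
  have h1 := hasDerivAt_velTM (Φ.contMDiff_normSq g) hα'
  rw [funext (Φ.normSq_eq_sum g)] at h1
  have h2 : HasDerivAt (fun r => ∑ j, ∑ k, Φ.coeff g j k (α r).1 *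
      (fiberDeriv (Φ.h j) (α r) * fiberDeriv (Φ.h k) (α r))) _ 0 :=
    HasDerivAt.fun_sum fun j _ => HasDerivAt.fun_sum fun k _ =>
    (hasDerivAt_velTM (contMDiff_comp_fst (Φ.contMDiff_coeff g j k)) hα').fun_mul
      ((hasDerivAt_velTM (contMDiff_fiberDeriv (Φ.contMDiff_h j)) hα').fun_mul
      (hasDerivAt_velTM (contMDiff_fiberDeriv (Φ.contMDiff_h k)) hα'))
  have h3 := h1.unique h2
  rw [← funext (Φ.normSq_eq_sum g)] at h3
  rwa [hα0, hαζ] at h3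

/-- `d(‖v‖²) = ∑ Q_k d(dh_k) + ∑ dG_jk dh_j dh_k`. -/
theorem Frame.diffTM_normSq_eq (q : TM n M)
    (ζ : EuclideanSpace ℝ (Fin n) × EuclideanSpace ℝ (Fin n)) :
    diffTM (normSq g) q ζ = ∑ k, Φ.momentum g k q * diffTM (fiberDeriv (Φ.h k)) q ζ +
      ∑ j, ∑ k, diffTM (fun q => Φ.coeff g j k q.1) q ζ *
      (fiberDeriv (Φ.h j) q * fiberDeriv (Φ.h k) q) := by
  have h1 : ∑ k, Φ.momentum g k q * diffTM (fiberDeriv (Φ.h k)) q ζ =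
      ∑ j, ∑ k, 2 * (Φ.coeff g j k q.1 *
        (fiberDeriv (Φ.h j) q * diffTM (fiberDeriv (Φ.h k)) q ζ)) := by
    rw [Finset.sum_comm]
    refine Finset.sum_congr rfl fun k _ => ?_
    rw [momentum, Finset.sum_mul]
    exact Finset.sum_congr rfl fun j _ => by ring
  have h2 : ∑ j, ∑ k, (Φ.coeff g j k q.1 *
      (diffTM (fiberDeriv (Φ.h j)) q ζ * fiberDeriv (Φ.h k) q) - Φ.coeff g j k q.1 *
        (fiberDeriv (Φ.h j) q * diffTM (fiberDeriv (Φ.h k)) q ζ)) = 0 := by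
    simp only [Finset.sum_sub_distrib]
    rw [sub_eq_zero, Finset.sum_comm]
    refine Finset.sum_congr rfl fun k _ => Finset.sum_congr rfl fun j _ => ?_
    rw [Φ.coeff_symm]
    ring
  rw [Φ.diffTM_normSq, h1, ← sub_eq_zero, ← h2]
  simp only [← Finset.sum_add_distrib, ← Finset.sum_sub_distrib]
  refine Finset.sum_congr rfl fun j _ => Finset.sum_congr rfl fun k _ => ?_
  ring

/-- The norm being quadratic on fibres, `∑ Q_k dh_k` evaluated on the vector itself is `2 ‖v‖²`; the
formula amounts to the differential of this identity combined with `Frame.diffTM_normSq_eq`. -/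
theorem Frame.eulerLagrange_vec (q : TM n M)
    (ζ : EuclideanSpace ℝ (Fin n) × EuclideanSpace ℝ (Fin n)) :
    ∑ k, diffTM (Φ.momentum g k) q ζ * fiberDeriv (Φ.h k) q =
      diffTM (normSq g) q ζ + ∑ j, ∑ k, diffTM (fun q => Φ.coeff g j k q.1) q ζ *
      (fiberDeriv (Φ.h j) q * fiberDeriv (Φ.h k) q) := by
  have h1 : ∑ k, diffTM (Φ.momentum g k) q ζ * fiberDeriv (Φ.h k) q =
      ∑ j, ∑ k, (2 * (diffTM (fun q => Φ.coeff g j k q.1) q ζ *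
        (fiberDeriv (Φ.h j) q * fiberDeriv (Φ.h k) q)) + 2 * (Φ.coeff g j k q.1 *
        (fiberDeriv (Φ.h j) q * diffTM (fiberDeriv (Φ.h k)) q ζ))) := by
    have h2 : ∑ k, diffTM (Φ.momentum g k) q ζ * fiberDeriv (Φ.h k) q =
      ∑ j, ∑ k, 2 * (diffTM (fun q => Φ.coeff g j k q.1) q ζ *
        fiberDeriv (Φ.h j) q + Φ.coeff g j k q.1 * diffTM (fiberDeriv (Φ.h j)) q ζ) *
          fiberDeriv (Φ.h k) q := by
      rw [Finset.sum_comm]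
      refine Finset.sum_congr rfl fun k _ => ?_
      rw [Φ.diffTM_momentum, Finset.sum_mul]
    have h3 : ∑ j, ∑ k, (Φ.coeff g j k q.1 *
      (diffTM (fiberDeriv (Φ.h j)) q ζ * fiberDeriv (Φ.h k) q) - Φ.coeff g j k q.1 *
        (fiberDeriv (Φ.h j) q * diffTM (fiberDeriv (Φ.h k)) q ζ)) = 0 := by
      simp only [Finset.sum_sub_distrib]
      rw [sub_eq_zero, Finset.sum_comm]
      refine Finset.sum_congr rfl fun k _ => Finset.sum_congr rfl fun j _ => ?_
      rw [Φ.coeff_symm]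
      ring
    rw [h2, ← sub_eq_zero, ← mul_zero (2 : ℝ), ← h3]
    simp only [Finset.mul_sum, ← Finset.sum_sub_distrib]
    refine Finset.sum_congr rfl fun j _ => Finset.sum_congr rfl fun k _ => ?_
    ring
  have h2 : ∑ k, Φ.momentum g k q * diffTM (fiberDeriv (Φ.h k)) q ζ =
      ∑ j, ∑ k, 2 * (Φ.coeff g j k q.1 *
        (fiberDeriv (Φ.h j) q * diffTM (fiberDeriv (Φ.h k)) q ζ)) := by
    rw [Finset.sum_comm]
    refine Finset.sum_congr rfl fun k _ => ?_
    rw [momentum, Finset.sum_mul]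
    exact Finset.sum_congr rfl fun j _ => by ring
  rw [Φ.diffTM_normSq_eq, h1, h2, ← sub_eq_zero]
  simp only [← Finset.sum_add_distrib, ← Finset.sum_sub_distrib]
  refine Finset.sum_eq_zero fun j _ => Finset.sum_eq_zero fun k _ => ?_
  ring

/-- The norm is constant along the geodesic flow. -/
theorem Frame.diffTM_normSq_spray (q : TM n M) : diffTM (normSq g) q (Φ.spray g q) = 0 := by
  have h1 := Φ.eulerLagrange_spray g q (vec q)
  have h2 := Φ.eulerLagrange_vec g q (Φ.spray g q)
  unfold Frame.eulerLagrange at h1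
  simp only [Φ.diffTM_comp_fst_spray g (Φ.contMDiff_coeff g _ _)] at h2
  have h3 : ∑ k, diffTM (Φ.momentum g k) q (Φ.spray g q) * diffAt n (Φ.h k) q.1 (vec q) =
    ∑ k, diffTM (Φ.momentum g k) q (Φ.spray g q) * fiberDeriv (Φ.h k) q := rfl
  rw [h3, h2] at h1
  have h4 : ∑ j, ∑ k, diffAt n (Φ.coeff g j k) q.1 (vec q) *
      (fiberDeriv (Φ.h j) q * fiberDeriv (Φ.h k) q) = ∑ j, ∑ k, fiberDeriv (Φ.coeff g j k) q *
      (fiberDeriv (Φ.h j) q * fiberDeriv (Φ.h k) q) := rfl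
  rw [h4] at h1
  linarith

variable [T2Space M] [CompactSpace M]

theorem fiberDeriv_smul (h : M → ℝ) (x : M) (r : ℝ) (v : EuclideanSpace ℝ (Fin n)) :
    fiberDeriv h (⟨x, r • v⟩ : TM n M) = r * fiberDeriv h (⟨x, v⟩ : TM n M) :=
  (diffAt n h x).map_smul r v

theorem normSq_smul (x : M) (r : ℝ) (v : EuclideanSpace ℝ (Fin n)) :
    normSq g (⟨x, r • v⟩ : TM n M) = r ^ 2 * normSq g (⟨x, v⟩ : TM n M) := by
  change metricAt g x (r • v) (r • v) = r ^ 2 * metricAt g x v v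
  simp only [map_smul, smul_apply, smul_eq_mul]
  ring

/-- Sets of tangent vectors with bounded components are relatively compact. -/
theorem Frame.isCompact_of_bounded (Φ : Frame n M) (g : Metric n M) {K : Set (TM n M)}
    (hK : IsClosed K) {R : ℝ} (hR : ∀ q ∈ K, ∑ j, fiberDeriv (Φ.h j) q ^ 2 ≤ R) : IsCompact K := by
  have h1 : IsCompact (Φ.combine '' (Set.univ ×ˢ Metric.closedBall 0 (|R| + 1))) :=
    (isCompact_univ.prod (isCompact_closedBall _ _)).image (Φ.contMDiff_combine g).continuous
  refine h1.of_isClosed_subset hK fun q hq => ⟨(q.1, fun j => fiberDeriv (Φ.h j) q),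
    ⟨Set.mem_univ _, ?_⟩, Φ.combine_fiberDeriv q⟩
  rw [mem_closedBall_zero_iff, pi_norm_le_iff_of_nonneg (by positivity)]
  intro j
  have h2 := (Finset.single_le_sum (fun j _ => sq_nonneg (fiberDeriv (Φ.h j) q))
    (Finset.mem_univ j)).trans (hR q hq)
  have h3 := le_abs_self R
  rw [Real.norm_eq_abs]
  refine abs_le_of_sq_le_sq (h2.trans ?_) (by positivity)
  nlinarith [abs_nonneg R]

/-- The unit sphere of the auxiliary fibre norm is compact, so `‖v‖²` has a positive minimum on it,
and both sides are homogeneous of degree two. If the sphere is empty any constant will do. -/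
theorem Frame.exists_normSq_ge (Φ : Frame n M) (g : Metric n M) :
    ∃ m > 0, ∀ q : TM n M, m * ∑ j, fiberDeriv (Φ.h j) q ^ 2 ≤ normSq g q := by
  let S : TM n M → ℝ := fun q => ∑ j, fiberDeriv (Φ.h j) q ^ 2
  have hS : Continuous S := continuous_finsetSum _ fun j _ =>
    (contMDiff_fiberDeriv (Φ.contMDiff_h j)).continuous.pow 2
  have hK : IsCompact {q | S q = 1} :=
    Φ.isCompact_of_bounded g (isClosed_eq hS continuous_const) (R := 1) fun q hq => le_of_eq hq
  have hpos : ∀ q, S q = 1 → 0 < normSq g q := by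
    intro q hq
    refine metricAt_pos g q.1 fun h0 => ?_
    have h1 : S q = 0 := by
      simp only [S, fiberDeriv]
      rw [show vec q = 0 from h0]
      simp
    rw [h1] at hq
    exact zero_ne_one hq
  obtain ⟨m, hm, hmS⟩ : ∃ m > 0, ∀ q, S q = 1 → m ≤ normSq g q := by
    rcases Set.eq_empty_or_nonempty {q | S q = 1} with he | hne
    · exact ⟨1, one_pos, fun q hq => ((he ▸ (show q ∈ {q | S q = 1} from hq) :
        q ∈ (∅ : Set (TM n M)))).elim⟩
    · obtain ⟨q₀, hq₀, hmin⟩ := hK.exists_isMinOn hne (Φ.contMDiff_normSq g).continuous.continuousOn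
      exact ⟨normSq g q₀, hpos q₀ hq₀, fun q hq => hmin hq⟩
  refine ⟨m, hm, fun q => ?_⟩
  change m * S q ≤ _
  have hS0 : 0 ≤ S q := Finset.sum_nonneg fun j _ => sq_nonneg _
  rcases hS0.eq_or_lt with h0 | h0
  · rw [← h0, mul_zero]
    by_cases hv : vec q = 0
    · rw [normSq_eq_metricAt, hv]
      simp
    · exact (metricAt_pos g q.1 hv).le
  · have h1 : S (⟨q.1, (Real.sqrt (S q))⁻¹ • vec q⟩ : TM n M) = 1 := by
      simp only [S, fiberDeriv_smul, mul_pow, ← Finset.mul_sum]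
      rw [inv_pow, Real.sq_sqrt hS0]
      exact inv_mul_cancel₀ h0.ne'
    have h2 := hmS _ h1
    rw [normSq_smul, inv_pow, Real.sq_sqrt hS0] at h2
    have h3 : normSq g (⟨q.1, vec q⟩ : TM n M) = normSq g q := rfl
    rw [h3, inv_mul_eq_div, le_div_iff₀ h0] at h2
    exact h2

theorem Frame.isCompact_normSq_le (Φ : Frame n M) (g : Metric n M) (R : ℝ) :
    IsCompact {q : TM n M | normSq g q ≤ R} := by
  obtain ⟨m, hm, h⟩ := Φ.exists_normSq_ge g
  refine Φ.isCompact_of_bounded g (isClosed_le (Φ.contMDiff_normSq g).continuous continuous_const)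
    (R := R / m) fun q hq => ?_
  rw [le_div_iff₀ hm, mul_comm]
  exact (h q).trans hq

theorem velTM_of_hasMFDerivAt {σ : ℝ → TM n M} {s : ℝ}
    {ζ : EuclideanSpace ℝ (Fin n) × EuclideanSpace ℝ (Fin n)}
    (h : HasMFDerivAt 𝓘(ℝ, ℝ) (𝓡 n).tangent σ s ((1 : ℝ →L[ℝ] ℝ).smulRight ζ)) :
    velTM σ s = ζ := by
  have h1 := congrArg (fun A : ℝ →L[ℝ] EuclideanSpace ℝ (Fin n) × EuclideanSpace ℝ (Fin n) => A 1)
    h.mfderiv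
  exact Eq.trans h1 (one_smul ℝ ζ)

/-- The geodesic spray is complete. -/
theorem Frame.exists_isMIntegralCurve_spray (q : TM n M) :
    ∃ σ : ℝ → TM n M, σ 0 = q ∧ IsMIntegralCurve (I := (𝓡 n).tangent) σ (Φ.spray g) := by
  let R := normSq g q
  -- Cut off by a function of `‖v‖²`, the spray has compact support and is complete. The norm is
  -- constant along the cut-off field as well, so the curve from `q` stays on the level `R`, where
  -- `χ` is `1`.
  let χ : TM n M → ℝ := fun q => Real.smoothTransition (R + 1 - normSq g q)
  have hχ : ContMDiff (𝓡 n).tangent 𝓘(ℝ, ℝ) ∞ χ :=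
    Real.smoothTransition.contDiff.contMDiff.comp (contMDiff_const.sub (Φ.contMDiff_normSq g))
  let Z : TM n M → EuclideanSpace ℝ (Fin n) × EuclideanSpace ℝ (Fin n) :=
    fun q => χ q • Φ.spray g q
  have hZ : ContMDiff (𝓡 n).tangent (𝓡 n).tangent.tangent ∞
      (fun q => (⟨q, Z q⟩ : TangentBundle (𝓡 n).tangent (TM n M))) :=
    fun q => (hχ q).smul_section (Φ.contMDiff_spray g q)
  obtain ⟨σ, hσ0, hσ⟩ := exists_isMIntegralCurve_of_isCompact (I := (𝓡 n).tangent) hZ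
    (Φ.isCompact_normSq_le g (R + 1)) (fun p hp => by
      have h1 : χ p = 0 := Real.smoothTransition.zero_of_nonpos (by
        have : ¬ normSq g p ≤ R + 1 := hp
        linarith)
      change χ p • Φ.spray g p = 0
      rw [h1, zero_smul]) q
  have hd : ∀ s, HasDerivAt (fun s => normSq g (σ s)) 0 s := by
    intro s
    have h1 := hasDerivAt_velTM (Φ.contMDiff_normSq g) (hσ s).mdifferentiableAt
    rw [velTM_of_hasMFDerivAt (hσ s)] at h1
    have h2 : diffTM (normSq g) (σ s) (Z (σ s)) = 0 := by
      rw [map_smul, Φ.diffTM_normSq_spray, smul_zero]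
    rwa [h2] at h1
  have hc : ∀ s, normSq g (σ s) = R := by
    intro s
    rw [is_const_of_deriv_eq_zero (fun s => (hd s).differentiableAt) (fun s => (hd s).deriv) s 0,
      hσ0]
  refine ⟨σ, hσ0, fun s => ?_⟩
  have h1 := hσ s
  have h2 : Z (σ s) = Φ.spray g (σ s) := by
    have h3 : χ (σ s) = 1 := by
      simp only [χ]
      rw [hc, add_sub_cancel_left, Real.smoothTransition.one]
    simp only [Z]
    rw [h3, one_smul]
  rw [h2] at h1
  exact h1

theorem Frame.isMIntegralCurve_velocity {c : ℝ → M} (hc : IsGeodesic g c) :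
    IsMIntegralCurve (I := (𝓡 n).tangent) (velocity (n := n) c) (Φ.spray g) := by
  obtain ⟨h1, h2⟩ := (Φ.isGeodesic_iff g).1 hc
  intro s
  have h3 := ((Φ.contMDiff_velocity g h1 s).mdifferentiableAt (by simp)).hasMFDerivAt
  refine h3.congr_mfderiv ?_
  refine ContinuousLinearMap.ext_ring ?_
  exact Eq.trans (h2 s)
    (one_smul ℝ (Φ.spray g (velocity (n := n) c s))).symm

/-- The spray at `(x, v)` projects to `v`. -/
theorem Frame.velocity_fst_eq {σ : ℝ → TM n M}
    (hσ : IsMIntegralCurve (I := (𝓡 n).tangent) σ (Φ.spray g)) :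
    velocity (n := n) (fun s => (σ s).1) = σ := by
  funext s
  have h0 : MDifferentiableAt 𝓘(ℝ, ℝ) (𝓡 n) (fun s => (σ s).1) s :=
    ((contMDiff_fst_tangent (σ s)).mdifferentiableAt (by simp)).comp s (hσ s).mdifferentiableAt
  have h1 : vec (velocity (n := n) (fun s => (σ s).1) s) = vec (σ s) := by
    refine Φ.ext_of_diffAt (x := (σ s).1) fun j => ?_
    have h2 := fiberDeriv_velocity (Φ.contMDiff_h j) h0
    have h3 := hasDerivAt_velTM (contMDiff_comp_fst (Φ.contMDiff_h j)) (hσ s).mdifferentiableAt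
    rw [velTM_of_hasMFDerivAt (hσ s), Φ.diffTM_comp_fst_spray g (Φ.contMDiff_h j)] at h3
    exact h2.unique h3
  exact congrArg (Bundle.TotalSpace.mk (σ s).1) h1

/-- The geodesic flow is the flow of the spray. -/
theorem Frame.geodesicFlow_spec : (∀ q : TM n M, geodesicFlow g 0 q = q) ∧
    (∀ q : TM n M, IsMIntegralCurve (I := (𝓡 n).tangent) (fun τ => geodesicFlow g τ q)
      (Φ.spray g)) := by
  choose F hF0 hF using Φ.exists_isMIntegralCurve_spray g
  have hsm : ContMDiff (𝓘(ℝ, ℝ).prod (𝓡 n).tangent) (𝓡 n).tangent ∞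
      (fun z : ℝ × TM n M => F z.2 z.1) :=
    contMDiff_flow (I := (𝓡 n).tangent) (F := fun τ q => F q τ) (Φ.contMDiff_spray g) hF0 hF
  -- Every tangent vector is the initial velocity of a geodesic, so the default branch in
  -- `geodesicFlow` is never taken.
  have hex : ∀ q : TM n M, ∃ c : ℝ → M, IsGeodesic g c ∧ velocity c 0 = q := by
    intro q
    have h1 := Φ.velocity_fst_eq g (hF q)
    refine ⟨fun s => (F q s).1, (Φ.isGeodesic_iff g).2 ⟨?_, fun s => ?_⟩, ?_⟩
    · exact contMDiff_fst_tangent.comp (hsm.comp (contMDiff_id.prodMk contMDiff_const))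
    · rw [h1]
      exact velTM_of_hasMFDerivAt (hF q s)
    · rw [h1, hF0]
  have heq : ∀ q : TM n M, ∃ c : ℝ → M, IsGeodesic g c ∧ velocity c 0 = q ∧
      (fun τ => geodesicFlow g τ q) = velocity (n := n) c := by
    intro q
    refine ⟨(hex q).choose, (hex q).choose_spec.1, (hex q).choose_spec.2, funext fun τ => ?_⟩
    rw [geodesicFlow, dif_pos (hex q)]
  refine ⟨fun q => ?_, fun q => ?_⟩
  · obtain ⟨c, -, hc0, hc⟩ := heq q
    rw [← hc0]
    exact congrFun hc 0 |>.trans rfl |> fun h => by rw [hc0]; rw [hc0] at h; exact h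
  · obtain ⟨c, hcg, -, hc⟩ := heq q
    rw [hc]
    exact Φ.isMIntegralCurve_velocity g hcg

theorem Frame.contMDiff_geodesicFlow (Φ : Frame n M) (g : Metric n M) :
    ContMDiff (𝓘(ℝ, ℝ).prod (𝓡 n).tangent) (𝓡 n).tangent ∞
      (fun z : ℝ × TM n M => geodesicFlow g z.1 z.2) :=
  contMDiff_flow (I := (𝓡 n).tangent) (Φ.contMDiff_spray g) (Φ.geodesicFlow_spec g).1
    (Φ.geodesicFlow_spec g).2

theorem geodesicFlow_add (g : Metric n M) (s τ : ℝ) (q : TM n M) :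
    geodesicFlow g (s + τ) q = geodesicFlow g s (geodesicFlow g τ q) := by
  obtain ⟨Φ⟩ := nonempty_frame n M
  exact flow_add (I := (𝓡 n).tangent) (Φ.contMDiff_spray g) (Φ.geodesicFlow_spec g).1
    (Φ.geodesicFlow_spec g).2 s τ q

theorem geodesicFlow_zero (g : Metric n M) (q : TM n M) : geodesicFlow g 0 q = q := by
  obtain ⟨Φ⟩ := nonempty_frame n M
  exact (Φ.geodesicFlow_spec g).1 q

theorem geodesicFlow_neg_apply (g : Metric n M) (s : ℝ) (q : TM n M) :
    geodesicFlow g (-s) (geodesicFlow g s q) = q := by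
  rw [← geodesicFlow_add, neg_add_cancel, geodesicFlow_zero]

theorem geodesicFlow_apply_neg (g : Metric n M) (s : ℝ) (q : TM n M) :
    geodesicFlow g s (geodesicFlow g (-s) q) = q := by
  rw [← geodesicFlow_add, add_neg_cancel, geodesicFlow_zero]

theorem Frame.eq_geodesicFlow {σ : ℝ → TM n M}
    (hσ : IsMIntegralCurve (I := (𝓡 n).tangent) σ (Φ.spray g)) (s : ℝ) :
    σ s = geodesicFlow g s (σ 0) := by
  have := isManifold_one_of_infty (𝓡 n).tangent (TM n M)
  have h := isMIntegralCurve_Ioo_eq_of_contMDiff_boundaryless (I := (𝓡 n).tangent) (t₀ := 0)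
    ((Φ.contMDiff_spray g).of_le (by simp)) hσ ((Φ.geodesicFlow_spec g).2 (σ 0))
    (by rw [geodesicFlow_zero])
  exact congrFun h s

/-- Functions along the geodesic flow. -/
theorem Frame.hasDerivAt_geodesicFlow {K : TM n M → ℝ}
    (hK : ContMDiff (𝓡 n).tangent 𝓘(ℝ, ℝ) ∞ K) (q : TM n M) (s : ℝ) :
    HasDerivAt (fun s => K (geodesicFlow g s q))
      (diffTM K (geodesicFlow g s q) (Φ.spray g (geodesicFlow g s q))) s := by
  have h := (Φ.geodesicFlow_spec g).2 q s
  have h1 := hasDerivAt_velTM hK h.mdifferentiableAt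
  rwa [velTM_of_hasMFDerivAt h] at h1

theorem normSq_geodesicFlow (g : Metric n M) (s : ℝ) (q : TM n M) :
    normSq g (geodesicFlow g s q) = normSq g q := by
  obtain ⟨Φ⟩ := nonempty_frame n M
  have hd : ∀ s, HasDerivAt (fun s => normSq g (geodesicFlow g s q)) 0 s := by
    intro s
    have h1 := Φ.hasDerivAt_geodesicFlow g (Φ.contMDiff_normSq g) q s
    rwa [Φ.diffTM_normSq_spray] at h1
  rw [is_const_of_deriv_eq_zero (fun s => (hd s).differentiableAt) (fun s => (hd s).deriv) s 0,
    geodesicFlow_zero]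

end GeodesicFlow

end

end TranslatedPoint

namespace TranslatedPoint

noncomputable section

/-- Symmetry of the second derivative. It is behind both the Jacobi equation and the symmetry of the
Hessian of the energy. -/
theorem hasDerivAt_deriv_swap {k : ℝ × ℝ → ℝ} {τ u : ℝ} (hk : ContDiffAt ℝ ∞ k (τ, u)) :
    HasDerivAt (fun r => deriv (fun w => k (r, w)) u)
      (deriv (fun w => deriv (fun r => k (r, w)) τ) u) τ := by
  have hk1 : ContDiffAt ℝ 1 k (τ, u) := hk.of_le (by simp)
  have hd : ∀ᶠ z in 𝓝 (τ, u), DifferentiableAt ℝ k z :=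
    (hk1.eventually (by simp)).mono fun z hz => hz.differentiableAt one_ne_zero
  have h2 : DifferentiableAt ℝ (fderiv ℝ k) (τ, u) :=
    (hk.fderiv_right (m := ∞) (by simp)).differentiableAt (by simp)
  have h1 : ∀ z, DifferentiableAt ℝ k z → HasDerivAt (fun w => k (z.1, w)) (fderiv ℝ k z (0, 1)) z.2 :=
    fun z hz => hasDerivAt_comp_fderiv (y := fun w => (z.1, w)) hz
      ((hasDerivAt_const z.2 z.1).prodMk (hasDerivAt_id z.2))
  have h1' : ∀ z, DifferentiableAt ℝ k z → HasDerivAt (fun r => k (r, z.2)) (fderiv ℝ k z (1, 0)) z.1 :=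
    fun z hz => hasDerivAt_comp_fderiv (y := fun r => (r, z.2)) hz
      ((hasDerivAt_id z.1).prodMk (hasDerivAt_const z.1 z.2))
  have c1 : HasDerivAt (fun r : ℝ => (r, u)) ((1 : ℝ), (0 : ℝ)) τ :=
    (hasDerivAt_id τ).prodMk (hasDerivAt_const τ u)
  have c2 : HasDerivAt (fun w : ℝ => (τ, w)) ((0 : ℝ), (1 : ℝ)) u :=
    (hasDerivAt_const u τ).prodMk (hasDerivAt_id u)
  have h3 : HasDerivAt (fun r => fderiv ℝ k (r, u) (0, 1))
      (fderiv ℝ (fderiv ℝ k) (τ, u) (1, 0) (0, 1)) τ := by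
    have := hasDerivAt_clm_apply_comp (y := fun r : ℝ => (r, u)) h2 c1 (hasDerivAt_const τ ((0 : ℝ), (1 : ℝ)))
    rwa [map_zero, add_zero] at this
  have h4 : HasDerivAt (fun w => fderiv ℝ k (τ, w) (1, 0))
      (fderiv ℝ (fderiv ℝ k) (τ, u) (0, 1) (1, 0)) u := by
    have := hasDerivAt_clm_apply_comp (y := fun w : ℝ => (τ, w)) h2 c2 (hasDerivAt_const u ((1 : ℝ), (0 : ℝ)))
    rwa [map_zero, add_zero] at this
  have e3 : (fun r => deriv (fun w => k (r, w)) u) =ᶠ[𝓝 τ] fun r => fderiv ℝ k (r, u) (0, 1) := by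
    filter_upwards [c1.continuousAt.eventually hd] with r hr
    exact (h1 _ hr).deriv
  have e4 : (fun w => deriv (fun r => k (r, w)) τ) =ᶠ[𝓝 u] fun w => fderiv ℝ k (τ, w) (1, 0) := by
    filter_upwards [c2.continuousAt.eventually hd] with w hw
    exact (h1' _ hw).deriv
  rw [e4.deriv_eq, h4.deriv, hk.isSymmSndFDerivAt (by
    rw [minSmoothness_of_isRCLikeNormedField]; exact WithTop.coe_le_coe.2 le_top)]
  exact h3.congr_of_eventuallyEq e3

/-! ### Variations of orbits of the geodesic flow. -/

section Jacobi

variable {n : ℕ} {M : Type*} [TopologicalSpace M] [ChartedSpace (EuclideanSpace ℝ (Fin n)) M]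
  [IsManifold (𝓡 n) ∞ M]

/-- The differential of a self-map of `TM`. -/
def mapTM (F : TM n M → TM n M) (q : TM n M) :
    EuclideanSpace ℝ (Fin n) × EuclideanSpace ℝ (Fin n) →L[ℝ]
      EuclideanSpace ℝ (Fin n) × EuclideanSpace ℝ (Fin n) :=
  mfderiv (𝓡 n).tangent (𝓡 n).tangent F q

/-- The differential of the projection of `TM`. -/
def projDeriv (q : TM n M) :
    EuclideanSpace ℝ (Fin n) × EuclideanSpace ℝ (Fin n) →L[ℝ] EuclideanSpace ℝ (Fin n) :=
  mfderiv (𝓡 n).tangent (𝓡 n) (fun q : TM n M => q.1) q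

theorem diffTM_comp {K : TM n M → ℝ} (hK : ContMDiff (𝓡 n).tangent 𝓘(ℝ, ℝ) ∞ K)
    {F : TM n M → TM n M} {q : TM n M}
    (hF : MDifferentiableAt (𝓡 n).tangent (𝓡 n).tangent F q)
    (ξ : EuclideanSpace ℝ (Fin n) × EuclideanSpace ℝ (Fin n)) :
    diffTM (fun q => K (F q)) q ξ = diffTM K (F q) (mapTM F q ξ) :=
  mfderiv_comp_apply (I'' := 𝓘(ℝ, ℝ)) q ((hK _).mdifferentiableAt (by simp)) hF ξ

theorem mapTM_comp {F F' : TM n M → TM n M} {q : TM n M}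
    (hF : MDifferentiableAt (𝓡 n).tangent (𝓡 n).tangent F (F' q))
    (hF' : MDifferentiableAt (𝓡 n).tangent (𝓡 n).tangent F' q)
    (ξ : EuclideanSpace ℝ (Fin n) × EuclideanSpace ℝ (Fin n)) :
    mapTM (F ∘ F') q ξ = mapTM F (F' q) (mapTM F' q ξ) :=
  mfderiv_comp_apply (I'' := (𝓡 n).tangent) q hF hF' ξ

theorem mapTM_id (q : TM n M) (ξ : EuclideanSpace ℝ (Fin n) × EuclideanSpace ℝ (Fin n)) :
    mapTM (id : TM n M → TM n M) q ξ = ξ := by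
  have h : mapTM (id : TM n M → TM n M) q = ContinuousLinearMap.id ℝ _ := mfderiv_id
  rw [h]
  rfl

theorem diffTM_comp_fst_eq {h : M → ℝ} (hh : ContMDiff (𝓡 n) 𝓘(ℝ, ℝ) ∞ h) (q : TM n M)
    (ξ : EuclideanSpace ℝ (Fin n) × EuclideanSpace ℝ (Fin n)) :
    diffTM (fun q => h q.1) q ξ = diffAt n h q.1 (projDeriv q ξ) :=
  mfderiv_comp_apply (I'' := 𝓘(ℝ, ℝ)) (I' := 𝓡 n) q ((hh _).mdifferentiableAt (by simp))
    ((contMDiff_fst_tangent q).mdifferentiableAt (by simp)) ξ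

theorem Frame.contMDiff_diffTM_spray (Φ : Frame n M) (g : Metric n M) {K : TM n M → ℝ}
    (hK : ContMDiff (𝓡 n).tangent 𝓘(ℝ, ℝ) ∞ K) :
    ContMDiff (𝓡 n).tangent 𝓘(ℝ, ℝ) ∞ (fun q => diffTM K q (Φ.spray g q)) := by
  have := isManifold_one_of_infty (𝓡 n).tangent (TM n M)
  exact ((contMDiff_snd_tangentBundle_modelSpace ℝ 𝓘(ℝ, ℝ)).comp
    (hK.contMDiff_tangentMap (m := ∞) (by simp))).comp (Φ.contMDiff_spray g)

/-- The vector is the velocity of `r ↦ v + r w` in the fibre. Such vectors are the jumps of broken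
Jacobi fields. -/
theorem Frame.exists_vertical (Φ : Frame n M) (g : Metric n M) (q : TM n M)
    (w : EuclideanSpace ℝ (Fin n)) :
    ∃ ζ : EuclideanSpace ℝ (Fin n) × EuclideanSpace ℝ (Fin n),
      (∀ h : M → ℝ, ContMDiff (𝓡 n) 𝓘(ℝ, ℝ) ∞ h → diffTM (fun q => h q.1) q ζ = 0) ∧
      ∀ h : M → ℝ, ContMDiff (𝓡 n) 𝓘(ℝ, ℝ) ∞ h →
        diffTM (fiberDeriv h) q ζ = diffAt n h q.1 w := by
  let α : ℝ → TM n M := fun r => ⟨q.1, vec q + r • w⟩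
  have hα0 : α 0 = q :=
    congrArg (Bundle.TotalSpace.mk q.1) (by rw [zero_smul, add_zero]; rfl)
  have hα : ContMDiffAt 𝓘(ℝ, ℝ) (𝓡 n).tangent ∞ α 0 := by
    refine Φ.contMDiffAt_tangent g contMDiffAt_const fun j => ?_
    have h1 : (fun r => metricAt g (α r).1 (vec (α r)) (Φ.X j (α r).1)) = fun r =>
        metricAt g q.1 (vec q) (Φ.X j q.1) + r * metricAt g q.1 w (Φ.X j q.1) := by
      funext r
      change metricAt g q.1 (vec q + r • w) (Φ.X j q.1) = _
      rw [map_add, map_smul]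
      rfl
    rw [h1]
    exact (contDiff_const.add (contDiff_id.mul contDiff_const)).contMDiff.contMDiffAt
  have hα' := hα.mdifferentiableAt (by simp)
  refine ⟨velTM α 0, fun h hh => ?_, fun h hh => ?_⟩
  · have h1 := hasDerivAt_velTM (contMDiff_comp_fst hh) hα'
    rw [hα0] at h1
    exact h1.unique (hasDerivAt_const 0 (h q.1))
  · have h1 := hasDerivAt_velTM (contMDiff_fiberDeriv hh) hα'
    rw [hα0] at h1
    refine h1.unique ?_
    have h2 : (fun r => fiberDeriv h (α r)) =
        fun r => diffAt n h q.1 (vec q) + r * diffAt n h q.1 w := by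
      funext r
      change diffAt n h q.1 (vec q + r • w) = _
      rw [map_add, map_smul]
      rfl
    rw [h2]
    simpa using ((hasDerivAt_id (0 : ℝ)).mul_const (diffAt n h q.1 w)).const_add
      (diffAt n h q.1 (vec q))

variable [T2Space M] [CompactSpace M] (g : Metric n M)

theorem contMDiff_geodesicFlow_apply (s : ℝ) :
    ContMDiff (𝓡 n).tangent (𝓡 n).tangent ∞ (geodesicFlow g s : TM n M → TM n M) := by
  obtain ⟨Φ⟩ := nonempty_frame n M
  exact (Φ.contMDiff_geodesicFlow g).comp (contMDiff_const.prodMk contMDiff_id)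

theorem mdifferentiableAt_geodesicFlow (s : ℝ) (q : TM n M) :
    MDifferentiableAt (𝓡 n).tangent (𝓡 n).tangent (geodesicFlow g s) q :=
  (contMDiff_geodesicFlow_apply g s q).mdifferentiableAt (by simp)

theorem contMDiff_geodesicFlow_curve (q : TM n M) :
    ContMDiff 𝓘(ℝ, ℝ) (𝓡 n).tangent ∞ (fun s => geodesicFlow g s q) := by
  obtain ⟨Φ⟩ := nonempty_frame n M
  exact (Φ.contMDiff_geodesicFlow g).comp (contMDiff_id.prodMk contMDiff_const)

theorem mapTM_geodesicFlow_neg (s : ℝ) (q : TM n M)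
    (ξ : EuclideanSpace ℝ (Fin n) × EuclideanSpace ℝ (Fin n)) :
    mapTM (geodesicFlow g (-s)) (geodesicFlow g s q) (mapTM (geodesicFlow g s) q ξ) = ξ := by
  rw [← mapTM_comp (mdifferentiableAt_geodesicFlow g _ _) (mdifferentiableAt_geodesicFlow g _ _)]
  have h : geodesicFlow g (-s) ∘ geodesicFlow g s = (id : TM n M → TM n M) :=
    funext (geodesicFlow_neg_apply g s)
  rw [h, mapTM_id]

theorem mapTM_geodesicFlow_apply_neg (s : ℝ) (q : TM n M)
    (ξ : EuclideanSpace ℝ (Fin n) × EuclideanSpace ℝ (Fin n)) :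
    mapTM (geodesicFlow g s) q (mapTM (geodesicFlow g (-s)) (geodesicFlow g s q) ξ) = ξ := by
  have h := mapTM_geodesicFlow_neg g (-s) (geodesicFlow g s q) ξ
  rwa [neg_neg, geodesicFlow_neg_apply] at h

/-- The derivative of a function along a variation of an orbit of the geodesic flow. -/
def jacobi (g : Metric n M) (q : TM n M) (ξ : EuclideanSpace ℝ (Fin n) × EuclideanSpace ℝ (Fin n))
    (K : TM n M → ℝ) (s : ℝ) : ℝ :=
  diffTM K (geodesicFlow g s q) (mapTM (geodesicFlow g s) q ξ)

theorem jacobi_eq {K : TM n M → ℝ} (hK : ContMDiff (𝓡 n).tangent 𝓘(ℝ, ℝ) ∞ K) (q : TM n M)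
    {α : ℝ → TM n M} (hα : MDifferentiableAt 𝓘(ℝ, ℝ) (𝓡 n).tangent α 0) (hα0 : α 0 = q) (s : ℝ) :
    HasDerivAt (fun u => K (geodesicFlow g s (α u))) (jacobi g q (velTM α 0) K s) 0 := by
  have h := hasDerivAt_velTM (hK.comp (contMDiff_geodesicFlow_apply g s)) hα
  have h1 : diffTM (K ∘ geodesicFlow g s) q (velTM α 0) = jacobi g q (velTM α 0) K s :=
    diffTM_comp hK (mdifferentiableAt_geodesicFlow g s q) _
  rw [hα0, h1] at h
  exact h

/-- The Jacobi equation. -/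
theorem Frame.hasDerivAt_jacobi (Φ : Frame n M) {K : TM n M → ℝ}
    (hK : ContMDiff (𝓡 n).tangent 𝓘(ℝ, ℝ) ∞ K) (q : TM n M)
    (ξ : EuclideanSpace ℝ (Fin n) × EuclideanSpace ℝ (Fin n)) (s : ℝ) :
    HasDerivAt (jacobi g q ξ K)
      (jacobi g q ξ (fun q => diffTM K q (Φ.spray g q)) s) s := by
  obtain ⟨α, hα, hα0, rfl⟩ := exists_curve_velTM q ξ
  have hα' := hα.mdifferentiableAt (by simp)
  have h1 : jacobi g q (velTM α 0) K = fun s => deriv (fun u => K (geodesicFlow g s (α u))) 0 :=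
    funext fun s => (jacobi_eq g hK q hα' hα0 s).deriv.symm
  have h2 : jacobi g q (velTM α 0) (fun q => diffTM K q (Φ.spray g q)) s =
      deriv (fun u => deriv (fun s => K (geodesicFlow g s (α u))) s) 0 := by
    rw [← (jacobi_eq g (Φ.contMDiff_diffTM_spray g hK) q hα' hα0 s).deriv]
    exact congrArg (fun F => deriv F 0)
      (funext fun u => (Φ.hasDerivAt_geodesicFlow g hK (α u) s).deriv.symm)
  rw [h1, h2]
  refine hasDerivAt_deriv_swap (k := fun z : ℝ × ℝ => K (geodesicFlow g z.1 (α z.2))) ?_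
  have h3 : ContMDiffAt 𝓘(ℝ, ℝ × ℝ) ((𝓘(ℝ, ℝ)).prod (𝓡 n).tangent) ∞
      (fun z : ℝ × ℝ => (z.1, α z.2)) (s, 0) :=
    contDiff_fst.contMDiff.contMDiffAt.prodMk
      (ContMDiffAt.comp (f := fun z : ℝ × ℝ => z.2) (s, 0) hα contDiff_snd.contMDiff.contMDiffAt)
  exact ((hK.comp (Φ.contMDiff_geodesicFlow g)).contMDiffAt.comp (s, (0 : ℝ)) h3).contDiffAt

/-- The derivative is the same kind of function for another smooth `K`, hence it is differentiable.
-/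
theorem contDiff_jacobi {K : TM n M → ℝ}
    (hK : ContMDiff (𝓡 n).tangent 𝓘(ℝ, ℝ) ∞ K) (q : TM n M)
    (ξ : EuclideanSpace ℝ (Fin n) × EuclideanSpace ℝ (Fin n)) : ContDiff ℝ 1 (jacobi g q ξ K) := by
  obtain ⟨Φ⟩ := nonempty_frame n M
  rw [contDiff_one_iff_deriv]
  refine ⟨fun s => (Φ.hasDerivAt_jacobi g hK q ξ s).differentiableAt, ?_⟩
  rw [funext fun s => (Φ.hasDerivAt_jacobi g hK q ξ s).deriv]
  exact continuous_iff_continuousAt.2 fun s =>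
    (Φ.hasDerivAt_jacobi g (Φ.contMDiff_diffTM_spray g hK) q ξ s).continuousAt

theorem jacobi_zero {K : TM n M → ℝ} (q : TM n M)
    (ξ : EuclideanSpace ℝ (Fin n) × EuclideanSpace ℝ (Fin n)) :
    jacobi g q ξ K 0 = diffTM K q ξ := by
  have h : geodesicFlow g 0 = (id : TM n M → TM n M) := funext (geodesicFlow_zero g)
  unfold jacobi
  rw [h, mapTM_id]
  rfl

theorem Frame.contMDiff_combine_smul (Φ : Frame n M) (g : Metric n M) :
    ContMDiff (𝓘(ℝ, ℝ).prod (𝓡 n).tangent) (𝓡 n).tangent ∞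
      (fun z : ℝ × TM n M => (⟨z.2.1, z.1 • vec z.2⟩ : TM n M)) := by
  have h1 : (fun z : ℝ × TM n M => (⟨z.2.1, z.1 • vec z.2⟩ : TM n M)) =
      fun z : ℝ × TM n M => Φ.combine (z.2.1, fun j => z.1 * fiberDeriv (Φ.h j) z.2) := by
    funext z
    refine Eq.trans (Φ.combine_fiberDeriv ⟨z.2.1, z.1 • vec z.2⟩).symm ?_
    exact congrArg (fun a => Φ.combine (z.2.1, a)) (funext fun j => fiberDeriv_smul (Φ.h j) z.2.1 z.1 (vec z.2))
  rw [h1]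
  refine (Φ.contMDiff_combine g).comp (ContMDiff.prodMk ?_ (contMDiff_pi_space.2 fun j => ?_))
  · exact contMDiff_fst_tangent.comp contMDiff_snd
  · exact contMDiff_fst.mul ((contMDiff_fiberDeriv (Φ.contMDiff_h j)).comp contMDiff_snd)

end Jacobi

end

end TranslatedPoint

namespace TranslatedPoint

noncomputable section

/-! ### The contact form and its Reeb vector field. -/

section Reeb

variable {n : ℕ} {M : Type*} [TopologicalSpace M] [ChartedSpace (EuclideanSpace ℝ (Fin n)) M]
  [IsManifold (𝓡 n) ∞ M]

/-- The derivative at `y` of the inverse of the chart of `TM` centred at `q₀`. -/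
def ofCoordTM (q₀ : TM n M) (y : EuclideanSpace ℝ (Fin n) × EuclideanSpace ℝ (Fin n)) :
    EuclideanSpace ℝ (Fin n) × EuclideanSpace ℝ (Fin n) →L[ℝ]
      EuclideanSpace ℝ (Fin n) × EuclideanSpace ℝ (Fin n) :=
  mfderiv 𝓘(ℝ, EuclideanSpace ℝ (Fin n) × EuclideanSpace ℝ (Fin n)) (𝓡 n).tangent
    (extChartAt (𝓡 n).tangent q₀).symm y

theorem ofCoordTM_self (q : TM n M) (ξ : EuclideanSpace ℝ (Fin n) × EuclideanSpace ℝ (Fin n)) :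
    ofCoordTM q (extChartAt (𝓡 n).tangent q q) ξ = ξ := by
  have h4 := mfderiv_symm_mfderiv_extChartAt (I := (𝓡 n).tangent) (mem_extChartAt_source q) ξ
  rw [mfderiv_extChartAt_self_apply (I := (𝓡 n).tangent) q ξ] at h4
  exact h4

theorem diffTM_ofCoordTM {K : TM n M → ℝ} (hK : ContMDiff (𝓡 n).tangent 𝓘(ℝ, ℝ) ∞ K) {q₀ : TM n M}
    {y : EuclideanSpace ℝ (Fin n) × EuclideanSpace ℝ (Fin n)}
    (hy : y ∈ (extChartAt (𝓡 n).tangent q₀).target)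
    (ξ : EuclideanSpace ℝ (Fin n) × EuclideanSpace ℝ (Fin n)) :
    diffTM K ((extChartAt (𝓡 n).tangent q₀).symm y) (ofCoordTM q₀ y ξ) =
      fderiv ℝ (K ∘ (extChartAt (𝓡 n).tangent q₀).symm) y ξ := by
  rw [← mfderiv_eq_fderiv, mfderiv_comp y ((hK _).mdifferentiableAt (by simp))
    ((contMDiffAt_extChartAt_symm_of_mem (I := (𝓡 n).tangent) hy).mdifferentiableAt (by simp))]
  rfl

theorem diffTM_eq_fderiv {K : TM n M → ℝ} (hK : ContMDiff (𝓡 n).tangent 𝓘(ℝ, ℝ) ∞ K) (q : TM n M)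
    (ξ : EuclideanSpace ℝ (Fin n) × EuclideanSpace ℝ (Fin n)) :
    fderiv ℝ (K ∘ (extChartAt (𝓡 n).tangent q).symm) (extChartAt (𝓡 n).tangent q q) ξ =
      diffTM K q ξ := by
  have h := diffTM_ofCoordTM hK ((extChartAt (𝓡 n).tangent q).map_source
    (mem_extChartAt_source q)) ξ
  rw [ofCoordTM_self, (extChartAt (𝓡 n).tangent q).left_inv (mem_extChartAt_source q)] at h
  exact h.symm

theorem contDiffOn_comp_symm_tangent {K : TM n M → ℝ}
    (hK : ContMDiff (𝓡 n).tangent 𝓘(ℝ, ℝ) ∞ K) (q : TM n M) :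
    ContDiffOn ℝ ∞ (K ∘ (extChartAt (𝓡 n).tangent q).symm) (extChartAt (𝓡 n).tangent q).target :=
  contMDiffOn_iff_contDiffOn.1 (hK.comp_contMDiffOn (contMDiffOn_extChartAt_symm q))

variable (Φ : Frame n M) (g : Metric n M)

/-- The contact form, with values in the linear forms on the model space. -/
def contactAt (g : Metric n M) (q : TM n M) :
    EuclideanSpace ℝ (Fin n) × EuclideanSpace ℝ (Fin n) →L[ℝ] ℝ :=
  (metricAt g q.1 (vec q)).comp (projDeriv q)

theorem Frame.sum_momentum_diffTM (Φ : Frame n M) (g : Metric n M) (q : TM n M)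
    (ξ : EuclideanSpace ℝ (Fin n) × EuclideanSpace ℝ (Fin n)) :
    ∑ k, Φ.momentum g k q * diffTM (fun q => Φ.h k q.1) q ξ = 2 * contactAt g q ξ := by
  simp only [diffTM_comp_fst_eq (Φ.contMDiff_h _)]
  exact Φ.sum_momentum g q (projDeriv q ξ)

theorem Frame.contactFormInChart_eq (q₀ : TM n M)
    {y : EuclideanSpace ℝ (Fin n) × EuclideanSpace ℝ (Fin n)}
    (hy : y ∈ (extChartAt (𝓡 n).tangent q₀).target) :
    contactFormInChart g q₀ y =
      ∑ k, ((1 / 2 : ℝ) * (Φ.momentum g k ∘ (extChartAt (𝓡 n).tangent q₀).symm) y) •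
        fderiv ℝ ((fun q : TM n M => Φ.h k q.1) ∘ (extChartAt (𝓡 n).tangent q₀).symm) y := by
  refine ContinuousLinearMap.ext fun ξ => ?_
  have h1 : contactFormInChart g q₀ y ξ =
    contactAt g ((extChartAt (𝓡 n).tangent q₀).symm y) (ofCoordTM q₀ y ξ) := rfl
  have h2 := Φ.sum_momentum_diffTM g ((extChartAt (𝓡 n).tangent q₀).symm y) (ofCoordTM q₀ y ξ)
  simp only [diffTM_ofCoordTM (contMDiff_comp_fst (Φ.contMDiff_h _)) hy] at h2
  rw [h1]
  simp only [sum_apply, smul_apply, smul_eq_mul, mul_assoc, ← Finset.mul_sum, Function.comp_apply]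
  rw [h2]
  ring

/-- Since `2 α = ∑ Q_k dh_k`, one has `2 dα = ∑ dQ_k ∧ dh_k`; in the chart the second derivatives of
the `h k` drop out by symmetry. -/
theorem Frame.dContactForm_eq (q : TM n M)
    (ξ η : EuclideanSpace ℝ (Fin n) × EuclideanSpace ℝ (Fin n)) :
    2 * dContactForm g q ξ η =
      ∑ k, (diffTM (Φ.momentum g k) q ξ * diffTM (fun q => Φ.h k q.1) q η -
        diffTM (Φ.momentum g k) q η * diffTM (fun q => Φ.h k q.1) q ξ) := by
  let ψ := extChartAt (𝓡 n).tangent q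
  let y₀ := ψ q
  have hy₀ : y₀ ∈ ψ.target := ψ.map_source (mem_extChartAt_source q)
  have hT := (isOpen_extChartAt_target (I := (𝓡 n).tangent) q).mem_nhds hy₀
  let A : Φ.J → EuclideanSpace ℝ (Fin n) × EuclideanSpace ℝ (Fin n) → ℝ :=
    fun k => Φ.momentum g k ∘ ψ.symm
  let H : Φ.J → EuclideanSpace ℝ (Fin n) × EuclideanSpace ℝ (Fin n) → ℝ :=
    fun k => (fun q : TM n M => Φ.h k q.1) ∘ ψ.symm
  have hA : ∀ k, DifferentiableAt ℝ (A k) y₀ := fun k =>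
    ((contDiffOn_comp_symm_tangent (Φ.contMDiff_momentum g k) q).contDiffAt hT).differentiableAt
      (by simp)
  have hH : ∀ k, ContDiffAt ℝ ∞ (H k) y₀ := fun k =>
    (contDiffOn_comp_symm_tangent (contMDiff_comp_fst (Φ.contMDiff_h k)) q).contDiffAt hT
  have hDH : ∀ k, DifferentiableAt ℝ (fderiv ℝ (H k)) y₀ := fun k =>
    ((hH k).fderiv_right (m := ∞) (by simp)).differentiableAt (by simp)
  have heq : contactFormInChart g q =ᶠ[𝓝 y₀] fun y => ∑ k, ((1 / 2 : ℝ) * A k y) • fderiv ℝ (H k) y := by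
    filter_upwards [hT] with y hy
    exact Φ.contactFormInChart_eq g q hy
  have hL : DifferentiableAt ℝ (contactFormInChart g q) y₀ :=
    (DifferentiableAt.fun_sum fun k _ => ((hA k).const_mul (1 / 2 : ℝ)).smul
      (hDH k)).congr_of_eventuallyEq heq
  have key : ∀ ξ η, fderiv ℝ (contactFormInChart g q) y₀ ξ η = ∑ k, (1 / 2 * diffTM (Φ.momentum g k) q ξ *
      diffTM (fun q => Φ.h k q.1) q η + 1 / 2 * A k y₀ * fderiv ℝ (fderiv ℝ (H k)) y₀ ξ η) := by
    intro ξ η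
    let l : ℝ → EuclideanSpace ℝ (Fin n) × EuclideanSpace ℝ (Fin n) := fun r => y₀ + r • ξ
    have hl : HasDerivAt l ξ 0 := by
      have := ((hasDerivAt_id (0 : ℝ)).smul_const ξ).const_add y₀
      simpa [l] using this
    have hl0 : l 0 = y₀ := by simp [l]
    have h1 := hasDerivAt_clm_apply_comp (L := contactFormInChart g q) (y := l) (by rwa [hl0]) hl
      (hasDerivAt_const (0 : ℝ) η)
    have h2 : HasDerivAt (fun r => ∑ k, (1 / 2 : ℝ) * A k (l r) * fderiv ℝ (H k) (l r) η) _ 0 :=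
      HasDerivAt.fun_sum fun k _ =>
        ((hasDerivAt_comp_fderiv (L := A k) (y := l) (by rw [hl0]; exact hA k) hl).const_mul
          (1 / 2 : ℝ)).fun_mul (hasDerivAt_clm_apply_comp (L := fderiv ℝ (H k)) (y := l)
          (by rw [hl0]; exact hDH k) hl (hasDerivAt_const (0 : ℝ) η))
    have h3 : (fun r => contactFormInChart g q (l r) η) =ᶠ[𝓝 0]
        fun r => ∑ k, (1 / 2 : ℝ) * A k (l r) * fderiv ℝ (H k) (l r) η := by
      have hc : Filter.Tendsto l (𝓝 0) (𝓝 y₀) := by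
        have := hl.continuousAt
        rwa [ContinuousAt, hl0] at this
      filter_upwards [hc.eventually heq] with r hr
      rw [hr]
      simp only [sum_apply, smul_apply, smul_eq_mul]
    have h4 := h1.unique (h2.congr_of_eventuallyEq h3)
    rw [map_zero, add_zero, hl0] at h4
    rw [h4]
    refine Finset.sum_congr rfl fun k _ => ?_
    rw [map_zero, add_zero, diffTM_eq_fderiv (Φ.contMDiff_momentum g k),
      diffTM_eq_fderiv (contMDiff_comp_fst (Φ.contMDiff_h k))]
  have hsym : ∀ k, fderiv ℝ (fderiv ℝ (H k)) y₀ ξ η = fderiv ℝ (fderiv ℝ (H k)) y₀ η ξ := fun k =>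
    (hH k).isSymmSndFDerivAt
      (by rw [minSmoothness_of_isRCLikeNormedField]; exact WithTop.coe_le_coe.2 le_top) _ _
  have hd : dContactForm g q ξ η = fderiv ℝ (contactFormInChart g q) y₀ (coordTM q q ξ)
    (coordTM q q η) - fderiv ℝ (contactFormInChart g q) y₀ (coordTM q q η) (coordTM q q ξ) := rfl
  rw [hd, coordTM_self, coordTM_self, key, key, ← Finset.sum_sub_distrib, Finset.mul_sum]
  refine Finset.sum_congr rfl fun k _ => ?_
  rw [hsym]
  ring

/-- This is the Hamiltonian form of the geodesic equation. The terms `dQ_k` of the spray are given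
by the Euler–Lagrange equation, those `dQ_k` of `η` by `Frame.eulerLagrange_vec`. -/
theorem Frame.dContactForm_spray (q : TM n M)
    (η : EuclideanSpace ℝ (Fin n) × EuclideanSpace ℝ (Fin n)) :
    2 * dContactForm g q (Φ.spray g q) η = -diffTM (normSq g) q η := by
  have h1 := Φ.eulerLagrange_spray g q (projDeriv q η)
  have h2 := Φ.eulerLagrange_vec g q η
  rw [eulerLagrange] at h1
  rw [Φ.dContactForm_eq, Finset.sum_sub_distrib]
  simp only [Φ.diffTM_comp_fst_spray g (Φ.contMDiff_h _), diffTM_comp_fst_eq (Φ.contMDiff_h _)]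
  simp only [diffTM_comp_fst_eq (Φ.contMDiff_coeff g _ _)] at h2
  linarith

theorem Frame.contactAt_spray (q : TM n M) : contactAt g q (Φ.spray g q) = normSq g q := by
  have h : projDeriv q (Φ.spray g q) = vec q := by
    refine Φ.ext_of_diffAt (x := q.1) fun j => ?_
    rw [← diffTM_comp_fst_eq (Φ.contMDiff_h j), Φ.diffTM_comp_fst_spray g (Φ.contMDiff_h j)]
    rfl
  change metricAt g q.1 (vec q) (projDeriv q (Φ.spray g q)) = _
  rw [h]
  rfl

theorem Frame.exists_projDeriv_eq (Φ : Frame n M) (q : TM n M) (v : EuclideanSpace ℝ (Fin n)) :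
    ∃ ζ, projDeriv q ζ = v := by
  refine ⟨(v, 0), Φ.ext_of_diffAt (x := q.1) fun j => ?_⟩
  rw [← diffTM_comp_fst_eq (Φ.contMDiff_h j),
    diffTM_comp_fst (Φ.contMDiff_h j) (q₀ := q) (mem_extChartAt_source _), coordTM_self,
    diffAt_eq_fderiv_toCoord (Φ.contMDiff_h j) (x₀ := q.1) (mem_extChartAt_source _), toCoord_self]

theorem Frame.diffTM_momentum_vertical (q : TM n M)
    {ζ : EuclideanSpace ℝ (Fin n) × EuclideanSpace ℝ (Fin n)} {w : EuclideanSpace ℝ (Fin n)}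
    (h1 : ∀ h : M → ℝ, ContMDiff (𝓡 n) 𝓘(ℝ, ℝ) ∞ h → diffTM (fun q => h q.1) q ζ = 0)
    (h2 : ∀ j, diffTM (fiberDeriv (Φ.h j)) q ζ = diffAt n (Φ.h j) q.1 w)
    (v : EuclideanSpace ℝ (Fin n)) :
    ∑ k, diffTM (Φ.momentum g k) q ζ * diffAt n (Φ.h k) q.1 v = 2 * metricAt g q.1 w v := by
  refine Eq.trans ?_ (Φ.sum_momentum g ⟨q.1, w⟩ v)
  refine Finset.sum_congr rfl fun k _ => congrArg (· * _) ?_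
  rw [Φ.diffTM_momentum, momentum]
  refine Finset.sum_congr rfl fun j _ => ?_
  rw [h1 _ (Φ.contMDiff_coeff g j k), h2, zero_mul, zero_add]
  rfl

theorem Frame.diffTM_normSq_vertical (q : TM n M)
    {ζ : EuclideanSpace ℝ (Fin n) × EuclideanSpace ℝ (Fin n)} {w : EuclideanSpace ℝ (Fin n)}
    (h1 : ∀ h : M → ℝ, ContMDiff (𝓡 n) 𝓘(ℝ, ℝ) ∞ h → diffTM (fun q => h q.1) q ζ = 0)
    (h2 : ∀ j, diffTM (fiberDeriv (Φ.h j)) q ζ = diffAt n (Φ.h j) q.1 w) :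
    diffTM (normSq g) q ζ = 2 * metricAt g q.1 (vec q) w := by
  rw [Φ.diffTM_normSq_eq, ← Φ.sum_momentum]
  simp only [h1 _ (Φ.contMDiff_coeff g _ _), h2, zero_mul, Finset.sum_const_zero, add_zero]

/-- In `dh_j(v) = ∑ dh_k(v) dh_j(X_k)` the functions `dh_j(X_k)` depend on the base point only, so a
vertical vector acts on the factors `dh_k(v)` alone. -/
theorem Frame.exists_vertical_eq (Φ : Frame n M) (q : TM n M)
    {ζ : EuclideanSpace ℝ (Fin n) × EuclideanSpace ℝ (Fin n)} (hζ : projDeriv q ζ = 0) :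
    ∃ w, ∀ j, diffTM (fiberDeriv (Φ.h j)) q ζ = diffAt n (Φ.h j) q.1 w := by
  refine ⟨∑ k, diffTM (fiberDeriv (Φ.h k)) q ζ • Φ.X k q.1, fun j => ?_⟩
  have h1 : ∀ q : TM n M, fiberDeriv (Φ.h j) q =
      ∑ k, fiberDeriv (Φ.h k) q * diffAt n (Φ.h j) q.1 (Φ.X k q.1) := by
    intro q
    have h2 := congrArg (diffAt n (Φ.h j) q.1) (Φ.sum_smul q.1 (vec q))
    rw [map_sum] at h2
    refine h2.symm.trans (Finset.sum_congr rfl fun k _ => ?_)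
    rw [map_smul]
    rfl
  obtain ⟨α, hα, hα0, rfl⟩ := exists_curve_velTM q ζ
  have hα' := hα.mdifferentiableAt (by simp)
  have h2 := hasDerivAt_velTM (contMDiff_fiberDeriv (Φ.contMDiff_h j)) hα'
  have h3 : HasDerivAt (fun r => ∑ k, fiberDeriv (Φ.h k) (α r) *
      diffAt n (Φ.h j) (α r).1 (Φ.X k (α r).1)) _ 0 := HasDerivAt.fun_sum fun k _ =>
    (hasDerivAt_velTM (contMDiff_fiberDeriv (Φ.contMDiff_h k)) hα').fun_mul
      (hasDerivAt_velTM (contMDiff_comp_fst (Φ.contMDiff_diffAt_X (Φ.contMDiff_h j) k)) hα')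
  rw [← funext fun r => h1 (α r)] at h3
  have h4 := h2.unique h3
  rw [hα0] at h4
  rw [h4, map_sum]
  refine Finset.sum_congr rfl fun k _ => ?_
  rw [diffTM_comp_fst_eq (Φ.contMDiff_diffAt_X (Φ.contMDiff_h j) k), hζ, map_zero, mul_zero,
    add_zero, map_smul, smul_eq_mul]

/-- The Reeb vector field of `SM` is the geodesic spray. -/
theorem Frame.isReebVector_iff {q : TM n M} (hq : normSq g q = 1)
    {ξ : EuclideanSpace ℝ (Fin n) × EuclideanSpace ℝ (Fin n)} :
    IsReebVector g q ξ ↔ ξ = Φ.spray g q := by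
  have hR : IsReebVector g q ξ ↔ diffTM (normSq g) q ξ = 0 ∧ contactAt g q ξ = 1 ∧
    ∀ η, diffTM (normSq g) q η = 0 → dContactForm g q ξ η = 0 := Iff.rfl
  rw [hR]
  constructor
  · rintro ⟨h1, h2, h3⟩
    rw [← sub_eq_zero]
    -- The difference `ζ` is tangent to `SM`, annihilated by `α`, and `dα(ζ, ·)` vanishes on `T SM`.
    -- Vertical test vectors show that `ζ` is vertical; lifts of arbitrary vectors show that its
    -- fibre part is zero.
    obtain ⟨ζ, hζ⟩ : ∃ ζ, ζ = ξ - Φ.spray g q := ⟨_, rfl⟩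
    rw [← hζ]
    have h4 : diffTM (normSq g) q ζ = 0 := by
      rw [hζ, map_sub, h1, Φ.diffTM_normSq_spray, sub_zero]
    have h5 : metricAt g q.1 (vec q) (projDeriv q ζ) = 0 := by
      change contactAt g q ζ = 0
      rw [hζ, map_sub, h2, Φ.contactAt_spray, hq, sub_self]
    have h6 : ∀ η, diffTM (normSq g) q η = 0 →
        ∑ k, (diffTM (Φ.momentum g k) q ζ * diffTM (fun q => Φ.h k q.1) q η -
        diffTM (Φ.momentum g k) q η * diffTM (fun q => Φ.h k q.1) q ζ) = 0 := by
      intro η hη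
      have e1 := Φ.dContactForm_eq g q ξ η
      have e2 := Φ.dContactForm_eq g q (Φ.spray g q) η
      rw [h3 η hη, mul_zero] at e1
      rw [Φ.dContactForm_spray, hη, neg_zero] at e2
      have e3 := congrArg₂ (· - ·) e1 e2
      simp only [← Finset.sum_sub_distrib, sub_zero] at e3
      rw [e3]
      refine Finset.sum_congr rfl fun k _ => ?_
      rw [hζ, map_sub, map_sub]
      ring
    have h7 : projDeriv q ζ = 0 := by
      -- The vertical lift of `dπ ζ` is tangent to `SM` because `α(ζ) = 0`, and pairing it with `ζ`
      -- under `dα` yields the squared norm of `dπ ζ` up to sign and a factor.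
      obtain ⟨η, hη1, hη2⟩ := Φ.exists_vertical g q (projDeriv q ζ)
      have hη3 := fun j => hη2 _ (Φ.contMDiff_h j)
      have e1 := h6 η (by rw [Φ.diffTM_normSq_vertical g q hη1 hη3, h5, mul_zero])
      simp only [hη1 _ (Φ.contMDiff_h _), mul_zero, zero_sub, Finset.sum_neg_distrib,
        neg_eq_zero, diffTM_comp_fst_eq (Φ.contMDiff_h _) q ζ] at e1
      rw [Φ.diffTM_momentum_vertical g q hη1 hη3] at e1
      by_contra h
      have := metricAt_pos g q.1 h
      linarith
    obtain ⟨w, hw⟩ := Φ.exists_vertical_eq q h7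
    have h8 : ∀ h : M → ℝ, ContMDiff (𝓡 n) 𝓘(ℝ, ℝ) ∞ h → diffTM (fun q => h q.1) q ζ = 0 := by
      intro h hh
      rw [diffTM_comp_fst_eq hh, h7, map_zero]
    have h9 : w = 0 := by
      refine eq_zero_of_metricAt g q.1 fun v => ?_
      obtain ⟨η, hη⟩ := Φ.exists_projDeriv_eq q v
      obtain ⟨μ, hμ1, hμ2⟩ := Φ.exists_vertical g q (vec q)
      have hμ3 := Φ.diffTM_normSq_vertical g q hμ1 fun j => hμ2 _ (Φ.contMDiff_h j)
      rw [← normSq_eq_metricAt, hq, mul_one] at hμ3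
      -- A multiple of the radial vector `μ`, on which `d(‖v‖²)` takes the value `2`, makes `η`
      -- tangent to `SM`. It does not affect the pairing, both `μ` and `ζ` being vertical.
      have e1 := h6 (η - (diffTM (normSq g) q η / 2) • μ) (by
        rw [map_sub, map_smul, hμ3, smul_eq_mul]; ring)
      simp only [h8 _ (Φ.contMDiff_h _), mul_zero, sub_zero, map_sub, map_smul,
        hμ1 _ (Φ.contMDiff_h _), smul_zero] at e1
      simp only [diffTM_comp_fst_eq (Φ.contMDiff_h _) q η, hη] at e1
      rw [Φ.diffTM_momentum_vertical g q h8 hw] at e1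
      linarith
    refine Φ.tangent_ext g (q := q) (fun j => ?_) (fun j => ?_)
    · rw [h8 _ (Φ.contMDiff_h j), map_zero]
    · rw [hw, h9, map_zero, map_zero]
  · rintro rfl
    refine ⟨Φ.diffTM_normSq_spray g q, by rw [Φ.contactAt_spray, hq], fun η hη => ?_⟩
    have h := Φ.dContactForm_spray g q η
    rw [hη] at h
    linarith

end Reeb

end

end TranslatedPoint

namespace TranslatedPoint

noncomputable section

/-! ### Reeb flow, contact lift and translated points. -/

section Translated

variable {n : ℕ} {M : Type*} [TopologicalSpace M] [ChartedSpace (EuclideanSpace ℝ (Fin n)) M]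
  [IsManifold (𝓡 n) ∞ M] [T2Space M] [CompactSpace M] (g : Metric n M)

/-- The Reeb flow of `SM` is the geodesic flow. -/
theorem reebFlow_eq {q : TM n M} (hq : normSq g q = 1) (s : ℝ) :
    reebFlow g s q = geodesicFlow g s q := by
  obtain ⟨Φ⟩ := nonempty_frame n M
  have hex : ∃ σ : ℝ → TM n M, IsReebOrbit g σ ∧ σ 0 = q := by
    refine ⟨fun s => geodesicFlow g s q, fun s => ?_, geodesicFlow_zero g q⟩
    have h1 : normSq g (geodesicFlow g s q) = 1 := by rw [normSq_geodesicFlow, hq]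
    have h2 := (Φ.geodesicFlow_spec g).2 q s
    exact ⟨h1, h2.mdifferentiableAt, (Φ.isReebVector_iff g h1).2 (velTM_of_hasMFDerivAt h2)⟩
  rw [reebFlow, dif_pos hex]
  obtain ⟨h1, h2⟩ := hex.choose_spec
  refine (Φ.eq_geodesicFlow g (fun s => ?_) s).trans (by rw [h2])
  obtain ⟨h3, h4, h5⟩ := h1 s
  refine h4.hasMFDerivAt.congr_mfderiv (ContinuousLinearMap.ext_ring ?_)
  exact Eq.trans ((Φ.isReebVector_iff g h3).1 h5) (one_smul ℝ (Φ.spray g (hex.choose s))).symm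

/-- The Lie derivative of `α` along the spray is `d(‖v‖²) / 2`, and the flow preserves the norm; so
the pairing with a vector tangent to a level of the norm is constant in `s`. -/
theorem contactAt_geodesicFlow {q : TM n M}
    {ζ : EuclideanSpace ℝ (Fin n) × EuclideanSpace ℝ (Fin n)} (hζ : diffTM (normSq g) q ζ = 0)
    (s : ℝ) :
    contactAt g (geodesicFlow g s q) (mapTM (geodesicFlow g s) q ζ) = contactAt g q ζ := by
  obtain ⟨Φ⟩ := nonempty_frame n M
  let a : ℝ → ℝ := fun s =>
    ∑ k, Φ.momentum g k (geodesicFlow g s q) * jacobi g q ζ (fun q => Φ.h k q.1) s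
  have ha : ∀ s, a s = 2 * contactAt g (geodesicFlow g s q) (mapTM (geodesicFlow g s) q ζ) :=
    fun s => Φ.sum_momentum_diffTM g _ _
  have hd : ∀ s, HasDerivAt a 0 s := by
    intro s
    have h1 : HasDerivAt a _ s := HasDerivAt.fun_sum fun k _ =>
      (Φ.hasDerivAt_geodesicFlow g (Φ.contMDiff_momentum g k) q s).fun_mul
        (Φ.hasDerivAt_jacobi g (contMDiff_comp_fst (Φ.contMDiff_h k)) q ζ s)
    convert h1 using 1
    have h2 := Φ.eulerLagrange_spray g (geodesicFlow g s q)
      (projDeriv (geodesicFlow g s q) (mapTM (geodesicFlow g s) q ζ))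
    have h3 := Φ.diffTM_normSq_eq g (geodesicFlow g s q) (mapTM (geodesicFlow g s) q ζ)
    have h4 : diffTM (normSq g) (geodesicFlow g s q) (mapTM (geodesicFlow g s) q ζ) = 0 := by
      rw [← diffTM_comp (Φ.contMDiff_normSq g) (mdifferentiableAt_geodesicFlow g s q),
        funext (normSq_geodesicFlow g s)]
      exact hζ
    have h5 : ∀ k, jacobi g q ζ (fun q' => diffTM (fun q : TM n M => Φ.h k q.1) q' (Φ.spray g q')) s =
        diffTM (fiberDeriv (Φ.h k)) (geodesicFlow g s q) (mapTM (geodesicFlow g s) q ζ) :=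
      fun k => congrArg (fun K => diffTM K (geodesicFlow g s q) (mapTM (geodesicFlow g s) q ζ))
        (funext (Φ.diffTM_comp_fst_spray g (Φ.contMDiff_h k)))
    have h6 : ∀ k, jacobi g q ζ (fun q => Φ.h k q.1) s =
        diffAt n (Φ.h k) (geodesicFlow g s q).1 (projDeriv (geodesicFlow g s q)
          (mapTM (geodesicFlow g s) q ζ)) :=
      fun k => diffTM_comp_fst_eq (Φ.contMDiff_h k) _ _
    rw [Finset.sum_add_distrib]
    simp only [h5, h6]
    rw [Frame.eulerLagrange] at h2
    simp only [diffTM_comp_fst_eq (Φ.contMDiff_coeff g _ _)] at h3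
    linarith
  have h1 := is_const_of_deriv_eq_zero (fun s => (hd s).differentiableAt) (fun s => (hd s).deriv) s 0
  rw [ha, ha] at h1
  have h2 : geodesicFlow g 0 = (id : TM n M → TM n M) := funext (geodesicFlow_zero g)
  rw [h2, mapTM_id] at h1
  have h3 : contactAt g (id q) ζ = contactAt g q ζ := rfl
  linarith

variable (f : M ≃ₘ⟮𝓡 n, 𝓡 n⟯ M)

/-- The contact form sees only the value `F q` and the projection `df ∘ dπ` of the differential, so
`metricAt_symplecticLift` applies. For `contactLift` the factor `c` is `1 / ‖f̂ q‖`. -/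
theorem contactAt_symplecticLift_comp {F : TM n M → TM n M} {q : TM n M} {c : ℝ}
    (hF : MDifferentiableAt (𝓡 n).tangent (𝓡 n).tangent F q) (hF1 : ∀ q, (F q).1 = f q.1)
    (hF2 : F q = ⟨f q.1, c • vec (symplecticLift g f q)⟩)
    (ζ : EuclideanSpace ℝ (Fin n) × EuclideanSpace ℝ (Fin n)) :
    contactAt g (F q) (mapTM F q ζ) = c * contactAt g q ζ := by
  obtain ⟨Φ⟩ := nonempty_frame n M
  have h1 : ∀ h : M → ℝ, ContMDiff (𝓡 n) 𝓘(ℝ, ℝ) ∞ h →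
      diffTM (fun q => h q.1) (F q) (mapTM F q ζ) =
        diffAt n h (f q.1) (mapDeriv f q.1 (projDeriv q ζ)) := by
    intro h hh
    rw [← diffTM_comp (contMDiff_comp_fst hh) hF, ← diffAt_comp f hh, ← diffTM_comp_fst_eq
      (h := fun y => h (f y)) (hh.comp f.contMDiff)]
    exact congrArg (fun K => diffTM K q ζ) (funext fun q => congrArg h (hF1 q))
  have h2 := Φ.sum_momentum_diffTM g (F q) (mapTM F q ζ)
  simp only [h1 _ (Φ.contMDiff_h _)] at h2
  rw [hF2] at h2 ⊢
  have h3 := Φ.sum_momentum g ⟨f q.1, c • vec (symplecticLift g f q)⟩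
    (mapDeriv f q.1 (projDeriv q ζ))
  have h4 : metricAt g (f q.1) (c • vec (symplecticLift g f q))
      (mapDeriv f q.1 (projDeriv q ζ)) = c * contactAt g q ζ := by
    rw [map_smul, smul_apply, metricAt_symplecticLift]
    rfl
  have h5 := h2.symm.trans h3
  have h6 := h5.trans (congrArg (2 * ·) h4)
  linarith

/-- At a translated point with time-shift `t`, the symplectic lift is the geodesic flow. -/
theorem symplecticLift_eq_geodesicFlow {p : TM n M} {t : ℝ} (hp : IsTranslatedPoint g f t p) :
    symplecticLift g f p = geodesicFlow g t p := by
  obtain ⟨Φ⟩ := nonempty_frame n M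
  obtain ⟨h1, h2, h3⟩ := hp
  have hp1 : normSq g p = 1 := h1
  have hN : ContMDiff (𝓡 n).tangent 𝓘(ℝ, ℝ) ∞ (fun q => normSq g (symplecticLift g f q)) :=
    (Φ.contMDiff_normSq g).comp (contMDiff_symplecticLift g f Φ)
  have hpos : ∀ q : TM n M, normSq g q ≠ 0 → 0 < normSq g (symplecticLift g f q) := by
    intro q hq
    refine metricAt_pos g _ (v := vec (symplecticLift g f q)) fun h0 => hq ?_
    have h4 := metricAt_symplecticLift g f q (vec q)
    rw [h0, map_zero] at h4
    exact h4.symm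
  have hev : ∀ᶠ q in 𝓝 p, normSq g q ≠ 0 :=
    (Φ.contMDiff_normSq g).continuous.continuousAt.eventually_ne (by rw [hp1]; exact one_ne_zero)
  have hc1 : ∀ q : TM n M, normSq g q ≠ 0 → normSq g (contactLift g f q) = 1 := by
    intro q hq
    have h4 := normSq_smul g (f q.1) (Real.sqrt (normSq g (symplecticLift g f q)))⁻¹
      (vec (symplecticLift g f q))
    refine Eq.trans h4 ?_
    rw [inv_pow, Real.sq_sqrt (hpos q hq).le]
    exact inv_mul_cancel₀ (hpos q hq).ne'
  have hsm : ContMDiffAt (𝓡 n).tangent (𝓡 n).tangent ∞ (contactLift g f) p := by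
    have h4 : ContMDiffAt (𝓡 n).tangent 𝓘(ℝ, ℝ) ∞
        (fun q => (Real.sqrt (normSq g (symplecticLift g f q)))⁻¹) p := by
      have h5 : ContDiffAt ℝ ∞ (fun x : ℝ => (Real.sqrt x)⁻¹) (normSq g (symplecticLift g f p)) := by
        have h6 := hpos p (by rw [hp1]; exact one_ne_zero)
        exact (contDiffAt_id.sqrt h6.ne').inv (Real.sqrt_pos.2 h6).ne'
      exact ContMDiffAt.comp (g := fun x : ℝ => (Real.sqrt x)⁻¹) p h5.contMDiffAt (hN p)
    exact ((Φ.contMDiff_combine_smul g).contMDiffAt).comp p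
      (h4.prodMk (contMDiff_symplecticLift g f Φ p))
  have hsm' := hsm.mdifferentiableAt (by simp)
  -- The two flows are known to agree on `SM` only; as `contactLift` maps a neighbourhood of `p` to
  -- `SM`, the compositions have the same differential.
  have heq : reebFlow g (-t) ∘ contactLift g f =ᶠ[𝓝 p] geodesicFlow g (-t) ∘ contactLift g f := by
    filter_upwards [hev] with q hq
    exact reebFlow_eq g (hc1 q hq) (-t)
  have h4 : geodesicFlow g (-t) (contactLift g f p) = p := heq.self_of_nhds.symm.trans h2
  have h5 : contactLift g f p = geodesicFlow g t p := by
    rw [← h4, geodesicFlow_apply_neg, h4]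
  have h6 : diffTM (normSq g) (contactLift g f p) (mapTM (contactLift g f) p (Φ.spray g p)) = 0 := by
    rw [← diffTM_comp (Φ.contMDiff_normSq g) hsm']
    have h7 : (fun q => normSq g (contactLift g f q)) =ᶠ[𝓝 p] fun _ => 1 := by
      filter_upwards [hev] with q hq using hc1 q hq
    have h8 : diffTM (fun q => normSq g (contactLift g f q)) p = diffTM (fun _ => 1) p :=
      h7.mfderiv_eq
    have h9 : diffTM (n := n) (M := M) (fun _ => 1) p = 0 := mfderiv_const
    rw [h8, h9]
    rfl
  -- The spray at `p` is tangent to `SM` and `α` is `1` on it, so this equation isolates the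
  -- conformal factor `1 / ‖f̂ p‖`.
  have h7 : contactAt g (geodesicFlow g (-t) (contactLift g f p))
      (mapTM (geodesicFlow g (-t) ∘ contactLift g f) p (Φ.spray g p)) =
      contactAt g p (Φ.spray g p) := by
    have h8 := h3 (Φ.spray g p) (Φ.diffTM_normSq_spray g p)
    rw [heq.mfderiv_eq] at h8
    rw [show (reebFlow g (-t) ∘ contactLift g f) p = geodesicFlow g (-t) (contactLift g f p) from
      heq.self_of_nhds] at h8
    exact h8
  rw [mapTM_comp (mdifferentiableAt_geodesicFlow g _ _) hsm', contactAt_geodesicFlow g h6,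
    contactAt_symplecticLift_comp g f hsm' (fun _ => rfl) rfl, Φ.contactAt_spray, hp1, mul_one] at h7
  rw [← h5]
  refine congrArg (Bundle.TotalSpace.mk (f p.1)) ?_
  have h8 : (Real.sqrt (normSq g (symplecticLift g f p)))⁻¹ • vec (symplecticLift g f p) =
      vec (symplecticLift g f p) := by rw [h7, one_smul]
  exact h8.symm

end Translated

end

end TranslatedPoint

namespace TranslatedPoint

noncomputable section

/-! ### Integration of products of `H¹` functions. -/

section Integrals

/-- `F` is integrable on `[0, 1]`, with integral `x`. -/
def HasUnitIntegral (F : ℝ → ℝ) (x : ℝ) : Prop :=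
  IntervalIntegrable F volume 0 1 ∧ ∫ s in (0 : ℝ)..1, F s = x

theorem HasUnitIntegral.add {F G : ℝ → ℝ} {x y : ℝ} (hF : HasUnitIntegral F x)
    (hG : HasUnitIntegral G y) : HasUnitIntegral (fun s => F s + G s) (x + y) :=
  ⟨hF.1.add hG.1, by rw [intervalIntegral.integral_add hF.1 hG.1, hF.2, hG.2]⟩

theorem HasUnitIntegral.sum {ι : Type*} {A : Finset ι} {F : ι → ℝ → ℝ} {x : ι → ℝ}
    (h : ∀ i ∈ A, HasUnitIntegral (F i) (x i)) :
    HasUnitIntegral (fun s => ∑ i ∈ A, F i s) (∑ i ∈ A, x i) := by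
  refine ⟨?_, ?_⟩
  · have := IntervalIntegrable.sum A fun i hi => (h i hi).1
    rwa [Finset.sum_fn] at this
  · rw [intervalIntegral.integral_finsetSum fun i hi => (h i hi).1]
    exact Finset.sum_congr rfl fun i hi => (h i hi).2

theorem hasUnitIntegral_energyForm (a b c : H1) :
    HasUnitIntegral (fun s => evalReal a s * b.2 s * c.2 s) (energyForm a b c) := by
  refine ⟨?_, (energyForm_eq_evalReal a b c).symm⟩
  have h1 : Integrable (fun s => inner ℝ (mulL (evalL a) b.2 s) (c.2 s)) unitMeasure :=
    L2.integrable_inner _ _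
  have h2 : Integrable (fun s => evalReal a s * b.2 s * c.2 s) unitMeasure := by
    refine h1.congr ?_
    filter_upwards [coeFn_mulL (evalL a) b.2, ae_restrict_mem measurableSet_Icc] with s hs hs'
    rw [hs]
    simp only [RCLike.inner_apply, conj_trivial]
    rw [mul_comm, Set.IccExtend_of_mem _ _ hs']
    rfl
  rw [intervalIntegrable_iff_integrableOn_Icc_of_le zero_le_one]
  exact h2

theorem absolutelyContinuousOnInterval_sum {ι : Type*} (A : Finset ι) {F : ι → ℝ → ℝ} {a b : ℝ}
    (h : ∀ i ∈ A, AbsolutelyContinuousOnInterval (F i) a b) :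
    AbsolutelyContinuousOnInterval (fun s => ∑ i ∈ A, F i s) a b := by
  classical
  induction A using Finset.induction_on with
  | empty =>
    simp only [Finset.sum_empty]
    exact (contDiff_const (n := 1)).contDiffOn.absolutelyContinuousOnInterval
  | insert i A hi ih =>
    simp only [Finset.sum_insert hi]
    exact (h i (Finset.mem_insert_self _ _)).add (ih fun j hj => h j (Finset.mem_insert_of_mem hj))

theorem integral_eq_sub_of_ae_hasDerivAt {B F : ℝ → ℝ} {a b : ℝ} (hab : a ≤ b)
    (hB : AbsolutelyContinuousOnInterval B a b)
    (h : ∀ᵐ s, s ∈ Set.Ioo a b → HasDerivAt B (F s) s) : ∫ s in a..b, F s = B b - B a := by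
  rw [← hB.integral_deriv_eq_sub]
  refine intervalIntegral.integral_congr_ae ?_
  filter_upwards [h, compl_mem_ae_iff.2 (measure_singleton b)] with s hs hsb hs'
  rw [Set.uIoc_of_le hab] at hs'
  exact (hs ⟨hs'.1, lt_of_le_of_ne hs'.2 hsb⟩).deriv.symm

/-- The evaluation at a point as a continuous linear form. -/
def evalAtL (s : unitInterval) : H1 →L[ℝ] ℝ := (ContinuousMap.evalCLM ℝ s).comp evalL

theorem evalAtL_apply (s : unitInterval) (u : H1) : evalAtL s u = u.eval s := rfl

theorem hasDerivAt_eval {Ψ : ℝ → H1} {Ψ' : H1} {r : ℝ} (h : HasDerivAt Ψ Ψ' r) (s : unitInterval) :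
    HasDerivAt (fun v => (Ψ v).eval s) (Ψ'.eval s) r :=
  (evalAtL s).hasFDerivAt.comp_hasDerivAt r h

theorem contDiff_energyForm {P : Type*} [NormedAddCommGroup P] [NormedSpace ℝ P] {a b c : P → H1}
    (ha : ContDiff ℝ ∞ a) (hb : ContDiff ℝ ∞ b) (hc : ContDiff ℝ ∞ c) :
    ContDiff ℝ ∞ (fun p => energyForm (a p) (b p) (c p)) :=
  ((mulL.contDiff.comp (evalL.contDiff.comp ha)).clm_apply (contDiff_snd.comp hb)).inner ℝ
    (contDiff_snd.comp hc)

end Integrals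

/-! ### The energy as a function of `H¹` functions. -/

section Energy

variable {n : ℕ} {M : Type*} [TopologicalSpace M] [ChartedSpace (EuclideanSpace ℝ (Fin n)) M]
  [IsManifold (𝓡 n) ∞ M]

/-- At almost every time all the functions `h_j ∘ γ` are differentiable, hence so is `γ`, and
`dh_j(γ')` is the weak derivative of `h_j ∘ γ`. Smoothness of the energy along families is read off
from the resulting sum of trilinear forms. -/
theorem Frame.energy_eq (Φ : Frame n M) (g : Metric n M) {γ : unitInterval → M} (hγ : Continuous γ)
    {u : Φ.J → H1} {Γ : Φ.J → Φ.J → H1} (hu : ∀ j s, Φ.h j (γ s) = (u j).eval s)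
    (hΓ : ∀ j k s, Φ.coeff g j k (γ s) = (Γ j k).eval s) :
    energy g γ = ∑ j, ∑ k, energyForm (Γ j k) (u j) (u k) := by
  have h1 : HasUnitIntegral (fun s => ∑ j, ∑ k, evalReal (Γ j k) s * (u j).2 s * (u k).2 s)
      (∑ j, ∑ k, energyForm (Γ j k) (u j) (u k)) :=
    HasUnitIntegral.sum fun j _ => HasUnitIntegral.sum fun k _ => hasUnitIntegral_energyForm _ _ _
  rw [← h1.2, energy]
  refine intervalIntegral.integral_congr_ae ?_
  have h2 : ∀ᵐ s, ∀ j, s ∈ Set.Icc (0 : ℝ) 1 → HasDerivAt (evalReal (u j)) ((u j).2 s) s :=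
    ae_all_iff.2 fun j => ae_hasDerivAt_evalReal (u j)
  filter_upwards [h2, compl_mem_ae_iff.2 (measure_singleton (1 : ℝ))] with s hs hs1 hs'
  rw [Set.uIoc_of_le zero_le_one] at hs'
  have hs2 : s ∈ Set.Ioo (0 : ℝ) 1 := ⟨hs'.1, lt_of_le_of_ne hs'.2 hs1⟩
  have hs3 : s ∈ Set.Icc (0 : ℝ) 1 := Set.Ioo_subset_Icc_self hs2
  have h3 : ∀ j, HasDerivAt (fun r => Φ.h j (Set.IccExtend zero_le_one γ r)) ((u j).2 s) s := by
    intro j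
    refine (hs j hs3).congr_of_eventuallyEq ?_
    filter_upwards [Icc_mem_nhds hs2.1 hs2.2] with r hr
    rw [Set.IccExtend_of_mem _ _ hr, hu]
    rfl
  have h4 : MDifferentiableAt 𝓘(ℝ, ℝ) (𝓡 n) (Set.IccExtend zero_le_one γ) s :=
    Φ.mdifferentiableAt hγ.Icc_extend'.continuousAt fun j => (h3 j).differentiableAt
  refine (Φ.normSq_eq_sum g _).trans ?_
  refine Finset.sum_congr rfl fun j _ => Finset.sum_congr rfl fun k _ => ?_
  have h5 : ∀ j, fiberDeriv (Φ.h j) (velocity (n := n) (Set.IccExtend zero_le_one γ) s) =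
      (u j).2 s := fun j => (fiberDeriv_velocity (Φ.contMDiff_h j) h4).unique (h3 j)
  have h6 : Φ.coeff g j k (velocity (n := n) (Set.IccExtend zero_le_one γ) s).1 =
      evalReal (Γ j k) s := by
    change Φ.coeff g j k (Set.IccExtend zero_le_one γ s) = _
    rw [Set.IccExtend_of_mem _ _ hs3, hΓ]
    rfl
  rw [h5, h5, h6, mul_assoc]

variable [T2Space M] [CompactSpace M]

/-- Evaluation at `s` is a continuous linear form on `H¹`, and smooth functions on `M` detect both
continuity and smoothness. -/
theorem IsSmoothFamily.contMDiff {P : Type*} [NormedAddCommGroup P] [NormedSpace ℝ P]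
    {c : P → unitInterval → M} (hc : IsSmoothFamily n c) (s : unitInterval) :
    ContMDiff 𝓘(ℝ, P) (𝓡 n) ∞ (fun p => c p s) := by
  obtain ⟨Φ⟩ := nonempty_frame n M
  have h1 : ∀ h : M → ℝ, ContMDiff (𝓡 n) 𝓘(ℝ, ℝ) ∞ h → ContDiff ℝ ∞ (fun p => h (c p s)) := by
    intro h hh
    obtain ⟨Ψ, hΨ, hΨ'⟩ := hc.2 h hh
    have h2 : (fun p => h (c p s)) = fun p => evalAtL s (Ψ p) := funext fun p => hΨ' p s
    rw [h2]
    exact (evalAtL s).contDiff.comp hΨ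
  intro p
  refine Φ.contMDiffAt (continuousAt_of_forall_contMDiff fun h hh =>
    (h1 h hh).continuous.continuousAt) fun j => ?_
  exact (h1 _ (Φ.contMDiff_h j)).contMDiff p

theorem fst_velocity_comp (f : M ≃ₘ⟮𝓡 n, 𝓡 n⟯ M) {c c' : ℝ → M} {r : ℝ}
    (hc : MDifferentiableAt 𝓘(ℝ, ℝ) (𝓡 n) c r) (hcc : ∀ r, c' r = f (c r)) {h : M → ℝ}
    (hh : ContMDiff (𝓡 n) 𝓘(ℝ, ℝ) ∞ h) :
    fiberDeriv h (velocity (n := n) c' r) =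
      diffAt n h (f (c r)) (mapDeriv f (c r) (vec (velocity (n := n) c r))) := by
  obtain rfl : c' = fun r => f (c r) := funext hcc
  rw [← diffAt_comp f hh]
  have h1 := fiberDeriv_velocity (hh.comp f.contMDiff) hc
  have h2 := fiberDeriv_velocity hh
    (((f.contMDiff (c r)).mdifferentiableAt (by simp)).comp r hc)
  exact h2.unique h1

theorem hasDerivAt_geodesicFlow_mul (Φ : Frame n M) (g : Metric n M) {K : TM n M → ℝ}
    (hK : ContMDiff (𝓡 n).tangent 𝓘(ℝ, ℝ) ∞ K) (p : TM n M) (t s : ℝ) :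
    HasDerivAt (fun s => K (geodesicFlow g (t * s) p))
      (t * diffTM K (geodesicFlow g (t * s) p) (Φ.spray g (geodesicFlow g (t * s) p))) s := by
  have h := HasDerivAt.comp s (Φ.hasDerivAt_geodesicFlow g hK p (t * s))
    ((hasDerivAt_id s).const_mul t)
  rw [mul_one, mul_comm] at h
  exact h

theorem contDiff_geodesicFlow_mul (g : Metric n M) {K : TM n M → ℝ}
    (hK : ContMDiff (𝓡 n).tangent 𝓘(ℝ, ℝ) ∞ K) (p : TM n M) (t : ℝ) :
    ContDiff ℝ ∞ (fun s => K (geodesicFlow g (t * s) p)) :=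
  (contMDiff_iff_contDiff.1 (hK.comp (contMDiff_geodesicFlow_curve g p))).comp
    (contDiff_const.mul contDiff_id)

/-- An `H¹` function that represents a function along a geodesic. -/
theorem ae_snd_geodesic (g : Metric n M) {h : M → ℝ} (hh : ContMDiff (𝓡 n) 𝓘(ℝ, ℝ) ∞ h) {p : TM n M}
    {t : ℝ} {u : H1} (hu : ∀ s, h (associatedGeodesic g t p s) = u.eval s) :
    ∀ᵐ s, s ∈ Set.Ioo (0 : ℝ) 1 → u.2 s = t * fiberDeriv h (geodesicFlow g (t * s) p) := by
  obtain ⟨Φ⟩ := nonempty_frame n M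
  have h1 := ae_snd_eq_deriv (u := u) (a := 0) (b := 1)
    (c := fun s => h (geodesicFlow g (t * s) p).1) (by simp) (by simp)
    (fun s hs => evalReal_eq (c := fun s => h (geodesicFlow g (t * s) p).1) hu hs)
  filter_upwards [h1] with s hs hs'
  rw [hs hs', (hasDerivAt_geodesicFlow_mul Φ g (contMDiff_comp_fst hh) p t s).deriv,
    Φ.diffTM_comp_fst_spray g hh]

end Energy

end

end TranslatedPoint

namespace TranslatedPoint

noncomputable section

/-- Symmetry of `G` merges the two polarized terms into the momenta. -/
theorem sum_mul_momentum_aux {J : Type*} [Fintype J] {G : J → J → ℝ} (hG : ∀ j k, G j k = G k j)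
    (A B : J → ℝ) (t : ℝ) :
    ∑ j, ∑ k, (G j k * B j * (t * A k) + G j k * (t * A j) * B k) =
      ∑ k, t * (∑ j, 2 * (G j k * A j)) * B k := by
  have h1 : ∑ j, ∑ k, G j k * B j * (t * A k) = ∑ j, ∑ k, G j k * (t * A j) * B k := by
    rw [Finset.sum_comm]
    refine Finset.sum_congr rfl fun k _ => Finset.sum_congr rfl fun j _ => ?_
    rw [hG]
    ring
  simp only [Finset.sum_add_distrib, h1]
  rw [← two_mul, Finset.sum_comm, Finset.mul_sum]
  refine Finset.sum_congr rfl fun k _ => ?_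
  rw [Finset.mul_sum, Finset.mul_sum, Finset.sum_mul]
  refine Finset.sum_congr rfl fun j _ => ?_
  ring

/-! ### The first variation of the energy. -/

section FirstVariation

variable {n : ℕ} {M : Type*} [TopologicalSpace M] [ChartedSpace (EuclideanSpace ℝ (Fin n)) M]
  [IsManifold (𝓡 n) ∞ M] [T2Space M] [CompactSpace M] (g : Metric n M) (f : M ≃ₘ⟮𝓡 n, 𝓡 n⟯ M)

theorem associatedGeodesic_zero (t : ℝ) (p : TM n M) : associatedGeodesic g t p 0 = p.1 := by
  unfold associatedGeodesic
  rw [show t * ((0 : unitInterval) : ℝ) = 0 by simp, geodesicFlow_zero]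

theorem associatedGeodesic_one {t : ℝ} {p : TM n M}
    (hp : symplecticLift g f p = geodesicFlow g t p) : associatedGeodesic g t p 1 = f p.1 := by
  unfold associatedGeodesic
  rw [show t * ((1 : unitInterval) : ℝ) = t by simp, ← hp]
  rfl

theorem associatedGeodesic_mem_lam {t : ℝ} {p : TM n M}
    (hp : symplecticLift g f p = geodesicFlow g t p) : associatedGeodesic g t p ∈ Lam n f := by
  refine ⟨⟨?_, fun h hh => ?_⟩, ?_⟩
  · exact contMDiff_fst_tangent.continuous.comp ((contMDiff_geodesicFlow_curve g p).continuous.comp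
      (continuous_const.mul continuous_subtype_val))
  · exact exists_eval_eq_of_contDiff
      ((contDiff_geodesicFlow_mul g (contMDiff_comp_fst hh) p t).of_le (by simp))
  · rw [associatedGeodesic_one g f hp, associatedGeodesic_zero]

/-- The derivative at `v = 0` of a family of paths. -/
def variation (c : ℝ → unitInterval → M) (s : unitInterval) : TM n M :=
  velocity (fun v => c v s) 0

theorem IsSmoothFamily.hasDerivAt {c : ℝ → unitInterval → M} (hc : IsSmoothFamily n c)
    {h : M → ℝ} (hh : ContMDiff (𝓡 n) 𝓘(ℝ, ℝ) ∞ h) (s : unitInterval) :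
    HasDerivAt (fun v => h (c v s)) (fiberDeriv (n := n) h (variation c s)) 0 :=
  fiberDeriv_velocity hh ((hc.contMDiff s 0).mdifferentiableAt (by simp))

theorem fiberDeriv_variation_one {c : ℝ → unitInterval → M} (hc : IsSmoothFamily n c)
    (hcf : ∀ v, c v ∈ Lam n f) {h : M → ℝ} (hh : ContMDiff (𝓡 n) 𝓘(ℝ, ℝ) ∞ h) :
    fiberDeriv (n := n) h (variation c 1) =
      diffAt n h (f (c 0 0)) (mapDeriv f (c 0 0) (vec (variation (n := n) c 0))) :=
  fst_velocity_comp f ((hc.contMDiff 0 0).mdifferentiableAt (by simp)) (fun v => (hcf v).2) hh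

/-- The identity `⟨f̂ p, df w⟩ = ⟨p, w⟩` in terms of momenta. It cancels the boundary terms of the
first variation and, once differentiated, those of the second. -/
theorem Frame.sum_momentum_symplecticLift (Φ : Frame n M) (g : Metric n M) (f : M ≃ₘ⟮𝓡 n, 𝓡 n⟯ M)
    (p : TM n M) (w : EuclideanSpace ℝ (Fin n)) :
    ∑ k, Φ.momentum g k (symplecticLift g f p) * diffAt n (Φ.h k) (f p.1) (mapDeriv f p.1 w) =
      ∑ k, Φ.momentum g k p * diffAt n (Φ.h k) p.1 w := by
  rw [Φ.sum_momentum, ← metricAt_symplecticLift g f]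
  exact Φ.sum_momentum g (symplecticLift g f p) (mapDeriv f p.1 w)

/-- By the Euler–Lagrange equation the integrand of the first variation is the derivative of `2 ⟨γ',
V⟩`, with `V` the variation field. The values at the two ends agree because `f̂ p = G_t p` and `V(1)
= df V(0)`. -/
theorem isCriticalPoint_associatedGeodesic {t : ℝ} {p : TM n M}
    (hp : symplecticLift g f p = geodesicFlow g t p) :
    IsCriticalPoint g f (associatedGeodesic g t p) := by
  obtain ⟨Φ⟩ := nonempty_frame n M
  refine ⟨associatedGeodesic_mem_lam g f hp, fun c hc hcf hc0 => ?_⟩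
  choose Ψ hΨ hΨe using hc.2
  let U : Φ.J → ℝ → H1 := fun j => Ψ _ (Φ.contMDiff_h j)
  let Γ : Φ.J → Φ.J → ℝ → H1 := fun j k => Ψ _ (Φ.contMDiff_coeff g j k)
  have hE : (fun r => energy g (c r)) = fun r => ∑ j, ∑ k, energyForm (Γ j k r) (U j r) (U k r) :=
    funext fun r => Φ.energy_eq g (hcf r).1.1 (fun j s => hΨe _ _ r s) (fun j k s => hΨe _ _ r s)
  have hU : ∀ j, HasDerivAt (U j) (deriv (U j) 0) 0 := fun j =>
    ((hΨ _ (Φ.contMDiff_h j)).differentiable (by simp) 0).hasDerivAt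
  have hΓ : ∀ j k, HasDerivAt (Γ j k) (deriv (Γ j k) 0) 0 := fun j k =>
    ((hΨ _ (Φ.contMDiff_coeff g j k)).differentiable (by simp) 0).hasDerivAt
  have hd : HasDerivAt (fun r => ∑ j, ∑ k, energyForm (Γ j k r) (U j r) (U k r)) _ 0 :=
    HasDerivAt.fun_sum fun j _ => HasDerivAt.fun_sum fun k _ =>
      TranslatedPoint.HasDerivAt.energyForm (hΓ j k) (hU j) (hU k)
  rw [hE, hd.deriv]
  have hI := HasUnitIntegral.sum (A := Finset.univ) fun j (_ : j ∈ Finset.univ) =>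
    HasUnitIntegral.sum (A := Finset.univ) fun k (_ : k ∈ Finset.univ) =>
    ((hasUnitIntegral_energyForm (deriv (Γ j k) 0) (U j 0) (U k 0)).add
      (hasUnitIntegral_energyForm (Γ j k 0) (deriv (U j) 0) (U k 0))).add
      (hasUnitIntegral_energyForm (Γ j k 0) (U j 0) (deriv (U k) 0))
  rw [← hI.2]
  have hUe : ∀ j (s : unitInterval), evalReal (deriv (U j) 0) s =
      fiberDeriv (n := n) (Φ.h j) (variation c s) := by
    intro j s
    have h1 := hasDerivAt_eval (hU j) s
    rw [← funext fun v => hΨe _ (Φ.contMDiff_h j) v s] at h1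
    exact h1.unique (hc.hasDerivAt (Φ.contMDiff_h j) s)
  have hΓe : ∀ j k (s : unitInterval), evalReal (deriv (Γ j k) 0) s =
      fiberDeriv (n := n) (Φ.coeff g j k) (variation c s) := by
    intro j k s
    have h1 := hasDerivAt_eval (hΓ j k) s
    rw [← funext fun v => hΨe _ (Φ.contMDiff_coeff g j k) v s] at h1
    exact h1.unique (hc.hasDerivAt (Φ.contMDiff_coeff g j k) s)
  -- This is `2 ⟨γ', V⟩` on `[0, 1]`. It is only absolutely continuous, `V` being of class `H¹`, so
  -- its derivative is computed almost everywhere.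
  let C : ℝ → ℝ := fun s =>
    ∑ k, t * Φ.momentum g k (geodesicFlow g (t * s) p) * evalReal (deriv (U k) 0) s
  have hγ : ∀ s : unitInterval, c 0 s = (geodesicFlow g (t * s) p).1 := fun s => congrFun hc0 s
  have hac : AbsolutelyContinuousOnInterval C 0 1 := by
    refine absolutelyContinuousOnInterval_sum _ fun k _ => AbsolutelyContinuousOnInterval.mul ?_ ?_
    · exact ((contDiff_const.mul (contDiff_geodesicFlow_mul g (Φ.contMDiff_momentum g k) p t)).of_le
        (m := 1) (by simp)).contDiffOn.absolutelyContinuousOnInterval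
    · exact absolutelyContinuousOnInterval_evalReal _ (by simp) (by simp)
  have hC : C 1 - C 0 = 0 := by
    have h1 : C 1 = t * ∑ k, Φ.momentum g k (symplecticLift g f p) *
        diffAt n (Φ.h k) (f p.1) (mapDeriv f p.1 (vec (variation (n := n) c 0))) := by
      simp only [C]
      rw [Finset.mul_sum]
      refine Finset.sum_congr rfl fun k _ => ?_
      rw [mul_one, ← hp, mul_assoc]
      refine congrArg (fun x => t * (_ * x)) ?_
      have h2 := (hUe k 1).trans (fiberDeriv_variation_one f hc hcf (Φ.contMDiff_h k))
      rw [hc0, associatedGeodesic_zero] at h2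
      exact h2
    have h2 : C 0 = t * ∑ k, Φ.momentum g k p *
        diffAt n (Φ.h k) p.1 (vec (variation (n := n) c 0)) := by
      simp only [C]
      rw [Finset.mul_sum]
      refine Finset.sum_congr rfl fun k _ => ?_
      rw [mul_zero, geodesicFlow_zero, mul_assoc]
      refine congrArg (fun x => t * (_ * x)) ((hUe k 0).trans ?_)
      have h3 : c 0 0 = p.1 := by rw [hc0, associatedGeodesic_zero]
      rw [← h3]
      rfl
    rw [h1, h2, Φ.sum_momentum_symplecticLift, sub_self]
  refine Eq.trans ?_ hC
  refine integral_eq_sub_of_ae_hasDerivAt zero_le_one hac ?_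
  have ae1 : ∀ᵐ s, ∀ j, s ∈ Set.Ioo (0 : ℝ) 1 → (U j 0).2 s =
      t * fiberDeriv (Φ.h j) (geodesicFlow g (t * s) p) := ae_all_iff.2 fun j =>
    ae_snd_geodesic g (Φ.contMDiff_h j) fun s => (congrArg (Φ.h j) (congrFun hc0 s)).symm.trans
      (hΨe _ _ 0 s)
  have ae2 : ∀ᵐ s, ∀ j, s ∈ Set.Icc (0 : ℝ) 1 → HasDerivAt (evalReal (deriv (U j) 0))
      ((deriv (U j) 0).2 s) s := ae_all_iff.2 fun j => ae_hasDerivAt_evalReal _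
  filter_upwards [ae1, ae2] with s hs1 hs2 hs
  have hs' : s ∈ Set.Icc (0 : ℝ) 1 := Set.Ioo_subset_Icc_self hs
  have h1 : HasDerivAt C _ s := HasDerivAt.fun_sum fun k _ =>
    ((hasDerivAt_geodesicFlow_mul Φ g (Φ.contMDiff_momentum g k) p t s).const_mul t).fun_mul
      (hs2 k hs')
  refine h1.congr_deriv ?_
  have hEL := Φ.eulerLagrange_spray g (geodesicFlow g (t * s) p)
    (vec (variation (n := n) c ⟨s, hs'⟩))
  rw [Frame.eulerLagrange, sub_eq_zero] at hEL
  have e1 : ∀ k, evalReal (deriv (U k) 0) s = diffAt n (Φ.h k) (geodesicFlow g (t * s) p).1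
      (vec (variation (n := n) c ⟨s, hs'⟩)) := by
    intro k
    rw [← hγ ⟨s, hs'⟩]
    exact hUe k ⟨s, hs'⟩
  have e2 : ∀ j k, evalReal (deriv (Γ j k) 0) s = diffAt n (Φ.coeff g j k)
      (geodesicFlow g (t * s) p).1 (vec (variation (n := n) c ⟨s, hs'⟩)) := by
    intro j k
    rw [← hγ ⟨s, hs'⟩]
    exact hΓe j k ⟨s, hs'⟩
  have e3 : ∀ j k, evalReal (Γ j k 0) s = Φ.coeff g j k (geodesicFlow g (t * s) p).1 := by
    intro j k
    rw [← hγ ⟨s, hs'⟩]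
    exact (hΨe _ (Φ.contMDiff_coeff g j k) 0 ⟨s, hs'⟩).symm
  have e4 := sum_mul_momentum_aux (G := fun j k => Φ.coeff g j k (geodesicFlow g (t * s) p).1)
    (fun j k => Φ.coeff_symm g j k _) (fun j => fiberDeriv (Φ.h j) (geodesicFlow g (t * s) p))
    (fun j => (deriv (U j) 0).2 s) t
  simp only [e2, e3, hs1 _ hs, add_assoc]
  simp only [Finset.sum_add_distrib] at e4 ⊢
  have e5 : ∑ k, t * (t * diffTM (Φ.momentum g k) (geodesicFlow g (t * s) p)
      (Φ.spray g (geodesicFlow g (t * s) p))) * evalReal (deriv (U k) 0) s =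
      ∑ j, ∑ k, diffAt n (Φ.coeff g j k) (geodesicFlow g (t * s) p).1
        (vec (variation (n := n) c ⟨s, hs'⟩)) *
        (t * fiberDeriv (Φ.h j) (geodesicFlow g (t * s) p)) *
        (t * fiberDeriv (Φ.h k) (geodesicFlow g (t * s) p)) := by
    simp only [e1]
    have e6 := congrArg (fun x => t ^ 2 * x) hEL
    simp only [Finset.mul_sum] at e6
    refine Eq.trans (Finset.sum_congr rfl fun k _ => ?_) (e6.trans
      (Finset.sum_congr rfl fun j _ => Finset.sum_congr rfl fun k _ => ?_)) <;> ring
  rw [e5]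
  exact congrArg₂ (· + ·) rfl e4.symm

end FirstVariation

end

end TranslatedPoint

namespace TranslatedPoint

noncomputable section

theorem exists_partials {F : Type*} [NormedAddCommGroup F] [NormedSpace ℝ F] {Ψ : ℝ × ℝ → F}
    (hΨ : ContDiff ℝ ∞ Ψ) : ∃ (a : F) (b : ℝ → F) (d : F), HasDerivAt (fun u => Ψ (u, 0)) a 0 ∧
      (∀ u, HasDerivAt (fun v => Ψ (u, v)) (b u) 0) ∧ HasDerivAt b d 0 := by
  have h1 : ∀ z, DifferentiableAt ℝ Ψ z := hΨ.differentiable (by simp)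
  have h2 : ContDiff ℝ ∞ (fun u : ℝ => fderiv ℝ Ψ (u, 0) (0, 1)) :=
    ((hΨ.fderiv_right (m := ∞) (by simp)).comp (contDiff_id.prodMk contDiff_const)).clm_apply
      contDiff_const
  refine ⟨fderiv ℝ Ψ (0, 0) (1, 0), fun u => fderiv ℝ Ψ (u, 0) (0, 1), _, ?_, fun u => ?_,
    (h2.differentiable (by simp) 0).hasDerivAt⟩
  · exact hasDerivAt_comp_fderiv (y := fun u : ℝ => (u, (0 : ℝ))) (h1 (0, 0))
      ((hasDerivAt_id (0 : ℝ)).prodMk (hasDerivAt_const (0 : ℝ) (0 : ℝ)))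
  · exact hasDerivAt_comp_fderiv (y := fun v : ℝ => (u, v)) (h1 (u, 0))
      ((hasDerivAt_const (0 : ℝ) u).prodMk (hasDerivAt_id (0 : ℝ)))

/-- The pointwise identity of the second variation. The nine terms on the left come from
differentiating `G u' u'` twice; the hypothesis `h` is the linearized geodesic equation
`Frame.sum_jacobi_spray_eq`, and the right-hand side is the derivative of the boundary expression
`B` in `deriv_deriv_energy_eq`. -/
theorem sum_hessian_aux {J : Type*} [Fintype J] {G P R S : J → J → ℝ} (hG : ∀ j k, G j k = G k j)
    (hP : ∀ j k, P j k = P k j) {A B V W V' W' Z Z' : J → ℝ} (t : ℝ)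
    (h : ∑ k, (Z' k * V k + Z k * W k) =
      ∑ j, ∑ k, (S j k * (A j * A k) + R j k * (B j * A k + A j * B k))) :
    ∑ j, ∑ k, (S j k * (t * A j) * (t * A k) + R j k * (t * B j) * (t * A k) +
        R j k * (t * A j) * (t * B k) +
      (P j k * V' j * (t * A k) + G j k * W' j * (t * A k) + G j k * V' j * (t * B k)) +
      (P j k * (t * A j) * V' k + G j k * (t * B j) * V' k + G j k * (t * A j) * W' k)) =
    ∑ k, t * (t * Z' k * V k + (∑ j, 2 * (P j k * A j + G j k * B j)) * V' k +
      (t * Z k * W k + (∑ j, 2 * (G j k * A j)) * W' k)) := by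
  have e1 := sum_mul_momentum_aux hP A V' t
  have e2 := sum_mul_momentum_aux hG B V' t
  have e3 := sum_mul_momentum_aux hG A W' t
  have e4 := congrArg (fun x => t ^ 2 * x) h
  have e5 : ∑ k, t * (t * Z' k * V k + (∑ j, 2 * (P j k * A j + G j k * B j)) * V' k +
      (t * Z k * W k + (∑ j, 2 * (G j k * A j)) * W' k)) =
      t ^ 2 * ∑ k, (Z' k * V k + Z k * W k) + (∑ k, t * (∑ j, 2 * (P j k * A j)) * V' k +
        ∑ k, t * (∑ j, 2 * (G j k * B j)) * V' k + ∑ k, t * (∑ j, 2 * (G j k * A j)) * W' k) := by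
    rw [Finset.mul_sum, ← Finset.sum_add_distrib, ← Finset.sum_add_distrib, ← Finset.sum_add_distrib]
    refine Finset.sum_congr rfl fun k _ => ?_
    simp only [mul_add, Finset.sum_add_distrib]
    ring
  rw [e5, e4, ← e1, ← e2, ← e3]
  simp only [Finset.mul_sum, ← Finset.sum_add_distrib]
  refine Finset.sum_congr rfl fun j _ => Finset.sum_congr rfl fun k _ => ?_
  ring

/-! ### Linearization of the geodesic equation and of the boundary condition. -/

section SecondVariation

variable {n : ℕ} {M : Type*} [TopologicalSpace M] [ChartedSpace (EuclideanSpace ℝ (Fin n)) M]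
  [IsManifold (𝓡 n) ∞ M] [T2Space M] [CompactSpace M]

theorem IsSmoothFamily.comp {P Q : Type*} [NormedAddCommGroup P] [NormedSpace ℝ P]
    [NormedAddCommGroup Q] [NormedSpace ℝ Q] {c : P → unitInterval → M} (hc : IsSmoothFamily n c)
    {φ : Q → P} (hφ : ContDiff ℝ ∞ φ) : IsSmoothFamily n (fun q => c (φ q)) := by
  refine ⟨fun q => hc.1 _, fun h hh => ?_⟩
  obtain ⟨Ψ, hΨ, hΨe⟩ := hc.2 h hh
  exact ⟨fun q => Ψ (φ q), hΨ.comp hφ, fun q => hΨe (φ q)⟩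

theorem mdifferentiableAt_velocity_family (g : Metric n M) {c : ℝ × ℝ → M}
    (hc : ContMDiff 𝓘(ℝ, ℝ × ℝ) (𝓡 n) ∞ c) (u : ℝ) :
    MDifferentiableAt 𝓘(ℝ, ℝ) (𝓡 n).tangent (fun u => velocity (n := n) (fun v => c (u, v)) 0) u := by
  obtain ⟨Φ⟩ := nonempty_frame n M
  have hcu : ∀ u, ContMDiff 𝓘(ℝ, ℝ) (𝓡 n) ∞ (fun v => c (u, v)) := fun u =>
    hc.comp (contDiff_const.prodMk contDiff_id).contMDiff
  have hc0 : ContMDiff 𝓘(ℝ, ℝ) (𝓡 n) ∞ (fun u => c (u, 0)) :=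
    hc.comp (contDiff_id.prodMk contDiff_const).contMDiff
  have hd : ∀ j, ContMDiff 𝓘(ℝ, ℝ) 𝓘(ℝ, ℝ) ∞
      (fun u => fiberDeriv (Φ.h j) (velocity (n := n) (fun v => c (u, v)) 0)) := by
    intro j
    have h2 : ContDiff ℝ ∞ (Φ.h j ∘ c) := contMDiff_iff_contDiff.1 ((Φ.contMDiff_h j).comp hc)
    have h3 : (fun u => fiberDeriv (Φ.h j) (velocity (n := n) (fun v => c (u, v)) 0)) =
        fun u => fderiv ℝ (Φ.h j ∘ c) (u, 0) (0, 1) := by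
      funext u
      refine (fiberDeriv_velocity (Φ.contMDiff_h j) ((hcu u 0).mdifferentiableAt (by simp))).unique ?_
      exact hasDerivAt_comp_fderiv (L := Φ.h j ∘ c) (y := fun v => (u, v))
        (h2.differentiable (by simp) (u, 0))
        ((hasDerivAt_const (0 : ℝ) u).prodMk (hasDerivAt_id (0 : ℝ)))
    rw [h3]
    exact (((h2.fderiv_right (m := ∞) (by simp)).comp
      (contDiff_id.prodMk contDiff_const)).clm_apply contDiff_const).contMDiff
  refine ContMDiffAt.mdifferentiableAt (Φ.contMDiffAt_tangent g (hc0 u) fun k => ?_) (by simp)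
  have h1 : (fun u => metricAt g (velocity (n := n) (fun v => c (u, v)) 0).1
      (vec (velocity (n := n) (fun v => c (u, v)) 0))
      (Φ.X k (velocity (n := n) (fun v => c (u, v)) 0).1)) =
      fun u => ∑ j, ∑ l, Φ.coeff g j l (c (u, 0)) *
        (fiberDeriv (Φ.h j) (velocity (n := n) (fun v => c (u, v)) 0) *
          diffAt n (Φ.h l) (c (u, 0)) (Φ.X k (c (u, 0)))) :=
    funext fun s => Φ.metricAt_eq_sum g _ _ _
  rw [h1]
  exact ContMDiffAt.sum fun j _ => ContMDiffAt.sum fun l _ =>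
    (((Φ.contMDiff_coeff g j l).comp hc0) u).mul ((hd j u).mul
      (((Φ.contMDiff_diffAt_X (Φ.contMDiff_h l) k).comp hc0) u))

variable (g : Metric n M)

/-- The derivative of the geodesic equation along a variation. -/
theorem Frame.sum_deriv_spray_eq (Φ : Frame n M) (g : Metric n M) {a b : ℝ → TM n M} {r : ℝ}
    (ha : MDifferentiableAt 𝓘(ℝ, ℝ) (𝓡 n).tangent a r)
    (hb : MDifferentiableAt 𝓘(ℝ, ℝ) (𝓡 n).tangent b r) (hab : (a r).1 = (b r).1)
    (hv : ∀ h : M → ℝ, ContMDiff (𝓡 n) 𝓘(ℝ, ℝ) ∞ h →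
      deriv (fun r => h (a r).1) r = deriv (fun r => h (b r).1) r) :
    ∑ k, (deriv (fun r => diffTM (Φ.momentum g k) (a r) (Φ.spray g (a r))) r *
        fiberDeriv (Φ.h k) (b r) + diffTM (Φ.momentum g k) (a r) (Φ.spray g (a r)) *
        deriv (fun r => fiberDeriv (Φ.h k) (b r)) r) =
      ∑ j, ∑ k, (deriv (fun r => fiberDeriv (Φ.coeff g j k) (b r)) r *
        (fiberDeriv (Φ.h j) (a r) * fiberDeriv (Φ.h k) (a r)) +
        fiberDeriv (Φ.coeff g j k) (b r) *
        (deriv (fun r => fiberDeriv (Φ.h j) (a r)) r * fiberDeriv (Φ.h k) (a r) +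
          fiberDeriv (Φ.h j) (a r) * deriv (fun r => fiberDeriv (Φ.h k) (a r)) r)) := by
  -- The geodesic equation is a relation `∑ A_i(p) B_i(q) = 0` on the fibre product, between the
  -- velocity `p` and a test vector `q` over the same point, so it can be differentiated without a
  -- connection.
  have h := Φ.sum_deriv_eq_zero g (ι := Φ.J ⊕ Φ.J × Φ.J)
    (A := Sum.elim (fun k q => diffTM (Φ.momentum g k) q (Φ.spray g q))
      (fun i q => -(fiberDeriv (Φ.h i.1) q * fiberDeriv (Φ.h i.2) q)))
    (B := Sum.elim (fun k => fiberDeriv (Φ.h k)) (fun i => fiberDeriv (Φ.coeff g i.1 i.2)))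
    (by
      rintro (k | i)
      · exact Φ.contMDiff_diffTM_spray g (Φ.contMDiff_momentum g k)
      · exact ((contMDiff_fiberDeriv (Φ.contMDiff_h _)).mul
          (contMDiff_fiberDeriv (Φ.contMDiff_h _))).neg)
    (by
      rintro (k | i)
      · exact contMDiff_fiberDeriv (Φ.contMDiff_h k)
      · exact contMDiff_fiberDeriv (Φ.contMDiff_coeff g _ _))
    (by
      intro p q hpq
      have h1 := Φ.eulerLagrange_spray g p (vec q)
      rw [eulerLagrange, sub_eq_zero] at h1
      rw [hpq] at h1
      simp only [Fintype.sum_sum_type, Sum.elim_inl, Sum.elim_inr, Fintype.sum_prod_type]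
      refine Eq.trans (congrArg (· + _) h1) ?_
      rw [← Finset.sum_add_distrib]
      refine Finset.sum_eq_zero fun j _ => ?_
      rw [← Finset.sum_add_distrib]
      refine Finset.sum_eq_zero fun k _ => ?_
      simp only [fiberDeriv]
      ring)
    ha hb hab hv
  simp only [Fintype.sum_sum_type, Sum.elim_inl, Sum.elim_inr, Fintype.sum_prod_type] at h
  rw [← sub_eq_zero, ← h, sub_eq_add_neg]
  refine congrArg₂ (· + ·) rfl ?_
  rw [← Finset.sum_neg_distrib]
  refine Finset.sum_congr rfl fun j _ => ?_
  rw [← Finset.sum_neg_distrib]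
  refine Finset.sum_congr rfl fun k _ => ?_
  have h1 := hasDerivAt_velTM (contMDiff_fiberDeriv (Φ.contMDiff_h j)) ha
  have h2 := hasDerivAt_velTM (contMDiff_fiberDeriv (Φ.contMDiff_h k)) ha
  have h3 : HasDerivAt (fun r => -(fiberDeriv (Φ.h j) (a r) * fiberDeriv (Φ.h k) (a r))) _ r :=
    (h1.fun_mul h2).neg
  rw [h3.deriv, h1.deriv, h2.deriv]
  ring

/-- The derivative of the boundary condition of `Λ(f)` along a variation. -/
theorem Frame.sum_deriv_symplecticLift_eq (Φ : Frame n M) (g : Metric n M)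
    (f : M ≃ₘ⟮𝓡 n, 𝓡 n⟯ M) {a b : ℝ → TM n M} {r : ℝ}
    (ha : MDifferentiableAt 𝓘(ℝ, ℝ) (𝓡 n).tangent a r)
    (hb : MDifferentiableAt 𝓘(ℝ, ℝ) (𝓡 n).tangent b r) (hab : (a r).1 = (b r).1)
    (hv : ∀ h : M → ℝ, ContMDiff (𝓡 n) 𝓘(ℝ, ℝ) ∞ h →
      deriv (fun r => h (a r).1) r = deriv (fun r => h (b r).1) r) :
    ∑ k, (deriv (fun r => Φ.momentum g k (symplecticLift g f (a r))) r *
        fiberDeriv (fun y => Φ.h k (f y)) (b r) + Φ.momentum g k (symplecticLift g f (a r)) *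
        deriv (fun r => fiberDeriv (fun y => Φ.h k (f y)) (b r)) r) =
    ∑ k, (deriv (fun r => Φ.momentum g k (a r)) r * fiberDeriv (Φ.h k) (b r) +
      Φ.momentum g k (a r) * deriv (fun r => fiberDeriv (Φ.h k) (b r)) r) := by
  have hhf : ∀ k, ContMDiff (𝓡 n) 𝓘(ℝ, ℝ) ∞ (fun y => Φ.h k (f y)) := fun k =>
    (Φ.contMDiff_h k).comp f.contMDiff
  -- Here the relation on the fibre product is `⟨f̂ p, df q⟩ = ⟨p, q⟩`.
  have h := Φ.sum_deriv_eq_zero g (ι := Φ.J ⊕ Φ.J)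
    (A := Sum.elim (fun k q => Φ.momentum g k (symplecticLift g f q))
      (fun k q => -Φ.momentum g k q))
    (B := Sum.elim (fun k => fiberDeriv (fun y => Φ.h k (f y))) (fun k => fiberDeriv (Φ.h k)))
    (by
      rintro (k | k)
      · exact (Φ.contMDiff_momentum g k).comp (contMDiff_symplecticLift g f Φ)
      · exact (Φ.contMDiff_momentum g k).neg)
    (by
      rintro (k | k)
      · exact contMDiff_fiberDeriv (hhf k)
      · exact contMDiff_fiberDeriv (Φ.contMDiff_h k))
    (by
      intro p q hpq
      have h1 := Φ.sum_momentum_symplecticLift g f p (vec q)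
      simp only [← diffAt_comp f (Φ.contMDiff_h _)] at h1
      rw [hpq] at h1
      simp only [Fintype.sum_sum_type, Sum.elim_inl, Sum.elim_inr]
      refine Eq.trans (congrArg (· + _) h1) ?_
      rw [← Finset.sum_add_distrib]
      refine Finset.sum_eq_zero fun k _ => ?_
      simp only [fiberDeriv]
      ring)
    ha hb hab hv
  simp only [Fintype.sum_sum_type, Sum.elim_inl, Sum.elim_inr] at h
  rw [← sub_eq_zero, ← h, sub_eq_add_neg]
  refine congrArg₂ (· + ·) rfl ?_
  rw [← Finset.sum_neg_distrib]
  refine Finset.sum_congr rfl fun k _ => ?_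
  have h1 := hasDerivAt_velTM (Φ.contMDiff_momentum g k) ha
  have h3 : HasDerivAt (fun r => -Φ.momentum g k (a r)) _ r := h1.neg
  rw [h3.deriv, h1.deriv]
  ring

end SecondVariation

end

end TranslatedPoint

namespace TranslatedPoint

noncomputable section

/-! ### The Hessian on broken Jacobi fields. -/

section HessianJacobi

variable {n : ℕ} {M : Type*} [TopologicalSpace M] [ChartedSpace (EuclideanSpace ℝ (Fin n)) M]
  [IsManifold (𝓡 n) ∞ M] [T2Space M] [CompactSpace M] (g : Metric n M)

theorem hasDerivAt_jacobi_mul (Φ : Frame n M) {K : TM n M → ℝ}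
    (hK : ContMDiff (𝓡 n).tangent 𝓘(ℝ, ℝ) ∞ K) (p : TM n M)
    (ζ : EuclideanSpace ℝ (Fin n) × EuclideanSpace ℝ (Fin n)) (t s : ℝ) :
    HasDerivAt (fun s => jacobi g p ζ K (t * s))
      (t * jacobi g p ζ (fun q => diffTM K q (Φ.spray g q)) (t * s)) s := by
  have h := HasDerivAt.comp s (Φ.hasDerivAt_jacobi g hK p ζ (t * s))
    ((hasDerivAt_id s).const_mul t)
  rw [mul_one, mul_comm] at h
  exact h

theorem contDiff_jacobi_mul {K : TM n M → ℝ} (hK : ContMDiff (𝓡 n).tangent 𝓘(ℝ, ℝ) ∞ K) (p : TM n M)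
    (ζ : EuclideanSpace ℝ (Fin n) × EuclideanSpace ℝ (Fin n)) (t : ℝ) :
    ContDiff ℝ 1 (fun s => jacobi g p ζ K (t * s)) :=
  (contDiff_jacobi g hK p ζ).comp (contDiff_const.mul contDiff_id)

/-- An `H¹` function that represents the derivative of a function along a Jacobi field. -/
theorem ae_snd_jacobi (Φ : Frame n M) {h : M → ℝ} (hh : ContMDiff (𝓡 n) 𝓘(ℝ, ℝ) ∞ h) {p : TM n M}
    {ζ : EuclideanSpace ℝ (Fin n) × EuclideanSpace ℝ (Fin n)} {t a b : ℝ}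
    (ha : a ∈ Set.Icc (0 : ℝ) 1) (hb : b ∈ Set.Icc (0 : ℝ) 1) {u : H1}
    (hu : ∀ s ∈ Set.Icc a b, evalReal u s = jacobi g p ζ (fun q => h q.1) (t * s)) :
    ∀ᵐ s, s ∈ Set.Ioo a b → u.2 s = t * jacobi g p ζ (fiberDeriv h) (t * s) := by
  filter_upwards [ae_snd_eq_deriv ha hb hu] with s hs hs'
  rw [hs hs', (hasDerivAt_jacobi_mul g Φ (contMDiff_comp_fst hh) p ζ t s).deriv,
    funext (Φ.diffTM_comp_fst_spray g hh)]

/-- A two-parameter family of paths with a geodesic at the origin, in terms of the `H¹` functions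
that represent its composition with a smooth function and the derivatives of these. -/
structure Jet (c : ℝ × ℝ → unitInterval → M) (h : M → ℝ) where
  U : ℝ × ℝ → H1
  a : H1
  b : ℝ → H1
  d : H1
  eval : ∀ z s, h (c z s) = (U z).eval s
  hasDerivAt_a : HasDerivAt (fun u => U (u, 0)) a 0
  hasDerivAt_b : ∀ u, HasDerivAt (fun v => U (u, v)) (b u) 0
  hasDerivAt_d : HasDerivAt b d 0

theorem IsSmoothFamily.nonempty_jet {c : ℝ × ℝ → unitInterval → M} (hc : IsSmoothFamily n c)
    {h : M → ℝ} (hh : ContMDiff (𝓡 n) 𝓘(ℝ, ℝ) ∞ h) : Nonempty (Jet c h) := by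
  obtain ⟨Ψ, hΨ, hΨe⟩ := hc.2 h hh
  obtain ⟨a, b, d, ha, hb, hd⟩ := exists_partials hΨ
  exact ⟨⟨Ψ, a, b, d, hΨe, ha, hb, hd⟩⟩

section JetLemmas

variable {c : ℝ × ℝ → unitInterval → M} {h : M → ℝ}

theorem Jet.evalReal_a (hc : IsSmoothFamily n c) (hh : ContMDiff (𝓡 n) 𝓘(ℝ, ℝ) ∞ h) (j : Jet c h)
    (s : unitInterval) :
    evalReal j.a s = fiberDeriv (n := n) h (variation (fun u => c (u, 0)) s) := by
  have h1 := hasDerivAt_eval j.hasDerivAt_a s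
  rw [← funext fun u => j.eval (u, 0) s] at h1
  exact h1.unique ((hc.comp (contDiff_id.prodMk contDiff_const)).hasDerivAt hh s)

theorem Jet.evalReal_b (hc : IsSmoothFamily n c) (hh : ContMDiff (𝓡 n) 𝓘(ℝ, ℝ) ∞ h) (j : Jet c h)
    (u : ℝ) (s : unitInterval) :
    evalReal (j.b u) s = fiberDeriv (n := n) h (variation (fun v => c (u, v)) s) := by
  have h1 := hasDerivAt_eval (j.hasDerivAt_b u) s
  rw [← funext fun v => j.eval (u, v) s] at h1
  exact h1.unique ((hc.comp (contDiff_const.prodMk contDiff_id)).hasDerivAt hh s)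

theorem Jet.deriv_evalReal_b (j : Jet c h) (s : unitInterval) :
    deriv (fun u => evalReal (j.b u) s) 0 = evalReal j.d s :=
  (hasDerivAt_eval j.hasDerivAt_d s).deriv

theorem Jet.evalReal_d (hc : IsSmoothFamily n c) (hh : ContMDiff (𝓡 n) 𝓘(ℝ, ℝ) ∞ h) (j : Jet c h)
    (s : unitInterval) : evalReal j.d s =
      deriv (fun u => fiberDeriv (n := n) h (variation (fun v => c (u, v)) s)) 0 := by
  rw [← j.deriv_evalReal_b, funext fun u => j.evalReal_b hc hh u s]

end JetLemmas

/-- The first boundary term of the second variation. -/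
theorem Frame.boundary_eq (Φ : Frame n M) (g : Metric n M) (f : M ≃ₘ⟮𝓡 n, 𝓡 n⟯ M) {t : ℝ} {p : TM n M}
    (hp : symplecticLift g f p = geodesicFlow g t p)
    {c : ℝ × ℝ → unitInterval → M} (hc : IsSmoothFamily n c) (hcf : ∀ z, c z ∈ Lam n f)
    (hc0 : c (0, 0) = associatedGeodesic g t p)
    {ξ η : EuclideanSpace ℝ (Fin n) × EuclideanSpace ℝ (Fin n)}
    (hend : mapTM (geodesicFlow g t) p η = mapTM (symplecticLift g f) p ξ)
    (hξ : ∀ h : M → ℝ, ContMDiff (𝓡 n) 𝓘(ℝ, ℝ) ∞ h →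
      fiberDeriv (n := n) h (variation (fun u => c (u, 0)) 0) = diffTM (fun q => h q.1) p ξ) :
    ∑ k, (jacobi g p η (Φ.momentum g k) t *
        fiberDeriv (n := n) (Φ.h k) (variation (fun v => c (0, v)) 1) +
      Φ.momentum g k (geodesicFlow g t p) *
        deriv (fun u => fiberDeriv (n := n) (Φ.h k) (variation (fun v => c (u, v)) 1)) 0) =
    ∑ k, (diffTM (Φ.momentum g k) p ξ *
        fiberDeriv (n := n) (Φ.h k) (variation (fun v => c (0, v)) 0) +
      Φ.momentum g k p *
        deriv (fun u => fiberDeriv (n := n) (Φ.h k) (variation (fun v => c (u, v)) 0)) 0) := by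
  obtain ⟨α, hα, hα0, rfl⟩ := exists_curve_velTM p ξ
  have hα' := hα.mdifferentiableAt (by simp)
  have hb : MDifferentiableAt 𝓘(ℝ, ℝ) (𝓡 n).tangent
      (fun u => variation (n := n) (fun v => c (u, v)) 0) 0 :=
    mdifferentiableAt_velocity_family g (hc.contMDiff 0) 0
  have h00 : c (0, 0) 0 = p.1 := by rw [hc0, associatedGeodesic_zero]
  -- The curve `α` carries initial velocities of geodesics, the curve `b` the `v`-variations at time
  -- `0`. Their base points and base velocities need to agree at `u = 0` only; the latter is `hξ`.
  have h := Φ.sum_deriv_symplecticLift_eq g f (a := α)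
    (b := fun u => variation (n := n) (fun v => c (u, v)) 0) (r := 0) hα' hb
    (by rw [hα0]; exact h00.symm)
    (fun h hh => by
      have e1 := (hasDerivAt_velTM (contMDiff_comp_fst hh) hα').deriv
      rw [hα0, ← hξ h hh] at e1
      refine e1.trans ?_
      exact ((hc.comp (contDiff_id.prodMk contDiff_const)).hasDerivAt hh 0).deriv.symm)
  have e1 : ∀ k u, fiberDeriv (n := n) (Φ.h k) (variation (fun v => c (u, v)) 1) =
      fiberDeriv (n := n) (fun y => Φ.h k (f y)) (variation (fun v => c (u, v)) 0) := by
    intro k u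
    refine Eq.trans (fiberDeriv_variation_one f (hc.comp (contDiff_const.prodMk contDiff_id))
      (fun v => hcf (u, v)) (Φ.contMDiff_h k)) ?_
    rw [← diffAt_comp f (Φ.contMDiff_h k)]
    rfl
  have e3 : ∀ k, deriv (fun r => Φ.momentum g k (symplecticLift g f (α r))) 0 =
      jacobi g p η (Φ.momentum g k) t := by
    intro k
    have e4 := (hasDerivAt_velTM ((Φ.contMDiff_momentum g k).comp
      (contMDiff_symplecticLift g f Φ)) hα').deriv
    refine e4.trans ?_
    rw [hα0]
    refine Eq.trans (diffTM_comp (Φ.contMDiff_momentum g k)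
      ((contMDiff_symplecticLift g f Φ p).mdifferentiableAt (by simp)) _) ?_
    rw [← hend, hp]
    rfl
  simp only [e1]
  rw [← hp]
  simp only [e3, (hasDerivAt_velTM (Φ.contMDiff_momentum g _) hα').deriv, hα0] at h
  exact h

/-- The linearized geodesic equation, for a variation by geodesics. -/
theorem Frame.sum_jacobi_spray_eq (Φ : Frame n M) (g : Metric n M) {t : ℝ} {p : TM n M}
    {c : ℝ × ℝ → unitInterval → M} (hc : IsSmoothFamily n c)
    (hc0 : c (0, 0) = associatedGeodesic g t p)
    {ζ : EuclideanSpace ℝ (Fin n) × EuclideanSpace ℝ (Fin n)} (s : unitInterval)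
    (hζ : ∀ h : M → ℝ, ContMDiff (𝓡 n) 𝓘(ℝ, ℝ) ∞ h →
      fiberDeriv (n := n) h (variation (fun u => c (u, 0)) s) =
        jacobi g p ζ (fun q => h q.1) (t * s))
    (U : ∀ j, Jet c (Φ.h j)) (Γ : ∀ j k, Jet c (Φ.coeff g j k)) :
    ∑ k, (jacobi g p ζ (fun q => diffTM (Φ.momentum g k) q (Φ.spray g q)) (t * s) *
        evalReal ((U k).b 0) s +
      diffTM (Φ.momentum g k) (geodesicFlow g (t * s) p) (Φ.spray g (geodesicFlow g (t * s) p)) *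
        evalReal (U k).d s) =
    ∑ j, ∑ k, (evalReal (Γ j k).d s * (fiberDeriv (Φ.h j) (geodesicFlow g (t * s) p) *
        fiberDeriv (Φ.h k) (geodesicFlow g (t * s) p)) +
      evalReal ((Γ j k).b 0) s * (jacobi g p ζ (fiberDeriv (Φ.h j)) (t * s) *
          fiberDeriv (Φ.h k) (geodesicFlow g (t * s) p) +
        fiberDeriv (Φ.h j) (geodesicFlow g (t * s) p) *
          jacobi g p ζ (fiberDeriv (Φ.h k)) (t * s))) := by
  obtain ⟨α, hα, hα0, rfl⟩ := exists_curve_velTM p ζ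
  have hα' := hα.mdifferentiableAt (by simp)
  have ha : MDifferentiableAt 𝓘(ℝ, ℝ) (𝓡 n).tangent (fun u => geodesicFlow g (t * s) (α u)) 0 :=
    ((contMDiff_geodesicFlow_apply g (t * s) (α 0)).mdifferentiableAt (by simp)).comp 0 hα'
  have h := Φ.sum_deriv_spray_eq g (a := fun u => geodesicFlow g (t * s) (α u))
    (b := fun u => variation (n := n) (fun v => c (u, v)) s) (r := 0) ha
    (mdifferentiableAt_velocity_family g (hc.contMDiff s) 0)
    (by
      rw [hα0]
      exact (congrFun hc0 s).symm)
    (fun h hh => by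
      refine (jacobi_eq g (contMDiff_comp_fst hh) p hα' hα0 (t * s)).deriv.trans ?_
      rw [← hζ h hh]
      exact ((hc.comp (contDiff_id.prodMk contDiff_const)).hasDerivAt hh s).deriv.symm)
  simp only [hα0, (jacobi_eq g (Φ.contMDiff_diffTM_spray g (Φ.contMDiff_momentum g _)) p hα' hα0
    (t * s)).deriv, (jacobi_eq g (contMDiff_fiberDeriv (Φ.contMDiff_h _)) p hα' hα0 (t * s)).deriv,
    ← (U _).evalReal_b hc (Φ.contMDiff_h _), ← (Γ _ _).evalReal_b hc (Φ.contMDiff_coeff g _ _),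
    Jet.deriv_evalReal_b] at h
  exact h

/-- The second variation, when one of the two vector fields is a Jacobi field which is broken at
one point. -/
theorem deriv_deriv_energy_eq (f : M ≃ₘ⟮𝓡 n, 𝓡 n⟯ M) {t : ℝ} {p : TM n M}
    (hp : symplecticLift g f p = geodesicFlow g t p)
    {c : ℝ × ℝ → unitInterval → M} (hc : IsSmoothFamily n c) (hcf : ∀ z, c z ∈ Lam n f)
    (hc0 : c (0, 0) = associatedGeodesic g t p) (s₀ : unitInterval)
    {ξ η ζ : EuclideanSpace ℝ (Fin n) × EuclideanSpace ℝ (Fin n)} {w : EuclideanSpace ℝ (Fin n)}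
    (hend : mapTM (geodesicFlow g t) p η = mapTM (symplecticLift g f) p ξ)
    (hjump : mapTM (geodesicFlow g (t * s₀)) p η - mapTM (geodesicFlow g (t * s₀)) p ξ = ζ)
    (hζ : ∀ h : M → ℝ, ContMDiff (𝓡 n) 𝓘(ℝ, ℝ) ∞ h →
      diffTM (fun q => h q.1) (geodesicFlow g (t * s₀) p) ζ = 0)
    (hζ' : ∀ h : M → ℝ, ContMDiff (𝓡 n) 𝓘(ℝ, ℝ) ∞ h →
      diffTM (fiberDeriv h) (geodesicFlow g (t * s₀) p) ζ =
        diffAt n h (geodesicFlow g (t * s₀) p).1 w)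
    (hξ : ∀ h : M → ℝ, ContMDiff (𝓡 n) 𝓘(ℝ, ℝ) ∞ h → ∀ s : unitInterval, s ≤ s₀ →
      fiberDeriv (n := n) h (variation (fun u => c (u, 0)) s) =
        jacobi g p ξ (fun q => h q.1) (t * s))
    (hη : ∀ h : M → ℝ, ContMDiff (𝓡 n) 𝓘(ℝ, ℝ) ∞ h → ∀ s : unitInterval, s₀ ≤ s →
      fiberDeriv (n := n) h (variation (fun u => c (u, 0)) s) =
        jacobi g p η (fun q => h q.1) (t * s)) :
    deriv (fun u => deriv (fun v => energy g (c (u, v))) 0) 0 =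
      -(2 * t) * metricAt g (geodesicFlow g (t * s₀) p).1 w
        (vec (variation (n := n) (fun v => c (0, v)) s₀)) := by
  obtain ⟨Φ⟩ := nonempty_frame n M
  have hjet : ∀ {h : M → ℝ} (hh : ContMDiff (𝓡 n) 𝓘(ℝ, ℝ) ∞ h), Nonempty (Jet c h) :=
    fun hh => hc.nonempty_jet hh
  let U : ∀ j, Jet c (Φ.h j) := fun j => (hjet (Φ.contMDiff_h j)).some
  let Γ : ∀ j k, Jet c (Φ.coeff g j k) := fun j k => (hjet (Φ.contMDiff_coeff g j k)).some
  have hE : ∀ u v, energy g (c (u, v)) = ∑ j, ∑ k, energyForm ((Γ j k).U (u, v)) ((U j).U (u, v))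
      ((U k).U (u, v)) := fun u v => Φ.energy_eq g (hcf (u, v)).1.1 (fun j s => (U j).eval _ s)
        (fun j k s => (Γ j k).eval _ s)
  have hD : ∀ u, HasDerivAt (fun v => ∑ j, ∑ k, energyForm ((Γ j k).U (u, v)) ((U j).U (u, v))
      ((U k).U (u, v))) _ 0 := fun u =>
    HasDerivAt.fun_sum fun j _ => HasDerivAt.fun_sum fun k _ =>
      TranslatedPoint.HasDerivAt.energyForm ((Γ j k).hasDerivAt_b u) ((U j).hasDerivAt_b u)
        ((U k).hasDerivAt_b u)
  have hD2 : HasDerivAt (fun u => ∑ j, ∑ k,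
      (energyForm ((Γ j k).b u) ((U j).U (u, 0)) ((U k).U (u, 0)) +
        energyForm ((Γ j k).U (u, 0)) ((U j).b u) ((U k).U (u, 0)) +
        energyForm ((Γ j k).U (u, 0)) ((U j).U (u, 0)) ((U k).b u))) _ 0 :=
    HasDerivAt.fun_sum fun j _ => HasDerivAt.fun_sum fun k _ =>
      HasDerivAt.fun_add (HasDerivAt.fun_add (TranslatedPoint.HasDerivAt.energyForm
        (Γ j k).hasDerivAt_d (U j).hasDerivAt_a (U k).hasDerivAt_a)
      (TranslatedPoint.HasDerivAt.energyForm
        (Γ j k).hasDerivAt_a (U j).hasDerivAt_d (U k).hasDerivAt_a))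
      (TranslatedPoint.HasDerivAt.energyForm
        (Γ j k).hasDerivAt_a (U j).hasDerivAt_a (U k).hasDerivAt_d)
  have hI := HasUnitIntegral.sum (A := Finset.univ) fun j (_ : j ∈ Finset.univ) =>
    HasUnitIntegral.sum (A := Finset.univ) fun k (_ : k ∈ Finset.univ) =>
    ((((hasUnitIntegral_energyForm (Γ j k).d ((U j).U (0, 0)) ((U k).U (0, 0))).add
      (hasUnitIntegral_energyForm ((Γ j k).b 0) (U j).a ((U k).U (0, 0)))).add
      (hasUnitIntegral_energyForm ((Γ j k).b 0) ((U j).U (0, 0)) (U k).a)).add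
    (((hasUnitIntegral_energyForm (Γ j k).a ((U j).b 0) ((U k).U (0, 0))).add
      (hasUnitIntegral_energyForm ((Γ j k).U (0, 0)) (U j).d ((U k).U (0, 0)))).add
      (hasUnitIntegral_energyForm ((Γ j k).U (0, 0)) ((U j).b 0) (U k).a))).add
    (((hasUnitIntegral_energyForm (Γ j k).a ((U j).U (0, 0)) ((U k).b 0)).add
      (hasUnitIntegral_energyForm ((Γ j k).U (0, 0)) (U j).a ((U k).b 0))).add
      (hasUnitIntegral_energyForm ((Γ j k).U (0, 0)) ((U j).U (0, 0)) (U k).d))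
  refine Eq.trans (Eq.trans (congrArg (fun F => deriv F 0) (funext fun u =>
    (congrArg (fun F => deriv F 0) (funext fun v => hE u v)).trans (hD u).deriv))
    (hD2.deriv.trans hI.2.symm)) ?_
  have hs₀ : (s₀ : ℝ) ∈ Set.uIcc (0 : ℝ) 1 := by
    rw [Set.uIcc_of_le zero_le_one]; exact s₀.2
  rw [← intervalIntegral.integral_add_adjacent_intervals
    (hI.1.mono_set (Set.uIcc_subset_uIcc_left hs₀)) (hI.1.mono_set (Set.uIcc_subset_uIcc_right hs₀))]
  -- The `u`-derivative of `t ∑ Q_k V_k`, where the geodesic varies in the direction `ζ` and `V` is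
  -- the `v`-variation. On an interval where the `u`-variation is the Jacobi field of `ζ`, this is
  -- an antiderivative of the integrand of the second variation.
  let B : EuclideanSpace ℝ (Fin n) × EuclideanSpace ℝ (Fin n) → ℝ → ℝ := fun ζ s =>
    ∑ k, t * (jacobi g p ζ (Φ.momentum g k) (t * s) * evalReal ((U k).b 0) s +
      Φ.momentum g k (geodesicFlow g (t * s) p) * evalReal (U k).d s)
  have piece : ∀ (ζ : EuclideanSpace ℝ (Fin n) × EuclideanSpace ℝ (Fin n)) (a b : unitInterval),
      a ≤ b → (∀ h : M → ℝ, ContMDiff (𝓡 n) 𝓘(ℝ, ℝ) ∞ h → ∀ s : unitInterval, a ≤ s → s ≤ b →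
        fiberDeriv (n := n) h (variation (fun u => c (u, 0)) s) =
        jacobi g p ζ (fun q => h q.1) (t * s)) →
      ∫ s in (a : ℝ)..b, (∑ j, ∑ k, (evalReal (Γ j k).d s * ((U j).U (0, 0)).2 s * ((U k).U (0, 0)).2 s +
        evalReal ((Γ j k).b 0) s * (U j).a.2 s * ((U k).U (0, 0)).2 s +
        evalReal ((Γ j k).b 0) s * ((U j).U (0, 0)).2 s * (U k).a.2 s +
        (evalReal (Γ j k).a s * ((U j).b 0).2 s * ((U k).U (0, 0)).2 s +
        evalReal ((Γ j k).U (0, 0)) s * (U j).d.2 s * ((U k).U (0, 0)).2 s +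
        evalReal ((Γ j k).U (0, 0)) s * ((U j).b 0).2 s * (U k).a.2 s) +
        (evalReal (Γ j k).a s * ((U j).U (0, 0)).2 s * ((U k).b 0).2 s +
        evalReal ((Γ j k).U (0, 0)) s * (U j).a.2 s * ((U k).b 0).2 s +
        evalReal ((Γ j k).U (0, 0)) s * ((U j).U (0, 0)).2 s * (U k).d.2 s))) = B ζ b - B ζ a := by
    intro ζ a b hab hζ
    have hac : AbsolutelyContinuousOnInterval (B ζ) a b := by
      refine absolutelyContinuousOnInterval_sum _ fun k _ =>
        AbsolutelyContinuousOnInterval.const_mul t (((contDiff_jacobi_mul g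
          (Φ.contMDiff_momentum g k) p ζ t).contDiffOn.absolutelyContinuousOnInterval.mul
          (absolutelyContinuousOnInterval_evalReal _ a.2 b.2)).add
          ((((contDiff_geodesicFlow_mul g (Φ.contMDiff_momentum g k) p t).of_le (m := 1)
            (by simp)).contDiffOn.absolutelyContinuousOnInterval).mul
          (absolutelyContinuousOnInterval_evalReal _ a.2 b.2)))
    refine integral_eq_sub_of_ae_hasDerivAt hab hac ?_
    have ae1 : ∀ᵐ s, ∀ j, s ∈ Set.Ioo (0 : ℝ) 1 → ((U j).U (0, 0)).2 s =
        t * fiberDeriv (Φ.h j) (geodesicFlow g (t * s) p) := ae_all_iff.2 fun j =>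
      ae_snd_geodesic g (Φ.contMDiff_h j) fun s => (congrArg (Φ.h j) (congrFun hc0 s)).symm.trans
        ((U j).eval _ s)
    have ae2 : ∀ᵐ s, ∀ j, s ∈ Set.Ioo (a : ℝ) b → (U j).a.2 s =
        t * jacobi g p ζ (fiberDeriv (Φ.h j)) (t * s) := ae_all_iff.2 fun j =>
      ae_snd_jacobi g Φ (Φ.contMDiff_h j) a.2 b.2 fun s hs => by
        have hs' : s ∈ Set.Icc (0 : ℝ) 1 := ⟨a.2.1.trans hs.1, hs.2.trans b.2.2⟩
        exact ((U j).evalReal_a hc (Φ.contMDiff_h j) ⟨s, hs'⟩).trans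
          (hζ _ (Φ.contMDiff_h j) ⟨s, hs'⟩ hs.1 hs.2)
    have ae3 : ∀ᵐ s, ∀ j, s ∈ Set.Icc (0 : ℝ) 1 → HasDerivAt (evalReal ((U j).b 0))
        (((U j).b 0).2 s) s := ae_all_iff.2 fun j => ae_hasDerivAt_evalReal _
    have ae4 : ∀ᵐ s, ∀ j, s ∈ Set.Icc (0 : ℝ) 1 → HasDerivAt (evalReal (U j).d)
        ((U j).d.2 s) s := ae_all_iff.2 fun j => ae_hasDerivAt_evalReal _
    filter_upwards [ae1, ae2, ae3, ae4] with s hs1 hs2 hs3 hs4 hs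
    have hs' : s ∈ Set.Icc (0 : ℝ) 1 := ⟨a.2.1.trans hs.1.le, hs.2.le.trans b.2.2⟩
    have hs'' : s ∈ Set.Ioo (0 : ℝ) 1 := ⟨a.2.1.trans_lt hs.1, hs.2.trans_le b.2.2⟩
    have h1 : HasDerivAt (B ζ) _ s := HasDerivAt.fun_sum fun k _ => HasDerivAt.const_mul t
      (((hasDerivAt_jacobi_mul g Φ (Φ.contMDiff_momentum g k) p ζ t s).fun_mul (hs3 k hs')).fun_add
        ((hasDerivAt_geodesicFlow_mul Φ g (Φ.contMDiff_momentum g k) p t s).fun_mul (hs4 k hs')))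
    refine h1.congr_deriv ?_
    have e2 : ∀ j k, evalReal (Γ j k).a s = jacobi g p ζ (fun q => Φ.coeff g j k q.1) (t * s) :=
      fun j k => ((Γ j k).evalReal_a hc (Φ.contMDiff_coeff g j k) ⟨s, hs'⟩).trans
        (hζ _ (Φ.contMDiff_coeff g j k) ⟨s, hs'⟩ hs.1.le hs.2.le)
    have e3 : ∀ j k, evalReal ((Γ j k).U (0, 0)) s = Φ.coeff g j k (geodesicFlow g (t * s) p).1 :=
      fun j k => ((Γ j k).eval (0, 0) ⟨s, hs'⟩).symm.trans
        (congrArg (Φ.coeff g j k) (congrFun hc0 ⟨s, hs'⟩))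
    have e4 : ∀ k, jacobi g p ζ (Φ.momentum g k) (t * s) =
        ∑ j, 2 * (jacobi g p ζ (fun q => Φ.coeff g j k q.1) (t * s) *
          fiberDeriv (Φ.h j) (geodesicFlow g (t * s) p) +
          Φ.coeff g j k (geodesicFlow g (t * s) p).1 *
          jacobi g p ζ (fiberDeriv (Φ.h j)) (t * s)) := fun k => Φ.diffTM_momentum g _ _ k
    have e5 := Φ.sum_jacobi_spray_eq g hc hc0 ⟨s, hs'⟩
      (fun h hh => hζ h hh ⟨s, hs'⟩ hs.1.le hs.2.le) U Γ
    have e6 := sum_hessian_aux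
      (G := fun j k => Φ.coeff g j k (geodesicFlow g (t * s) p).1)
      (P := fun j k => jacobi g p ζ (fun q => Φ.coeff g j k q.1) (t * s))
      (fun j k => Φ.coeff_symm g j k _)
      (fun j k => congrArg (fun K => jacobi g p ζ K (t * s))
        (funext fun q => Φ.coeff_symm g j k q.1))
      (V' := fun k => ((U k).b 0).2 s) (W' := fun k => (U k).d.2 s) t e5
    simp only [hs1 _ hs'', hs2 _ hs, e2, e3, e4]
    exact e6.symm
  have h1 := piece ξ 0 s₀ s₀.2.1 fun h hh s _ hs => hξ h hh s hs
  have h2 := piece η s₀ 1 s₀.2.2 fun h hh s hs _ => hη h hh s hs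
  refine (congrArg₂ (· + ·) h1 h2).trans ?_
  -- The outer boundary terms cancel by the linearized condition `dG_t η = df̂ ξ`.
  have hends : B η (1 : unitInterval) = B ξ (0 : unitInterval) := by
    have h3 := Φ.boundary_eq g f hp hc hcf hc0 hend fun h hh => by
      rw [hξ h hh 0 s₀.2.1, show t * ((0 : unitInterval) : ℝ) = 0 by simp, jacobi_zero]
    have h4 := congrArg (fun x => t * x) h3
    simp only [Finset.mul_sum] at h4
    refine Eq.trans (Finset.sum_congr rfl fun k _ => ?_) (h4.trans (Finset.sum_congr rfl fun k _ => ?_))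
    · rw [(U k).evalReal_b hc (Φ.contMDiff_h k), (U k).evalReal_d hc (Φ.contMDiff_h k),
        show t * ((1 : unitInterval) : ℝ) = t by simp]
    · rw [(U k).evalReal_b hc (Φ.contMDiff_h k), (U k).evalReal_d hc (Φ.contMDiff_h k),
        show t * ((0 : unitInterval) : ℝ) = 0 by simp, jacobi_zero, geodesicFlow_zero]
  -- At the break the terms with second-order variations cancel, and the momenta jump by their
  -- derivative along the vertical vector `ζ`.
  have hBj : B η s₀ - B ξ s₀ = 2 * t * metricAt g (geodesicFlow g (t * s₀) p).1 w
        (vec (variation (n := n) (fun v => c (0, v)) s₀)) := by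
    have h3 := Φ.diffTM_momentum_vertical g (geodesicFlow g (t * s₀) p) hζ
      (fun j => hζ' _ (Φ.contMDiff_h j)) (vec (variation (n := n) (fun v => c (0, v)) s₀))
    rw [mul_comm 2 t, mul_assoc, ← h3, Finset.mul_sum]
    simp only [B]
    rw [← Finset.sum_sub_distrib]
    refine Finset.sum_congr rfl fun k _ => ?_
    have h4 : jacobi g p η (Φ.momentum g k) (t * s₀) - jacobi g p ξ (Φ.momentum g k) (t * s₀) =
        diffTM (Φ.momentum g k) (geodesicFlow g (t * s₀) p) ζ := by
      rw [← hjump, map_sub]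
      rfl
    have h5 : evalReal ((U k).b 0) s₀ = diffAt n (Φ.h k) (geodesicFlow g (t * s₀) p).1
        (vec (variation (n := n) (fun v => c (0, v)) s₀)) := by
      rw [(U k).evalReal_b hc (Φ.contMDiff_h k)]
      have h6 : c (0, 0) s₀ = (geodesicFlow g (t * s₀) p).1 := congrFun hc0 s₀
      rw [← h6]
      rfl
    rw [← h4, h5]
    ring
  linarith

end HessianJacobi

end

end TranslatedPoint

namespace TranslatedPoint

noncomputable section

/-! ### The exponential map. -/

section Exponential

variable {n : ℕ} {M : Type*} [TopologicalSpace M] [ChartedSpace (EuclideanSpace ℝ (Fin n)) M]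
  [IsManifold (𝓡 n) ∞ M] [T2Space M] [CompactSpace M] (g : Metric n M)

/-- Every term of the geodesic equation is multiplied by `r ^ 2`. -/
theorem IsGeodesic.comp_mul {c : ℝ → M} (hc : IsGeodesic g c) (r : ℝ) :
    IsGeodesic g (fun s => c (r * s)) := by
  refine ⟨hc.1.comp (contDiff_const.mul contDiff_id).contMDiff, fun t => ?_⟩
  intro u w
  have h := hc.2 (r * t) w
  set u₀ : ℝ → EuclideanSpace ℝ (Fin n) := fun s => extChartAt (𝓡 n) (c (r * t)) (c s) with hu₀
  have h1 : deriv u = fun s => r • deriv u₀ (r * s) :=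
    funext fun s => deriv_comp_mul_left r u₀ s
  have h2 : deriv (deriv u) t = r • r • deriv (deriv u₀) (r * t) := by
    rw [h1, deriv_fun_const_smul_field, deriv_comp_mul_left]
  have h3 : u t = u₀ (r * t) := rfl
  simp only [metricInChart_eq_localMetric] at h ⊢
  rw [h2, h1, h3]
  have h4 : ∀ (a : ℝ) (F : EuclideanSpace ℝ (Fin n) → ℝ) (y v : EuclideanSpace ℝ (Fin n)),
      fderiv ℝ (fun y => a * F y) y v = a * fderiv ℝ F y v := fun a F y v =>
    congrArg (fun L : EuclideanSpace ℝ (Fin n) →L[ℝ] ℝ => L v)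
      (congrFun (fderiv_const_smul_field (f := F) a) y)
  simp only [map_smul, smul_apply, smul_eq_mul, ← mul_assoc, h4]
  linear_combination r ^ 2 * h

theorem isGeodesic_geodesicFlow (q : TM n M) : IsGeodesic g (fun s => (geodesicFlow g s q).1) := by
  obtain ⟨Φ⟩ := nonempty_frame n M
  have h1 := Φ.velocity_fst_eq g ((Φ.geodesicFlow_spec g).2 q)
  refine (Φ.isGeodesic_iff g).2 ⟨contMDiff_fst_tangent.comp (contMDiff_geodesicFlow_curve g q),
    fun s => ?_⟩
  rw [h1]
  exact velTM_of_hasMFDerivAt ((Φ.geodesicFlow_spec g).2 q s)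

/-- The rescaled geodesic `s ↦ π (G_{rs} q)` has initial velocity `r v`; uniqueness identifies it
with the geodesic of that velocity. -/
theorem fst_geodesicFlow_smul (q : TM n M) (r : ℝ) :
    (geodesicFlow g 1 (⟨q.1, r • vec q⟩ : TM n M)).1 = (geodesicFlow g r q).1 := by
  obtain ⟨Φ⟩ := nonempty_frame n M
  have h1 := IsGeodesic.comp_mul g (isGeodesic_geodesicFlow g q) r
  have h2 := Φ.eq_geodesicFlow g (Φ.isMIntegralCurve_velocity g h1) 1
  have h3 : velocity (n := n) (fun s => (geodesicFlow g (r * s) q).1) 0 = ⟨q.1, r • vec q⟩ := by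
    have h4 : (geodesicFlow g (r * 0) q).1 = q.1 := by rw [mul_zero, geodesicFlow_zero]
    have h5 : vec (velocity (n := n) (fun s => (geodesicFlow g (r * s) q).1) 0) = r • vec q := by
      refine Φ.ext_of_diffAt (x := (geodesicFlow g (r * 0) q).1) fun j => ?_
      have h6 := fiberDeriv_velocity (Φ.contMDiff_h j) ((h1.1 0).mdifferentiableAt (by simp))
      have h7 := hasDerivAt_geodesicFlow_mul Φ g (contMDiff_comp_fst (Φ.contMDiff_h j)) q r 0
      rw [Φ.diffTM_comp_fst_spray g (Φ.contMDiff_h j)] at h7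
      refine (h6.unique h7).trans ?_
      rw [mul_zero, geodesicFlow_zero, map_smul]
      rfl
    exact congrArg₂ (fun (x : M) (v : EuclideanSpace ℝ (Fin n)) => (⟨x, v⟩ : TM n M)) h4 h5
  rw [h3] at h2
  rw [← h2]
  change (geodesicFlow g (r * 1) q).1 = _
  rw [mul_one]

/-- The point reached at time `1` along the geodesic with initial velocity `∑ a j • X j x`. -/
def Frame.exp (Φ : Frame n M) (g : Metric n M) (z : M × (Φ.J → ℝ)) : M :=
  (geodesicFlow g 1 (Φ.combine z)).1

theorem Frame.contMDiff_exp (Φ : Frame n M) (g : Metric n M) :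
    ContMDiff ((𝓡 n).prod 𝓘(ℝ, Φ.J → ℝ)) (𝓡 n) ∞ (Φ.exp g) :=
  contMDiff_fst_tangent.comp ((contMDiff_geodesicFlow_apply g 1).comp (Φ.contMDiff_combine g))

theorem Frame.exp_smul (Φ : Frame n M) (g : Metric n M) (x : M) (a : Φ.J → ℝ) (r : ℝ) :
    Φ.exp g (x, r • a) = (geodesicFlow g r (Φ.combine (x, a))).1 := by
  rw [← fst_geodesicFlow_smul]
  have h1 : ∑ j, (r • a) j • Φ.X j x = r • ∑ j, a j • Φ.X j x := by
    simp [Finset.smul_sum, smul_smul]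
  exact congrArg (fun v : EuclideanSpace ℝ (Fin n) => (geodesicFlow g 1 (⟨x, v⟩ : TM n M)).1) h1

theorem Frame.exp_zero (Φ : Frame n M) (g : Metric n M) (x : M) : Φ.exp g (x, 0) = x := by
  have h := Φ.exp_smul g x 0 0
  rw [smul_zero, geodesicFlow_zero] at h
  exact h

theorem Frame.hasDerivAt_exp (Φ : Frame n M) (g : Metric n M) {h : M → ℝ}
    (hh : ContMDiff (𝓡 n) 𝓘(ℝ, ℝ) ∞ h) (x : M) (a : Φ.J → ℝ) :
    HasDerivAt (fun r : ℝ => h (Φ.exp g (x, r • a))) (∑ j, a j * diffAt n h x (Φ.X j x)) 0 := by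
  have h1 := Φ.hasDerivAt_geodesicFlow g (contMDiff_comp_fst hh) (Φ.combine (x, a)) 0
  rw [Φ.diffTM_comp_fst_spray g hh, geodesicFlow_zero] at h1
  rw [funext fun r : ℝ => congrArg h (Φ.exp_smul g x a r)]
  refine h1.congr_deriv ?_
  change diffAt n h x (∑ j, a j • Φ.X j x) = _
  simp [map_sum]

end Exponential

end

end TranslatedPoint

namespace TranslatedPoint

noncomputable section

/-! ### Two-parameter families in `Λ(f)` with prescribed derivatives. -/

section Families

variable {n : ℕ} {M : Type*} [TopologicalSpace M] [ChartedSpace (EuclideanSpace ℝ (Fin n)) M]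
  [IsManifold (𝓡 n) ∞ M] [T2Space M] [CompactSpace M] (g : Metric n M)

theorem Frame.sum_mul_diffAt (Φ : Frame n M) (h : M → ℝ) (x : M) (v : EuclideanSpace ℝ (Fin n)) :
    ∑ j, diffAt n (Φ.h j) x v * diffAt n h x (Φ.X j x) = diffAt n h x v := by
  conv_rhs => rw [← Φ.sum_smul x v]
  simp [map_sum]

/-- The derivative along the diagonal is the sum of the two partial derivatives, and on each axis
one of the exponentials is trivial. -/
theorem Frame.hasDerivAt_exp_exp (Φ : Frame n M) (g : Metric n M) (f : M ≃ₘ⟮𝓡 n, 𝓡 n⟯ M)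
    {h : M → ℝ} (hh : ContMDiff (𝓡 n) 𝓘(ℝ, ℝ) ∞ h) (x : M) (a b : Φ.J → ℝ) :
    HasDerivAt (fun r : ℝ => h (f (Φ.exp g (f.symm (Φ.exp g (x, r • a)), r • b))))
      (∑ j, a j * diffAt n h x (Φ.X j x) +
        ∑ j, b j * diffAt n (fun y => h (f y)) (f.symm x) (Φ.X j (f.symm x))) 0 := by
  let k : ℝ × ℝ → ℝ := fun z => h (f (Φ.exp g (f.symm (Φ.exp g (x, z.1 • a)), z.2 • b)))
  have hk : ContDiff ℝ ∞ k := by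
    rw [← contMDiff_iff_contDiff]
    have h1 : ContMDiff 𝓘(ℝ, ℝ × ℝ) 𝓘(ℝ, Φ.J → ℝ) ∞ (fun z : ℝ × ℝ => z.1 • a) :=
      (contDiff_fst.smul contDiff_const).contMDiff
    have h2 : ContMDiff 𝓘(ℝ, ℝ × ℝ) 𝓘(ℝ, Φ.J → ℝ) ∞ (fun z : ℝ × ℝ => z.2 • b) :=
      (contDiff_snd.smul contDiff_const).contMDiff
    exact hh.comp (f.contMDiff.comp ((Φ.contMDiff_exp g).comp ((f.symm.contMDiff.comp
      ((Φ.contMDiff_exp g).comp (contMDiff_const.prodMk h1))).prodMk h2)))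
  have hd := hk.differentiable (by simp) (0, 0)
  have h0 := hasDerivAt_comp_fderiv (L := k) (y := fun r : ℝ => (r, r)) (s := 0) hd
    ((hasDerivAt_id (0 : ℝ)).prodMk (hasDerivAt_id (0 : ℝ)))
  have h1 := hasDerivAt_comp_fderiv (L := k) (y := fun r : ℝ => (r, (0 : ℝ))) (s := 0) hd
    ((hasDerivAt_id (0 : ℝ)).prodMk (hasDerivAt_const (0 : ℝ) (0 : ℝ)))
  have h2 := hasDerivAt_comp_fderiv (L := k) (y := fun r : ℝ => ((0 : ℝ), r)) (s := 0) hd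
    ((hasDerivAt_const (0 : ℝ) (0 : ℝ)).prodMk (hasDerivAt_id (0 : ℝ)))
  have e1 : (fun r : ℝ => k (r, 0)) = fun r => h (Φ.exp g (x, r • a)) := by
    funext r
    simp only [k, zero_smul, Φ.exp_zero, f.apply_symm_apply]
  have e2 : (fun r : ℝ => k (0, r)) = fun r => h (f (Φ.exp g (f.symm x, r • b))) := by
    funext r
    simp only [k, zero_smul, Φ.exp_zero]
  rw [e1] at h1
  rw [e2] at h2
  have h3 := h1.unique (Φ.hasDerivAt_exp g hh x a)
  have h4 := h2.unique (Φ.hasDerivAt_exp g (hh.comp f.contMDiff) (f.symm x) b)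
  refine h0.congr_deriv ?_
  refine Eq.trans ?_ (congrArg₂ (· + ·) h3 h4)
  rw [← map_add, Prod.mk_add_mk, add_zero, zero_add]

/-- The maps `(s, a, b) ↦ f (exp (f⁻¹ (exp (c s, (1 - s) a)), s b))`, which parametrize paths near
a path `c` with `c 1 = f (c 0)`. -/
def Frame.deform (Φ : Frame n M) (g : Metric n M) (f : M ≃ₘ⟮𝓡 n, 𝓡 n⟯ M) (c : ℝ → M)
    (x : Option (Φ.J ⊕ Φ.J) → ℝ) : M :=
  f (Φ.exp g (f.symm (Φ.exp g (c (x none), fun j => (1 - x none) * x (some (Sum.inl j)))),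
    fun j => x none * x (some (Sum.inr j))))

theorem Frame.contMDiff_deform (Φ : Frame n M) (g : Metric n M) (f : M ≃ₘ⟮𝓡 n, 𝓡 n⟯ M) {c : ℝ → M}
    (hc : ContMDiff 𝓘(ℝ, ℝ) (𝓡 n) ∞ c) :
    ContMDiff 𝓘(ℝ, Option (Φ.J ⊕ Φ.J) → ℝ) (𝓡 n) ∞ (Φ.deform g f c) := by
  have h0 : ∀ i, ContDiff ℝ ∞ (fun x : Option (Φ.J ⊕ Φ.J) → ℝ => x i) := fun i => contDiff_apply _ _ i
  have h1 : ContMDiff 𝓘(ℝ, Option (Φ.J ⊕ Φ.J) → ℝ) 𝓘(ℝ, Φ.J → ℝ) ∞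
      (fun (x : Option (Φ.J ⊕ Φ.J) → ℝ) j => (1 - x none) * x (some (Sum.inl j))) :=
    (contDiff_pi.2 fun j => (contDiff_const.sub (h0 _)).mul (h0 _)).contMDiff
  have h2 : ContMDiff 𝓘(ℝ, Option (Φ.J ⊕ Φ.J) → ℝ) 𝓘(ℝ, Φ.J → ℝ) ∞
      (fun (x : Option (Φ.J ⊕ Φ.J) → ℝ) j => x none * x (some (Sum.inr j))) :=
    (contDiff_pi.2 fun j => (h0 _).mul (h0 _)).contMDiff
  exact f.contMDiff.comp ((Φ.contMDiff_exp g).comp ((f.symm.contMDiff.comp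
    ((Φ.contMDiff_exp g).comp ((hc.comp (h0 none).contMDiff).prodMk h1))).prodMk h2))

/-- The inner exponential contributes `(1 - s) v`. The outer one is applied after `f⁻¹` with
parameters describing `s df⁻¹ v`, so that after `f` it contributes `s v`. -/
theorem Frame.hasDerivAt_deform (Φ : Frame n M) (g : Metric n M) (f : M ≃ₘ⟮𝓡 n, 𝓡 n⟯ M) (c : ℝ → M)
    {h : M → ℝ} (hh : ContMDiff (𝓡 n) 𝓘(ℝ, ℝ) ∞ h) (s : ℝ) (v : EuclideanSpace ℝ (Fin n)) :
    HasDerivAt (fun r : ℝ => h (Φ.deform g f c fun i => i.elim s (Sum.elim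
      (fun j => r * diffAt n (Φ.h j) (c s) v)
      (fun j => r * diffAt n (fun y => Φ.h j (f.symm y)) (c s) v)))) (diffAt n h (c s) v) 0 := by
  have h1 := Φ.hasDerivAt_exp_exp g f hh (c s) (fun j => (1 - s) * diffAt n (Φ.h j) (c s) v)
    (fun j => s * diffAt n (fun y => Φ.h j (f.symm y)) (c s) v)
  have h2 : diffAt n (fun y => h (f y)) (f.symm (c s)) (mapDeriv f.symm (c s) v) =
      diffAt n h (c s) v := by
    refine (diffAt_comp f.symm (h := fun y => h (f y)) (hh.comp f.contMDiff) (c s) v).symm.trans ?_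
    simp only [f.apply_symm_apply]
  simp only [mul_assoc, ← Finset.mul_sum, diffAt_comp f.symm (Φ.contMDiff_h _), Φ.sum_mul_diffAt,
    h2] at h1
  rw [← add_mul, sub_add_cancel, one_mul] at h1
  refine h1.congr_of_eventuallyEq (Filter.Eventually.of_forall fun r => ?_)
  simp only [diffAt_comp f.symm (Φ.contMDiff_h _), Frame.deform, Option.elim_none, Option.elim_some,
    Sum.elim_inl, Sum.elim_inr, mul_left_comm _ r]
  rfl

/-- At time `0` only the first group of parameters acts, at time `1` only the second, and the latter
acts at `c 0` before `f`. Paths whose second parameters at `1` equal the first ones at `0` therefore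
satisfy the boundary condition of `Λ(f)`. -/
theorem Frame.deform_zero (Φ : Frame n M) (g : Metric n M) (f : M ≃ₘ⟮𝓡 n, 𝓡 n⟯ M) (c : ℝ → M)
    {x : Option (Φ.J ⊕ Φ.J) → ℝ} (hx : x none = 0) :
    Φ.deform g f c x = Φ.exp g (c 0, fun j => x (some (Sum.inl j))) := by
  simp only [Frame.deform, hx, zero_mul, sub_zero, one_mul]
  exact (congrArg f (Φ.exp_zero g _)).trans (f.apply_symm_apply _)

theorem Frame.deform_one (Φ : Frame n M) (g : Metric n M) (f : M ≃ₘ⟮𝓡 n, 𝓡 n⟯ M) {c : ℝ → M}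
    (hc : c 1 = f (c 0)) {x : Option (Φ.J ⊕ Φ.J) → ℝ} (hx : x none = 1) :
    Φ.deform g f c x = f (Φ.exp g (c 0, fun j => x (some (Sum.inr j)))) := by
  simp only [Frame.deform, hx, zero_mul, sub_self, one_mul]
  refine congrArg (fun y => f (Φ.exp g (y, fun j => x (some (Sum.inr j)))))
    ((congrArg f.symm (Φ.exp_zero g _)).trans ?_)
  rw [hc, f.symm_apply_apply]

theorem velocity_eq {c : ℝ → M} {r : ℝ} (hc : MDifferentiableAt 𝓘(ℝ, ℝ) (𝓡 n) c r)
    {v : EuclideanSpace ℝ (Fin n)} (h : ∀ h : M → ℝ, ContMDiff (𝓡 n) 𝓘(ℝ, ℝ) ∞ h →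
      HasDerivAt (fun r => h (c r)) (diffAt n h (c r) v) r) :
    velocity (n := n) c r = ⟨c r, v⟩ := by
  obtain ⟨Φ⟩ := nonempty_frame n M
  have h1 : vec (velocity (n := n) c r) = v := Φ.ext_of_diffAt (x := c r) fun j =>
    (fiberDeriv_velocity (Φ.contMDiff_h j) hc).unique (h _ (Φ.contMDiff_h j))
  exact congrArg (fun w : EuclideanSpace ℝ (Fin n) => (⟨c r, w⟩ : TM n M)) h1

theorem exists_eval_eq_coe : ∃ u : H1, ∀ s : unitInterval, u.eval s = s := by
  obtain ⟨u, hu⟩ := exists_eval_eq_of_contDiff (c := fun s => s) contDiff_id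
  exact ⟨u, fun s => (hu s).symm⟩

/-- Two tangent vectors of `Λ(f)` at a smooth path are the partial derivatives of a family. -/
theorem exists_family (f : M ≃ₘ⟮𝓡 n, 𝓡 n⟯ M) (g : Metric n M) {c : ℝ → M}
    (hc : ContMDiff 𝓘(ℝ, ℝ) (𝓡 n) ∞ c) (hcf : c 1 = f (c 0))
    {U V : ∀ s : unitInterval, TangentSpace (𝓡 n) (c s)}
    (hU : IsTangent f (fun s : unitInterval => c s) U)
    (hV : IsTangent f (fun s : unitInterval => c s) V) :
    ∃ b : ℝ × ℝ → unitInterval → M, IsSmoothFamily n b ∧ (∀ z, b z ∈ Lam n f) ∧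
      b (0, 0) = (fun s : unitInterval => c s) ∧
      (∀ s, variation (n := n) (fun u => b (u, 0)) s = ⟨c s, U s⟩) ∧
      (∀ s, variation (n := n) (fun v => b (0, v)) s = ⟨c s, V s⟩) := by
  obtain ⟨Φ⟩ := nonempty_frame n M
  obtain ⟨e, he⟩ := exists_eval_eq_coe
  have hhf : ∀ j, ContMDiff (𝓡 n) 𝓘(ℝ, ℝ) ∞ (fun y => Φ.h j (f.symm y)) := fun j =>
    (Φ.contMDiff_h j).comp f.symm.contMDiff
  choose U₁ hU₁ using fun j => hU.1 _ (Φ.contMDiff_h j)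
  choose U₂ hU₂ using fun j => hU.1 _ (hhf j)
  choose V₁ hV₁ using fun j => hV.1 _ (Φ.contMDiff_h j)
  choose V₂ hV₂ using fun j => hV.1 _ (hhf j)
  -- The parameters are linear in `z`: the functions `dh_j` of the two fields, and `dh_j` of their
  -- images under `df⁻¹`. The latter are `H¹` because the definition of the tangent space allows
  -- every smooth function, in particular `h_j ∘ f⁻¹`.
  let Ψ : Option (Φ.J ⊕ Φ.J) → ℝ × ℝ → H1 := fun i => i.elim (fun _ => e)
    (Sum.elim (fun j z => z.1 • U₁ j + z.2 • V₁ j) (fun j z => z.1 • U₂ j + z.2 • V₂ j))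
  have hΨ : ∀ i, ContDiff ℝ ∞ (Ψ i) := by
    rintro (_ | j | j)
    · exact contDiff_const
    · exact (contDiff_fst.smul contDiff_const).add (contDiff_snd.smul contDiff_const)
    · exact (contDiff_fst.smul contDiff_const).add (contDiff_snd.smul contDiff_const)
  have hev : ∀ (z : ℝ × ℝ) (u v : H1) (s : unitInterval),
      (z.1 • u + z.2 • v).eval s = z.1 * u.eval s + z.2 * v.eval s := by
    intro z u v s
    simp only [← evalAtL_apply, map_add, map_smul, smul_eq_mul]
  let b : ℝ × ℝ → unitInterval → M := fun z s => Φ.deform g f c fun i => (Ψ i z).eval s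
  have hD := Φ.contMDiff_deform g f hc
  -- By `W(1) = df W(0)`, the second group of parameters at time `1` equals the first group at time
  -- `0`.
  have hend : ∀ W : (∀ s : unitInterval, TangentSpace (𝓡 n) (c s)),
      IsTangent f (fun s : unitInterval => c s) W → ∀ j,
      diffAt n (fun y => Φ.h j (f.symm y)) (c 1) (W 1) = diffAt n (Φ.h j) (c 0) (W 0) := by
    intro W hW j
    have h1 := congrArg (fiberDeriv (fun y => Φ.h j (f.symm y))) hW.2
    refine h1.symm.trans ?_
    have h2 := diffAt_comp f (hhf j) (c 0) (W 0)
    simp only [f.symm_apply_apply] at h2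
    exact h2.symm
  have hb : IsSmoothFamily n b := by
    have h1 : ∀ h : M → ℝ, ContMDiff (𝓡 n) 𝓘(ℝ, ℝ) ∞ h →
        ∃ Φ : ℝ × ℝ → H1, ContDiff ℝ ∞ Φ ∧ ∀ p t, h (b p t) = (Φ p).eval t := fun h hh =>
      exists_contDiff_comp_eval (contMDiff_iff_contDiff.1 (hh.comp hD)) hΨ
    refine ⟨fun z => ⟨hD.continuous.comp (continuous_pi fun i => (evalL (Ψ i z)).continuous),
      fun h hh => ?_⟩, h1⟩
    obtain ⟨F, -, hF⟩ := h1 h hh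
    exact ⟨F z, hF z⟩
  have hb0 : b (0, 0) = fun s : unitInterval => c s := by
    funext s
    have h1 : (fun i => (Ψ i (0, 0)).eval s) =
        fun i => i.elim (s : ℝ) (Sum.elim (fun _ => 0) (fun _ => 0)) := by
      funext i
      rcases i with (_ | j | j)
      · exact he s
      · exact (hev (0, 0) _ _ s).trans (by simp)
      · exact (hev (0, 0) _ _ s).trans (by simp)
    simp only [b]
    rw [h1]
    simp only [Frame.deform, Option.elim_none, Option.elim_some, Sum.elim_inl, Sum.elim_inr,
      mul_zero]
    exact (congrArg f ((Φ.exp_zero g _).trans (congrArg f.symm (Φ.exp_zero g _)))).trans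
      (f.apply_symm_apply _)
  have hvel : ∀ (W : ∀ s : unitInterval, TangentSpace (𝓡 n) (c s)) (φ : ℝ → ℝ × ℝ),
      ContDiff ℝ ∞ φ → φ 0 = (0, 0) →
      (∀ r s j, (Ψ (some (Sum.inl j)) (φ r)).eval s = r * diffAt n (Φ.h j) (c s) (W s)) →
      (∀ r s j, (Ψ (some (Sum.inr j)) (φ r)).eval s =
        r * diffAt n (fun y => Φ.h j (f.symm y)) (c s) (W s)) →
      ∀ s, variation (n := n) (fun r => b (φ r)) s = ⟨c s, W s⟩ := by
    intro W φ hφ hφ0 hl hr s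
    have h1 : b (φ 0) s = c s := by rw [hφ0, hb0]
    have h2 := velocity_eq (c := fun r => b (φ r) s) (r := 0) (v := W s)
      (((hb.comp hφ).contMDiff s 0).mdifferentiableAt (by simp)) fun h hh => by
        rw [h1]
        refine (Φ.hasDerivAt_deform g f c hh s (W s)).congr_of_eventuallyEq
          (Filter.Eventually.of_forall fun r => congrArg (fun x => h (Φ.deform g f c x))
            (funext fun i => ?_))
        rcases i with (_ | j | j)
        · exact he s
        · exact hl r s j
        · exact hr r s j
    refine Eq.trans h2 ?_
    exact congrArg (fun x : M => (⟨x, (W s : EuclideanSpace ℝ (Fin n))⟩ : TM n M)) h1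
  refine ⟨b, hb, fun z => ⟨hb.1 z, ?_⟩, hb0, ?_, ?_⟩
  · have h1 : (fun j => (Ψ (some (Sum.inr j)) z).eval 1) =
        fun j => (Ψ (some (Sum.inl j)) z).eval 0 := by
      funext j
      refine (hev z _ _ 1).trans (Eq.trans ?_ (hev z _ _ 0).symm)
      rw [← hU₂, ← hV₂, ← hU₁, ← hV₁]
      exact congrArg₂ (fun a b => z.1 * a + z.2 * b) (hend U hU j) (hend V hV j)
    refine (Φ.deform_one g f hcf (he 1)).trans (Eq.trans ?_
      (congrArg f (Φ.deform_zero g f c (x := fun i => (Ψ i z).eval 0) (he 0))).symm)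
    rw [h1]
  · refine hvel U (fun r => (r, 0)) (contDiff_id.prodMk contDiff_const) rfl (fun r s j => ?_)
      fun r s j => ?_
    · exact (hev (r, 0) _ _ s).trans (by rw [← hU₁]; simp; rfl)
    · exact (hev (r, 0) _ _ s).trans (by rw [← hU₂]; simp; rfl)
  · refine hvel V (fun r => (0, r)) (contDiff_const.prodMk contDiff_id) rfl (fun r s j => ?_)
      fun r s j => ?_
    · exact (hev (0, r) _ _ s).trans (by rw [← hV₁]; simp; rfl)
    · exact (hev (0, r) _ _ s).trans (by rw [← hV₂]; simp; rfl)

end Families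

end

end TranslatedPoint

namespace TranslatedPoint

noncomputable section

/-! ### Broken Jacobi fields as tangent vectors of `Λ(f)`. -/

section Fields

variable {n : ℕ} {M : Type*} [TopologicalSpace M] [ChartedSpace (EuclideanSpace ℝ (Fin n)) M]
  [IsManifold (𝓡 n) ∞ M] [T2Space M] [CompactSpace M] (g : Metric n M)

theorem tangentBundle_ext {q q' : TM n M} (h1 : q.1 = q'.1)
    (h2 : ∀ h : M → ℝ, ContMDiff (𝓡 n) 𝓘(ℝ, ℝ) ∞ h → fiberDeriv h q = fiberDeriv h q') : q = q' := by
  obtain ⟨Φ⟩ := nonempty_frame n M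
  obtain ⟨x, v⟩ := q
  obtain ⟨x', v'⟩ := q'
  obtain rfl : x = x' := h1
  exact congrArg (fun w : EuclideanSpace ℝ (Fin n) => (⟨x, w⟩ : TM n M))
    (Φ.ext_of_diffAt (x := x) fun j => h2 _ (Φ.contMDiff_h j))

/-- The vector field along a geodesic which is the Jacobi field given by `ξ` on `[0, s₀]`, and the
one given by `η` on `(s₀, 1]`. -/
def brokenJacobiField (g : Metric n M) (t : ℝ) (p : TM n M)
    (ξ η : EuclideanSpace ℝ (Fin n) × EuclideanSpace ℝ (Fin n)) (s₀ s : unitInterval) :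
    EuclideanSpace ℝ (Fin n) :=
  projDeriv (geodesicFlow g (t * s) p)
    (mapTM (geodesicFlow g (t * s)) p (if (s : ℝ) ≤ s₀ then ξ else η))

variable {t : ℝ} {p : TM n M} {ξ η : EuclideanSpace ℝ (Fin n) × EuclideanSpace ℝ (Fin n)}
  {s₀ : unitInterval}

theorem diffAt_brokenJacobiField {h : M → ℝ} (hh : ContMDiff (𝓡 n) 𝓘(ℝ, ℝ) ∞ h) (s : unitInterval) :
    diffAt n h (geodesicFlow g (t * s) p).1 (brokenJacobiField g t p ξ η s₀ s) =
      if (s : ℝ) ≤ s₀ then jacobi g p ξ (fun q => h q.1) (t * s) else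
        jacobi g p η (fun q => h q.1) (t * s) := by
  split_ifs with hs
  · rw [brokenJacobiField, if_pos hs]
    exact (diffTM_comp_fst_eq hh _ _).symm
  · rw [brokenJacobiField, if_neg hs]
    exact (diffTM_comp_fst_eq hh _ _).symm

/-- By definition the field uses `ξ` at the break itself; there `hs₀` allows `η` to be used instead.
-/
theorem diffAt_brokenJacobiField_of_ge {h : M → ℝ} (hh : ContMDiff (𝓡 n) 𝓘(ℝ, ℝ) ∞ h)
    (hs₀ : ∀ h : M → ℝ, ContMDiff (𝓡 n) 𝓘(ℝ, ℝ) ∞ h →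
      jacobi g p ξ (fun q => h q.1) (t * s₀) = jacobi g p η (fun q => h q.1) (t * s₀))
    {s : unitInterval} (hs : s₀ ≤ s) :
    diffAt n h (geodesicFlow g (t * s) p).1 (brokenJacobiField g t p ξ η s₀ s) =
      jacobi g p η (fun q => h q.1) (t * s) := by
  rw [diffAt_brokenJacobiField g hh]
  split_ifs with hs'
  · obtain rfl : s = s₀ := le_antisymm hs' hs
    exact hs₀ h hh
  · rfl

/-- Class `H¹` comes from continuity at the break, and the condition at the ends is the projection
to `M` of `dG_t η = df̂ ξ`. -/
theorem isTangent_brokenJacobiField (f : M ≃ₘ⟮𝓡 n, 𝓡 n⟯ M)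
    (hp : symplecticLift g f p = geodesicFlow g t p)
    (hend : mapTM (geodesicFlow g t) p η = mapTM (symplecticLift g f) p ξ)
    (hs₀ : ∀ h : M → ℝ, ContMDiff (𝓡 n) 𝓘(ℝ, ℝ) ∞ h →
      jacobi g p ξ (fun q => h q.1) (t * s₀) = jacobi g p η (fun q => h q.1) (t * s₀)) :
    IsTangent (n := n) f (associatedGeodesic g t p) (brokenJacobiField g t p ξ η s₀) := by
  obtain ⟨Φ⟩ := nonempty_frame n M
  refine ⟨fun h hh => ?_, tangentBundle_ext ?_ fun h hh => ?_⟩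
  · obtain ⟨u, hu⟩ := exists_eval_eq_of_piecewise
      (contDiff_jacobi_mul g (contMDiff_comp_fst hh) p ξ t)
      (contDiff_jacobi_mul g (contMDiff_comp_fst hh) p η t) s₀.2 (hs₀ h hh)
    exact ⟨u, fun s => (diffAt_brokenJacobiField g hh s).trans (hu s)⟩
  · exact (associatedGeodesic_mem_lam g f hp).2.symm
  · have h1 := diffAt_brokenJacobiField_of_ge (s := 1) g hh hs₀ s₀.2.2
    have h2 := diffAt_brokenJacobiField (ξ := ξ) (η := η) (s₀ := s₀) (t := t) (p := p) g
      (hh.comp f.contMDiff) 0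
    rw [if_pos (show ((0 : unitInterval) : ℝ) ≤ s₀ from s₀.2.1)] at h2
    refine Eq.trans ?_ h1.symm
    refine (diffAt_comp f hh (geodesicFlow g (t * ((0 : unitInterval) : ℝ)) p).1
      (brokenJacobiField g t p ξ η s₀ 0)).symm.trans (h2.trans ?_)
    rw [show t * ((0 : unitInterval) : ℝ) = 0 by simp, show t * ((1 : unitInterval) : ℝ) = t by simp,
      jacobi_zero, jacobi, hend, ← hp]
    exact diffTM_comp (contMDiff_comp_fst hh)
      ((contMDiff_symplecticLift g f Φ p).mdifferentiableAt (by simp)) ξ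

/-- The Hessian, evaluated at a broken Jacobi field. -/
theorem exists_family_brokenJacobiField (f : M ≃ₘ⟮𝓡 n, 𝓡 n⟯ M)
    (hp : symplecticLift g f p = geodesicFlow g t p)
    (hend : mapTM (geodesicFlow g t) p η = mapTM (symplecticLift g f) p ξ)
    {ζ : EuclideanSpace ℝ (Fin n) × EuclideanSpace ℝ (Fin n)} {w : EuclideanSpace ℝ (Fin n)}
    (hjump : mapTM (geodesicFlow g (t * s₀)) p η - mapTM (geodesicFlow g (t * s₀)) p ξ = ζ)
    (hζ : ∀ h : M → ℝ, ContMDiff (𝓡 n) 𝓘(ℝ, ℝ) ∞ h →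
      diffTM (fun q => h q.1) (geodesicFlow g (t * s₀) p) ζ = 0)
    (hζ' : ∀ h : M → ℝ, ContMDiff (𝓡 n) 𝓘(ℝ, ℝ) ∞ h →
      diffTM (fiberDeriv h) (geodesicFlow g (t * s₀) p) ζ =
        diffAt n h (geodesicFlow g (t * s₀) p).1 w)
    {c : ℝ × ℝ → unitInterval → M} (hc : IsSmoothFamily n c) (hcf : ∀ z, c z ∈ Lam n f)
    (hc0 : c (0, 0) = associatedGeodesic g t p)
    (hcu : ∀ s, variation (n := n) (fun u => c (u, 0)) s =
      ⟨associatedGeodesic g t p s, brokenJacobiField g t p ξ η s₀ s⟩) :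
    deriv (fun u => deriv (fun v => energy g (c (u, v))) 0) 0 =
      -(2 * t) * metricAt g (geodesicFlow g (t * s₀) p).1 w
        (vec (variation (n := n) (fun v => c (0, v)) s₀)) := by
  have hs₀ : ∀ h : M → ℝ, ContMDiff (𝓡 n) 𝓘(ℝ, ℝ) ∞ h →
      jacobi g p ξ (fun q => h q.1) (t * s₀) = jacobi g p η (fun q => h q.1) (t * s₀) := by
    intro h hh
    have h1 := hζ h hh
    rw [← hjump, map_sub, sub_eq_zero] at h1
    exact h1.symm
  refine deriv_deriv_energy_eq g f hp hc hcf hc0 s₀ hend hjump hζ hζ' (fun h hh s hs => ?_)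
    fun h hh s hs => ?_
  · refine (congrArg (fiberDeriv h) (hcu s)).trans
      ((diffAt_brokenJacobiField g hh s).trans (if_pos hs))
  · exact (congrArg (fiberDeriv h) (hcu s)).trans (diffAt_brokenJacobiField_of_ge g hh hs₀ hs)

/-- Applying the inverse of `dG_t` puts the end condition of a broken Jacobi field in the form `η =
D ξ`, with the endomorphism `D` of the definition of non-degeneracy. -/
theorem mapTM_geodesicFlow_eq_iff (f : M ≃ₘ⟮𝓡 n, 𝓡 n⟯ M)
    (hp : symplecticLift g f p = geodesicFlow g t p) :
    mapTM (geodesicFlow g t) p η = mapTM (symplecticLift g f) p ξ ↔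
      mapTM (geodesicFlow g (-t) ∘ symplecticLift g f) p ξ = η := by
  obtain ⟨Φ⟩ := nonempty_frame n M
  rw [mapTM_comp (mdifferentiableAt_geodesicFlow g _ _)
    ((contMDiff_symplecticLift g f Φ p).mdifferentiableAt (by simp)), hp]
  constructor
  · intro h
    rw [← h, mapTM_geodesicFlow_neg]
  · intro h
    rw [← h, mapTM_geodesicFlow_apply_neg]

/-- If the field vanishes identically, so does its derivative, which is `t` times the action of the
transported vector on the `dh_j`. Thus the transported vector is zero at the interior time `1 / 2`,
and the flow carries this back to `ξ`. -/
theorem eq_zero_of_brokenJacobiField_eq_zero (ht : 0 < t)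
    (h0 : ∀ s, brokenJacobiField g t p ξ ξ 0 s = 0) : ξ = 0 := by
  obtain ⟨Φ⟩ := nonempty_frame n M
  have h1 : ∀ h : M → ℝ, ContMDiff (𝓡 n) 𝓘(ℝ, ℝ) ∞ h → ∀ s ∈ Set.Ioo (0 : ℝ) 1,
      jacobi g p ξ (fun q => h q.1) (t * s) = 0 := by
    intro h hh s hs
    have h2 := diffAt_brokenJacobiField (ξ := ξ) (η := ξ) (s₀ := 0) (t := t) (p := p) g hh
      ⟨s, hs.1.le, hs.2.le⟩
    rw [h0, map_zero, ite_self] at h2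
    exact h2.symm
  have hhalf : (1 / 2 : ℝ) ∈ Set.Ioo (0 : ℝ) 1 := by norm_num
  have h2 : mapTM (geodesicFlow g (t * (1 / 2))) p ξ = 0 := by
    refine Φ.tangent_ext g (q := geodesicFlow g (t * (1 / 2)) p) (fun j => ?_) (fun j => ?_)
    · rw [map_zero]
      exact h1 _ (Φ.contMDiff_h j) _ hhalf
    · rw [map_zero]
      have h3 := hasDerivAt_jacobi_mul g Φ (contMDiff_comp_fst (Φ.contMDiff_h j)) p ξ t (1 / 2)
      have h4 := h3.congr_of_eventuallyEq (f₁ := fun _ => (0 : ℝ)) (by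
        filter_upwards [Ioo_mem_nhds hhalf.1 hhalf.2] with s hs
        exact (h1 _ (Φ.contMDiff_h j) s hs).symm)
      have h5 := h4.unique (hasDerivAt_const _ _)
      rw [funext (Φ.diffTM_comp_fst_spray g (Φ.contMDiff_h j))] at h5
      exact (mul_eq_zero.1 h5).resolve_left ht.ne'
  rw [← mapTM_geodesicFlow_neg g (t * (1 / 2)) p ξ, h2, map_zero]

/-- A fixed vector `ξ = D ξ` gives an unbroken Jacobi field tangent to `Λ(f)`. The second variation
formula with jump `0` puts it in the kernel of the Hessian, so it vanishes, and with it `ξ`. -/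
theorem isNondegenerateTranslatedPoint_of_isNondegenerateCriticalPoint (f : M ≃ₘ⟮𝓡 n, 𝓡 n⟯ M)
    (ht : 0 < t) (hpt : IsTranslatedPoint g f t p)
    (h : IsNondegenerateCriticalPoint g f (associatedGeodesic g t p)) :
    IsNondegenerateTranslatedPoint g f t p := by
  have hp := symplecticLift_eq_geodesicFlow g f hpt
  refine ⟨hpt, fun ξ hξ => ?_⟩
  have hend := (mapTM_geodesicFlow_eq_iff (ξ := ξ) (η := ξ) g f hp).2 hξ
  -- With equal data on both sides, the break at time `0` is none.
  have hU := isTangent_brokenJacobiField (s₀ := 0) g f hp hend fun _ _ => rfl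
  have hc : ContMDiff 𝓘(ℝ, ℝ) (𝓡 n) ∞ (fun s => (geodesicFlow g (t * s) p).1) :=
    contMDiff_fst_tangent.comp ((contMDiff_geodesicFlow_curve g p).comp
      (contDiff_const.mul contDiff_id).contMDiff)
  have hcf : (geodesicFlow g (t * 1) p).1 = f (geodesicFlow g (t * 0) p).1 :=
    (associatedGeodesic_mem_lam g f hp).2
  have h0 := h.2 _ hU fun V hV => by
    obtain ⟨c, hc, hcf, hc0, hcu, hcv⟩ := exists_family f g hc hcf hU hV
    refine ⟨c, hc, hcf, hc0, hcu, hcv, ?_⟩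
    refine (exists_family_brokenJacobiField (s₀ := 0) (ζ := 0) (w := 0) g f hp hend (sub_self _)
      (fun _ _ => map_zero _) (fun _ _ => by rw [map_zero, map_zero]) hc hcf hc0 hcu).trans ?_
    rw [map_zero]
    simp
  exact eq_zero_of_brokenJacobiField_eq_zero g ht fun s => congrFun h0 s

end Fields

end

end TranslatedPoint

namespace TranslatedPoint

noncomputable section

/-! ### From non-degenerate translated points to non-degenerate critical points. -/

section Nondegenerate

variable {n : ℕ} {M : Type*} [TopologicalSpace M] [ChartedSpace (EuclideanSpace ℝ (Fin n)) M]
  [IsManifold (𝓡 n) ∞ M] [T2Space M] [CompactSpace M] (g : Metric n M)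

theorem IsSmoothFamily.contDiff_energy {P : Type*} [NormedAddCommGroup P] [NormedSpace ℝ P]
    (g : Metric n M) {c : P → unitInterval → M} (hc : IsSmoothFamily n c) :
    ContDiff ℝ ∞ (fun z => energy g (c z)) := by
  obtain ⟨Φ⟩ := nonempty_frame n M
  choose Ψ hΨ hΨe using hc.2
  rw [funext fun z => Φ.energy_eq g (hc.1 z).1 (fun j s => hΨe _ (Φ.contMDiff_h j) z s)
    (fun j k s => hΨe _ (Φ.contMDiff_coeff g j k) z s)]
  exact ContDiff.sum fun j _ => ContDiff.sum fun k _ => contDiff_energyForm (hΨ _ _) (hΨ _ _) (hΨ _ _)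

/-- The symmetry of the Hessian. -/
theorem IsSmoothFamily.deriv_deriv_energy_swap (g : Metric n M) {c : ℝ × ℝ → unitInterval → M}
    (hc : IsSmoothFamily n c) :
    deriv (fun u => deriv (fun v => energy g (c (v, u))) 0) 0 =
      deriv (fun u => deriv (fun v => energy g (c (u, v))) 0) 0 :=
  (hasDerivAt_deriv_swap (k := fun z => energy g (c z))
    (hc.contDiff_energy g).contDiffAt).deriv.symm

variable {t : ℝ} {p : TM n M}

/-- At each time `s₀` an element `U` of the kernel is tested against the broken Jacobi field with
jump `U s₀` there. Such a field exists because `D - 1`, injective on a finite-dimensional space, is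
onto. -/
theorem isNondegenerateCriticalPoint_of_isNondegenerateTranslatedPoint (f : M ≃ₘ⟮𝓡 n, 𝓡 n⟯ M)
    (ht : 0 < t) (h : IsNondegenerateTranslatedPoint g f t p) :
    IsNondegenerateCriticalPoint g f (associatedGeodesic g t p) := by
  obtain ⟨Φ⟩ := nonempty_frame n M
  have hp := symplecticLift_eq_geodesicFlow g f h.1
  refine ⟨isCriticalPoint_associatedGeodesic g f hp, fun U hU hUV => funext fun s₀ => ?_⟩
  let D := mapTM (geodesicFlow g (-t) ∘ symplecticLift g f) p
  have hinj : Function.Injective (D - 1).toLinearMap := by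
    rw [← LinearMap.ker_eq_bot, LinearMap.ker_eq_bot']
    exact fun ξ hξ => h.2 ξ (sub_eq_zero.1 hξ)
  have hsurj := LinearMap.injective_iff_surjective.1 hinj
  let w : EuclideanSpace ℝ (Fin n) := U s₀
  obtain ⟨ζ, hζ, hζ'⟩ := Φ.exists_vertical g (geodesicFlow g (t * s₀) p) w
  -- The jump prescribed at time `s₀` is pulled back to `p` by the flow, and `D ξ - ξ` is made equal
  -- to it.
  obtain ⟨ξ, hξ⟩ := hsurj (mapTM (geodesicFlow g (-(t * s₀))) (geodesicFlow g (t * s₀) p) ζ)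
  have hξ' : D ξ - ξ = mapTM (geodesicFlow g (-(t * s₀))) (geodesicFlow g (t * s₀) p) ζ := hξ
  have hjump : mapTM (geodesicFlow g (t * s₀)) p (D ξ) - mapTM (geodesicFlow g (t * s₀)) p ξ = ζ := by
    rw [← map_sub, hξ', mapTM_geodesicFlow_apply_neg]
  have hend := (mapTM_geodesicFlow_eq_iff (ξ := ξ) (η := D ξ) g f hp).2 rfl
  have hs₀ : ∀ h : M → ℝ, ContMDiff (𝓡 n) 𝓘(ℝ, ℝ) ∞ h →
      jacobi g p ξ (fun q => h q.1) (t * s₀) = jacobi g p (D ξ) (fun q => h q.1) (t * s₀) := by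
    intro h hh
    have h1 := hζ h hh
    rw [← hjump, map_sub, sub_eq_zero] at h1
    exact h1.symm
  obtain ⟨c, hc, hcf, hc0, hcu, hcv, hE⟩ :=
    hUV _ (isTangent_brokenJacobiField (s₀ := s₀) g f hp hend hs₀)
  -- The formula wants the broken field in the first slot, but the family at hand has `U` there; the
  -- parameters are exchanged, and the symmetry of the Hessian compensates for it.
  have h1 := exists_family_brokenJacobiField g f hp hend hjump hζ hζ'
    (c := fun z => c (z.2, z.1)) (hc.comp (contDiff_snd.prodMk contDiff_fst)) (fun z => hcf _) hc0 hcv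
  have h2 := h1.symm.trans ((hc.deriv_deriv_energy_swap g).trans hE)
  have h3 : metricAt g (geodesicFlow g (t * s₀) p).1 w w = 0 := by
    -- The other field takes the value `U s₀ = w` at the break, so the formula reads `-2 t ‖w‖² =
    -- 0`.
    have h4 : vec (variation (n := n) (fun u => c (u, 0)) s₀) = w := congrArg vec (hcu s₀)
    rw [h4] at h2
    exact (mul_eq_zero.1 h2).resolve_left (by linarith)
  by_contra hw
  exact (metricAt_pos g _ hw).ne' h3

end Nondegenerate

end

end TranslatedPoint

theorem mainTheorem4 {n : ℕ} {M : Type*} [TopologicalSpace M] [T2Space M] [CompactSpace M]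
    [ChartedSpace (EuclideanSpace ℝ (Fin n)) M] [IsManifold (𝓡 n) ∞ M]
    (g : TranslatedPoint.Metric n M) (f : M ≃ₘ⟮𝓡 n, 𝓡 n⟯ M)
    (p : TangentBundle (𝓡 n) M) (t : ℝ) (ht : 0 < t)
    (hp : TranslatedPoint.IsTranslatedPoint g f t p) :
    TranslatedPoint.IsCriticalPoint g f (TranslatedPoint.associatedGeodesic g t p) ∧
    (TranslatedPoint.IsNondegenerateTranslatedPoint g f t p ↔
      TranslatedPoint.IsNondegenerateCriticalPoint g f
        (TranslatedPoint.associatedGeodesic g t p)) :=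
  ⟨TranslatedPoint.isCriticalPoint_associatedGeodesic g f
      (TranslatedPoint.symplecticLift_eq_geodesicFlow g f hp),
    TranslatedPoint.isNondegenerateCriticalPoint_of_isNondegenerateTranslatedPoint g f ht,
    TranslatedPoint.isNondegenerateTranslatedPoint_of_isNondegenerateCriticalPoint g f ht hp⟩
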